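/- \textbf{Setting.} Let $S>0$, let $P\ge 2$ be an integer, and let $a_l,T_l>0$ for $l=1,2,3$. Put $B_a=\prod_l(-a_l,a_l)$ and $B_{a,T}=\prod_l(-a_l-T_l,a_l+T_l)$. Let $\sigma_l$ be the even function with $\sigma_l(t)=0$ for $0\le t<a_l$, $\sigma_l(t)=\dfrac{2Sf_1^P}{f_1^P+f_2^P}$ for $a_l\le t\le a_l+T_l$, and $\sigma_l(t)=S$ for $t>a_l+T_l$, where $f_1=(\frac12-\frac1P)\bar t^3+\frac{\bar t}{P}+\frac12$, $f_2=1-f_1$ and $\bar t=\frac{t-(a_l+T_l)}{T_l}$. Put $\widetilde x_l=x_l+i\int_0^{x_l}\sigma_l(t)\,dt$, $\alpha_l=1+i\sigma_l(x_l)$, $\mathbb B=\mathrm{diag}(\alpha_1,\alpha_2,\alpha_3)$, $J=\alpha_1\alpha_2\alpha_3$ and $\widetilde\nabla\times u=J^{-1}\mathbb B\,\mathrm{curl}(\mathbb B u)$. For $k>0$ let $$\widetilde\Phi(k,x,y)=\frac{e^{ik\rho(x,y)}}{4\pi\rho(x,y)},\qquad \rho(x,y)=\Bigl(\sum_{l}(\widetilde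 x_l-\widetilde y_l)^2\Bigr)^{1/2}\ \text{(principal branch)}.$$ Let $W\subset\mathbb R^3$ be an open set with $C^\infty$ boundary $\Gamma$ that coincides with a half-space $\{x_3>d\}$, $|d|<a_3$, outside a compact subset of $B_a$. Let $U_0$ be an open set with $C^\infty$ boundary (possibly empty) with $\overline{U_0}\subset W\cap B_a$. Let $\nu$ be the unit normal on $\Gamma\cup\partial U_0$ pointing out of $W\setminus\overline{U_0}$. Put $M=(\Gamma\cap B_{a,T})\cup\partial U_0$; thus $M=\Gamma^b:=\Gamma\cap B_{a,T}$ if $U_0=\emptyset$, and in general $M=\Gamma_*^b:=\Gamma^b\cup\partial U_0$. Let $ds$ be surface measure and $\partial M=\overline M\setminus M$. For a complex vector field $v$ on $M$ put $\mathrm{div}_\Gamma v=\mathrm{div}\,v-\nu\cdot\partial_\nu v$, and for a scalar function $u$ on $M$ that is differentiable along $M$ put $\overrightarrow{\mathrm{curl}}_\Gamma u=\nu\times\nabla_\Gamma u$ with $\nabla_\Gamma u=\nabla u-\nu\,\partial_\nu u$ (these depend only on derivatives along $M$). For $x\in M$ the hyper-singular operator $$\widetilde N(\varphi)(x)=\nu_x\times\mathbb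 B\,\widetilde\nabla\times\widetilde\nabla\times\int_M\widetilde\Phi(k,\cdot,y)\,\mathbb B(y)\varphi(y)\,ds_y$$ is understood as the limit, as $h\to0^+$, of $\nu_x\times\bigl[\mathbb B\,\widetilde\nabla\times\widetilde\nabla\times\int_M\widetilde\Phi(k,\cdot,y)\mathbb B(y)\varphi(y)\,ds_y\bigr](x\mp h\nu_x)$, with either choice of sign. For $U_0=\emptyset$ and $k=k_j$, $j=1,2$, this is the operator $\widetilde N_j$ on $\Gamma^b$; for general $U_0$ and $k=k_1$ it is the operator $\widetilde N_{01}$ on $\Gamma^b_*$. \textbf{Theorem (regularization of the hyper-singular operators).} Let $k>0$ and let $\varphi:\overline M\to\mathbb C^3$ be of class $C^1$ along $M$ up to its boundary, tangential on $M$, and zero on $\partial M$. Let $x\in M$. Then the integrals $$\int_M\widetilde\Phi(k,x,y)\,\mathbb B(y)\varphi(y)\,ds_y,\qquad u(x)=\int_M\widetilde\Phi(k,x,y)\,\mathrm{div}_\Gamma\varphi(y)\,ds_y$$ converge absolutely. For either choice of sign, the limit $\widetilde N(\varphi)(x)$ exists if and only if $u$ is differentiable along $M$ at $x$, and in that case $$\widetilde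 N(\varphi)(x)=k^2\,\nu_x\times\mathbb B(x)\int_M\widetilde\Phi(k,x,y)\,\mathbb B(y)\varphi(y)\,ds_y+\overrightarrow{\mathrm{curl}}_\Gamma\int_M\widetilde\Phi(k,x,y)\,\mathrm{div}_\Gamma\varphi(y)\,ds_y .$$ Both sides exist at every point $x\in M$ at which $\mathrm{div}_\Gamma\varphi$ is Hölder continuous, that is, at which $|\mathrm{div}_\Gamma\varphi(y)-\mathrm{div}_\Gamma\varphi(x)|\le C|y-x|^\beta$ for some $C$, some $\beta>0$ and all $y\in M$ near $x$. -/

import Mathlib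

open Filter Topology MeasureTheory Set Asymptotics
open scoped ContDiff Matrix

noncomputable section

/-- Real Euclidean three-space. The third Cartesian coordinate is `x 2`. -/
abbrev E3 : Type := EuclideanSpace ℝ (Fin 3)

/-- Complex vectors with three components. -/
abbrev C3 : Type := Fin 3 → ℂ

/-! ### Complex coordinate stretching -/

/-- Parameters of the perfectly matched layer: the strength `S`, the exponent `P`, the half-widths
`a l` of the physical box and the thicknesses `T l` of the layer. -/
structure PML where
  S : ℝ
  P : ℕ
  a : Fin 3 → ℝ
  T : Fin 3 → ℝ
  S_pos : 0 < S
  two_le_P : 2 ≤ P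
  a_pos : ∀ l, 0 < a l
  T_pos : ∀ l, 0 < T l

namespace PML

variable (p : PML)

/-- The physical box, `|x_l| < a_l` for all `l`. -/
def physBox : Set E3 := {x | ∀ l, |x l| < p.a l}

/-- The truncated box, `|x_l| < a_l + T_l` for all `l`. -/
def truncBox : Set E3 := {x | ∀ l, |x l| < p.a l + p.T l}

/-- The cubic `f₁` as a function of the scaled variable. -/
def f₁ (t : ℝ) : ℝ := (1 / 2 - 1 / (p.P : ℝ)) * t ^ 3 + t / (p.P : ℝ) + 1 / 2

/-- `f₂ = 1 - f₁`. -/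
def f₂ (t : ℝ) : ℝ := 1 - p.f₁ t

/-- The medium property `σ_l`, an even function that vanishes on `[-a_l, a_l]`. -/
def sigma (l : Fin 3) (x : ℝ) : ℝ :=
  if |x| < p.a l then 0
  else if |x| ≤ p.a l + p.T l then
    2 * p.S * p.f₁ ((|x| - (p.a l + p.T l)) / p.T l) ^ p.P /
      (p.f₁ ((|x| - (p.a l + p.T l)) / p.T l) ^ p.P +
        p.f₂ ((|x| - (p.a l + p.T l)) / p.T l) ^ p.P)
  else p.S

/-- The stretched coordinate `x_l + i ∫₀^{x_l} σ_l`. -/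
def stretch (l : Fin 3) (x : ℝ) : ℂ := (x : ℂ) + Complex.I * ((∫ t in (0 : ℝ)..x, p.sigma l t : ℝ) : ℂ)

/-- `α_l = 1 + i σ_l`, evaluated at the point `x`. -/
def alpha (x : E3) (l : Fin 3) : ℂ := 1 + Complex.I * (p.sigma l (x l) : ℂ)

/-- `J = α₁ α₂ α₃`. -/
def jac (x : E3) : ℂ := p.alpha x 0 * p.alpha x 1 * p.alpha x 2

/-- `𝔹 = diag(α₁, α₂, α₃)`. -/
def B (x : E3) : Matrix (Fin 3) (Fin 3) ℂ := Matrix.diagonal (p.alpha x)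

/-- The complex distance `ρ`, with the principal branch of the square root. -/
def rho (x y : E3) : ℂ :=
  (∑ l, (p.stretch l (x l) - p.stretch l (y l)) ^ 2) ^ (1 / 2 : ℂ)

/-- The stretched fundamental solution of the Helmholtz equation with wavenumber `k`. -/
def Phi (k : ℝ) (x y : E3) : ℂ :=
  Complex.exp (Complex.I * (k : ℂ) * p.rho x y) / (4 * (Real.pi : ℂ) * p.rho x y)

end PML

/-- The partial derivative `∂_l u_m` at `x`. -/
def partialD (u : E3 → C3) (l m : Fin 3) (x : E3) : ℂ :=
  fderiv ℝ u x (EuclideanSpace.single l 1) m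

/-- The curl of a complex vector field. -/
def curl (u : E3 → C3) (x : E3) : C3 :=
  ![partialD u 1 2 x - partialD u 2 1 x,
    partialD u 2 0 x - partialD u 0 2 x,
    partialD u 0 1 x - partialD u 1 0 x]

/-- The stretched curl `J⁻¹ 𝔹 curl (𝔹 u)`. -/
def PML.curl (p : PML) (u : E3 → C3) (x : E3) : C3 :=
  (p.jac x)⁻¹ • (p.B x *ᵥ _root_.curl (fun z => p.B z *ᵥ u z) x)

/-! ### Surfaces -/

/-- A real vector regarded as a complex one. -/
def toC3 (v : E3) : C3 := fun l => ((v l : ℝ) : ℂ)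

/-- `Ω` is an open set with smooth boundary, lying locally on one side of it, and on the boundary
of `Ω` the field `ν` is the unit normal that points out of `Ω`. -/
def IsSmoothDomain (Ω : Set E3) (ν : E3 → E3) : Prop :=
  IsOpen Ω ∧ ∀ x ∈ frontier Ω, ∃ V : Set E3, IsOpen V ∧ x ∈ V ∧ ∃ F : E3 → ℝ,
    ContDiffOn ℝ ∞ F V ∧ ∀ y ∈ V, gradient F y ≠ 0 ∧ (y ∈ Ω ↔ F y < 0) ∧
      (y ∈ frontier Ω → ν y = ‖gradient F y‖⁻¹ • gradient F y)

/-- A locally perturbed layered configuration. The set `upper` lies above the interface `Γ`, its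
boundary; off a compact part of the physical box, `Γ` is the plane `x₃ = height`. The set `obstacle`
(possibly empty) is a bounded obstacle above `Γ` in the physical box. The domain `Ω₁` is `upper`
without the closed obstacle, and `ν` is the unit normal on `Γ` and on the boundary of the obstacle
that points out of `Ω₁`. -/
structure LayeredGeometry (p : PML) where
  upper : Set E3
  obstacle : Set E3
  ν : E3 → E3
  height : ℝ
  height_lt : |height| < p.a 2
  smooth_upper : IsSmoothDomain upper ν
  smooth_obstacle : IsSmoothDomain obstacle (fun x => -ν x)
  flat : ∃ K : Set E3, IsCompact K ∧ K ⊆ p.physBox ∧ ∀ x, x ∉ K → (x ∈ upper ↔ height < x 2)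
  obstacle_subset : closure obstacle ⊆ upper ∩ p.physBox

/-- The truncated surface: the part of `Γ` in the truncated box, together with the boundary of the
obstacle. It is `Γᵇ` if the obstacle is empty, and `Γ_*ᵇ` in general. -/
def LayeredGeometry.surface {p : PML} (G : LayeredGeometry p) : Set E3 :=
  (frontier G.upper ∩ p.truncBox) ∪ frontier G.obstacle

/-- The surface measure of a subset `M` of a smooth surface: two-dimensional Hausdorff measure,
normalized so that it is Lebesgue measure on planes. -/
def surfaceMeasure (M : Set E3) : Measure E3 := (μHE[2] : Measure E3).restrict M

/-- The surface divergence `div v - ν · ∂_ν v` of a vector field on `M`. The derivative is the one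
along `M`: its value on normal vectors is irrelevant, since the normal part is subtracted. -/
def surfaceDiv (M : Set E3) (ν : E3 → E3) (v : E3 → C3) (x : E3) : ℂ :=
  (∑ l, fderivWithin ℝ v M x (EuclideanSpace.single l 1) l) -
    toC3 (ν x) ⬝ᵥ fderivWithin ℝ v M x (ν x)

/-- The scalar function `u` on `M` has at `x` a derivative along `M`, and `c = ν × ∇_Γ u`, where
`∇_Γ u = ∇ u - ν ∂_ν u`, is the value of its surface vector curl. Here too the normal part of the
derivative is irrelevant. -/
def HasSurfaceCurlAt (M : Set E3) (ν : E3 → E3) (u : E3 → ℂ) (c : C3) (x : E3) : Prop :=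
  ∃ L : E3 →L[ℝ] ℂ, HasFDerivWithinAt u L M x ∧
    c = toC3 (ν x) ⨯₃ ((fun l => L (EuclideanSpace.single l 1)) - L (ν x) • toC3 (ν x))

/-! ### Potentials and the hyper-singular operator -/

/-- `∫_M Φ̃(k, x, y) 𝔹(y) φ(y) ds_y`. -/
def PML.vecPotential (p : PML) (k : ℝ) (M : Set E3) (φ : E3 → C3) (x : E3) : C3 :=
  ∫ y, p.Phi k x y • (p.B y *ᵥ φ y) ∂(surfaceMeasure M)

/-- `∫_M Φ̃(k, x, y) ψ(y) ds_y`. -/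
def PML.scalPotential (p : PML) (k : ℝ) (M : Set E3) (ψ : E3 → ℂ) (x : E3) : ℂ :=
  ∫ y, p.Phi k x y * ψ y ∂(surfaceMeasure M)

/-- The layer potential `𝔹(x) ∇̃ × ∇̃ × ∫_M Φ̃(k, x, y) 𝔹(y) φ(y) ds_y`, for `x` off the surface. -/
def PML.layerPotential (p : PML) (k : ℝ) (M : Set E3) (φ : E3 → C3) (x : E3) : C3 :=
  p.B x *ᵥ p.curl (p.curl (p.vecPotential k M φ)) x

/-- The hyper-singular operator on `M`, applied to `φ`, has at `x ∈ M` the value `w`: it is the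
boundary value of `ν_x × 𝔹 ∇̃ × ∇̃ × ∫_M Φ̃ 𝔹 φ ds` along the normal, from the side into which `ν`
points if `s = 1` and from the other side if `s = -1`. -/
def PML.HasHypersingularAt (p : PML) (k : ℝ) (M : Set E3) (ν : E3 → E3) (s : ℝ) (φ : E3 → C3)
    (w : C3) (x : E3) : Prop :=
  Tendsto (fun h : ℝ => toC3 (ν x) ⨯₃ p.layerPotential k M φ (x + (s * h) • ν x))
    (𝓝[>] 0) (𝓝 w)

end

/-! The proof rests on two facts: an identity off the surface, and a first-order expansion of the
single layer potential along the surface.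

The identity. In the stretched coordinates the fundamental solution solves the Helmholtz equation
and `curl curl = grad div - Δ` holds componentwise. Applied to the vector potential off the surface,
the Laplacian gives `k²` times that potential. In the term `grad div`, one derivative of the kernel
is transferred from `x` to `y` and integrated by parts over `M`. The edge contributes nothing
because `φ` vanishes there, and what remains is the stretched gradient of the single layer potential
with density `div_Γ φ` (`LayeredGeometry.layerPotential_eq`). The vector potential is weakly
singular, hence continuous along the normal. The hyper-singular limit therefore exists exactly when
`ν × gradPot` converges at `x + s h ν` (`LayeredGeometry.hasHypersingularAt_iff`).

The expansion. Let `u` be a single layer potential with continuous bounded density. Its increment `u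
y - u x`, for `y` in `M` with `‖y - x‖ ≤ h`, equals the gradient at `x + s h ν` applied to `y - x`,
up to `o(h)` (`LayeredGeometry.firstOrderAt`). No limit of the gradient is needed for this. The
density is split into `ψ x` times a smooth cutoff and a remainder vanishing at `x`. For the
remainder, kernel estimates on the scale `h` suffice (`firstOrderAt_of_tendsto_zero`). For the
cutoff, a second integration by parts shows that the tangential gradient has a limit
(`exists_tendsto_tangPart_gradPot`), and integration along a segment lifted off the surface by `h ^
(5/4)` gives the expansion (`firstOrderAt_of_tendsto_tangPart`).

Given the expansion, convergence of the tangential gradient and differentiability of `u` along `M`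
are equivalent: the normal part of the gradient grows at most like `h ^ (-1/10)`, while `ν · (y -
x)` is `O(h ^ 2)`. At a point of Hölder continuity the remainder has an absolutely integrable
gradient, so the limit exists.

The integrations by parts need a divergence theorem on `M` with its Hausdorff measure. It is derived
from an area formula for charts inverted by linear projections, a partition of unity, and cutoffs at
the edge. -/

noncomputable section

/-! ### The area formula for graph-like parametrized surfaces -/

/-- The Euclidean plane. -/
abbrev E2 : Type := EuclideanSpace ℝ (Fin 2)

/-- The hypothesis makes `f` constant on the fibres of `g` in `s`, so `f` factors there through a
`K`-Lipschitz map on `g '' s`, which scales two-dimensional measure by at most `K ^ 2`. In this form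
a surface patch and its linearization can be compared in both directions. -/
lemma hausdorff_image_le_of_edist_le {α β γ : Type*} [EMetricSpace β]
    [MeasurableSpace β] [BorelSpace β] [EMetricSpace γ] [MeasurableSpace γ] [BorelSpace γ]
    {f : α → γ} {g : α → β} {s : Set α} {K : NNReal}
    (h : ∀ a ∈ s, ∀ b ∈ s, edist (f a) (f b) ≤ K * edist (g a) (g b)) :
    (μHE[2] : Measure γ) (f '' s) ≤ (K : ENNReal) ^ 2 * (μHE[2] : Measure β) (g '' s) := by
  classical
  rcases s.eq_empty_or_nonempty with rfl | ⟨a0, ha0⟩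
  · simp
  have : Nonempty α := ⟨a0⟩
  set F : β → γ := fun y => f (Function.invFunOn g s y) with hF
  have hmem : ∀ y ∈ g '' s, Function.invFunOn g s y ∈ s ∧ g (Function.invFunOn g s y) = y :=
    fun y hy => ⟨Function.invFunOn_mem hy, Function.invFunOn_eq hy⟩
  have hL : LipschitzOnWith K F (g '' s) := by
    intro y hy z hz
    have := h _ (hmem y hy).1 _ (hmem z hz).1
    rwa [(hmem y hy).2, (hmem z hz).2] at this
  have himg : f '' s ⊆ F '' (g '' s) := by
    rintro _ ⟨a, ha, rfl⟩
    refine ⟨g a, ⟨a, ha, rfl⟩, ?_⟩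
    have h1 := hmem (g a) ⟨a, ha, rfl⟩
    have h2 := h _ h1.1 _ ha
    rw [h1.2, edist_self, mul_zero, nonpos_iff_eq_zero, edist_eq_zero] at h2
    exact h2
  have h3 := hL.hausdorffMeasure_image_le (d := 2) (by norm_num)
  simp only [Measure.euclideanHausdorffMeasure_def, Measure.smul_apply, ENNReal.smul_def,
    smul_eq_mul]
  rw [mul_left_comm]
  gcongr
  refine (measure_mono himg).trans ?_
  simpa using h3

lemma hausdorff_image_le_of_dist_le {α β γ : Type*} [MetricSpace β]
    [MeasurableSpace β] [BorelSpace β] [MetricSpace γ] [MeasurableSpace γ] [BorelSpace γ]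
    {f : α → γ} {g : α → β} {s : Set α} {K : ℝ} (hK : 0 ≤ K)
    (h : ∀ a ∈ s, ∀ b ∈ s, dist (f a) (f b) ≤ K * dist (g a) (g b)) :
    (μHE[2] : Measure γ) (f '' s) ≤ ENNReal.ofReal (K ^ 2) * (μHE[2] : Measure β) (g '' s) := by
  lift K to NNReal using hK
  refine (hausdorff_image_le_of_edist_le (f := f) (g := g) (s := s) (K := K) ?_).trans
    (le_of_eq ?_)
  · intro a ha b hb
    rw [edist_dist, edist_dist, ← ENNReal.ofReal_coe_nnreal, ← ENNReal.ofReal_mul (NNReal.coe_nonneg K)]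
    exact ENNReal.ofReal_le_ofReal (h a ha b hb)
  · rw [ENNReal.ofReal_pow (NNReal.coe_nonneg K), ENNReal.ofReal_coe_nnreal]

lemma area_linear (T : E2 →L[ℝ] E3) (s : Set E2) :
    (μHE[2] : Measure E3) (T '' s) = ENNReal.ofReal T.toLinearMap.normDet * volume s := by
  have := LinearMap.euclideanHausdorffMeasure_image_eq_normDet_mul_volume T.toLinearMap s
  simpa using this

section Area
variable {G : E2 → E3} {U : Set E2} {π : E3 →L[ℝ] E2} {K : NNReal}

/-- The Jacobian of a parametrization. -/
def areaJac (G : E2 → E3) (u : E2) : ℝ := (fderiv ℝ G u).toLinearMap.normDet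

lemma measure_image_le_of_lipschitz (hL : LipschitzOnWith K G U) {A : Set E2} (hA : A ⊆ U) :
    (μHE[2] : Measure E3) (G '' A) ≤ (K : ENNReal) ^ 2 * volume A := by
  have := hausdorff_image_le_of_edist_le (f := G) (g := id) (s := A) (K := K)
    (fun a ha b hb => hL (hA ha) (hA hb))
  simpa [EuclideanSpace.euclideanHausdorffMeasure_eq_volume] using this

/-- Near `u` the map `G` differs from its differential `T` by a factor close to one in every
distance: the linearization error is at most `ε ‖a - b‖`, and this is at most `ε ‖T (a - b)‖`
because `π` is a norm-one left inverse of `T`. The areas of the two images of a small ball then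
agree up to `(1 ± ε) ^ 2`. -/
lemma measure_image_bounds (hU : IsOpen U) (hG : ContDiffOn ℝ 1 G U) (hπ1 : ‖π‖ ≤ 1)
    (hπ : ∀ u ∈ U, π (G u) = u) {u : E2} (hu : u ∈ U) {ε : ℝ} (hε : 0 < ε) (hε1 : ε < 1) :
    ∀ᶠ r in 𝓝[>] (0 : ℝ),
      (μHE[2] : Measure E3) (G '' Metric.closedBall u r) ≤
        ENNReal.ofReal ((1 + ε) ^ 2 * areaJac G u) * volume (Metric.closedBall u r) ∧
      ENNReal.ofReal ((1 - ε) ^ 2 * areaJac G u) * volume (Metric.closedBall u r) ≤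
        (μHE[2] : Measure E3) (G '' Metric.closedBall u r) := by
  have hc : ContDiffAt ℝ 1 G u := hG.contDiffAt (hU.mem_nhds hu)
  set T := fderiv ℝ G u with hT
  have hs : HasStrictFDerivAt G T u := hc.hasStrictFDerivAt (by norm_num)
  have hTπ : ∀ v, ‖v‖ ≤ ‖T v‖ := by
    have h1 : HasFDerivAt (fun z => π (G z)) (π.comp T) u := π.hasFDerivAt.comp u hs.hasFDerivAt
    have h2 : HasFDerivAt (fun z => π (G z)) (ContinuousLinearMap.id ℝ E2) u :=
      (hasFDerivAt_id u).congr_of_eventuallyEq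
        (by filter_upwards [hU.mem_nhds hu] with z hz using hπ z hz)
    have h3 := h1.unique h2
    intro v
    have h4 : π (T v) = v := by simpa using congrArg (fun L => L v) h3
    calc ‖v‖ = ‖π (T v)‖ := by rw [h4]
      _ ≤ ‖π‖ * ‖T v‖ := π.le_opNorm _
      _ ≤ 1 * ‖T v‖ := by gcongr
      _ = ‖T v‖ := one_mul _
  have hev : ∀ᶠ p : E2 × E2 in 𝓝 (u, u),
      ‖G p.1 - G p.2 - T (p.1 - p.2)‖ ≤ ε * ‖p.1 - p.2‖ := hs.isLittleO.def hε
  obtain ⟨δ, hδ, hball⟩ := Metric.eventually_nhds_iff_ball.1 hev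
  filter_upwards [Ioo_mem_nhdsGT hδ] with r hr
  have key : ∀ a ∈ Metric.closedBall u r, ∀ b ∈ Metric.closedBall u r,
      ‖G a - G b - T (a - b)‖ ≤ ε * ‖a - b‖ := by
    intro a ha b hb
    have : (a, b) ∈ Metric.ball (u, u) δ := by
      rw [Metric.mem_ball, Prod.dist_eq]
      exact max_lt (lt_of_le_of_lt ha hr.2) (lt_of_le_of_lt hb hr.2)
    exact hball (a, b) this
  have hJ : 0 ≤ areaJac G u := LinearMap.normDet_nonneg _
  have h0 : 0 < 1 - ε := by linarith
  have e1 := hausdorff_image_le_of_dist_le (f := G) (g := T) (s := Metric.closedBall u r)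
    (K := 1 + ε) (by positivity) (by
      intro a ha b hb
      rw [dist_eq_norm, dist_eq_norm, ← map_sub]
      have h1 := key a ha b hb
      have h2 := hTπ (a - b)
      have h3 : ‖G a - G b‖ ≤ ‖G a - G b - T (a - b)‖ + ‖T (a - b)‖ := by
        simpa using norm_add_le (G a - G b - T (a - b)) (T (a - b))
      nlinarith)
  have e2 := hausdorff_image_le_of_dist_le (f := T) (g := G) (s := Metric.closedBall u r)
    (K := (1 - ε)⁻¹) (by positivity) (by
      intro a ha b hb
      rw [dist_eq_norm, dist_eq_norm, ← map_sub]
      have h1 := key a ha b hb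
      have h2 := hTπ (a - b)
      have h3 : ‖T (a - b)‖ ≤ ‖G a - G b - T (a - b)‖ + ‖G a - G b‖ := by
        have := norm_sub_le (G a - G b) (G a - G b - T (a - b))
        simp only [sub_sub_cancel] at this
        linarith
      rw [inv_mul_eq_div, le_div_iff₀ h0]
      nlinarith)
  rw [area_linear] at e1 e2
  constructor
  · rwa [ENNReal.ofReal_mul (by positivity), mul_assoc]
  · calc ENNReal.ofReal ((1 - ε) ^ 2 * areaJac G u) * volume (Metric.closedBall u r)
        = ENNReal.ofReal ((1 - ε) ^ 2) *
          (ENNReal.ofReal T.toLinearMap.normDet * volume (Metric.closedBall u r)) := by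
          rw [ENNReal.ofReal_mul (by positivity), mul_assoc]; rfl
      _ ≤ ENNReal.ofReal ((1 - ε) ^ 2) * (ENNReal.ofReal ((1 - ε)⁻¹ ^ 2) *
          (μHE[2] : Measure E3) (G '' Metric.closedBall u r)) := by gcongr
      _ = _ := by
          rw [← mul_assoc, ← ENNReal.ofReal_mul (by positivity), ← mul_pow,
            mul_inv_cancel₀ h0.ne']
          simp

lemma map_proj_apply (hπ : ∀ u ∈ U, π (G u) = u) (A : Set E2)
    (hA : MeasurableSet A) :
    ((μHE[2] : Measure E3).restrict (G '' U)).map π A = (μHE[2] : Measure E3) (G '' (A ∩ U)) := by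
  rw [Measure.map_apply π.continuous.measurable hA,
    Measure.restrict_apply (π.continuous.measurable hA)]
  congr 1
  ext y
  constructor
  · rintro ⟨h1, u, hu, rfl⟩
    exact ⟨u, ⟨by simpa [hπ u hu] using h1, hu⟩, rfl⟩
  · rintro ⟨u, ⟨h1, h2⟩, rfl⟩
    exact ⟨by simpa [hπ u h2] using h1, u, h2, rfl⟩

/-- Area formula: projecting the surface measure to the parameter domain gives the density
`areaJac`. -/
lemma map_proj_eq (hU : IsOpen U) (hUf : volume U ≠ ⊤) (hG : ContDiffOn ℝ 1 G U)
    (hL : LipschitzOnWith K G U)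
    (hπ1 : ‖π‖ ≤ 1) (hπ : ∀ u ∈ U, π (G u) = u) :
    ((μHE[2] : Measure E3).restrict (G '' U)).map π =
      (volume.restrict U).withDensity (fun u => ENNReal.ofReal (areaJac G u)) := by
  set ν := ((μHE[2] : Measure E3).restrict (G '' U)).map π with hν
  have happ : ∀ A, MeasurableSet A → ν A = (μHE[2] : Measure E3) (G '' (A ∩ U)) := fun A hA => map_proj_apply hπ A hA
  have hle : ∀ A, MeasurableSet A → ν A ≤ (K : ENNReal) ^ 2 * volume (A ∩ U) := fun A hA => by
    rw [happ A hA]; exact measure_image_le_of_lipschitz hL inter_subset_right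
  have hfin : IsFiniteMeasure ν := ⟨by
    refine (hle univ MeasurableSet.univ).trans_lt ?_
    rw [univ_inter]
    exact ENNReal.mul_lt_top (by simp) hUf.lt_top⟩
  have hac : ν ≪ (volume : Measure E2) := by
    refine Measure.AbsolutelyContinuous.mk fun A hA h0 => ?_
    refine le_antisymm ((hle A hA).trans ?_) bot_le
    rw [measure_mono_null inter_subset_left h0, mul_zero]
  -- The density is found by differentiation of measures: almost everywhere it is the limit of
  -- ratios over shrinking balls, and `measure_image_bounds` traps that limit between `(1 ± ε) ^ 2`
  -- times the Jacobian for every `ε`.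
  have hrn := Besicovitch.ae_tendsto_rnDeriv ν (volume : Measure E2)
  have hlim : ∀ᵐ u ∂(volume : Measure E2), u ∈ U → ν.rnDeriv volume u = ENNReal.ofReal (areaJac G u) := by
    filter_upwards [hrn] with u hu huU
    have hJ : 0 ≤ areaJac G u := LinearMap.normDet_nonneg _
    have hsub : ∀ᶠ r in 𝓝[>] (0 : ℝ), Metric.closedBall u r ⊆ U := by
      obtain ⟨δ, hδ, hb⟩ := Metric.isOpen_iff.1 hU u huU
      filter_upwards [Ioo_mem_nhdsGT hδ] with r hr
      exact (Metric.closedBall_subset_ball hr.2).trans hb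
    have hpos : ∀ᶠ r in 𝓝[>] (0 : ℝ), 0 < r := self_mem_nhdsWithin
    have hb : ∀ ε : ℝ, 0 < ε → ε < 1 →
        ENNReal.ofReal ((1 - ε) ^ 2 * areaJac G u) ≤ ν.rnDeriv volume u ∧
        ν.rnDeriv volume u ≤ ENNReal.ofReal ((1 + ε) ^ 2 * areaJac G u) := by
      intro ε h0 h1
      have hev := measure_image_bounds hU hG hπ1 hπ huU h0 h1
      constructor
      · refine ge_of_tendsto hu ?_
        filter_upwards [hev, hsub, hpos] with r h2 h3 h4
        rw [ENNReal.le_div_iff_mul_le (Or.inl (Metric.measure_closedBall_pos _ _ h4).ne')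
          (Or.inl measure_closedBall_lt_top.ne), happ _ Metric.isClosed_closedBall.measurableSet,
          inter_eq_self_of_subset_left h3]
        exact h2.2
      · refine le_of_tendsto hu ?_
        filter_upwards [hev, hsub, hpos] with r h2 h3 h4
        rw [ENNReal.div_le_iff_le_mul (Or.inl (Metric.measure_closedBall_pos _ _ h4).ne')
          (Or.inl measure_closedBall_lt_top.ne), happ _ Metric.isClosed_closedBall.measurableSet,
          inter_eq_self_of_subset_left h3]
        exact h2.1
    have hcont : ∀ c : ℝ, Tendsto (fun ε : ℝ => ENNReal.ofReal ((1 + c * ε) ^ 2 * areaJac G u)) (𝓝[>] 0)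
        (𝓝 (ENNReal.ofReal (areaJac G u))) := by
      intro c
      refine ENNReal.tendsto_ofReal ?_
      have : Tendsto (fun ε : ℝ => (1 + c * ε) ^ 2 * areaJac G u) (𝓝 0) (𝓝 ((1 + c * 0) ^ 2 * areaJac G u)) :=
        Continuous.tendsto (by fun_prop) 0
      simpa using this.mono_left nhdsWithin_le_nhds
    apply le_antisymm
    · refine ge_of_tendsto (hcont 1) ?_
      filter_upwards [Ioo_mem_nhdsGT one_pos] with ε hε
      simpa using (hb ε hε.1 hε.2).2
    · refine le_of_tendsto (hcont (-1)) ?_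
      filter_upwards [Ioo_mem_nhdsGT one_pos] with ε hε
      simpa [← sub_eq_add_neg] using (hb ε hε.1 hε.2).1
  have h1 : ν = volume.withDensity (ν.rnDeriv volume) := (Measure.withDensity_rnDeriv_eq _ _ hac).symm
  have h2 : ν = ν.restrict U := by
    symm
    rw [Measure.restrict_eq_self_of_ae_mem]
    rw [ae_iff]
    have := hle Uᶜ hU.measurableSet.compl
    rw [compl_inter_self, measure_empty, mul_zero] at this
    exact le_antisymm this bot_le
  rw [h2, h1, restrict_withDensity hU.measurableSet]
  refine withDensity_congr_ae ?_
  exact (ae_restrict_iff' hU.measurableSet).2 hlim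

lemma continuousOn_areaJac (hU : IsOpen U) (hG : ContDiffOn ℝ 1 G U) : ContinuousOn (areaJac G) U := by
  have h1 : ContinuousOn (fun u => fderiv ℝ G u) U := hG.continuousOn_fderiv_of_isOpen hU le_rfl
  let b := EuclideanSpace.basisFun (Fin 2) ℝ
  have h2 : ∀ u, areaJac G u = Real.sqrt ((Matrix.gram ℝ (fun i => fderiv ℝ G u (b i))).det) := by
    intro u
    have := LinearMap.normDet_sq_eq_det_gram (fderiv ℝ G u).toLinearMap b
    simp only [RCLike.ofReal_real_eq_id, id] at this
    rw [show (fun i => fderiv ℝ G u (b i)) = fun i => (fderiv ℝ G u).toLinearMap (b i) from rfl,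
      ← this, Real.sqrt_sq (LinearMap.normDet_nonneg _)]
    rfl
  simp_rw [funext h2]
  refine Continuous.comp_continuousOn Real.continuous_sqrt ?_
  simp only [Matrix.det_fin_two, Matrix.gram_apply]
  fun_prop

/-- Change of variables in a surface integral. -/
lemma setIntegral_image_eq {F : Type*} [NormedAddCommGroup F] [NormedSpace ℝ F]
    (hU : IsOpen U) (hUf : volume U ≠ ⊤) (hG : ContDiffOn ℝ 1 G U)
    (hL : LipschitzOnWith K G U) (hπ1 : ‖π‖ ≤ 1) (hπ : ∀ u ∈ U, π (G u) = u)
    (hm : MeasurableSet (G '' U)) (f : E3 → F) (hf : ContinuousOn f (G '' U)) :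
    ∫ y in G '' U, f y ∂(μHE[2] : Measure E3) = ∫ u in U, areaJac G u • f (G u) := by
  -- On the patch `f` equals `f ∘ G ∘ π`, so the integrand factors through `π` and the projected
  -- measure can be used.
  have h0 : ∫ y in G '' U, f y ∂(μHE[2] : Measure E3) =
      ∫ y in G '' U, f (G (π y)) ∂(μHE[2] : Measure E3) := by
    refine setIntegral_congr_fun hm ?_
    rintro _ ⟨u, hu, rfl⟩
    simp [hπ u hu]
  have hmap := map_proj_eq hU hUf hG hL hπ1 hπ
  have hfm : AEStronglyMeasurable (fun u => f (G u)) (volume.restrict U) :=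
    (hf.comp hG.continuousOn (mapsTo_image _ _)).aestronglyMeasurable hU.measurableSet
  have hJ := continuousOn_areaJac hU hG
  rw [h0, ← integral_map (μ := (μHE[2] : Measure E3).restrict (G '' U)) (φ := π)
    (f := fun u => f (G u)) π.continuous.aemeasurable, hmap,
    integral_withDensity_eq_integral_toReal_smul₀]
  · refine integral_congr_ae (Eventually.of_forall fun u => ?_)
    simp only
    rw [ENNReal.toReal_ofReal (show 0 ≤ areaJac G u from LinearMap.normDet_nonneg _)]
  · exact (hJ.aemeasurable hU.measurableSet).ennreal_ofReal
  · exact Eventually.of_forall fun u => ENNReal.ofReal_lt_top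
  · rw [hmap]
    exact hfm.mono_ac (withDensity_absolutelyContinuous _ _)

end Area
end

noncomputable section

/-! ### The divergence theorem in a chart -/

/-- The triple product of complex vectors. -/
def tri (x y z : C3) : ℂ :=
  x 0 * (y 1 * z 2 - y 2 * z 1) + x 1 * (y 2 * z 0 - y 0 * z 2) + x 2 * (y 0 * z 1 - y 1 * z 0)

/-- The trace of the derivative `L` along the plane orthogonal to `n`. -/
def tanTrace (n : E3) (L : E3 →L[ℝ] C3) : ℂ :=
  (∑ l, L (EuclideanSpace.single l 1) l) - toC3 n ⬝ᵥ L n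

lemma surfaceDiv_eq_tanTrace (M : Set E3) (ν : E3 → E3) (v : E3 → C3) (x : E3) :
    surfaceDiv M ν v x = tanTrace (ν x) (fderivWithin ℝ v M x) := rfl

lemma E3_eq_sum (v : E3) : v = v 0 • EuclideanSpace.single 0 1 + v 1 • EuclideanSpace.single 1 1
    + v 2 • EuclideanSpace.single 2 1 := by
  ext i; fin_cases i <;> simp

lemma clm_apply_eq_sum {F : Type*} [NormedAddCommGroup F] [NormedSpace ℝ F] (L : E3 →L[ℝ] F)
    (v : E3) : L v = v 0 • L (EuclideanSpace.single 0 1) + v 1 • L (EuclideanSpace.single 1 1)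
    + v 2 • L (EuclideanSpace.single 2 1) := by
  conv_lhs => rw [E3_eq_sum v]
  simp

/-- Replacing the columns of a determinant one at a time by their images under `L` produces the
trace of `L` times the determinant. Replacing only the two tangential columns leaves the trace over
the plane orthogonal to `ν`. The identity is polynomial modulo the three components of `hc` and the
relation `hν`. -/
lemma tri_tanTrace (ν a b : E3) (L : E3 →L[ℝ] C3) (s : ℂ)
    (hc : toC3 a ⨯₃ toC3 b = s • toC3 ν) (hν : toC3 ν ⬝ᵥ toC3 ν = 1) :
    tri (L a) (toC3 b) (toC3 ν) + tri (toC3 a) (L b) (toC3 ν) = s * tanTrace ν L := by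
  have h0 := congrFun hc 0
  have h1 := congrFun hc 1
  have h2 := congrFun hc 2
  simp [cross_apply] at h0 h1 h2
  simp only [dotProduct, Fin.sum_univ_three] at hν
  have ea := clm_apply_eq_sum L a
  have eb := clm_apply_eq_sum L b
  have en := clm_apply_eq_sum L ν
  simp only [tri, tanTrace, dotProduct, Fin.sum_univ_three]
  rw [ea, eb, en]
  simp only [Pi.add_apply, Pi.smul_apply, Complex.real_smul]
  simp only [toC3] at *
  set L0 := L (EuclideanSpace.single 0 1)
  set L1 := L (EuclideanSpace.single 1 1)
  set L2 := L (EuclideanSpace.single 2 1)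
  generalize (a 0 : ℂ) = a0 at *
  generalize (a 1 : ℂ) = a1 at *
  generalize (a 2 : ℂ) = a2 at *
  generalize (b 0 : ℂ) = b0 at *
  generalize (b 1 : ℂ) = b1 at *
  generalize (b 2 : ℂ) = b2 at *
  generalize (ν 0 : ℂ) = n0 at *
  generalize (ν 1 : ℂ) = n1 at *
  generalize (ν 2 : ℂ) = n2 at *
  linear_combination (L1 1 * n0 + L2 2 * n0 - n1 * L1 0 - n2 * L2 0) * h0 +
    (L0 0 * n1 + L2 2 * n1 - n0 * L0 1 - n2 * L2 1) * h1 +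
    (L1 1 * n2 + L0 0 * n2 - n1 * L1 2 - n0 * L0 2) * h2 + s * (L0 0 + L1 1 + L2 2) * hν

/-- Three vectors in the two-dimensional complement of `n` are linearly dependent. The pairing is
bilinear, not Hermitian, so `n ⬝ᵥ n = 1` is what makes `n` independent of that complement. -/
lemma tri_eq_zero_of_orth {x y z n : C3} (hn : n ⬝ᵥ n = 1) (hx : n ⬝ᵥ x = 0) (hy : n ⬝ᵥ y = 0)
    (hz : n ⬝ᵥ z = 0) : tri x y z = 0 := by
  simp only [dotProduct, Fin.sum_univ_three] at *
  simp only [tri]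
  linear_combination (-(x 0 * (y 1 * z 2 - y 2 * z 1) + x 1 * (y 2 * z 0 - y 0 * z 2) + x 2 * (y 0 * z 1 - y 1 * z 0))) * hn
   + (n 0 * (y 1 * z 2 - y 2 * z 1) + n 1 * (y 2 * z 0 - y 0 * z 2) + n 2 * (y 0 * z 1 - y 1 * z 0)) * hx
   - (n 0 * (x 1 * z 2 - x 2 * z 1) + n 1 * (x 2 * z 0 - x 0 * z 2) + n 2 * (x 0 * z 1 - x 1 * z 0)) * hy
   + (n 0 * (x 1 * y 2 - x 2 * y 1) + n 1 * (x 2 * y 0 - x 0 * y 2) + n 2 * (x 0 * y 1 - x 1 * y 0)) * hz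

lemma hasDerivAt_tri {f g h : ℝ → C3} {f' g' h' : C3} {t : ℝ} (hf : HasDerivAt f f' t)
    (hg : HasDerivAt g g' t) (hh : HasDerivAt h h' t) :
    HasDerivAt (fun s => tri (f s) (g s) (h s))
      (tri f' (g t) (h t) + tri (f t) g' (h t) + tri (f t) (g t) h') t := by
  rw [hasDerivAt_pi] at hf hg hh
  have := (((hf 0).mul (((hg 1).mul (hh 2)).sub ((hg 2).mul (hh 1)))).add
    ((hf 1).mul (((hg 2).mul (hh 0)).sub ((hg 0).mul (hh 2))))).add
    ((hf 2).mul (((hg 0).mul (hh 1)).sub ((hg 1).mul (hh 0))))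
  refine (this.congr_deriv ?_).congr_of_eventuallyEq (Eventually.of_forall fun s => ?_)
  · simp only [tri, Pi.mul_apply, Pi.sub_apply]; ring
  · simp only [tri, Pi.mul_apply, Pi.sub_apply, Pi.add_apply]

lemma contDiffOn_tri {f g h : E2 → C3} {U : Set E2} (hf : ContDiffOn ℝ 1 f U)
    (hg : ContDiffOn ℝ 1 g U) (hh : ContDiffOn ℝ 1 h U) :
    ContDiffOn ℝ 1 (fun s => tri (f s) (g s) (h s)) U := by
  rw [contDiffOn_pi] at hf hg hh
  have h0 := hf 0
  have h1 := hf 1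
  have h2 := hf 2
  have g0 := hg 0
  have g1 := hg 1
  have g2 := hg 2
  have k0 := hh 0
  have k1 := hh 1
  have k2 := hh 2
  unfold tri
  fun_prop

/-- `toC3` as a continuous linear map. -/
def toC3L : E3 →L[ℝ] C3 :=
  ContinuousLinearMap.pi fun l => Complex.ofRealCLM.comp (EuclideanSpace.proj l)

@[simp] lemma toC3L_apply (v : E3) : toC3L v = toC3 v := rfl

lemma toC3_dotProduct (v w : E3) : toC3 v ⬝ᵥ toC3 w = ((inner ℝ v w : ℝ) : ℂ) := by
  simp [dotProduct, toC3, Fin.sum_univ_three, PiLp.inner_apply]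
  ring

/-- Integration by parts against the constant function one. -/
lemma integral_fderiv_eq_zero {g : E2 → ℂ} (hg : ContDiff ℝ 1 g) (hc : HasCompactSupport g)
    (v : E2) : ∫ u, fderiv ℝ g u v = 0 := by
  have hcont : Continuous (fun u => fderiv ℝ g u v) :=
    (hg.continuous_fderiv one_ne_zero).clm_apply continuous_const
  have hcs : HasCompactSupport (fun u => fderiv ℝ g u v) :=
    (hc.fderiv ℝ).comp_left (g := fun L : E2 →L[ℝ] ℂ => L v) (by simp)
  have h1 := hcont.integrable_of_hasCompactSupport hcs (μ := (volume : Measure E2))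
  have h2 := hg.continuous.integrable_of_hasCompactSupport hc (μ := (volume : Measure E2))
  have := integral_mul_fderiv_eq_neg_fderiv_mul_of_integrable (μ := (volume : Measure E2)) (𝕜 := ℂ)
    (f := fun _ => 1) (g := g) (v := v)
    (by simp) (by simpa using h1) (by simpa using h2) (fun x _ => differentiableAt_const _)
    (fun x _ => hg.differentiable (by norm_num) x)
  simpa using this

section Chart
variable {G : E2 → E3} {U : Set E2} {π : E3 →L[ℝ] E2}

/-- The coordinate tangent vectors of a parametrization. -/
def tangentVec (G : E2 → E3) (i : Fin 2) (u : E2) : E3 := fderiv ℝ G u (EuclideanSpace.single i 1)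

/-- Lagrange's identity: the Gram determinant of two vectors is the squared length of their cross
product. -/
lemma areaJac_sq (u : E2) : ((areaJac G u : ℝ) : ℂ) ^ 2 =
    (toC3 (tangentVec G 0 u) ⨯₃ toC3 (tangentVec G 1 u)) ⬝ᵥ
      (toC3 (tangentVec G 0 u) ⨯₃ toC3 (tangentVec G 1 u)) := by
  have := LinearMap.normDet_sq_eq_det_gram (fderiv ℝ G u).toLinearMap (EuclideanSpace.basisFun (Fin 2) ℝ)
  rw [Matrix.det_fin_two] at this
  simp only [Matrix.gram_apply, PiLp.inner_apply, Fin.sum_univ_three] at this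
  have h2 : (areaJac G u) ^ 2 = _ := this
  rw [← Complex.ofReal_pow, h2]
  simp [dotProduct, cross_apply, Fin.sum_univ_three, toC3, tangentVec]
  ring

lemma contDiffOn_tangentVec (hU : IsOpen U) (hG : ContDiffOn ℝ 2 G U) (i : Fin 2) :
    ContDiffOn ℝ 1 (tangentVec G i) U :=
  (hG.fderiv_of_isOpen hU (m := 1) (by norm_num)).clm_apply contDiffOn_const

/-- The differential of `G` has `π` as a left inverse, so it is injective and its Jacobian cannot
vanish. -/
lemma areaJac_pos (hU : IsOpen U) (hG : ContDiffOn ℝ 1 G U)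
    (hπ : ∀ u ∈ U, π (G u) = u) {u : E2} (hu : u ∈ U) : 0 < areaJac G u := by
  refine lt_of_le_of_ne (LinearMap.normDet_nonneg _) (Ne.symm ?_)
  have hd := (hG.contDiffAt (hU.mem_nhds hu)).differentiableAt (by norm_num)
  have h1 : HasFDerivAt (fun z => π (G z)) (π.comp (fderiv ℝ G u)) u :=
    π.hasFDerivAt.comp u hd.hasFDerivAt
  have h2 : HasFDerivAt (fun z => π (G z)) (ContinuousLinearMap.id ℝ E2) u :=
    (hasFDerivAt_id u).congr_of_eventuallyEq
      (by filter_upwards [hU.mem_nhds hu] with z hz using hπ z hz)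
  have h3 := h1.unique h2
  intro h0
  have h4 := (LinearMap.normDet_eq_zero_iff_ker_ne_bot).1 h0
  apply h4
  rw [LinearMap.ker_eq_bot']
  intro v hv
  have h5 : π (fderiv ℝ G u v) = v := by simpa using congrArg (fun L => L v) h3
  rw [← h5]
  have : fderiv ℝ G u v = 0 := hv
  rw [this, map_zero]

/-- The unit normal of a parametrized surface, as a complex vector. -/
def chartNormal (G : E2 → E3) (u : E2) : C3 :=
  ((areaJac G u : ℂ))⁻¹ • (toC3 (tangentVec G 0 u) ⨯₃ toC3 (tangentVec G 1 u))

lemma contDiffOn_chartNormal (hU : IsOpen U) (hG : ContDiffOn ℝ 2 G U)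
    (hπ : ∀ u ∈ U, π (G u) = u) : ContDiffOn ℝ 1 (chartNormal G) U := by
  have ht : ∀ i l, ContDiffOn ℝ 1 (fun u => tangentVec G i u l) U := fun i l =>
    (EuclideanSpace.proj (𝕜 := ℝ) l).contDiff.comp_contDiffOn (contDiffOn_tangentVec hU hG i)
  have hJ : ContDiffOn ℝ 1 (areaJac G) U := by
    have hsq : ∀ u, areaJac G u = Real.sqrt ((areaJac G u) ^ 2) := fun u =>
      (Real.sqrt_sq (LinearMap.normDet_nonneg _)).symm
    rw [funext hsq]
    refine ContDiffOn.sqrt ?_ (fun u hu => (pow_pos (areaJac_pos hU (hG.of_le (by norm_num)) hπ hu) 2).ne')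
    have : (fun u => areaJac G u ^ 2) = fun u =>
      (tangentVec G 0 u 1 * tangentVec G 1 u 2 - tangentVec G 0 u 2 * tangentVec G 1 u 1) ^ 2
      + (tangentVec G 0 u 2 * tangentVec G 1 u 0 - tangentVec G 0 u 0 * tangentVec G 1 u 2) ^ 2
      + (tangentVec G 0 u 0 * tangentVec G 1 u 1 - tangentVec G 0 u 1 * tangentVec G 1 u 0) ^ 2 := by
      funext u
      have := areaJac_sq (G := G) u
      simp [dotProduct, cross_apply, Fin.sum_univ_three, toC3] at this
      norm_cast at this
      rw [this]; ring
    rw [this]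
    have h00 := ht 0 0
    have h01 := ht 0 1
    have h02 := ht 0 2
    have h10 := ht 1 0
    have h11 := ht 1 1
    have h12 := ht 1 2
    fun_prop
  have hJi : ContDiffOn ℝ 1 (fun u => ((areaJac G u)⁻¹ : ℝ)) U :=
    hJ.inv (fun u hu => (areaJac_pos hU (hG.of_le (by norm_num)) hπ hu).ne')
  have htc : ∀ i l, ContDiffOn ℝ 1 (fun u => toC3 (tangentVec G i u) l) U := fun i l =>
    Complex.ofRealCLM.contDiff.comp_contDiffOn (ht i l)
  have hJc : ContDiffOn ℝ 1 (fun u => ((areaJac G u : ℂ))⁻¹) U := by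
    have := Complex.ofRealCLM.contDiff.comp_contDiffOn hJi
    refine this.congr fun u _ => ?_
    simp
  rw [contDiffOn_pi]
  have h00 := htc 0 0
  have h01 := htc 0 1
  have h02 := htc 0 2
  have h10 := htc 1 0
  have h11 := htc 1 1
  have h12 := htc 1 2
  intro l
  fin_cases l <;> simp [chartNormal, cross_apply] <;> fun_prop

end Chart
end

/-! ### Surface divergence in a chart -/

noncomputable section

section Chart
variable {G : E2 → E3} {U : Set E2} {π : E3 →L[ℝ] E2}

lemma hasDerivAt_line {F : Type*} [NormedAddCommGroup F] [NormedSpace ℝ F] {f : E2 → F} {u v : E2}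
    (hf : DifferentiableAt ℝ f u) :
    HasDerivAt (fun s : ℝ => f (u + s • v)) (fderiv ℝ f u v) 0 :=
  hf.hasFDerivAt.hasLineDerivAt v

/-- Symmetry of second derivatives. It makes the derivatives of the tangent vectors cancel when the
two fluxes are differentiated. -/
lemma tangentVec_symm (hU : IsOpen U) (hG : ContDiffOn ℝ 2 G U) {u : E2} (hu : u ∈ U) (i j : Fin 2) :
    fderiv ℝ (tangentVec G i) u (EuclideanSpace.single j 1) =
      fderiv ℝ (tangentVec G j) u (EuclideanSpace.single i 1) := by
  have hc := hG.contDiffAt (hU.mem_nhds hu)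
  have hd : DifferentiableAt ℝ (fderiv ℝ G) u :=
    (hc.fderiv_right (m := 1) (by norm_num)).differentiableAt (by norm_num)
  have h1 : ∀ i : Fin 2, fderiv ℝ (tangentVec G i) u = (fderiv ℝ (fderiv ℝ G) u).flip (EuclideanSpace.single i 1) := by
    intro i
    unfold tangentVec
    rw [fderiv_clm_apply hd (differentiableAt_const _)]
    simp
  rw [h1, h1]
  simp only [ContinuousLinearMap.flip_apply]
  exact (hc.isSymmSndFDerivAt (by simp)).eq _ _

lemma chartNormal_dot_self {u : E2} (h : areaJac G u ≠ 0) : chartNormal G u ⬝ᵥ chartNormal G u = 1 := by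
  unfold chartNormal
  rw [smul_dotProduct, dotProduct_smul, ← areaJac_sq]
  have : (areaJac G u : ℂ) ≠ 0 := by exact_mod_cast h
  simp only [smul_eq_mul]
  field_simp

lemma chartNormal_dot_tangentVec (i : Fin 2) (u : E2) : chartNormal G u ⬝ᵥ toC3 (tangentVec G i u) = 0 := by
  unfold chartNormal
  rw [smul_dotProduct]
  have : (toC3 (tangentVec G 0 u) ⨯₃ toC3 (tangentVec G 1 u)) ⬝ᵥ toC3 (tangentVec G i u) = 0 := by
    fin_cases i <;> simp [dotProduct, cross_apply, Fin.sum_univ_three] <;> ring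
  rw [this, smul_zero]

/-- The cross product of the tangent vectors is a multiple of any unit normal. -/
lemma cross_tangentVec {u : E2} {n : E3} (hn : ‖n‖ = 1) (ho : ∀ i, inner ℝ n (tangentVec G i u) = 0) :
    ∃ s : ℂ, s ^ 2 = (areaJac G u : ℂ) ^ 2 ∧
      toC3 (tangentVec G 0 u) ⨯₃ toC3 (tangentVec G 1 u) = s • toC3 n := by
  have h0 := toC3_dotProduct n (tangentVec G 0 u)
  have h1 := toC3_dotProduct n (tangentVec G 1 u)
  have h2 := toC3_dotProduct n n
  rw [ho, Complex.ofReal_zero] at h0 h1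
  rw [real_inner_self_eq_norm_sq, hn] at h2
  norm_num at h2
  rw [areaJac_sq]
  generalize toC3 n = n at *
  generalize toC3 (tangentVec G 0 u) = a at *
  generalize toC3 (tangentVec G 1 u) = b at *
  have key : a ⨯₃ b = ((a ⨯₃ b) ⬝ᵥ n) • n := by
    simp only [dotProduct, Fin.sum_univ_three] at h0 h1 h2
    ext l
    fin_cases l <;> simp [dotProduct, cross_apply, Fin.sum_univ_three]
    · linear_combination (-(a 1 * b 2 - a 2 * b 1)) * h2 - (n 2 * b 1 - n 1 * b 2) * h0 - (n 1 * a 2 - n 2 * a 1) * h1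
    · linear_combination (-(a 2 * b 0 - a 0 * b 2)) * h2 - (n 0 * b 2 - n 2 * b 0) * h0 - (n 2 * a 0 - n 0 * a 2) * h1
    · linear_combination (-(a 0 * b 1 - a 1 * b 0)) * h2 - (n 1 * b 0 - n 0 * b 1) * h0 - (n 0 * a 1 - n 1 * a 0) * h1
  refine ⟨(a ⨯₃ b) ⬝ᵥ n, ?_, key⟩
  set t := (a ⨯₃ b) ⬝ᵥ n with ht
  rw [key, smul_dotProduct, dotProduct_smul, h2, smul_eq_mul, smul_eq_mul]
  ring

/-- The first flux component of a field in a chart. -/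
def flux₁ (G : E2 → E3) (w : E3 → C3) (u : E2) : ℂ :=
  tri (w (G u)) (toC3 (tangentVec G 1 u)) (chartNormal G u)

/-- The second flux component of a field in a chart. -/
def flux₂ (G : E2 → E3) (w : E3 → C3) (u : E2) : ℂ :=
  tri (toC3 (tangentVec G 0 u)) (w (G u)) (chartNormal G u)

lemma contDiffOn_toC3_tangentVec (hU : IsOpen U) (hG : ContDiffOn ℝ 2 G U) (i : Fin 2) :
    ContDiffOn ℝ 1 (fun u => toC3 (tangentVec G i u)) U :=
  toC3L.contDiff.comp_contDiffOn (contDiffOn_tangentVec hU hG i)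

variable {M : Set E3} {ν : E3 → E3} {w : E3 → C3}

/-- In a chart, the surface divergence of an arbitrary field. -/
lemma areaJac_mul_surfaceDiv (hU : IsOpen U) (hG : ContDiffOn ℝ 2 G U)
    (hπ : ∀ u ∈ U, π (G u) = u) (hM : G '' U ⊆ M)
    (hν : ∀ u ∈ U, ‖ν (G u)‖ = 1) (hνt : ∀ u ∈ U, ∀ i, inner ℝ (ν (G u)) (tangentVec G i u) = 0)
    {u : E2} (hu : u ∈ U) {L : E3 →L[ℝ] C3} (hL : HasFDerivWithinAt w L M (G u)) :
    (areaJac G u : ℂ) * tanTrace (ν (G u)) L =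
      tri (fderiv ℝ (w ∘ G) u (EuclideanSpace.single 0 1)) (toC3 (tangentVec G 1 u)) (chartNormal G u) +
      tri (toC3 (tangentVec G 0 u)) (fderiv ℝ (w ∘ G) u (EuclideanSpace.single 1 1)) (chartNormal G u) := by
  have hc := hG.contDiffAt (hU.mem_nhds hu)
  have hd : HasFDerivAt (w ∘ G) (L.comp (fderiv ℝ G u)) u := by
    have h1 : HasFDerivWithinAt G (fderiv ℝ G u) U u :=
      (hc.differentiableAt (by norm_num)).hasFDerivAt.hasFDerivWithinAt
    exact (hL.comp u h1 (fun z hz => hM ⟨z, hz, rfl⟩)).hasFDerivAt (hU.mem_nhds hu)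
  rw [hd.fderiv]
  obtain ⟨s, hs, hcr⟩ := cross_tangentVec (hν u hu) (hνt u hu)
  have hJ : (areaJac G u : ℂ) ≠ 0 := by
    exact_mod_cast (areaJac_pos hU (hG.of_le (by norm_num)) hπ hu).ne'
  have hνν : toC3 (ν (G u)) ⬝ᵥ toC3 (ν (G u)) = 1 := by
    rw [toC3_dotProduct, real_inner_self_eq_norm_sq, hν u hu]; norm_num
  -- The chart normal is `ν` up to a sign carried by `s`. The factor `s` enters twice and `s ^ 2` is
  -- the squared Jacobian, so the orientation of the chart plays no role.
  have hn : chartNormal G u = ((areaJac G u : ℂ)⁻¹ * s) • toC3 (ν (G u)) := by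
    rw [chartNormal, hcr, smul_smul]
  have := tri_tanTrace (ν (G u)) (tangentVec G 0 u) (tangentVec G 1 u) L s hcr hνν
  have hlin : ∀ (x y z : C3) (c : ℂ), tri x y (c • z) = c * tri x y z := by
    intro x y z c; simp [tri]; ring
  rw [hn, hlin, hlin, ← mul_add]
  change _ = _ * (tri (L (tangentVec G 0 u)) _ _ + tri _ (L (tangentVec G 1 u)) _)
  rw [this]
  have : (areaJac G u : ℂ) * (areaJac G u : ℂ) = s * s := by rw [← sq, ← sq, hs]
  field_simp
  linear_combination (tanTrace (ν (G u)) L) * this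

lemma contDiffOn_comp_chart (hG : ContDiffOn ℝ 2 G U) (hw : ContDiffOn ℝ 1 w (G '' U)) :
    ContDiffOn ℝ 1 (w ∘ G) U :=
  hw.comp (hG.of_le (by norm_num)) (mapsTo_image _ _)

/-- The surface divergence in a chart does not depend on the choice of the derivative. -/
lemma tanTrace_unique (hU : IsOpen U) (hG : ContDiffOn ℝ 2 G U)
    (hπ : ∀ u ∈ U, π (G u) = u) (hM : G '' U ⊆ M)
    (hν : ∀ u ∈ U, ‖ν (G u)‖ = 1) (hνt : ∀ u ∈ U, ∀ i, inner ℝ (ν (G u)) (tangentVec G i u) = 0)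
    {u : E2} (hu : u ∈ U) {L : E3 →L[ℝ] C3} (hL : HasFDerivWithinAt w L M (G u)) :
    surfaceDiv M ν w (G u) = tanTrace (ν (G u)) L := by
  have h1 := areaJac_mul_surfaceDiv hU hG hπ hM hν hνt hu hL
  have h2 := areaJac_mul_surfaceDiv hU hG hπ hM hν hνt hu hL.differentiableWithinAt.hasFDerivWithinAt
  have hJ : (areaJac G u : ℂ) ≠ 0 := by
    exact_mod_cast (areaJac_pos hU (hG.of_le (by norm_num)) hπ hu).ne'
  rw [surfaceDiv_eq_tanTrace]
  exact mul_left_cancel₀ hJ (h2.trans h1.symm)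

/-- The chart formula expresses the divergence through continuous functions of the parameter;
composition with `π` brings the continuity back to the surface. -/
lemma continuousOn_surfaceDiv_chart (hU : IsOpen U) (hG : ContDiffOn ℝ 2 G U)
    (hπ : ∀ u ∈ U, π (G u) = u) (hM : G '' U ⊆ M)
    (hν : ∀ u ∈ U, ‖ν (G u)‖ = 1) (hνt : ∀ u ∈ U, ∀ i, inner ℝ (ν (G u)) (tangentVec G i u) = 0)
    (hw : ContDiffOn ℝ 1 w M) :
    ContinuousOn (surfaceDiv M ν w) (G '' U) := by
  have hW := contDiffOn_comp_chart hG (hw.mono hM)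
  have hDW : ∀ v : E2, ContinuousOn (fun u => fderiv ℝ (w ∘ G) u v) U := fun v =>
    (hW.continuousOn_fderiv_of_isOpen hU le_rfl).clm_apply continuousOn_const
  have ht := fun i => (contDiffOn_toC3_tangentVec hU hG i).continuousOn
  have hn := (contDiffOn_chartNormal hU hG hπ).continuousOn
  have hJ := continuousOn_areaJac hU (hG.of_le (by norm_num))
  have htri : ∀ {f g h : E2 → C3}, ContinuousOn f U → ContinuousOn g U → ContinuousOn h U →
      ContinuousOn (fun u => tri (f u) (g u) (h u)) U := by
    intro f g h hf hg hh
    rw [continuousOn_pi] at hf hg hh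
    have h0 := hf 0
    have h1 := hf 1
    have h2 := hf 2
    have g0 := hg 0
    have g1 := hg 1
    have g2 := hg 2
    have k0 := hh 0
    have k1 := hh 1
    have k2 := hh 2
    unfold tri
    fun_prop
  have hc : ContinuousOn (fun u => surfaceDiv M ν w (G u)) U := by
    have h1 : ContinuousOn (fun u => (areaJac G u : ℂ)⁻¹ *
      (tri (fderiv ℝ (w ∘ G) u (EuclideanSpace.single 0 1)) (toC3 (tangentVec G 1 u)) (chartNormal G u) +
      tri (toC3 (tangentVec G 0 u)) (fderiv ℝ (w ∘ G) u (EuclideanSpace.single 1 1)) (chartNormal G u))) U := by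
      refine ContinuousOn.mul (ContinuousOn.inv₀ (Complex.continuous_ofReal.comp_continuousOn hJ) ?_)
        ((htri (hDW _) (ht 1) hn).add (htri (ht 0) (hDW _) hn))
      intro u hu
      exact_mod_cast (areaJac_pos hU (hG.of_le (by norm_num)) hπ hu).ne'
    refine h1.congr fun u hu => ?_
    have hdw : DifferentiableWithinAt ℝ w M (G u) :=
      (hw (G u) (hM ⟨u, hu, rfl⟩)).differentiableWithinAt (by norm_num)
    have := areaJac_mul_surfaceDiv hU hG hπ hM hν hνt hu hdw.hasFDerivWithinAt
    simp only
    rw [← this, surfaceDiv_eq_tanTrace, inv_mul_cancel_left₀]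
    exact_mod_cast (areaJac_pos hU (hG.of_le (by norm_num)) hπ hu).ne'
  have : ContinuousOn (fun y => surfaceDiv M ν w (G (π y))) (G '' U) :=
    hc.comp π.continuous.continuousOn (by rintro _ ⟨u, hu, rfl⟩; simpa [hπ u hu] using hu)
  refine this.congr ?_
  rintro _ ⟨u, hu, rfl⟩
  simp [hπ u hu]

/-- In a chart, the surface divergence of a tangential field is a divergence. -/
lemma areaJac_mul_surfaceDiv_eq_fderiv (hU : IsOpen U) (hG : ContDiffOn ℝ 2 G U)
    (hπ : ∀ u ∈ U, π (G u) = u) (hM : G '' U ⊆ M)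
    (hν : ∀ u ∈ U, ‖ν (G u)‖ = 1) (hνt : ∀ u ∈ U, ∀ i, inner ℝ (ν (G u)) (tangentVec G i u) = 0)
    (hw : ContDiffOn ℝ 1 w M) (hwt : ∀ u ∈ U, toC3 (ν (G u)) ⬝ᵥ w (G u) = 0) {u : E2} (hu : u ∈ U) :
    (areaJac G u : ℂ) * surfaceDiv M ν w (G u) =
      fderiv ℝ (flux₁ G w) u (EuclideanSpace.single 0 1) +
      fderiv ℝ (flux₂ G w) u (EuclideanSpace.single 1 1) := by
  have hdw : DifferentiableWithinAt ℝ w M (G u) :=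
    (hw (G u) (hM ⟨u, hu, rfl⟩)).differentiableWithinAt (by norm_num)
  have hJ0 := areaJac_pos hU (hG.of_le (by norm_num)) hπ hu
  rw [surfaceDiv_eq_tanTrace, areaJac_mul_surfaceDiv hU hG hπ hM hν hνt hu hdw.hasFDerivWithinAt]
  have hUn := hU.mem_nhds hu
  have hWc := contDiffOn_comp_chart hG (hw.mono hM)
  have hW : DifferentiableAt ℝ (w ∘ G) u := (hWc.contDiffAt hUn).differentiableAt (by norm_num)
  have htc := fun i => contDiffOn_toC3_tangentVec hU hG i
  have ht : ∀ i, DifferentiableAt ℝ (fun u => toC3 (tangentVec G i u)) u := fun i =>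
    ((htc i).contDiffAt hUn).differentiableAt (by norm_num)
  have hnc := contDiffOn_chartNormal hU hG hπ
  have hn : DifferentiableAt ℝ (chartNormal G) u := (hnc.contDiffAt hUn).differentiableAt (by norm_num)
  have hf1 : DifferentiableAt ℝ (flux₁ G w) u :=
    ((contDiffOn_tri hWc (htc 1) hnc).contDiffAt hUn).differentiableAt (by norm_num)
  have hf2 : DifferentiableAt ℝ (flux₂ G w) u :=
    ((contDiffOn_tri (htc 0) hWc hnc).contDiffAt hUn).differentiableAt (by norm_num)
  have e1 := hasDerivAt_tri (hasDerivAt_line (v := EuclideanSpace.single 0 1) hW)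
    (hasDerivAt_line (v := EuclideanSpace.single 0 1) (ht 1))
    (hasDerivAt_line (v := EuclideanSpace.single 0 1) hn)
  have e2 := hasDerivAt_tri (hasDerivAt_line (v := EuclideanSpace.single 1 1) (ht 0))
    (hasDerivAt_line (v := EuclideanSpace.single 1 1) hW)
    (hasDerivAt_line (v := EuclideanSpace.single 1 1) hn)
  have k1 := (hasDerivAt_line (v := EuclideanSpace.single 0 1) hf1).unique e1
  have k2 := (hasDerivAt_line (v := EuclideanSpace.single 1 1) hf2).unique e2
  rw [k1, k2]
  simp only [zero_smul, add_zero, Function.comp_apply]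
  have hnn : chartNormal G u ⬝ᵥ chartNormal G u = 1 := chartNormal_dot_self hJ0.ne'
  have hnW : chartNormal G u ⬝ᵥ w (G u) = 0 := by
    obtain ⟨s, hs, hcr⟩ := cross_tangentVec (hν u hu) (hνt u hu)
    rw [chartNormal, hcr, smul_dotProduct, smul_dotProduct, hwt u hu, smul_zero, smul_zero]
  -- Differentiating `n ⬝ᵥ n = 1` along a line shows that the derivative of the normal is
  -- tangential.
  have hn' : ∀ v : E2, chartNormal G u ⬝ᵥ fderiv ℝ (chartNormal G) u v = 0 := by
    intro v
    have hl := hasDerivAt_line (v := v) hn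
    rw [hasDerivAt_pi] at hl
    have hsum := HasDerivAt.fun_sum (u := Finset.univ) fun (i : Fin 3) _ => (hl i).mul (hl i)
    have hone : (fun s : ℝ => ∑ i, chartNormal G (u + s • v) i * chartNormal G (u + s • v) i) =ᶠ[𝓝 0] fun _ => 1 := by
      have : ∀ᶠ s : ℝ in 𝓝 0, u + s • v ∈ U := by
        have : Tendsto (fun s : ℝ => u + s • v) (𝓝 0) (𝓝 (u + (0 : ℝ) • v)) := Continuous.tendsto (by fun_prop) 0
        rw [zero_smul, add_zero] at this
        exact this hUn
      filter_upwards [this] with s hs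
      exact chartNormal_dot_self (areaJac_pos hU (hG.of_le (by norm_num)) hπ hs).ne'
    have h0 := (hasDerivAt_const (0 : ℝ) (1 : ℂ)).congr_of_eventuallyEq hone
    have := HasDerivAt.unique hsum h0
    simp only [zero_smul, add_zero, Fin.sum_univ_three] at this
    simp only [dotProduct, Fin.sum_univ_three]
    linear_combination this / 2
  have ht' : ∀ i v, fderiv ℝ (fun u => toC3 (tangentVec G i u)) u v = toC3 (fderiv ℝ (tangentVec G i) u v) := by
    intro i v
    have h := toC3L.hasFDerivAt.comp u (((contDiffOn_tangentVec hU hG i).contDiffAt hUn).differentiableAt (by norm_num)).hasFDerivAt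
    have := h.fderiv
    rw [show (fun u => toC3 (tangentVec G i u)) = toC3L ∘ tangentVec G i from rfl, this]
    rfl
  -- The terms in which the normal is differentiated are triple products of tangential vectors and
  -- vanish; this is where tangentiality of `w` enters. The terms with second derivatives of `G`
  -- cancel by symmetry and the antisymmetry of `tri`.
  have z1 := tri_eq_zero_of_orth hnn hnW (chartNormal_dot_tangentVec 1 u) (hn' (EuclideanSpace.single 0 1))
  have z2 := tri_eq_zero_of_orth hnn (chartNormal_dot_tangentVec 0 u) hnW (hn' (EuclideanSpace.single 1 1))
  rw [z1, z2, ht', ht', tangentVec_symm hU hG hu 1 0]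
  have hanti : ∀ x y z : C3, tri x y z = - tri y x z := by intro x y z; simp only [tri]; ring
  rw [hanti (w (G u)) _ (chartNormal G u)]
  ring

/-- The divergence theorem for tangential fields supported in a chart. -/
theorem integral_surfaceDiv_chart {K : NNReal} (hU : IsOpen U) (hUf : volume U ≠ ⊤)
    (hL : LipschitzOnWith K G U) (hπ1 : ‖π‖ ≤ 1) (hm : MeasurableSet (G '' U))
    (hG : ContDiffOn ℝ 2 G U)
    (hπ : ∀ u ∈ U, π (G u) = u) (hM : G '' U ⊆ M)
    (hν : ∀ u ∈ U, ‖ν (G u)‖ = 1) (hνt : ∀ u ∈ U, ∀ i, inner ℝ (ν (G u)) (tangentVec G i u) = 0)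
    (hw : ContDiffOn ℝ 1 w M) (hwt : ∀ u ∈ U, toC3 (ν (G u)) ⬝ᵥ w (G u) = 0)
    {C : Set E2} (hC : IsCompact C) (hCU : C ⊆ U) (hwC : ∀ u ∈ U, u ∉ C → w (G u) = 0) :
    ∫ y in G '' U, surfaceDiv M ν w y ∂(μHE[2] : Measure E3) = 0 := by
  rw [setIntegral_image_eq hU hUf (hG.of_le (by norm_num)) hL hπ1 hπ hm _
    (continuousOn_surfaceDiv_chart hU hG hπ hM hν hνt hw)]
  have hWc := contDiffOn_comp_chart hG (hw.mono hM)
  have htc := fun i => contDiffOn_toC3_tangentVec hU hG i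
  have hnc := contDiffOn_chartNormal hU hG hπ
  -- A flux that vanishes off the compact set `C` extends by zero to a compactly supported `C¹`
  -- function on the whole plane, whose derivatives integrate to zero.
  have ext : ∀ g : E2 → ℂ, ContDiffOn ℝ 1 g U → (∀ u ∈ U, u ∉ C → g u = 0) → ∀ v : E2,
      ∫ u in U, fderiv ℝ g u v = 0 ∧ IntegrableOn (fun u => fderiv ℝ g u v) U := by
    intro g hg hg0 v
    set g' : E2 → ℂ := U.indicator g with hg'
    have hz : ∀ u, u ∉ C → g' u = 0 := by
      intro u hu
      by_cases hUu : u ∈ U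
      · rw [hg', indicator_of_mem hUu]; exact hg0 u hUu hu
      · rw [hg', indicator_of_notMem hUu]
    have hcd : ContDiff ℝ 1 g' := by
      rw [contDiff_iff_contDiffAt]
      intro u
      by_cases hu : u ∈ C
      · refine (hg.contDiffAt (hU.mem_nhds (hCU hu))).congr_of_eventuallyEq ?_
        filter_upwards [hU.mem_nhds (hCU hu)] with z hz
        rw [hg', indicator_of_mem hz]
      · refine (contDiffAt_const (c := (0 : ℂ))).congr_of_eventuallyEq ?_
        filter_upwards [hC.isClosed.isOpen_compl.mem_nhds hu] with z hz'
        exact hz z hz'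
    have hcs : HasCompactSupport g' := HasCompactSupport.intro hC hz
    have heq : ∀ u ∈ U, fderiv ℝ g u v = fderiv ℝ g' u v := by
      intro u hu
      congr 1
      refine Filter.EventuallyEq.fderiv_eq ?_
      filter_upwards [hU.mem_nhds hu] with z hz
      rw [hg', indicator_of_mem hz]
    have hz' : ∀ u, u ∉ U → fderiv ℝ g' u v = 0 := by
      intro u hu
      have : g' =ᶠ[𝓝 u] fun _ => 0 := by
        filter_upwards [hC.isClosed.isOpen_compl.mem_nhds (fun h => hu (hCU h))] with z hz'
        exact hz z hz'
      rw [this.fderiv_eq]; simp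
    constructor
    · rw [setIntegral_congr_fun hU.measurableSet heq, setIntegral_eq_integral_of_forall_compl_eq_zero hz',
        integral_fderiv_eq_zero hcd hcs]
    · rw [integrableOn_congr_fun heq hU.measurableSet]
      refine Integrable.integrableOn ?_
      have hcont : Continuous (fun u => fderiv ℝ g' u v) :=
        (hcd.continuous_fderiv one_ne_zero).clm_apply continuous_const
      exact hcont.integrable_of_hasCompactSupport
        ((hcs.fderiv ℝ).comp_left (g := fun L : E2 →L[ℝ] ℂ => L v) (by simp))
  have e1 := ext (flux₁ G w) (contDiffOn_tri hWc (htc 1) hnc)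
    (fun u hu hc => by simp [flux₁, hwC u hu hc, tri]) (EuclideanSpace.single 0 1)
  have e2 := ext (flux₂ G w) (contDiffOn_tri (htc 0) hWc hnc)
    (fun u hu hc => by simp [flux₂, hwC u hu hc, tri]) (EuclideanSpace.single 1 1)
  rw [setIntegral_congr_fun (g := fun u => fderiv ℝ (flux₁ G w) u (EuclideanSpace.single 0 1) +
      fderiv ℝ (flux₂ G w) u (EuclideanSpace.single 1 1)) hU.measurableSet, integral_add e1.2 e2.2, e1.1, e2.1, add_zero]
  intro u hu
  simp only [Complex.real_smul]
  exact areaJac_mul_surfaceDiv_eq_fderiv hU hG hπ hM hν hνt hw hwt hu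

end Chart
end

noncomputable section

/-! ### Charts of smooth surfaces -/

/-- A chart of the surface `M` with unit normal field `ν`: a parametrization `G` of `M ∩ V` by an
open set `U` of the plane, whose inverse is the restriction of a linear contraction `π`, and a
continuously differentiable extension `N` of the normal field to `V`. -/
structure SurfaceChart (M : Set E3) (ν : E3 → E3) where
  G : E2 → E3
  U : Set E2
  π : E3 →L[ℝ] E2
  V : Set E3
  N : E3 → E3
  K : NNReal
  isOpen_U : IsOpen U
  volume_U : volume U ≠ ⊤
  lipschitz : LipschitzOnWith K G U
  norm_π : ‖π‖ ≤ 1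
  contDiffOn_G : ContDiffOn ℝ 2 G U
  π_G : ∀ u ∈ U, π (G u) = u
  isOpen_V : IsOpen V
  image_G : G '' U = M ∩ V
  contDiffOn_N : ContDiffOn ℝ 1 N V
  N_eq : ∀ y ∈ M ∩ V, N y = ν y
  norm_ν : ∀ y ∈ M ∩ V, ‖ν y‖ = 1
  orth : ∀ u ∈ U, ∀ i, inner ℝ (ν (G u)) (tangentVec G i u) = 0

/-- The part of a chart that lies in an open set. -/
def SurfaceChart.restrict {M : Set E3} {ν : E3 → E3} (c : SurfaceChart M ν) {O : Set E3}
    (hO : IsOpen O) : SurfaceChart (M ∩ O) ν where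
  G := c.G
  U := c.U ∩ c.G ⁻¹' O
  π := c.π
  V := c.V
  N := c.N
  K := c.K
  isOpen_U := c.contDiffOn_G.continuousOn.isOpen_inter_preimage c.isOpen_U hO
  volume_U := measure_ne_top_of_subset inter_subset_left c.volume_U
  lipschitz := c.lipschitz.mono inter_subset_left
  norm_π := c.norm_π
  contDiffOn_G := c.contDiffOn_G.mono inter_subset_left
  π_G := fun u hu => c.π_G u hu.1
  isOpen_V := c.isOpen_V
  image_G := by rw [image_inter_preimage, c.image_G, inter_right_comm]
  contDiffOn_N := c.contDiffOn_N
  N_eq := fun y hy => c.N_eq y ⟨hy.1.1, hy.2⟩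
  norm_ν := fun y hy => c.norm_ν y ⟨hy.1.1, hy.2⟩
  orth := fun u hu => c.orth u hu.1

/-- `M` is covered by charts. -/
def IsSurface (M : Set E3) (ν : E3 → E3) : Prop :=
  ∀ y ∈ M, ∃ c : SurfaceChart M ν, y ∈ c.V

lemma IsSurface.inter {M : Set E3} {ν : E3 → E3} (h : IsSurface M ν) {O : Set E3}
    (hO : IsOpen O) : IsSurface (M ∩ O) ν := fun y hy => by
  obtain ⟨c, hc⟩ := h y hy.1
  exact ⟨c.restrict hO, hc⟩

/-- The orthogonal projection onto the complement of `n`, written in orthonormal coordinates. -/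
lemma exists_proj_kernel {n : E3} (hn : n ≠ 0) :
    ∃ π : E3 →L[ℝ] E2, ‖π‖ ≤ 1 ∧ ∀ v, π v = 0 → ∃ t : ℝ, v = t • n := by
  have : Fact (Module.finrank ℝ E3 = 2 + 1) := ⟨by simp⟩
  let b := OrthonormalBasis.fromOrthogonalSpanSingleton (𝕜 := ℝ) 2 hn
  refine ⟨(b.repr.toContinuousLinearEquiv : _ →L[ℝ] E2).comp (ℝ ∙ n)ᗮ.orthogonalProjectionOnto, ?_, ?_⟩
  · refine ContinuousLinearMap.opNorm_le_bound _ zero_le_one fun v => ?_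
    have : ‖b.repr ((ℝ ∙ n)ᗮ.orthogonalProjectionOnto v)‖ ≤ 1 * ‖v‖ := by
      rw [LinearIsometryEquiv.norm_map]
      exact ContinuousLinearMap.le_of_opNorm_le _ (Submodule.orthogonalProjectionOnto_norm_le _) v
    exact this
  · intro v hv
    have h1 : b.repr ((ℝ ∙ n)ᗮ.orthogonalProjectionOnto v) = 0 := hv
    rw [map_eq_zero_iff _ b.repr.injective, Submodule.orthogonalProjectionOnto_eq_zero_iff,
      Submodule.orthogonal_orthogonal] at h1
    obtain ⟨t, ht⟩ := Submodule.mem_span_singleton.1 h1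
    exact ⟨t, ht.symm⟩

/-- The map `z ↦ (π z, F z)`, with `π` projecting along the gradient, has an injective differential
at `y₀`: a vector killed by `π` is a multiple of the gradient, on which the derivative of `F` is
nonzero. The inverse function theorem then applies. Since the first component is linear, the
resulting chart is inverted by `π`. -/
lemma exists_straightening {V : Set E3} (hV : IsOpen V)
    {F : E3 → ℝ} (hF : ContDiffOn ℝ ∞ F V) {y₀ : E3} (hy : y₀ ∈ V) (hg : gradient F y₀ ≠ 0) :
    ∃ (π : E3 →L[ℝ] E2) (e : OpenPartialHomeomorph E3 (E2 × ℝ)), ‖π‖ ≤ 1 ∧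
      (∀ z, e z = (π z, F z)) ∧ y₀ ∈ e.source ∧ ContDiffAt ℝ 2 e.symm (e y₀) := by
  obtain ⟨π, hπ1, hπk⟩ := exists_proj_kernel hg
  let Ψ : E3 → E2 × ℝ := fun z => (π z, F z)
  have hFc := hF.contDiffAt (hV.mem_nhds hy)
  have hΨ : ContDiffAt ℝ 2 Ψ y₀ :=
    π.contDiff.contDiffAt.prodMk (hFc.of_le (by norm_cast))
  let D : E3 →L[ℝ] E2 × ℝ := π.prod (fderiv ℝ F y₀)
  have hD : HasFDerivAt Ψ D y₀ :=
    π.hasFDerivAt.prodMk (hFc.differentiableAt (by simp)).hasFDerivAt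
  have hDinj : Function.Injective D := by
    rw [← ContinuousLinearMap.coe_coe, ← LinearMap.ker_eq_bot, LinearMap.ker_eq_bot']
    intro v hv
    have h1 : π v = 0 ∧ fderiv ℝ F y₀ v = 0 := by simpa [D] using hv
    obtain ⟨t, rfl⟩ := hπk v h1.1
    have h2 := h1.2
    have hin : fderiv ℝ F y₀ (t • gradient F y₀) = inner ℝ (gradient F y₀) (t • gradient F y₀) := by
      simp [gradient]
    rw [hin, inner_smul_right, real_inner_self_eq_norm_sq] at h2
    have : ‖gradient F y₀‖ ^ 2 ≠ 0 := by simpa using hg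
    rcases mul_eq_zero.1 h2 with h3 | h3
    · rw [h3, zero_smul]
    · exact absurd h3 this
  have hDsurj : Function.Surjective D :=
    (LinearMap.injective_iff_surjective_of_finrank_eq_finrank (f := D.toLinearMap) (by simp)).1 hDinj
  let D' : E3 ≃L[ℝ] E2 × ℝ := ContinuousLinearEquiv.ofBijective D
    (LinearMap.ker_eq_bot.2 hDinj) (LinearMap.range_eq_top.2 hDsurj)
  have hD' : HasFDerivAt Ψ (D' : E3 →L[ℝ] E2 × ℝ) y₀ := by
    have : (D' : E3 →L[ℝ] E2 × ℝ) = D := ContinuousLinearMap.ext fun v => rfl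
    rwa [this]
  exact ⟨π, hΨ.toOpenPartialHomeomorph Ψ hD' (by norm_num), hπ1, fun z => rfl,
    hΨ.mem_toOpenPartialHomeomorph_source hD' (by norm_num),
    hΨ.to_localInverse hD' (by norm_num)⟩

/-- A regular level set has a chart around each of its points. -/
lemma exists_chart_of_levelSet {M : Set E3} {ν : E3 → E3} {V : Set E3} (hV : IsOpen V)
    {F : E3 → ℝ} (hF : ContDiffOn ℝ ∞ F V) (hg : ∀ y ∈ V, gradient F y ≠ 0)
    (hM : ∀ y ∈ V, y ∈ M ↔ F y = 0) {σ : ℝ} (hσ : |σ| = 1)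
    (hν : ∀ y ∈ V, y ∈ M → ν y = σ • (‖gradient F y‖⁻¹ • gradient F y)) {y₀ : E3} (hy : y₀ ∈ V)
    (hyM : y₀ ∈ M) : ∃ c : SurfaceChart M ν, y₀ ∈ c.V := by
  obtain ⟨π, e, hπ1, hecoe, hes, hsymm⟩ := exists_straightening hV hF hy (hg y₀ hy)
  have hFd : ∀ y ∈ V, DifferentiableAt ℝ F y := fun y hy =>
    (hF.contDiffAt (hV.mem_nhds hy)).differentiableAt (by simp)
  have hin : ∀ y v, fderiv ℝ F y v = inner ℝ (gradient F y) v := by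
    intro y v; simp [gradient]
  have het : e y₀ ∈ e.target := e.map_source hes
  have hsy : e.symm (e y₀) = y₀ := e.left_inv hes
  rw [hecoe, (hM y₀ hy).1 hyM] at hsymm het hsy
  -- In the straightened coordinates the level set is the slice on which the second coordinate is
  -- zero.
  let G : E2 → E3 := fun u => e.symm (u, 0)
  have hG : ContDiffAt ℝ 2 G (π y₀) :=
    ContDiffAt.comp (π y₀) (g := e.symm) (f := fun u : E2 => ((u, 0) : E2 × ℝ)) hsymm
      (contDiff_id.prodMk contDiff_const).contDiffAt
  obtain ⟨W, hW, hGW⟩ := hG.contDiffOn (m := 2) le_rfl (by simp)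
  obtain ⟨K, W', hW', hKW⟩ := (hG.of_le (by norm_num)).exists_lipschitzOnWith
  have hcont : Continuous (fun u : E2 => ((u, 0) : E2 × ℝ)) := by fun_prop
  have h1 : ∀ᶠ u in 𝓝 (π y₀), (u, (0 : ℝ)) ∈ e.target :=
    hcont.continuousAt.preimage_mem_nhds (e.open_target.mem_nhds het)
  have h2 : ∀ᶠ u in 𝓝 (π y₀), G u ∈ V :=
    hG.continuousAt.preimage_mem_nhds (hV.mem_nhds (show e.symm (π y₀, 0) ∈ V by rw [hsy]; exact hy))
  obtain ⟨δ, hδ, hball⟩ := Metric.mem_nhds_iff.1 (inter_mem (inter_mem hW hW') (inter_mem h1 h2))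
  set U := Metric.ball (π y₀) δ with hU
  have hGsrc : ∀ u ∈ U, G u ∈ e.source ∧ π (G u) = u ∧ F (G u) = 0 := by
    intro u hu
    have h3 := (hball hu).2.1
    have h4 := e.right_inv h3
    rw [hecoe, Prod.mk.injEq] at h4
    exact ⟨e.map_target h3, h4.1, h4.2⟩
  have himg : G '' U = M ∩ (e.source ∩ V ∩ π ⁻¹' U) := by
    ext z
    constructor
    · rintro ⟨u, hu, rfl⟩
      have h3 := hGsrc u hu
      have h4 : G u ∈ V := (hball hu).2.2
      exact ⟨(hM _ h4).2 h3.2.2, ⟨h3.1, h4⟩, by simpa [h3.2.1] using hu⟩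
    · rintro ⟨hzM, ⟨hzs, hzV⟩, hzU⟩
      refine ⟨π z, hzU, ?_⟩
      have h3 : e z = (π z, 0) := by rw [hecoe, (hM z hzV).1 hzM]
      change e.symm (π z, 0) = z
      rw [← h3]
      exact e.left_inv hzs
  have hgrad : ContDiffOn ℝ 1 (gradient F) V := by
    have h3 : ContDiffOn ℝ 1 (fderiv ℝ F) V := hF.fderiv_of_isOpen hV (by norm_cast)
    exact ((InnerProductSpace.toDual ℝ E3).symm.toContinuousLinearEquiv.contDiff).comp_contDiffOn h3
  have hGU : ContDiffOn ℝ 2 G U := hGW.mono fun u hu => (hball hu).1.1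
  have hN : ContDiffOn ℝ 1 (fun y => σ • (‖gradient F y‖⁻¹ • gradient F y))
      (e.source ∩ V ∩ π ⁻¹' U) := by
    have h3 : ContDiffOn ℝ 1 (fun y => ‖gradient F y‖⁻¹) V :=
      (hgrad.norm ℝ hg).inv fun y hy => norm_ne_zero_iff.2 (hg y hy)
    exact ((h3.smul hgrad).const_smul σ).mono fun y hy => hy.1.2
  have hnorm : ∀ y ∈ M ∩ (e.source ∩ V ∩ π ⁻¹' U), ‖ν y‖ = 1 := by
    intro y hy
    rw [hν y hy.2.1.2 hy.1, norm_smul, norm_smul, Real.norm_eq_abs, hσ, norm_inv, norm_norm,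
      inv_mul_cancel₀ (norm_ne_zero_iff.2 (hg y hy.2.1.2)), mul_one]
  have horth : ∀ u ∈ U, ∀ i, inner ℝ (ν (G u)) (tangentVec G i u) = 0 := by
    intro u hu i
    have h3 : G u ∈ M ∩ (e.source ∩ V ∩ π ⁻¹' U) := himg ▸ ⟨u, hu, rfl⟩
    rw [hν _ h3.2.1.2 h3.1, inner_smul_left, inner_smul_left, ← hin]
    have hGd : DifferentiableAt ℝ G u :=
      (hGU.contDiffAt (Metric.isOpen_ball.mem_nhds hu)).differentiableAt (by norm_num)
    have h4 : HasFDerivAt (fun u => F (G u)) ((fderiv ℝ F (G u)).comp (fderiv ℝ G u)) u :=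
      (hFd _ h3.2.1.2).hasFDerivAt.comp u hGd.hasFDerivAt
    have h5 : HasFDerivAt (fun u => F (G u)) (0 : E2 →L[ℝ] ℝ) u :=
      (hasFDerivAt_const (0 : ℝ) u).congr_of_eventuallyEq (by
        filter_upwards [Metric.isOpen_ball.mem_nhds hu] with v hv using (hGsrc v hv).2.2)
    have h6 := congrArg (fun L => L (EuclideanSpace.single i 1)) (h4.unique h5)
    simp only [ContinuousLinearMap.comp_apply, zero_apply] at h6
    unfold tangentVec
    rw [h6]; simp
  have hvol : volume U ≠ ⊤ := measure_ball_lt_top.ne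
  have hUo : IsOpen U := Metric.isOpen_ball
  have hVo : IsOpen (e.source ∩ V ∩ π ⁻¹' U) :=
    (e.open_source.inter hV).inter (hUo.preimage π.continuous)
  have hmU : π y₀ ∈ U := by rw [hU]; exact Metric.mem_ball_self hδ
  have hmem : y₀ ∈ e.source ∩ V ∩ π ⁻¹' U := mem_inter (mem_inter hes hy) (mem_preimage.2 hmU)
  have hlip : LipschitzOnWith K G U := hKW.mono fun u hu => (hball hu).1.2
  have hπG : ∀ u ∈ U, π (G u) = u := fun u hu => (hGsrc u hu).2.1
  have hNν : ∀ y ∈ M ∩ (e.source ∩ V ∩ π ⁻¹' U), σ • (‖gradient F y‖⁻¹ • gradient F y) = ν y :=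
    fun y hy => (hν y hy.2.1.2 hy.1).symm
  clear_value U G
  let c : SurfaceChart M ν :=
    { G := G, U := U, π := π, V := e.source ∩ V ∩ π ⁻¹' U,
      N := fun y => σ • (‖gradient F y‖⁻¹ • gradient F y), K := K
      isOpen_U := hUo
      volume_U := hvol
      lipschitz := hlip
      norm_π := hπ1
      contDiffOn_G := hGU
      π_G := hπG
      isOpen_V := hVo
      image_G := himg
      contDiffOn_N := hN
      N_eq := hNν
      norm_ν := hnorm
      orth := horth }
  exact ⟨c, hmem⟩

/-- A positive value of `F` persists nearby and keeps the point out of the closure of `Ω`.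
Conversely, a zero of `F` outside that closure would be a local minimum, contrary to the
nonvanishing gradient. -/
lemma IsSmoothDomain.frontier_eq {Ω : Set E3} {ν : E3 → E3} (hΩ : IsOpen Ω) {V : Set E3}
    (hV : IsOpen V) {F : E3 → ℝ} (hF : ContDiffOn ℝ ∞ F V)
    (h : ∀ y ∈ V, gradient F y ≠ 0 ∧ (y ∈ Ω ↔ F y < 0) ∧
      (y ∈ frontier Ω → ν y = ‖gradient F y‖⁻¹ • gradient F y)) (y : E3) (hy : y ∈ V) :
    y ∈ frontier Ω ↔ F y = 0 := by
  have hFd : DifferentiableAt ℝ F y :=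
    (hF.contDiffAt (hV.mem_nhds hy)).differentiableAt (by simp)
  rw [hΩ.frontier_eq]
  constructor
  · rintro ⟨h1, h2⟩
    rw [(h y hy).2.1, not_lt] at h2
    refine le_antisymm (not_lt.1 fun h3 => ?_) h2
    have h4 : ∀ᶠ z in 𝓝 y, z ∈ V ∧ 0 < F z :=
      (show ∀ᶠ z in 𝓝 y, z ∈ V from hV.mem_nhds hy).and (hFd.continuousAt.eventually_const_lt h3)
    obtain ⟨z, hz, hzΩ⟩ := mem_closure_iff_nhds.1 h1 _ h4
    exact absurd (((h z hz.1).2.1).1 hzΩ) (not_lt.2 hz.2.le)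
  · intro h0
    refine ⟨?_, fun h1 => by rw [(h y hy).2.1, h0] at h1; exact lt_irrefl _ h1⟩
    by_contra hc
    have hmin : IsLocalMin F y := by
      filter_upwards [hV.mem_nhds hy, isClosed_closure.isOpen_compl.mem_nhds hc] with z hz hz'
      rw [h0]
      by_contra h3
      exact hz' (subset_closure (((h z hz).2.1).2 (not_le.1 h3)))
    have h5 := hmin.fderiv_eq_zero
    exact (h y hy).1 (by simp [gradient, h5])

/-! ### The surface of a layered configuration -/

/-- The full interface together with the boundary of the obstacle. -/
def LayeredGeometry.fullSurface {p : PML} (G : LayeredGeometry p) : Set E3 :=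
  frontier G.upper ∪ frontier G.obstacle

lemma PML.physBox_subset_truncBox (p : PML) : p.physBox ⊆ p.truncBox := fun x hx l =>
  (hx l).trans (by linarith [p.T_pos l])

lemma PML.isOpen_truncBox (p : PML) : IsOpen p.truncBox := by
  unfold PML.truncBox
  simp only [ofPred_forall]
  exact isOpen_iInter_of_finite fun l => isOpen_lt (by fun_prop) continuous_const

/-- The obstacle lies in the physical box, so cutting with the truncated box removes nothing from
its boundary. The truncated surface is thus a relatively open part of a closed surface without edge,
and it inherits the charts of the latter. -/
lemma LayeredGeometry.surface_eq {p : PML} (G : LayeredGeometry p) :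
    G.surface = G.fullSurface ∩ p.truncBox := by
  unfold LayeredGeometry.surface LayeredGeometry.fullSurface
  rw [union_inter_distrib_right]
  congr 1
  symm
  rw [inter_eq_left]
  exact frontier_subset_closure.trans (G.obstacle_subset.trans (inter_subset_right.trans p.physBox_subset_truncBox))

lemma LayeredGeometry.isClosed_fullSurface {p : PML} (G : LayeredGeometry p) :
    IsClosed G.fullSurface := isClosed_frontier.union isClosed_frontier

/-- The interface and the obstacle boundary are disjoint, so each point has a neighbourhood meeting
only one of them. The sign is `-1` on the obstacle because there `ν` points into the obstacle, while
the defining function increases outwards from it. -/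
lemma LayeredGeometry.isSurface_fullSurface {p : PML} (G : LayeredGeometry p) :
    IsSurface G.fullSurface G.ν := by
  have hdisj : ∀ y ∈ frontier G.upper, y ∉ closure G.obstacle := by
    intro y hy h
    rw [G.smooth_upper.1.frontier_eq] at hy
    exact hy.2 (G.obstacle_subset h).1
  rintro y (hy | hy)
  · obtain ⟨V, hV, hyV, F, hF, h⟩ := G.smooth_upper.2 y hy
    refine exists_chart_of_levelSet (V := V ∩ (closure G.obstacle)ᶜ) (F := F) (σ := 1)
      (hV.inter isClosed_closure.isOpen_compl) (hF.mono inter_subset_left)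
      (fun z hz => (h z hz.1).1) (fun z hz => ?_) (by simp) (fun z hz hzM => ?_)
      ⟨hyV, hdisj y hy⟩ (Or.inl hy)
    · rw [← IsSmoothDomain.frontier_eq G.smooth_upper.1 hV hF h z hz.1]
      exact ⟨fun h => h.resolve_right fun h' => hz.2 (frontier_subset_closure h'), Or.inl⟩
    · rw [one_smul]
      exact (h z hz.1).2.2 (hzM.resolve_right fun h' => hz.2 (frontier_subset_closure h'))
  · obtain ⟨V, hV, hyV, F, hF, h⟩ := G.smooth_obstacle.2 y hy
    refine exists_chart_of_levelSet (V := V ∩ G.upper) (F := F) (σ := -1)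
      (hV.inter G.smooth_upper.1) (hF.mono inter_subset_left)
      (fun z hz => (h z hz.1).1) (fun z hz => ?_) (by simp) (fun z hz hzM => ?_)
      ⟨hyV, (G.obstacle_subset (frontier_subset_closure hy)).1⟩ (Or.inr hy)
    · rw [← IsSmoothDomain.frontier_eq G.smooth_obstacle.1 hV hF h z hz.1]
      refine ⟨fun h => h.resolve_left fun h' => ?_, Or.inr⟩
      rw [G.smooth_upper.1.frontier_eq] at h'
      exact h'.2 hz.2
    · have h1 : z ∈ frontier G.obstacle := by
        refine hzM.resolve_left fun h' => ?_
        rw [G.smooth_upper.1.frontier_eq] at h'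
        exact h'.2 hz.2
      have := (h z hz.1).2.2 h1
      rw [← this]; simp

lemma LayeredGeometry.isSurface_surface {p : PML} (G : LayeredGeometry p) :
    IsSurface G.surface G.ν := by
  rw [G.surface_eq]
  exact G.isSurface_fullSurface.inter p.isOpen_truncBox

end

/-! ### Global calculus and compactness on a surface covered by charts -/

noncomputable section

section Surf
variable {M : Set E3} {ν : E3 → E3}

instance : Nonempty (SurfaceChart M ν) := ⟨{
  G := fun _ => 0
  U := ∅
  π := 0
  V := ∅
  N := fun _ => 0
  K := 0
  isOpen_U := isOpen_empty
  volume_U := by simp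
  lipschitz := by simp [LipschitzOnWith]
  norm_π := by simp
  contDiffOn_G := contDiffOn_const
  π_G := by simp
  isOpen_V := isOpen_empty
  image_G := by simp
  contDiffOn_N := contDiffOn_const
  N_eq := by simp
  norm_ν := by simp
  orth := by simp }⟩

lemma SurfaceChart.mem_image (c : SurfaceChart M ν) {y : E3} (hy : y ∈ M) (hV : y ∈ c.V) :
    ∃ u ∈ c.U, c.G u = y := by
  have : y ∈ c.G '' c.U := c.image_G ▸ ⟨hy, hV⟩
  exact this

lemma SurfaceChart.image_subset (c : SurfaceChart M ν) : c.G '' c.U ⊆ M :=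
  c.image_G ▸ inter_subset_left

lemma SurfaceChart.norm_ν_G (c : SurfaceChart M ν) (u : E2) (hu : u ∈ c.U) : ‖ν (c.G u)‖ = 1 :=
  c.norm_ν _ (c.image_G ▸ ⟨u, hu, rfl⟩)

lemma IsSurface.norm_ν (h : IsSurface M ν) {y : E3} (hy : y ∈ M) : ‖ν y‖ = 1 := by
  obtain ⟨c, hc⟩ := h y hy
  exact c.norm_ν y ⟨hy, hc⟩

/-- The surface divergence does not depend on the choice of the derivative. -/
lemma IsSurface.surfaceDiv_eq (h : IsSurface M ν) {w : E3 → C3} {y : E3} (hy : y ∈ M)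
    {L : E3 →L[ℝ] C3} (hL : HasFDerivWithinAt w L M y) :
    surfaceDiv M ν w y = tanTrace (ν y) L := by
  obtain ⟨c, hc⟩ := h y hy
  obtain ⟨u, hu, rfl⟩ := c.mem_image hy hc
  exact tanTrace_unique c.isOpen_U c.contDiffOn_G c.π_G c.image_subset c.norm_ν_G c.orth hu hL

lemma IsSurface.continuousOn_surfaceDiv (h : IsSurface M ν) {w : E3 → C3}
    (hw : ContDiffOn ℝ 1 w M) : ContinuousOn (surfaceDiv M ν w) M := by
  intro y hy
  obtain ⟨c, hc⟩ := h y hy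
  have h1 := continuousOn_surfaceDiv_chart c.isOpen_U c.contDiffOn_G c.π_G c.image_subset
    c.norm_ν_G c.orth hw
  rw [c.image_G] at h1
  exact (continuousWithinAt_inter (c.isOpen_V.mem_nhds hc)).1 (h1 y ⟨hy, hc⟩)

lemma tanTrace_add (n : E3) (L L' : E3 →L[ℝ] C3) :
    tanTrace n (L + L') = tanTrace n L + tanTrace n L' := by
  simp only [tanTrace, add_apply, Pi.add_apply, Finset.sum_add_distrib, dotProduct_add]
  ring

lemma tanTrace_zero (n : E3) : tanTrace n 0 = 0 := by simp [tanTrace]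

lemma tanTrace_smul (n : E3) (a : ℂ) (L : E3 →L[ℝ] C3) : tanTrace n (a • L) = a * tanTrace n L := by
  have h : ∀ v, (a • L) v = a • L v := fun v => rfl
  simp only [tanTrace, h, Pi.smul_apply, smul_eq_mul, dotProduct_smul, ← Finset.mul_sum]
  ring

lemma tanTrace_smulRight (n : E3) (l : E3 →L[ℝ] ℂ) (w : C3) (hw : toC3 n ⬝ᵥ w = 0) :
    tanTrace n (l.smulRight w) = (fun i => l (EuclideanSpace.single i 1)) ⬝ᵥ w := by
  simp only [tanTrace, ContinuousLinearMap.smulRight_apply, Pi.smul_apply, smul_eq_mul, dotProduct_smul, hw,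
    mul_zero, sub_zero]
  rfl

/-- The product rule for the surface divergence. -/
lemma IsSurface.surfaceDiv_smul (h : IsSurface M ν) {w : E3 → C3} {f : E3 → ℂ} {y : E3} (hy : y ∈ M)
    {l : E3 →L[ℝ] ℂ} (hf : HasFDerivWithinAt f l M y) (hw : DifferentiableWithinAt ℝ w M y)
    (ht : toC3 (ν y) ⬝ᵥ w y = 0) :
    surfaceDiv M ν (fun z => f z • w z) y =
      f y * surfaceDiv M ν w y + (fun i => l (EuclideanSpace.single i 1)) ⬝ᵥ w y := by
  have h1 : HasFDerivWithinAt (fun z => f z • w z) _ M y := hf.fun_smul hw.hasFDerivWithinAt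
  rw [h.surfaceDiv_eq hy hw.hasFDerivWithinAt, h.surfaceDiv_eq hy h1, tanTrace_add, tanTrace_smul,
    tanTrace_smulRight _ _ _ ht]

lemma IsSurface.surfaceDiv_eq_zero (h : IsSurface M ν) {w : E3 → C3} {y : E3} (hy : y ∈ M)
    (hw : w =ᶠ[𝓝[M] y] 0) : surfaceDiv M ν w y = 0 := by
  have h1 : HasFDerivWithinAt w (0 : E3 →L[ℝ] C3) M y :=
    (hasFDerivWithinAt_const (0 : C3) y M).congr_of_eventuallyEq hw (hw.self_of_nhdsWithin hy)
  rw [h.surfaceDiv_eq hy h1, tanTrace_zero]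

/-- Each chart patch is a Lipschitz image of a plane set of finite area, and finitely many patches
cover the compact set. -/
lemma IsSurface.measure_compact_lt_top {C : Set E3} (h : IsSurface M ν) (hC : IsCompact C)
    (hCM : C ⊆ M) : (μHE[2] : Measure E3) C < ⊤ := by
  refine hC.induction_on (p := fun s => (μHE[2] : Measure E3) (s ∩ M) < ⊤) (by simp)
    (fun s t hst ht => (measure_mono (inter_subset_inter_left _ hst)).trans_lt ht)
    (fun s t hs ht => ?_) (fun y hy => ?_) |>.trans_le' (measure_mono (subset_inter le_rfl hCM))
  · rw [union_inter_distrib_right]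
    exact (measure_union_le _ _).trans_lt (ENNReal.add_lt_top.2 ⟨hs, ht⟩)
  · obtain ⟨c, hc⟩ := h y (hCM hy)
    refine ⟨c.V, mem_nhdsWithin_of_mem_nhds (c.isOpen_V.mem_nhds hc), ?_⟩
    rw [inter_comm, ← c.image_G]
    refine (measure_image_le_of_lipschitz c.lipschitz le_rfl).trans_lt ?_
    exact ENNReal.mul_lt_top (by simp) c.volume_U.lt_top

/-- The divergence theorem for tangential fields with compact support in the surface. -/
theorem IsSurface.integral_surfaceDiv_of_compact (h : IsSurface M ν) (hMm : MeasurableSet M)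
    {w : E3 → C3} (hw : ContDiffOn ℝ 1 w M) (hwt : ∀ y ∈ M, toC3 (ν y) ⬝ᵥ w y = 0)
    {C : Set E3} (hC : IsCompact C) (hCM : C ⊆ M) (hwC : ∀ y ∈ M, y ∉ C → w y = 0) :
    IntegrableOn (surfaceDiv M ν w) M (μHE[2] : Measure E3) ∧
    ∫ y in M, surfaceDiv M ν w y ∂(μHE[2] : Measure E3) = 0 := by
  have hint : ∀ v : E3 → C3, ContDiffOn ℝ 1 v M → (∀ y ∈ M, y ∉ C → v y = 0) →
      IntegrableOn (surfaceDiv M ν v) M (μHE[2] : Measure E3) := by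
    -- The divergence is continuous, hence bounded, on the compact set `C` of finite area, and it
    -- vanishes on the rest of the surface.
    intro v hv hvC
    have hz : ∀ y ∈ M \ C, surfaceDiv M ν v y = 0 := by
      intro y hy
      refine h.surfaceDiv_eq_zero hy.1 ?_
      filter_upwards [self_mem_nhdsWithin, mem_nhdsWithin_of_mem_nhds (hC.isClosed.isOpen_compl.mem_nhds hy.2)]
        with z hz hz' using hvC z hz hz'
    have h1 : IntegrableOn (surfaceDiv M ν v) C (μHE[2] : Measure E3) := by
      have : IsFiniteMeasure ((μHE[2] : Measure E3).restrict C) :=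
        ⟨by rw [Measure.restrict_apply_univ]; exact h.measure_compact_lt_top hC hCM⟩
      have hcont := (h.continuousOn_surfaceDiv hv).mono hCM
      obtain ⟨B, hB⟩ := hC.exists_bound_of_continuousOn hcont
      refine Integrable.of_bound (hcont.aestronglyMeasurable hC.measurableSet) B ?_
      filter_upwards [ae_restrict_mem hC.measurableSet] with y hy using hB y hy
    have h2 : IntegrableOn (surfaceDiv M ν v) (M \ C) (μHE[2] : Measure E3) :=
      integrableOn_zero.congr_fun (fun y hy => (hz y hy).symm) (hMm.diff hC.measurableSet)
    exact (h1.union h2).mono_set (by rw [union_sdiff_self]; exact subset_union_right)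
  refine ⟨hint w hw hwC, ?_⟩
  choose! c hc using h
  obtain ⟨t, ht, hcov⟩ := hC.elim_nhds_subcover (fun y => (c y).V)
    (fun y hy => (c y).isOpen_V.mem_nhds (hc y (hCM hy)))
  -- The field is split into pieces supported in single charts. The functions `f` sum to one only on
  -- `C`, which is enough because `w` vanishes on the rest of `M`.
  obtain ⟨f, hf⟩ := SmoothPartitionOfUnity.exists_isSubordinate (ι := t) (modelWithCornersSelf ℝ E3) hC.isClosed
    (fun i => (c i).V) (fun i => (c i).isOpen_V) (by
      intro y hy
      obtain ⟨i, hi, hyi⟩ := mem_iUnion₂.1 (hcov hy)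
      exact mem_iUnion.2 ⟨⟨i, hi⟩, hyi⟩)
  have hfs : ∀ i, ContDiff ℝ ∞ (f i) := fun i => (f i).contMDiff.contDiff
  let W : t → E3 → C3 := fun i y => (f i y : ℂ) • w y
  have hfc : ∀ i, ContDiffOn ℝ 1 (fun y => (f i y : ℂ)) M := fun i =>
    ((Complex.ofRealCLM.contDiff).comp ((hfs i).of_le (by norm_cast))).contDiffOn
  have hWc : ∀ i, ContDiffOn ℝ 1 (W i) M := fun i => (hfc i).smul hw
  have hsum : ∀ y ∈ M, w y = ∑ i, W i y := by
    intro y hy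
    by_cases hyC : y ∈ C
    · have h1 := f.sum_eq_one hyC
      rw [finsum_eq_sum_of_fintype] at h1
      simp only [W]
      rw [← Finset.sum_smul, ← Complex.ofReal_sum, h1, Complex.ofReal_one, one_smul]
    · simp [W, hwC y hy hyC]
  have hW0 : ∀ i, ∀ y ∈ M, y ∉ C ∩ tsupport (f i) → W i y = 0 := by
    intro i y hy hyn
    by_cases hyC : y ∈ C
    · have : f i y = 0 := image_eq_zero_of_notMem_tsupport fun h' => hyn ⟨hyC, h'⟩
      simp [W, this]
    · simp [W, hwC y hy hyC]
  have hS : IsSurface M ν := fun y hy => ⟨c y, hc y hy⟩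
  have hdiv : ∀ y ∈ M, surfaceDiv M ν w y = ∑ i, surfaceDiv M ν (W i) y := by
    intro y hy
    have hd : ∀ i, HasFDerivWithinAt (W i) (fderivWithin ℝ (W i) M y) M y := fun i =>
      ((hWc i y hy).differentiableWithinAt (by norm_num)).hasFDerivWithinAt
    have h1 : HasFDerivWithinAt w (∑ i, fderivWithin ℝ (W i) M y) M y :=
      (HasFDerivWithinAt.fun_sum fun i _ => hd i).congr hsum (hsum y hy)
    rw [hS.surfaceDiv_eq hy h1]
    simp only [surfaceDiv_eq_tanTrace]
    classical
    refine Finset.induction_on (Finset.univ : Finset t) (by simp [tanTrace_zero]) fun i s hi ih => ?_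
    rw [Finset.sum_insert hi, Finset.sum_insert hi, tanTrace_add, ih]
  rw [setIntegral_congr_fun hMm hdiv, integral_finsetSum]
  swap
  · intro i _
    exact hint _ (hWc i) fun y hy hyC => hW0 i y hy fun h' => hyC h'.1
  refine Finset.sum_eq_zero fun i _ => ?_
  have hVm : M ∩ (c i).V ⊆ M := inter_subset_left
  rw [setIntegral_eq_of_subset_of_forall_sdiff_eq_zero hMm hVm]
  · rw [← (c i).image_G]
    have hts : IsCompact (C ∩ tsupport (f i)) := hC.inter_right (isClosed_tsupport _)
    refine integral_surfaceDiv_chart (c i).isOpen_U (c i).volume_U (c i).lipschitz (c i).norm_π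
      (by rw [(c i).image_G]; exact hMm.inter (c i).isOpen_V.measurableSet) (c i).contDiffOn_G
      (c i).π_G (c i).image_subset (c i).norm_ν_G (c i).orth (hWc i) ?_
      (hts.image (c i).π.continuous) ?_ ?_
    · intro u hu
      simp only [W]
      rw [dotProduct_smul, hwt _ ((c i).image_subset ⟨u, hu, rfl⟩), smul_zero]
    · rintro _ ⟨y, hy, rfl⟩
      obtain ⟨u, hu, rfl⟩ := (c i).mem_image (hCM hy.1) (hf i hy.2)
      rw [(c i).π_G u hu]; exact hu
    · intro u hu huC
      refine hW0 i _ ((c i).image_subset ⟨u, hu, rfl⟩) fun h' => huC ⟨_, h', (c i).π_G u hu⟩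
  · intro y hy
    refine hS.surfaceDiv_eq_zero hy.1 ?_
    have h1 : y ∉ tsupport (f i) := fun h' => hy.2 ⟨hy.1, hf i h'⟩
    filter_upwards [mem_nhdsWithin_of_mem_nhds ((isClosed_tsupport _).isOpen_compl.mem_nhds h1), self_mem_nhdsWithin] with z hz hzM
    exact hW0 i z hzM fun h' => hz h'.2

/-- Upper regularity of the surface measure near a compact part of a surface. -/
lemma IsSurface.exists_measure_ball_le (h : IsSurface M ν) {C : Set E3} (hC : IsCompact C)
    (hCM : C ⊆ M) : ∃ A : ℝ, 0 ≤ A ∧ ∀ z : E3, ∀ r : ℝ, 0 < r →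
      (μHE[2] : Measure E3) (C ∩ Metric.ball z r) ≤ ENNReal.ofReal (A * r ^ 2) := by
  suffices H : ∃ A : ℝ, 0 ≤ A ∧ ∀ z : E3, ∀ r : ℝ, 0 < r →
      (μHE[2] : Measure E3) (C ∩ M ∩ Metric.ball z r) ≤ ENNReal.ofReal (A * r ^ 2) by
    rwa [inter_eq_self_of_subset_left hCM] at H
  refine hC.induction_on (p := fun s => ∃ A : ℝ, 0 ≤ A ∧ ∀ z : E3, ∀ r : ℝ, 0 < r →
      (μHE[2] : Measure E3) (s ∩ M ∩ Metric.ball z r) ≤ ENNReal.ofReal (A * r ^ 2))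
      ⟨0, le_rfl, by simp⟩ ?_ ?_ ?_
  · rintro s t hst ⟨A, hA0, hA⟩
    exact ⟨A, hA0, fun z r hr => (measure_mono (by gcongr)).trans (hA z r hr)⟩
  · rintro s t ⟨A, hA0, hA⟩ ⟨B, hB0, hB⟩
    refine ⟨A + B, by positivity, fun z r hr => ?_⟩
    rw [union_inter_distrib_right, union_inter_distrib_right, add_mul,
      ENNReal.ofReal_add (by positivity) (by positivity)]
    exact (measure_union_le _ _).trans (add_le_add (hA z r hr) (hB z r hr))
  · intro y hy
    obtain ⟨c, hc⟩ := h y (hCM hy)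
    set v := (volume (Metric.ball (0 : E2) 1)).toReal with hv
    refine ⟨c.V, mem_nhdsWithin_of_mem_nhds (c.isOpen_V.mem_nhds hc), (c.K : ℝ) ^ 2 * (4 * v),
      by positivity, fun z r hr => ?_⟩
    rw [inter_comm c.V, ← c.image_G]
    rcases (c.G '' c.U ∩ Metric.ball z r).eq_empty_or_nonempty with h0 | ⟨_, ⟨u₀, hu₀, rfl⟩, hz⟩
    · simp [h0]
    -- The centre `z` need not lie on the surface. Two surface points in the ball are less than `2 *
    -- r` apart, and the contraction `π` passes this bound to their parameters.
    have hsub : c.G '' c.U ∩ Metric.ball z r ⊆ c.G '' (c.U ∩ Metric.ball u₀ (2 * r)) := by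
      rintro _ ⟨⟨u, hu, rfl⟩, hzu⟩
      refine ⟨u, ⟨hu, ?_⟩, rfl⟩
      rw [Metric.mem_ball, dist_eq_norm]
      have h1 : u - u₀ = c.π (c.G u - c.G u₀) := by rw [map_sub, c.π_G u hu, c.π_G u₀ hu₀]
      have h2 : dist (c.G u) (c.G u₀) < 2 * r := by
        have := dist_triangle_right (c.G u) (c.G u₀) z
        rw [Metric.mem_ball] at hz hzu
        linarith
      calc ‖u - u₀‖ ≤ 1 * ‖c.G u - c.G u₀‖ := by
            rw [h1]; exact c.π.le_of_opNorm_le c.norm_π _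
        _ < 2 * r := by rwa [one_mul, ← dist_eq_norm]
    refine (measure_mono hsub).trans ((measure_image_le_of_lipschitz c.lipschitz inter_subset_left).trans ?_)
    have hvol : volume (Metric.ball u₀ (2 * r)) = ENNReal.ofReal ((2 * r) ^ 2 * v) := by
      rw [Measure.addHaar_ball _ _ (by positivity), ENNReal.ofReal_mul (by positivity), hv,
        ENNReal.ofReal_toReal measure_ball_lt_top.ne]
      simp
    calc (c.K : ENNReal) ^ 2 * volume (c.U ∩ Metric.ball u₀ (2 * r))
        ≤ (c.K : ENNReal) ^ 2 * volume (Metric.ball u₀ (2 * r)) := by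
          gcongr; exact inter_subset_right
      _ = ENNReal.ofReal ((c.K : ℝ) ^ 2 * (4 * v) * r ^ 2) := by
          rw [hvol, ← ENNReal.ofReal_coe_nnreal, ← ENNReal.ofReal_pow (NNReal.coe_nonneg _),
            ← ENNReal.ofReal_mul (by positivity)]
          congr 1; ring

end Surf
end

noncomputable section

/-! ### The divergence theorem on the truncated surface -/

lemma norm_tanTrace_le {n : E3} (hn : ‖n‖ = 1) (L : E3 →L[ℝ] C3) : ‖tanTrace n L‖ ≤ 6 * ‖L‖ := by
  have h1 : ∀ l, ‖L (EuclideanSpace.single l 1) l‖ ≤ ‖L‖ := fun l =>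
    (norm_le_pi_norm _ l).trans (by simpa using L.le_opNorm (EuclideanSpace.single l (1 : ℝ)))
  have h2 : ∀ l, ‖toC3 n l * L n l‖ ≤ ‖L‖ := fun l => by
    rw [norm_mul]
    have h3 : ‖toC3 n l‖ ≤ 1 := by
      simp only [toC3, Complex.norm_real]
      rw [← hn]; exact PiLp.norm_apply_le n l
    have h4 : ‖L n l‖ ≤ ‖L‖ := (norm_le_pi_norm _ l).trans (by simpa [hn] using L.le_opNorm n)
    calc _ ≤ 1 * ‖L‖ := by gcongr
      _ = _ := one_mul _
  unfold tanTrace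
  refine (norm_sub_le _ _).trans ?_
  have h5 := norm_sum_le (Finset.univ : Finset (Fin 3)) fun l => L (EuclideanSpace.single l 1) l
  have h6 : ‖toC3 n ⬝ᵥ L n‖ ≤ _ := norm_sum_le (Finset.univ : Finset (Fin 3)) fun l => toC3 n l * L n l
  simp only [Fin.sum_univ_three] at h5 h6 ⊢
  linarith [h1 0, h1 1, h1 2, h2 0, h2 1, h2 2]

/-- A function that is `C¹` on a thin set need not have a unique derivative within it, so locally a
bounded choice of derivatives is taken from the definition, and compactness makes the bound uniform.
Any choice will do later, since the surface divergence does not depend on it. -/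
lemma exists_bound_fderivWithin {F : Type*} [NormedAddCommGroup F] [NormedSpace ℝ F]
    {S : Set E3} (hS : IsCompact S) {w : E3 → F}
    (hw : ContDiffOn ℝ 1 w S) : ∃ B : ℝ, 0 ≤ B ∧ ∀ y ∈ S, ∃ L : E3 →L[ℝ] F,
      HasFDerivWithinAt w L S y ∧ ‖L‖ ≤ B := by
  refine hS.induction_on (p := fun s => ∃ B : ℝ, 0 ≤ B ∧ ∀ y ∈ s ∩ S, ∃ L : E3 →L[ℝ] F,
      HasFDerivWithinAt w L S y ∧ ‖L‖ ≤ B) ⟨0, le_rfl, by simp⟩ ?_ ?_ ?_ |>.imp fun B h => ⟨h.1, fun y hy => h.2 y ⟨hy, hy⟩⟩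
  · rintro s t hst ⟨B, hB, h⟩
    exact ⟨B, hB, fun y hy => h y ⟨hst hy.1, hy.2⟩⟩
  · rintro s t ⟨B, hB, h⟩ ⟨B', hB', h'⟩
    refine ⟨max B B', le_max_of_le_left hB, fun y hy => ?_⟩
    rcases hy.1 with h1 | h1
    · obtain ⟨L, hL, hLB⟩ := h y ⟨h1, hy.2⟩
      exact ⟨L, hL, hLB.trans (le_max_left _ _)⟩
    · obtain ⟨L, hL, hLB⟩ := h' y ⟨h1, hy.2⟩
      exact ⟨L, hL, hLB.trans (le_max_right _ _)⟩
  · intro y hy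
    have h1 := hw y hy
    rw [show (1 : WithTop ℕ∞) = 0 + 1 by norm_num, contDiffWithinAt_succ_iff_hasFDerivWithinAt' (by simp)] at h1
    obtain ⟨u, hu, -, -, f', hf', hc⟩ := h1
    rw [insert_eq_of_mem hy] at hu
    have h2 : ∀ᶠ z in 𝓝[S] y, ‖f' z‖ < ‖f' y‖ + 1 :=
      hc.continuousWithinAt.norm.eventually_lt_const (by linarith)
    refine ⟨u ∩ {z | ‖f' z‖ < ‖f' y‖ + 1}, inter_mem hu h2, ‖f' y‖ + 1, by positivity, fun z hz => ?_⟩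
    exact ⟨f' z, (hf' z hz.1.1), (show ‖f' z‖ < ‖f' y‖ + 1 from hz.1.2).le⟩

/-- A smooth cutoff in one variable. -/
def edgeCut (b ε s : ℝ) : ℝ := Real.smoothTransition ((b ^ 2 - s ^ 2) / ε - 1)

lemma exists_bound_deriv_smoothTransition : ∃ B : ℝ, 0 ≤ B ∧ ∀ x, |deriv Real.smoothTransition x| ≤ B ∧
    ((x < 0 ∨ 1 < x) → deriv Real.smoothTransition x = 0) := by
  have hc : Continuous (deriv Real.smoothTransition) :=
    (Real.smoothTransition.contDiff (n := 1)).continuous_deriv le_rfl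
  obtain ⟨B, hB⟩ := (isCompact_Icc (a := (0 : ℝ)) (b := 1)).exists_bound_of_continuousOn hc.continuousOn
  have h0 : ∀ x : ℝ, (x < 0 ∨ 1 < x) → deriv Real.smoothTransition x = 0 := by
    rintro x (hx | hx)
    · have : Real.smoothTransition =ᶠ[𝓝 x] fun _ => 0 := by
        filter_upwards [gt_mem_nhds hx] with y hy using Real.smoothTransition.zero_of_nonpos hy.le
      rw [this.deriv_eq]; simp
    · have : Real.smoothTransition =ᶠ[𝓝 x] fun _ => 1 := by
        filter_upwards [lt_mem_nhds hx] with y hy using Real.smoothTransition.one_of_one_le hy.le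
      rw [this.deriv_eq]; simp
  refine ⟨max B 0, le_max_right _ _, fun x => ⟨?_, h0 x⟩⟩
  by_cases hx : x ∈ Icc (0 : ℝ) 1
  · exact (hB x hx).trans (le_max_left _ _)
  · rw [h0 x (by rw [mem_Icc, not_and_or, not_le, not_le] at hx; exact hx)]; simp

lemma hasDerivAt_edgeCut (b ε s : ℝ) : HasDerivAt (edgeCut b ε)
    (deriv Real.smoothTransition ((b ^ 2 - s ^ 2) / ε - 1) * (-(2 * s) / ε)) s := by
  have h1 : HasDerivAt (fun s : ℝ => (b ^ 2 - s ^ 2) / ε - 1) (-(2 * s) / ε) s := by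
    have := (((hasDerivAt_pow 2 s).const_sub (b ^ 2)).div_const ε).sub_const 1
    simpa using this
  exact ((Real.smoothTransition.contDiff (n := 1)).differentiable (by norm_num) _).hasDerivAt.comp s h1

lemma contDiff_edgeCut (b ε : ℝ) : ContDiff ℝ 1 (edgeCut b ε) := by
  unfold edgeCut
  exact Real.smoothTransition.contDiff.comp (by fun_prop)

section Layered
variable {p : PML} (G : LayeredGeometry p)
include G

lemma LayeredGeometry.closure_surface_subset :
    closure G.surface ⊆ G.fullSurface ∩ {x | ∀ l, |x l| ≤ p.a l + p.T l} := by
  have hc : IsClosed {x : E3 | ∀ l, |x l| ≤ p.a l + p.T l} := by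
    simp only [ofPred_forall]
    exact isClosed_iInter fun l => isClosed_le (by fun_prop) continuous_const
  refine closure_minimal ?_ (G.isClosed_fullSurface.inter hc)
  rw [G.surface_eq]
  exact inter_subset_inter_right _ fun x hx l => (hx l).le

lemma LayeredGeometry.isCompact_closure_surface : IsCompact (closure G.surface) := by
  refine Metric.isCompact_of_isClosed_isBounded isClosed_closure ?_
  refine (Metric.isBounded_closedBall (x := (0 : E3)) (r := ∑ l, (p.a l + p.T l))).subset fun x hx => ?_
  have h := (G.closure_surface_subset hx).2
  rw [mem_closedBall_zero_iff]
  have h1 : ‖x‖ ≤ ∑ l, |x l| := by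
    rw [EuclideanSpace.norm_eq]
    apply Real.sqrt_le_iff.2 ⟨by positivity, ?_⟩
    simp only [Real.norm_eq_abs, Fin.sum_univ_three]
    nlinarith [abs_nonneg (x 0), abs_nonneg (x 1), abs_nonneg (x 2), mul_nonneg (abs_nonneg (x 0)) (abs_nonneg (x 1)),
      mul_nonneg (abs_nonneg (x 0)) (abs_nonneg (x 2)), mul_nonneg (abs_nonneg (x 1)) (abs_nonneg (x 2))]
  exact h1.trans (Finset.sum_le_sum fun l _ => h l)

lemma LayeredGeometry.measurableSet_surface : MeasurableSet G.surface := by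
  rw [G.surface_eq]
  exact G.isClosed_fullSurface.measurableSet.inter p.isOpen_truncBox.measurableSet

lemma LayeredGeometry.measure_surface_lt_top : (μHE[2] : Measure E3) G.surface < ⊤ :=
  (measure_mono subset_closure).trans_lt (G.isSurface_fullSurface.measure_compact_lt_top
    G.isCompact_closure_surface fun _ hx => (G.closure_surface_subset hx).1)

/-- Away from the compact perturbation, the interface is the plane `x₃ = height`. -/
lemma LayeredGeometry.mem_frontier_upper_iff {K : Set E3} (hK : IsCompact K)
    (h : ∀ x, x ∉ K → (x ∈ G.upper ↔ G.height < x 2)) {x : E3} (hx : x ∉ K) :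
    x ∈ frontier G.upper ↔ x 2 = G.height := by
  rw [G.smooth_upper.1.frontier_eq]
  have hKo : ∀ᶠ z in 𝓝 x, z ∉ K := hK.isClosed.isOpen_compl.mem_nhds hx
  constructor
  · rintro ⟨h1, h2⟩
    rw [h x hx, not_lt] at h2
    refine le_antisymm h2 (not_lt.1 fun h3 => ?_)
    have hc : ContinuousAt (fun z : E3 => z 2) x := by fun_prop
    have h4 : ∀ᶠ z in 𝓝 x, z 2 < G.height := hc.eventually_lt_const h3
    obtain ⟨z, hz, hz'⟩ := mem_closure_iff_nhds.1 h1 _ (inter_mem hKo h4)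
    have h5 : z 2 < G.height := hz.2
    exact absurd ((h z hz.1).1 hz') (not_lt.2 h5.le)
  · intro h2
    refine ⟨?_, fun h3 => by rw [h x hx, h2] at h3; exact lt_irrefl _ h3⟩
    have ht : Tendsto (fun t : ℝ => x + t • EuclideanSpace.single (2 : Fin 3) (1 : ℝ)) (𝓝[>] 0) (𝓝 x) := by
      have : Tendsto (fun t : ℝ => x + t • EuclideanSpace.single (2 : Fin 3) (1 : ℝ)) (𝓝 0)
          (𝓝 (x + (0 : ℝ) • EuclideanSpace.single (2 : Fin 3) (1 : ℝ))) := Continuous.tendsto (by fun_prop) 0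
      rw [zero_smul, add_zero] at this
      exact this.mono_left nhdsWithin_le_nhds
    refine mem_closure_of_tendsto ht ?_
    filter_upwards [ht hKo, self_mem_nhdsWithin] with t ht1 ht2
    rw [h _ ht1]
    simp [h2]; exact ht2

/-- A point of the surface outside the slab `|x_l| < a_l` lies on the flat part of the interface. -/
lemma LayeredGeometry.norm_le_of_edge {w : E3 → C3} {B : ℝ}
    (hB : ∀ y ∈ closure G.surface, ∃ L : E3 →L[ℝ] C3, HasFDerivWithinAt w L (closure G.surface) y ∧ ‖L‖ ≤ B)
    (h0 : ∀ y ∈ closure G.surface \ G.surface, w y = 0) {l : Fin 3} (hl : l ≠ 2) {y : E3}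
    (hy : y ∈ G.surface) (hyl : p.a l ≤ |y l|) : ‖w y‖ ≤ B * (p.a l + p.T l - |y l|) := by
  obtain ⟨K, hK, hKb, hflat⟩ := G.flat
  have hnot : ∀ z : E3, p.a l ≤ |z l| → z ∉ K := fun z hz hzK => absurd (hKb hzK l) (not_lt.2 hz)
  have hpos : 0 < |y l| := (p.a_pos l).trans_le hyl
  set σ : ℝ := ((SignType.sign (y l) : SignType) : ℝ) with hσ
  have hσy : σ * |y l| = y l := sign_mul_abs _
  have hσ1 : |σ| = 1 := by
    rcases lt_or_gt_of_ne (abs_pos.1 hpos) with h | h <;> simp [hσ, h]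
  have hyb : |y l| < p.a l + p.T l := by
    rw [G.surface_eq] at hy; exact hy.2 l
  have hy2 : y 2 = G.height := by
    rcases hy with hy | hy
    · exact (G.mem_frontier_upper_iff hK hflat (hnot y hyl)).1 hy.1
    · exact absurd ((G.obstacle_subset (frontier_subset_closure hy)).2 l) (not_lt.2 hyl)
  -- The path runs outwards in the direction `e_l`. As `l ≠ 2`, it stays in the plane `x₃ = height`,
  -- and at time `τ` it reaches the edge, where `w` vanishes. The mean value inequality along it
  -- bounds `w y` by the distance to the edge.
  set γ : ℝ → E3 := fun t => y + t • (σ • EuclideanSpace.single l (1 : ℝ)) with hγ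
  have hγl : ∀ t, 0 ≤ t → |γ t l| = |y l| + t := by
    intro t ht
    have : γ t l = σ * (|y l| + t) := by simp [hγ, mul_add, hσy]; ring
    rw [this, abs_mul, hσ1, one_mul, abs_of_nonneg (by positivity)]
  have hγn : ∀ t i, i ≠ l → γ t i = y i := by
    intro t i hi; simp [hγ, hi]
  set τ := p.a l + p.T l - |y l| with hτ
  have hτ0 : 0 < τ := by rw [hτ]; linarith
  have hfr : ∀ t, 0 ≤ t → γ t ∈ frontier G.upper := by
    intro t ht
    refine (G.mem_frontier_upper_iff hK hflat (hnot _ ?_)).2 ?_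
    · rw [hγl t ht]; linarith
    · rw [hγn t 2 hl.symm, hy2]
  have hyT : y ∈ p.truncBox := by rw [G.surface_eq] at hy; exact hy.2
  have hM : ∀ t ∈ Ico 0 τ, γ t ∈ G.surface := by
    intro t ht
    refine Or.inl ⟨hfr t ht.1, fun i => ?_⟩
    by_cases hi : i = l
    · rw [hi, hγl t ht.1]; rw [hτ] at ht; linarith [ht.2]
    · rw [hγn t i hi]; exact hyT i
  have hγc : Continuous γ := by fun_prop
  have hcl : ∀ t ∈ Icc 0 τ, γ t ∈ closure G.surface := by
    intro t ht
    have h1 : t ∈ closure (Ico 0 τ) := by rwa [closure_Ico hτ0.ne]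
    exact map_mem_closure hγc h1 hM
  have hend : w (γ τ) = 0 := by
    refine h0 _ ⟨hcl τ ⟨hτ0.le, le_rfl⟩, fun h => ?_⟩
    rw [G.surface_eq] at h
    have := h.2 l
    rw [hγl τ hτ0.le, hτ] at this
    linarith
  choose! L hL hLB using hB
  have hγd : ∀ t, HasDerivWithinAt γ (σ • EuclideanSpace.single l (1 : ℝ)) (Icc 0 τ) t := by
    intro t
    have h1 := (hasDerivAt_id t).smul_const (σ • (EuclideanSpace.single l (1 : ℝ) : E3))
    rw [one_smul] at h1
    exact (h1.const_add y).hasDerivWithinAt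
  have hder : ∀ t ∈ Icc 0 τ, HasDerivWithinAt (fun t => w (γ t)) (L (γ t) (σ • EuclideanSpace.single l (1 : ℝ))) (Icc 0 τ) t :=
    fun t ht => (hL _ (hcl t ht)).comp_hasDerivWithinAt t (hγd t) fun s hs => hcl s hs
  have := norm_image_sub_le_of_norm_deriv_le_segment' hder (C := B) (fun t ht => by
    refine ((L (γ t)).le_opNorm _).trans ?_
    rw [norm_smul, Real.norm_eq_abs, hσ1]
    simpa using hLB _ (hcl t ⟨ht.1, ht.2.le⟩)) τ ⟨hτ0.le, le_rfl⟩
  have hγ0 : γ 0 = y := by simp [hγ]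
  simpa only [hend, hγ0, zero_sub, norm_neg, sub_zero] using this

lemma LayeredGeometry.exists_bound_surfaceDiv {w : E3 → C3} (hw : ContDiffOn ℝ 1 w (closure G.surface)) :
    ∃ B : ℝ, 0 ≤ B ∧ ∀ y ∈ G.surface, ‖surfaceDiv G.surface G.ν w y‖ ≤ B := by
  obtain ⟨B, hB0, hB⟩ := exists_bound_fderivWithin G.isCompact_closure_surface hw
  refine ⟨6 * B, by positivity, fun y hy => ?_⟩
  obtain ⟨L, hL, hLB⟩ := hB y (subset_closure hy)
  rw [G.isSurface_surface.surfaceDiv_eq hy (hL.mono subset_closure)]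
  exact (norm_tanTrace_le (G.isSurface_surface.norm_ν hy) L).trans (by gcongr)

/-- The divergence theorem for tangential fields that vanish on the boundary of the truncated
surface. -/
theorem LayeredGeometry.integral_surfaceDiv {w : E3 → C3} (hw : ContDiffOn ℝ 1 w (closure G.surface))
    (hwt : ∀ y ∈ G.surface, toC3 (G.ν y) ⬝ᵥ w y = 0)
    (h0 : ∀ y ∈ closure G.surface \ G.surface, w y = 0) :
    ∫ y, surfaceDiv G.surface G.ν w y ∂(surfaceMeasure G.surface) = 0 := by
  have hS := G.isSurface_surface
  set M := G.surface with hM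
  obtain ⟨B, hB0, hB⟩ := exists_bound_fderivWithin G.isCompact_closure_surface hw
  obtain ⟨D, hD0, hD⟩ := G.exists_bound_surfaceDiv hw
  obtain ⟨A, hA0, hA⟩ := exists_bound_deriv_smoothTransition
  have hwM : ContDiffOn ℝ 1 w M := hw.mono subset_closure
  set b : Fin 3 → ℝ := fun l => p.a l + p.T l with hb
  have hbpos : ∀ l, 0 < b l := fun l => by have := p.a_pos l; have := p.T_pos l; positivity
  -- Only the first two coordinates are cut off: the surface stays away from the faces `|x₃| = a₃ +
  -- T₃`, since it is either at the height `|height| < a₃` or inside the physical box.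
  let η : ℝ → E3 → ℝ := fun ε y => edgeCut (b 0) ε (y 0) * edgeCut (b 1) ε (y 1)
  let W : ℝ → E3 → C3 := fun ε y => (η ε y : ℂ) • w y
  have hηc : ∀ ε, ContDiff ℝ 1 (fun y => (η ε y : ℂ)) := by
    intro ε
    refine Complex.ofRealCLM.contDiff.comp ?_
    exact ((contDiff_edgeCut _ _).comp (EuclideanSpace.proj (𝕜 := ℝ) (0 : Fin 3)).contDiff).mul
      ((contDiff_edgeCut _ _).comp (EuclideanSpace.proj (𝕜 := ℝ) (1 : Fin 3)).contDiff)
  have hWc : ∀ ε, ContDiffOn ℝ 1 (W ε) M := fun ε => (hηc ε).contDiffOn.smul hwM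
  have hMT : ∀ y ∈ M, ∀ l, |y l| < b l := fun y hy l => by
    rw [hM, G.surface_eq] at hy; exact hy.2 l
  have hMsq : ∀ y ∈ M, ∀ l, 0 < b l ^ 2 - y l ^ 2 := fun y hy l => by
    have := hMT y hy l
    have h1 : |y l| ^ 2 < b l ^ 2 := by gcongr
    rw [sq_abs] at h1; linarith
  obtain ⟨K, hK, hKb, hflat⟩ := G.flat
  have hcompact : ∀ ε : ℝ, 0 < ε → ∫ y in M, surfaceDiv M G.ν (W ε) y ∂(μHE[2] : Measure E3) = 0 := by
    intro ε hε
    let C : Set E3 := closure M ∩ ({y : E3 | ε ≤ b 0 ^ 2 - y 0 ^ 2} ∩ {y : E3 | ε ≤ b 1 ^ 2 - y 1 ^ 2})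
    have hCc : IsCompact C := G.isCompact_closure_surface.inter_right
      ((isClosed_le continuous_const (by fun_prop)).inter (isClosed_le continuous_const (by fun_prop)))
    have hCM : C ⊆ M := by
      rintro y ⟨hy, hy0, hy1⟩
      have h1 := G.closure_surface_subset hy
      have habs : ∀ l, ε ≤ b l ^ 2 - y l ^ 2 → |y l| < b l := by
        intro l h
        refine abs_lt_of_sq_lt_sq ?_ (hbpos l).le
        linarith
      rw [hM, G.surface_eq]
      refine ⟨h1.1, fun l => ?_⟩
      fin_cases l
      · exact habs 0 hy0
      · exact habs 1 hy1
      · change |y 2| < p.a 2 + p.T 2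
        have hT := p.T_pos 2
        rcases h1.1 with h2 | h2
        · by_cases hyK : y ∈ K
          · exact (hKb hyK 2).trans (by linarith)
          · rw [(G.mem_frontier_upper_iff hK hflat hyK).1 h2]
            exact G.height_lt.trans (by linarith)
        · exact ((G.obstacle_subset (frontier_subset_closure h2)).2 2).trans (by linarith)
    refine (hS.integral_surfaceDiv_of_compact G.measurableSet_surface (hWc ε) ?_ hCc hCM ?_).2
    · intro y hy
      simp only [W]; rw [dotProduct_smul, hwt y hy, smul_zero]
    · intro y hy hyC
      have : ¬ (ε ≤ b 0 ^ 2 - y 0 ^ 2 ∧ ε ≤ b 1 ^ 2 - y 1 ^ 2) := fun h => hyC ⟨subset_closure hy, h⟩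
      have hz : ∀ l, b l ^ 2 - y l ^ 2 < ε → edgeCut (b l) ε (y l) = 0 := by
        intro l h
        refine Real.smoothTransition.zero_of_nonpos ?_
        rw [sub_nonpos, div_le_one hε]; exact h.le
      rw [not_and_or, not_le, not_le] at this
      have : η ε y = 0 := by
        rcases this with h | h
        · simp only [η]; rw [hz 0 h, zero_mul]
        · simp only [η]; rw [hz 1 h, mul_zero]
      simp [W, this]
  -- the derivative of the cutoff is compensated by the decay of the field
  have hedge : ∀ l : Fin 3, l ≠ 2 → ∃ E : ℝ, 0 ≤ E ∧ ∀ᶠ ε in 𝓝[>] (0 : ℝ), ∀ y ∈ M,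
      ‖((deriv Real.smoothTransition ((b l ^ 2 - y l ^ 2) / ε - 1) * (-(2 * y l) / ε) : ℝ) : ℂ) * w y l‖ ≤ E := by
    intro l hl
    -- Where the derivative of the cutoff is nonzero, `b ^ 2 - s ^ 2 ≤ 2 ε`. There `|s| (b - |s|) ≤
    -- 2 ε`, so the factor `2 |s| / ε` times `B (b - |s|)` is at most `4 B`.
    refine ⟨A * 4 * B, by positivity, ?_⟩
    have hal := p.a_pos l
    have hTl := p.T_pos l
    -- For `ε` below this threshold the transition zone of the cutoff lies in `|y_l| ≥ a_l`, where
    -- the surface is flat and `norm_le_of_edge` applies.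
    have hd : 0 < (b l ^ 2 - p.a l ^ 2) / 2 := by simp only [hb]; nlinarith
    filter_upwards [Ioo_mem_nhdsGT hd] with ε hε y hy
    have hbl := hMT y hy l
    by_cases hx : (b l ^ 2 - y l ^ 2) / ε - 1 ≤ 1
    · have h1 : b l ^ 2 - y l ^ 2 ≤ 2 * ε := by
        have : (b l ^ 2 - y l ^ 2) / ε ≤ 2 := by linarith
        rwa [div_le_iff₀ hε.1] at this
      have h2 : p.a l ≤ |y l| := by
        refine abs_le_of_sq_le_sq' ?_ (abs_nonneg _) |>.2
        rw [sq_abs]; linarith [hε.2]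
      have h3 := G.norm_le_of_edge hB h0 hl hy h2
      have h4 : ‖w y l‖ ≤ B * (b l - |y l|) := (norm_le_pi_norm _ l).trans h3
      have h5 : (b l - |y l|) * b l ≤ 2 * ε := by
        refine le_trans ?_ h1
        rw [← sq_abs (y l)]
        nlinarith [abs_nonneg (y l)]
      rw [norm_mul, Complex.norm_real, norm_mul, Real.norm_eq_abs, Real.norm_eq_abs, abs_div, abs_neg, abs_mul,
        abs_two, abs_of_pos hε.1]
      have h6 : 2 * |y l| / ε * (B * (b l - |y l|)) ≤ 4 * B := by
        rw [div_mul_eq_mul_div, div_le_iff₀ hε.1]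
        have : |y l| * (b l - |y l|) ≤ 2 * ε := by
          nlinarith [abs_nonneg (y l)]
        nlinarith
      have h7 : 0 ≤ 2 * |y l| / ε := by have := hε.1; positivity
      calc _ ≤ A * (2 * |y l| / ε) * (B * (b l - |y l|)) := by
            gcongr
            exact (hA _).1
        _ = A * (2 * |y l| / ε * (B * (b l - |y l|))) := by ring
        _ ≤ A * (4 * B) := by gcongr
        _ = _ := by ring
    · rw [((hA _).2 (Or.inr (not_le.1 hx)))]
      simp; positivity
  obtain ⟨E0, hE0, hE0'⟩ := hedge 0 (by decide)
  obtain ⟨E1, hE1, hE1'⟩ := hedge 1 (by decide)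
  have hfin : IsFiniteMeasure ((μHE[2] : Measure E3).restrict M) :=
    ⟨by rw [Measure.restrict_apply_univ]; exact G.measure_surface_lt_top⟩
  -- The truncated fields have zero total divergence. Their divergences are uniformly bounded, and
  -- at each fixed point they eventually agree with that of `w`, so the identity passes to the
  -- limit.
  have hlim := tendsto_integral_filter_of_dominated_convergence (μ := (μHE[2] : Measure E3).restrict M)
    (l := 𝓝[>] (0 : ℝ)) (F := fun ε y => surfaceDiv M G.ν (W ε) y) (f := surfaceDiv M G.ν w)
    (fun _ => D + E0 + E1) ?_ ?_ (integrable_const _) ?_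
  · refine tendsto_nhds_unique hlim ?_
    refine tendsto_const_nhds.congr' ?_
    filter_upwards [self_mem_nhdsWithin] with ε hε using (hcompact ε hε).symm
  · exact Eventually.of_forall fun ε =>
      (hS.continuousOn_surfaceDiv (hWc ε)).aestronglyMeasurable G.measurableSet_surface
  · filter_upwards [hE0', hE1'] with ε h1 h2
    filter_upwards [ae_restrict_mem G.measurableSet_surface] with y hy
    have hd0 := (hasDerivAt_edgeCut (b 0) ε (y 0)).comp_hasFDerivAt y
      (EuclideanSpace.proj (𝕜 := ℝ) (0 : Fin 3)).hasFDerivAt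
    have hd1 := (hasDerivAt_edgeCut (b 1) ε (y 1)).comp_hasFDerivAt y
      (EuclideanSpace.proj (𝕜 := ℝ) (1 : Fin 3)).hasFDerivAt
    have hd := Complex.ofRealCLM.hasFDerivAt.comp y (hd0.mul hd1)
    have := hS.surfaceDiv_smul hy (f := fun y => (η ε y : ℂ)) hd.hasFDerivWithinAt
      ((hwM y hy).differentiableWithinAt (by norm_num)) (hwt y hy)
    simp only [W]
    rw [this]
    have hcut : ∀ l, |edgeCut (b l) ε (y l)| ≤ 1 := fun l => by
      unfold edgeCut
      rw [abs_of_nonneg (Real.smoothTransition.nonneg _)]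
      exact Real.smoothTransition.le_one _
    have hη1 : ‖(η ε y : ℂ)‖ ≤ 1 := by
      rw [Complex.norm_real, norm_mul]
      exact mul_le_one₀ (hcut 0) (abs_nonneg _) (hcut 1)
    have hl : ∀ i : Fin 3, (Complex.ofRealCLM.comp
        ((edgeCut (b 0) ε (y 0)) • (deriv Real.smoothTransition ((b 1 ^ 2 - y 1 ^ 2) / ε - 1) *
          (-(2 * y 1) / ε)) • (EuclideanSpace.proj 1 : E3 →L[ℝ] ℝ) +
        (edgeCut (b 1) ε (y 1)) • (deriv Real.smoothTransition ((b 0 ^ 2 - y 0 ^ 2) / ε - 1) *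
          (-(2 * y 0) / ε)) • (EuclideanSpace.proj 0 : E3 →L[ℝ] ℝ)))
        (EuclideanSpace.single i (1 : ℝ)) =
      ((edgeCut (b 0) ε (y 0) * ((deriv Real.smoothTransition ((b 1 ^ 2 - y 1 ^ 2) / ε - 1) *
          (-(2 * y 1) / ε)) * (EuclideanSpace.single i (1 : ℝ) : E3) 1) +
        edgeCut (b 1) ε (y 1) * ((deriv Real.smoothTransition ((b 0 ^ 2 - y 0 ^ 2) / ε - 1) *
          (-(2 * y 0) / ε)) * (EuclideanSpace.single i (1 : ℝ) : E3) 0) : ℝ) : ℂ) := fun i => rfl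
    have hdot := congrArg (fun v : C3 => v ⬝ᵥ w y) (funext hl)
    refine (congrArg (fun z : ℂ => ‖(η ε y : ℂ) * surfaceDiv M G.ν w y + z‖) hdot).trans_le ?_
    simp only [dotProduct, Fin.sum_univ_three]
    have e1 := h1 y hy
    have e2 := h2 y hy
    set d0 := deriv Real.smoothTransition ((b 0 ^ 2 - y 0 ^ 2) / ε - 1) * (-(2 * y 0) / ε)
    set d1 := deriv Real.smoothTransition ((b 1 ^ 2 - y 1 ^ 2) / ε - 1) * (-(2 * y 1) / ε)
    have h3 : ‖(η ε y : ℂ) * surfaceDiv M G.ν w y‖ ≤ D := by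
      rw [norm_mul]
      calc _ ≤ 1 * D := by gcongr; exact hD y hy
        _ = D := one_mul _
    have h4 : ‖(edgeCut (b 1) ε (y 1) : ℂ) * ((d0 : ℂ) * w y 0)‖ ≤ E0 := by
      rw [norm_mul, Complex.norm_real]
      calc _ ≤ 1 * E0 := by gcongr; exact hcut 1
        _ = E0 := one_mul _
    have h5 : ‖(edgeCut (b 0) ε (y 0) : ℂ) * ((d1 : ℂ) * w y 1)‖ ≤ E1 := by
      rw [norm_mul, Complex.norm_real]
      calc _ ≤ 1 * E1 := by gcongr; exact hcut 0
        _ = E1 := one_mul _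
    refine le_trans (le_of_eq ?_) ((norm_add₃_le).trans (add_le_add (add_le_add h3 h4) h5))
    simp only [add_assoc]
    congr 2
    simp
    ring
  · filter_upwards [ae_restrict_mem G.measurableSet_surface] with y hy
    refine tendsto_const_nhds.congr' ?_
    have hm := lt_min (hMsq y hy 0) (hMsq y hy 1)
    filter_upwards [Ioo_mem_nhdsGT (half_pos hm)] with ε hε
    unfold surfaceDiv
    have hev : W ε =ᶠ[𝓝 y] w := by
      have hone : ∀ l, ε < (b l ^ 2 - y l ^ 2) / 2 → ∀ᶠ z in 𝓝 y, edgeCut (b l) ε (z l) = 1 := by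
        intro l h
        have hc : ContinuousAt (fun z : E3 => (b l ^ 2 - z l ^ 2) / 2) y := by fun_prop
        filter_upwards [hc.eventually_const_lt h] with z hz
        refine Real.smoothTransition.one_of_one_le ?_
        have : 2 ≤ (b l ^ 2 - z l ^ 2) / ε := by rw [le_div_iff₀ hε.1]; linarith
        linarith
      filter_upwards [hone 0 (hε.2.trans_le (by linarith [min_le_left (b 0 ^ 2 - y 0 ^ 2) (b 1 ^ 2 - y 1 ^ 2)])),
        hone 1 (hε.2.trans_le (by linarith [min_le_right (b 0 ^ 2 - y 0 ^ 2) (b 1 ^ 2 - y 1 ^ 2)]))] with z h1 h2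
      simp [W, η, h1, h2]
    rw [hev.fderivWithin_eq_of_nhds]

end Layered
end

noncomputable section

/-! ### The medium property -/

/-- The constant branch and the branch `R` join differentiably at the origin because `R` has zero
slope there. -/
lemma hasDerivAt_comp_max {R : ℝ → ℝ} (hR : ContDiff ℝ 1 R) (h1 : deriv R 0 = 0) (s : ℝ) :
    HasDerivAt (fun s => R (max s 0)) (deriv R (max s 0)) s := by
  have hd : ∀ s, HasDerivAt R (deriv R s) s := fun s => (hR.differentiable (by norm_num) s).hasDerivAt
  rcases lt_trichotomy s 0 with hs | rfl | hs
  · rw [max_eq_right hs.le, h1]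
    refine (hasDerivAt_const s (R 0)).congr_of_eventuallyEq ?_
    filter_upwards [gt_mem_nhds hs] with t ht
    rw [max_eq_right (le_of_lt ht)]
  · rw [max_self, h1]
    have e1 : HasDerivWithinAt (fun s => R (max s 0)) 0 (Iic 0) 0 := by
      refine (hasDerivWithinAt_const (0 : ℝ) (Iic 0) (R 0)).congr (fun t ht => ?_) (by simp)
      rw [max_eq_right ht]
    have e2 : HasDerivWithinAt (fun s => R (max s 0)) 0 (Ici 0) 0 := by
      have := hd 0
      rw [h1] at this
      refine this.hasDerivWithinAt.congr (fun t ht => ?_) (by simp)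
      rw [max_eq_left ht]
    have := e1.union e2
    rwa [Iic_union_Ici, hasDerivWithinAt_univ] at this
  · rw [max_eq_left hs.le]
    refine (hd s).congr_of_eventuallyEq ?_
    filter_upwards [lt_mem_nhds hs] with t ht
    rw [max_eq_left (le_of_lt ht)]

lemma contDiff_comp_max {R : ℝ → ℝ} (hR : ContDiff ℝ 1 R) (h1 : deriv R 0 = 0) :
    ContDiff ℝ 1 (fun s => R (max s 0)) := by
  rw [contDiff_one_iff_deriv]
  refine ⟨fun s => (hasDerivAt_comp_max hR h1 s).differentiableAt, ?_⟩
  rw [funext fun s => (hasDerivAt_comp_max hR h1 s).deriv]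
  exact (hR.continuous_deriv le_rfl).comp (by fun_prop)

namespace PML
variable (p : PML)

/-- The transition profile of the medium property. -/
def profile (s : ℝ) : ℝ := p.f₁ (s - 1) ^ p.P / (p.f₁ (s - 1) ^ p.P + p.f₂ (s - 1) ^ p.P)

lemma P_ne_zero : (p.P : ℝ) ≠ 0 := by have := p.two_le_P; positivity

lemma f₁_neg_one : p.f₁ (-1) = 0 := by
  have := p.P_ne_zero
  unfold f₁; field_simp; ring

/-- Since `f₁ + f₂ = 1`, the two do not vanish together, which settles even `P`. For odd `P`, `f₁ >
-f₂` and odd powers are strictly increasing. -/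
lemma profile_den_pos (t : ℝ) : 0 < p.f₁ t ^ p.P + p.f₂ t ^ p.P := by
  have hsum : p.f₁ t + p.f₂ t = 1 := by unfold f₂; ring
  have hP : p.P ≠ 0 := by have := p.two_le_P; omega
  rcases Nat.even_or_odd p.P with h | h
  · by_cases h1 : p.f₁ t = 0
    · have : p.f₂ t = 1 := by linarith
      rw [h1, this, zero_pow hP]; simp
    · have := h.pow_pos h1
      have := h.pow_nonneg (p.f₂ t)
      positivity
  · have h1 : -p.f₂ t < p.f₁ t := by linarith
    have h2 := h.strictMono_pow h1
    simp only [h.neg_pow] at h2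
    linarith

lemma contDiff_f₁ {n : WithTop ℕ∞} : ContDiff ℝ n p.f₁ := by
  unfold f₁; fun_prop

lemma contDiff_profile : ContDiff ℝ 1 p.profile := by
  have h1 : ContDiff ℝ 1 p.f₁ := p.contDiff_f₁
  have h2 : ContDiff ℝ 1 p.f₂ := by unfold f₂; exact contDiff_const.sub h1
  have h3 : ContDiff ℝ 1 (fun s => p.f₁ (s - 1)) := h1.comp (by fun_prop)
  have h4 : ContDiff ℝ 1 (fun s => p.f₂ (s - 1)) := h2.comp (by fun_prop)
  unfold profile
  exact (h3.pow _).div ((h3.pow _).add (h4.pow _)) fun s => (p.profile_den_pos _).ne'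

lemma profile_zero : p.profile 0 = 0 := by
  have hP : p.P ≠ 0 := by have := p.two_le_P; omega
  simp [profile, p.f₁_neg_one, zero_pow hP]

/-- The numerator is a power at least two of a function vanishing at this point. This is what makes
`σ` continuously differentiable at the inner end of the layer. -/
lemma deriv_profile_zero : deriv p.profile 0 = 0 := by
  have hP : p.P - 1 ≠ 0 := by have := p.two_le_P; omega
  have hP' : p.P ≠ 0 := by have := p.two_le_P; omega
  have h1 : ContDiff ℝ 1 p.f₁ := p.contDiff_f₁
  have h2 : ContDiff ℝ 1 p.f₂ := by unfold f₂; exact contDiff_const.sub h1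
  have h3 : DifferentiableAt ℝ (fun s => p.f₁ (s - 1)) 0 :=
    (h1.comp (contDiff_id.sub contDiff_const)).differentiable (by norm_num) 0
  have h4 : DifferentiableAt ℝ (fun s => p.f₂ (s - 1)) 0 :=
    (h2.comp (contDiff_id.sub contDiff_const)).differentiable (by norm_num) 0
  have e1 := h3.hasDerivAt.pow p.P
  have e2 := h4.hasDerivAt.pow p.P
  have := (e1.div (e1.add e2) (p.profile_den_pos _).ne').deriv
  refine (Eq.trans ?_ this).trans ?_
  · rfl
  · simp [zero_pow hP, zero_pow hP', p.f₁_neg_one]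

/-- On `[-1, 0]` one has `t ≤ t ^ 3 ≤ 0` and the coefficients are nonnegative, so `f₁` lies between
`(t + 1) / 2` and `1 / 2`. -/
lemma f₁_bounds {t : ℝ} (h1 : -1 ≤ t) (h2 : t ≤ 0) : 0 ≤ p.f₁ t ∧ p.f₁ t ≤ 1 / 2 := by
  have hP : (2 : ℝ) ≤ p.P := by exact_mod_cast p.two_le_P
  have hc : 0 ≤ 1 / 2 - 1 / (p.P : ℝ) := by
    rw [sub_nonneg]; exact one_div_le_one_div_of_le (by norm_num) hP
  have hi : 0 ≤ 1 / (p.P : ℝ) := by positivity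
  have h3 : t ≤ t ^ 3 := by nlinarith [mul_nonneg (sub_nonneg.2 h1) (neg_nonneg.2 h2), mul_nonneg (mul_nonneg (sub_nonneg.2 h1) (neg_nonneg.2 h2)) (show 0 ≤ 1 - t by linarith)]
  have h4 : t ^ 3 ≤ 0 := by
    have : t ^ 3 = t * t ^ 2 := by ring
    rw [this]; exact mul_nonpos_of_nonpos_of_nonneg h2 (sq_nonneg t)
  have h5 : t / (p.P : ℝ) = t * (1 / p.P) := by ring
  unfold f₁
  rw [h5]
  constructor
  · nlinarith
  · nlinarith

lemma profile_bounds {s : ℝ} (h1 : 0 ≤ s) (h2 : s ≤ 1) : 0 ≤ p.profile s ∧ p.profile s ≤ 1 / 2 := by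
  obtain ⟨h3, h4⟩ := p.f₁_bounds (t := s - 1) (by linarith) (by linarith)
  have h5 : p.f₁ (s - 1) ≤ p.f₂ (s - 1) := by unfold f₂; linarith
  have h6 : p.f₁ (s - 1) ^ p.P ≤ p.f₂ (s - 1) ^ p.P := by gcongr
  have h7 := p.profile_den_pos (s - 1)
  unfold profile
  constructor
  · have : 0 ≤ p.f₁ (s - 1) ^ p.P := by positivity
    positivity
  · rw [div_le_iff₀ h7]; linarith

lemma profile_one : p.profile 1 = 1 / 2 := by
  have h0 : p.f₁ 0 = 1 / 2 := by simp [f₁]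
  have h1 : p.f₂ 0 = 1 / 2 := by simp only [f₂, h0]; norm_num
  have h2 : (0 : ℝ) < (1 / 2) ^ p.P := by positivity
  unfold profile
  rw [sub_self, h0, h1]
  field_simp
  norm_num

lemma sigma_eq_of_le (l : Fin 3) {x : ℝ} (hx : |x| ≤ p.a l + p.T l) :
    p.sigma l x = 2 * p.S * p.profile (max ((|x| - p.a l) / p.T l) 0) := by
  have hT := p.T_pos l
  unfold sigma
  split_ifs with h
  · rw [max_eq_right, profile_zero, mul_zero]
    exact div_nonpos_of_nonpos_of_nonneg (by linarith) hT.le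
  · rw [max_eq_left (div_nonneg (by linarith [not_lt.1 h]) hT.le)]
    have : (|x| - (p.a l + p.T l)) / p.T l = (|x| - p.a l) / p.T l - 1 := by field_simp; ring
    rw [this, profile, mul_div_assoc]

/-- Clamping the argument of the profile to `[0, 1]` merges the three branches, because the profile
is `0` at `0` and `1 / 2` at `1`. Continuity and the bounds `0 ≤ σ ≤ S` can then be read off. -/
lemma sigma_eq (l : Fin 3) (x : ℝ) :
    p.sigma l x = 2 * p.S * p.profile (min (max ((|x| - p.a l) / p.T l) 0) 1) := by
  have hT := p.T_pos l
  by_cases hx : |x| ≤ p.a l + p.T l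
  · rw [p.sigma_eq_of_le l hx, min_eq_left]
    refine max_le ?_ zero_le_one
    rw [div_le_one hT]; linarith
  · rw [min_eq_right, profile_one]
    · unfold sigma
      have ha := p.T_pos l
      rw [if_neg (by linarith [not_le.1 hx]), if_neg hx]; ring
    · refine le_max_of_le_left ?_
      rw [le_div_iff₀ hT]; linarith [not_le.1 hx]

lemma continuous_sigma (l : Fin 3) : Continuous (p.sigma l) := by
  rw [funext (p.sigma_eq l)]
  have := p.contDiff_profile.continuous
  have hT := (p.T_pos l).ne'
  fun_prop

lemma sigma_bounds (l : Fin 3) (x : ℝ) : 0 ≤ p.sigma l x ∧ p.sigma l x ≤ p.S := by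
  have hS := p.S_pos
  obtain ⟨h1, h2⟩ := p.profile_bounds (s := min (max ((|x| - p.a l) / p.T l) 0) 1)
    (le_min (le_max_right _ _) zero_le_one) (min_le_right _ _)
  rw [sigma_eq]
  constructor
  · positivity
  · nlinarith

/-- Strictly inside the outer end only the inner junction matters. The origin is treated separately:
the absolute value is not differentiable there, but `σ` vanishes nearby. -/
lemma contDiffAt_sigma (l : Fin 3) {x : ℝ} (hx : |x| < p.a l + p.T l) :
    ContDiffAt ℝ 1 (p.sigma l) x := by
  by_cases h0 : x = 0
  · refine (contDiffAt_const (c := (0 : ℝ))).congr_of_eventuallyEq ?_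
    have : ContinuousAt (fun t : ℝ => |t|) x := by fun_prop
    filter_upwards [this.eventually_lt_const (show |x| < p.a l by rw [h0, abs_zero]; exact p.a_pos l)] with t ht
    unfold sigma; rw [if_pos ht]
  · have h1 : ContDiffAt ℝ 1 (fun x => 2 * p.S * p.profile (max ((|x| - p.a l) / p.T l) 0)) x := by
      refine contDiffAt_const.mul ?_
      exact ContDiffAt.comp (g := fun s => p.profile (max s 0)) x
        (contDiff_comp_max p.contDiff_profile p.deriv_profile_zero).contDiffAt
        (((contDiffAt_abs h0).sub contDiffAt_const).div_const _)
    refine h1.congr_of_eventuallyEq ?_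
    have : ContinuousAt (fun t : ℝ => |t|) x := by fun_prop
    filter_upwards [this.eventually_lt_const hx] with t ht
    exact p.sigma_eq_of_le l ht.le

/-! ### The stretched coordinates -/

lemma hasDerivAt_stretch (l : Fin 3) (x : ℝ) :
    HasDerivAt (p.stretch l) (1 + Complex.I * (p.sigma l x : ℂ)) x := by
  unfold stretch
  have h1 : HasDerivAt (fun x : ℝ => ∫ t in (0 : ℝ)..x, p.sigma l t) (p.sigma l x) x :=
    intervalIntegral.integral_hasDerivAt_right ((p.continuous_sigma l).intervalIntegrable _ _)
      (p.continuous_sigma l).stronglyMeasurable.stronglyMeasurableAtFilter (p.continuous_sigma l).continuousAt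
  exact (hasDerivAt_id x).ofReal_comp.add (h1.ofReal_comp.const_mul _)

lemma contDiff_stretch (l : Fin 3) : ContDiff ℝ 1 (p.stretch l) := by
  rw [contDiff_one_iff_deriv]
  refine ⟨fun x => (p.hasDerivAt_stretch l x).differentiableAt, ?_⟩
  rw [funext fun x => (p.hasDerivAt_stretch l x).deriv]
  have := p.continuous_sigma l
  fun_prop

/-- Mean value theorem for the primitive of `σ`. Hence a stretched difference is the real difference
times `1 + iτ` with `0 ≤ τ ≤ S`. -/
lemma exists_stretch_sub (l : Fin 3) (x y : ℝ) : ∃ τ : ℝ, 0 ≤ τ ∧ τ ≤ p.S ∧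
    p.stretch l x - p.stretch l y = ((x - y : ℝ) : ℂ) * (1 + Complex.I * τ) := by
  have key : ∀ x y : ℝ, x < y → ∃ τ : ℝ, 0 ≤ τ ∧ τ ≤ p.S ∧
      p.stretch l x - p.stretch l y = ((x - y : ℝ) : ℂ) * (1 + Complex.I * τ) := by
    intro x y hxy
    have h1 : ∀ x, HasDerivAt (fun x : ℝ => ∫ t in (0 : ℝ)..x, p.sigma l t) (p.sigma l x) x := fun x =>
      intervalIntegral.integral_hasDerivAt_right ((p.continuous_sigma l).intervalIntegrable _ _)
        (p.continuous_sigma l).stronglyMeasurable.stronglyMeasurableAtFilter (p.continuous_sigma l).continuousAt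
    obtain ⟨c, -, hc⟩ := exists_hasDerivAt_eq_slope (fun x : ℝ => ∫ t in (0 : ℝ)..x, p.sigma l t) (p.sigma l) hxy
      (fun x _ => (h1 x).continuousAt.continuousWithinAt) (fun x _ => h1 x)
    refine ⟨p.sigma l c, (p.sigma_bounds l c).1, (p.sigma_bounds l c).2, ?_⟩
    rw [eq_div_iff (sub_ne_zero.2 hxy.ne')] at hc
    unfold stretch
    have h2 := congrArg (fun z : ℝ => (z : ℂ)) hc
    push_cast at h2 ⊢
    linear_combination (-Complex.I) * (-h2)
  rcases lt_trichotomy x y with h | rfl | h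
  · exact key x y h
  · exact ⟨0, le_rfl, p.S_pos.le, by simp⟩
  · obtain ⟨τ, h1, h2, h3⟩ := key y x h
    refine ⟨τ, h1, h2, ?_⟩
    rw [← neg_sub, h3]; push_cast; ring

/-- The squared complex distance. -/
def qdist (x y : E3) : ℂ := ∑ l, (p.stretch l (x l) - p.stretch l (y l)) ^ 2

lemma qdist_comm (x y : E3) : p.qdist x y = p.qdist y x := by
  unfold qdist; congr 1; ext l; ring

/-- Each summand is `(x_l - y_l) ^ 2 (1 - τ ^ 2 + 2 i τ)`, and `τ ^ 2 ≤ S τ` gives `1 - τ ^ 2 + 2 S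
τ ≥ 1`. From these two inequalities it follows that the squared distance avoids the branch cut for
`x ≠ y` and bounds `‖x - y‖ ^ 2` up to the factor `1 + S`. -/
lemma qdist_facts (x y : E3) : 0 ≤ (p.qdist x y).im ∧
    ‖x - y‖ ^ 2 ≤ (p.qdist x y).re + p.S * (p.qdist x y).im := by
  have hS := p.S_pos
  have h : ∀ l, 0 ≤ ((p.stretch l (x l) - p.stretch l (y l)) ^ 2).im ∧
      (x l - y l) ^ 2 ≤ ((p.stretch l (x l) - p.stretch l (y l)) ^ 2).re +
        p.S * ((p.stretch l (x l) - p.stretch l (y l)) ^ 2).im := by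
    intro l
    obtain ⟨τ, h1, h2, h3⟩ := p.exists_stretch_sub l (x l) (y l)
    rw [h3]
    have e : (((x l - y l : ℝ) : ℂ) * (1 + Complex.I * τ)) ^ 2 =
        (((x l - y l) ^ 2 * (1 - τ ^ 2) : ℝ) : ℂ) + (((x l - y l) ^ 2 * (2 * τ) : ℝ) : ℂ) * Complex.I := by
      push_cast
      linear_combination ((x l : ℂ) - y l) ^ 2 * (τ : ℂ) ^ 2 * Complex.I_sq
    rw [e, Complex.add_re, Complex.add_im, Complex.re_ofReal_mul, Complex.im_ofReal_mul, Complex.ofReal_re, Complex.ofReal_im,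
      Complex.I_re, Complex.I_im]
    have h4 := sq_nonneg (x l - y l)
    constructor
    · positivity
    · nlinarith [mul_nonneg h4 (mul_nonneg h1 (sub_nonneg.2 h2)), mul_nonneg h4 (mul_nonneg h1 hS.le)]
  unfold qdist
  rw [Complex.im_sum, Complex.re_sum, EuclideanSpace.norm_sq_eq]
  constructor
  · exact Finset.sum_nonneg fun l _ => (h l).1
  · rw [Finset.mul_sum, ← Finset.sum_add_distrib]
    exact Finset.sum_le_sum fun l _ => by simpa [sq_abs] using (h l).2

lemma qdist_mem_slitPlane {x y : E3} (h : x ≠ y) : p.qdist x y ∈ Complex.slitPlane := by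
  obtain ⟨h1, h2⟩ := p.qdist_facts x y
  have h3 : 0 < ‖x - y‖ := norm_pos_iff.2 (sub_ne_zero.2 h)
  rw [Complex.mem_slitPlane_iff]
  by_cases h4 : (p.qdist x y).im = 0
  · left; rw [h4, mul_zero, add_zero] at h2; nlinarith
  · right; exact h4

lemma le_norm_qdist (x y : E3) : ‖x - y‖ ^ 2 ≤ (1 + p.S) * ‖p.qdist x y‖ := by
  obtain ⟨h1, h2⟩ := p.qdist_facts x y
  have hS := p.S_pos
  have h3 := Complex.re_le_norm (p.qdist x y)
  have h4 := Complex.im_le_norm (p.qdist x y)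
  nlinarith

lemma norm_stretch_sub_le (l : Fin 3) (x y : E3) :
    ‖p.stretch l (x l) - p.stretch l (y l)‖ ≤ (1 + p.S) * ‖x - y‖ := by
  obtain ⟨τ, h1, h2, h3⟩ := p.exists_stretch_sub l (x l) (y l)
  rw [h3, norm_mul, Complex.norm_real, mul_comm]
  have h4 : ‖(1 : ℂ) + Complex.I * τ‖ ≤ 1 + p.S := by
    refine (norm_add_le _ _).trans ?_
    simp [abs_of_nonneg h1]; exact h2
  have h5 : ‖x l - y l‖ ≤ ‖x - y‖ := PiLp.norm_apply_le (x - y) l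
  have := p.S_pos
  gcongr

lemma norm_qdist_le (x y : E3) : ‖p.qdist x y‖ ≤ 3 * (1 + p.S) ^ 2 * ‖x - y‖ ^ 2 := by
  unfold qdist
  refine (norm_sum_le _ _).trans ?_
  rw [Fin.sum_univ_three]
  have h : ∀ l, ‖(p.stretch l (x l) - p.stretch l (y l)) ^ 2‖ ≤ ((1 + p.S) * ‖x - y‖) ^ 2 := fun l => by
    rw [norm_pow]; gcongr; exact p.norm_stretch_sub_le l x y
  nlinarith [h 0, h 1, h 2]

end PML
end

noncomputable section

/-! ### The fundamental solution as a function of the squared distance -/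

/-- The fundamental solution as a function of the squared distance. -/
def psi₀ (k : ℝ) (q : ℂ) : ℂ :=
  Complex.exp (Complex.I * k * q ^ (1 / 2 : ℂ)) / (4 * Real.pi * q ^ (1 / 2 : ℂ))

/-- The derivative of `psi₀`. -/
def psi₁ (k : ℝ) (q : ℂ) : ℂ :=
  Complex.exp (Complex.I * k * q ^ (1 / 2 : ℂ)) * (Complex.I * k * q ^ (1 / 2 : ℂ) - 1) /
    (8 * Real.pi * (q ^ (1 / 2 : ℂ)) ^ 3)

/-- The derivative of `psi₁`. -/
def psi₂ (k : ℝ) (q : ℂ) : ℂ :=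
  Complex.exp (Complex.I * k * q ^ (1 / 2 : ℂ)) *
    (3 - 3 * (Complex.I * k * q ^ (1 / 2 : ℂ)) - k ^ 2 * (q ^ (1 / 2 : ℂ)) ^ 2) /
    (16 * Real.pi * (q ^ (1 / 2 : ℂ)) ^ 5)

lemma sqrt_sq_complex (q : ℂ) : (q ^ (1 / 2 : ℂ)) ^ 2 = q := by
  rw [← Complex.cpow_nat_mul]; simp

lemma sqrt_ne_zero_complex {q : ℂ} (hq : q ≠ 0) : q ^ (1 / 2 : ℂ) ≠ 0 := by
  intro h
  have := sqrt_sq_complex q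
  rw [h] at this
  exact hq (by rw [← this]; simp)

lemma norm_sqrt_sq_complex (q : ℂ) : ‖q ^ (1 / 2 : ℂ)‖ ^ 2 = ‖q‖ := by
  rw [← norm_pow, sqrt_sq_complex]

lemma hasDerivAt_sqrt_complex {q : ℂ} (hq : q ∈ Complex.slitPlane) :
    HasDerivAt (fun q : ℂ => q ^ (1 / 2 : ℂ)) (1 / (2 * q ^ (1 / 2 : ℂ))) q := by
  have h := (hasDerivAt_id q).cpow_const (c := (1 / 2 : ℂ)) hq
  refine h.congr_deriv ?_
  have hq0 := Complex.slitPlane_ne_zero hq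
  have hr := sqrt_ne_zero_complex hq0
  have : (id q : ℂ) ^ ((1 / 2 : ℂ) - 1) = (q ^ (1 / 2 : ℂ))⁻¹ := by
    rw [show (1 / 2 : ℂ) - 1 = -(1 / 2) by norm_num, Complex.cpow_neg]; rfl
  rw [this]
  field_simp

lemma hasDerivAt_psi₀ (k : ℝ) {q : ℂ} (hq : q ∈ Complex.slitPlane) :
    HasDerivAt (psi₀ k) (psi₁ k q) q := by
  have hr := sqrt_ne_zero_complex (Complex.slitPlane_ne_zero hq)
  have h := hasDerivAt_sqrt_complex hq
  have hpi : (Real.pi : ℂ) ≠ 0 := by exact_mod_cast Real.pi_ne_zero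
  have h1 := ((h.const_mul (Complex.I * k)).cexp).div (h.const_mul (4 * (Real.pi : ℂ))) (by simp [hpi]; simpa using hr)
  refine h1.congr_deriv ?_
  unfold psi₁
  field_simp
  ring

lemma hasDerivAt_psi₁ (k : ℝ) {q : ℂ} (hq : q ∈ Complex.slitPlane) :
    HasDerivAt (psi₁ k) (psi₂ k q) q := by
  have hr := sqrt_ne_zero_complex (Complex.slitPlane_ne_zero hq)
  have h := hasDerivAt_sqrt_complex hq
  have hpi : (Real.pi : ℂ) ≠ 0 := by exact_mod_cast Real.pi_ne_zero
  have h1 := (((h.const_mul (Complex.I * k)).cexp).mul ((h.const_mul (Complex.I * k)).sub_const 1)).div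
    ((h.pow 3).const_mul (8 * (Real.pi : ℂ))) (by simp [hpi]; simpa using hr)
  refine h1.congr_deriv ?_
  unfold psi₂
  have hI := Complex.I_sq
  simp only [Pi.pow_apply, Pi.mul_apply]
  generalize q ^ (1 / 2 : ℂ) = r at *
  field_simp
  ring_nf
  simp only [hI]
  ring

/-- The Helmholtz equation in radial form. -/
lemma psi_helmholtz (k : ℝ) {q : ℂ} (hq : q ≠ 0) :
    4 * q * psi₂ k q + 6 * psi₁ k q = -(k : ℂ) ^ 2 * psi₀ k q := by
  have hr := sqrt_ne_zero_complex hq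
  have h2 := sqrt_sq_complex q
  have hpi : (Real.pi : ℂ) ≠ 0 := by exact_mod_cast Real.pi_ne_zero
  unfold psi₀ psi₁ psi₂
  generalize q ^ (1 / 2 : ℂ) = r at *
  subst h2
  field_simp
  ring

/-- The linear functional `x ↦ v · x`. -/
def dotCLM (v : C3) : E3 →L[ℝ] ℂ :=
  ∑ l, v l • (Complex.ofRealCLM.comp (EuclideanSpace.proj l))

lemma dotCLM_apply (v : C3) (x : E3) : dotCLM v x = v ⬝ᵥ toC3 x := by
  simp only [dotCLM, sum_apply, dotProduct]
  rfl

lemma dotCLM_single (v : C3) (l : Fin 3) : dotCLM v (EuclideanSpace.single l 1) = v l := by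
  rw [dotCLM_apply]
  simp only [dotProduct, toC3]
  rw [Finset.sum_eq_single l]
  · simp
  · intro b _ hb; simp [hb]
  · simp

lemma norm_dotCLM_le (v : C3) : ‖dotCLM v‖ ≤ 3 * ‖v‖ := by
  refine ContinuousLinearMap.opNorm_le_bound _ (by positivity) fun x => ?_
  rw [dotCLM_apply]
  refine (norm_sum_le _ _).trans ?_
  have h : ∀ l, ‖v l * toC3 x l‖ ≤ ‖v‖ * ‖x‖ := fun l => by
    rw [norm_mul]
    have h1 : ‖toC3 x l‖ ≤ ‖x‖ := by
      simp only [toC3, Complex.norm_real]; exact PiLp.norm_apply_le x l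
    have := norm_le_pi_norm v l
    gcongr
  rw [Fin.sum_univ_three]
  linarith [h 0, h 1, h 2]

lemma continuous_dotCLM : Continuous dotCLM := by
  unfold dotCLM
  fun_prop

namespace PML
variable (p : PML)

/-- The difference of the stretched coordinates. -/
def wdiff (l : Fin 3) (x y : E3) : ℂ := p.stretch l (x l) - p.stretch l (y l)

/-- The first derivatives of the fundamental solution in the stretched coordinates. -/
def dPhi (k : ℝ) (l : Fin 3) (x y : E3) : ℂ := 2 * p.wdiff l x y * psi₁ k (p.qdist x y)

/-- The second derivatives of the fundamental solution in the stretched coordinates. -/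
def ddPhi (k : ℝ) (l m : Fin 3) (x y : E3) : ℂ :=
  4 * p.wdiff l x y * p.wdiff m x y * psi₂ k (p.qdist x y) +
    if l = m then 2 * psi₁ k (p.qdist x y) else 0

lemma Phi_eq (k : ℝ) (x y : E3) : p.Phi k x y = psi₀ k (p.qdist x y) := rfl

lemma Phi_comm (k : ℝ) (x y : E3) : p.Phi k x y = p.Phi k y x := by
  rw [Phi_eq, Phi_eq, qdist_comm]

lemma dPhi_comm (k : ℝ) (l : Fin 3) (x y : E3) : p.dPhi k l x y = - p.dPhi k l y x := by
  unfold dPhi wdiff; rw [qdist_comm]; ring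

lemma ddPhi_comm (k : ℝ) (l m : Fin 3) (x y : E3) : p.ddPhi k l m x y = p.ddPhi k m l x y := by
  unfold ddPhi
  simp only [eq_comm (a := l) (b := m)]
  ring

lemma hasFDerivAt_wdiff (l : Fin 3) (x y : E3) :
    HasFDerivAt (fun x => p.wdiff l x y) (p.alpha x l • (Complex.ofRealCLM.comp (EuclideanSpace.proj l)) : E3 →L[ℝ] ℂ) x := by
  have h := HasFDerivAt.comp (g := p.stretch l) x (f := fun x : E3 => x l) (p.hasDerivAt_stretch l (x l)).hasFDerivAt
    (EuclideanSpace.proj (𝕜 := ℝ) l).hasFDerivAt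
  refine (h.sub_const (p.stretch l (y l))).congr_fderiv ?_
  ext v
  simp [alpha]
  ring

lemma hasFDerivAt_qdist {x y : E3} :
    HasFDerivAt (fun x => p.qdist x y) (dotCLM fun l => p.alpha x l * (2 * p.wdiff l x y)) x := by
  have h := HasFDerivAt.fun_sum (u := Finset.univ) fun (l : Fin 3) _ => (p.hasFDerivAt_wdiff l x y).pow 2
  refine h.congr_fderiv ?_
  unfold dotCLM
  congr 1
  ext l v
  simp
  ring

lemma hasFDerivAt_comp_qdist {f : ℂ → ℂ} {f' : ℂ} {x y : E3}
    (hf : HasDerivAt f f' (p.qdist x y)) :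
    HasFDerivAt (fun x => f (p.qdist x y)) (dotCLM fun l => p.alpha x l * (2 * p.wdiff l x y * f')) x := by
  have h := (hf.hasFDerivAt.restrictScalars ℝ).comp x p.hasFDerivAt_qdist
  refine h.congr_fderiv ?_
  ext v
  simp [dotCLM_apply, dotProduct, Fin.sum_univ_three]
  ring

lemma hasFDerivAt_Phi (k : ℝ) {x y : E3} (h : x ≠ y) :
    HasFDerivAt (fun x => p.Phi k x y) (dotCLM fun l => p.alpha x l * p.dPhi k l x y) x :=
  p.hasFDerivAt_comp_qdist (hasDerivAt_psi₀ k (p.qdist_mem_slitPlane h))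

lemma hasFDerivAt_dPhi (k : ℝ) (l : Fin 3) {x y : E3} (h : x ≠ y) :
    HasFDerivAt (fun x => p.dPhi k l x y) (dotCLM fun m => p.alpha x m * p.ddPhi k l m x y) x := by
  have h1 := ((p.hasFDerivAt_wdiff l x y).const_mul 2).mul
    (p.hasFDerivAt_comp_qdist (hasDerivAt_psi₁ k (p.qdist_mem_slitPlane h)))
  refine h1.congr_fderiv ?_
  ext v
  simp [dotCLM_apply, dotProduct, Fin.sum_univ_three, ddPhi, toC3]
  fin_cases l <;> simp <;> ring

lemma hasFDerivAt_Phi_right (k : ℝ) {x y : E3} (h : x ≠ y) :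
    HasFDerivAt (fun y => p.Phi k x y) (dotCLM fun l => -(p.alpha y l * p.dPhi k l x y)) y := by
  have h1 := p.hasFDerivAt_Phi k h.symm
  rw [funext fun y => p.Phi_comm k x y]
  convert h1 using 3
  rw [p.dPhi_comm]; ring

lemma hasFDerivAt_dPhi_right (k : ℝ) (l : Fin 3) {x y : E3} (h : x ≠ y) :
    HasFDerivAt (fun y => p.dPhi k l x y) (dotCLM fun m => -(p.alpha y m * p.ddPhi k l m x y)) y := by
  have h1 := (p.hasFDerivAt_dPhi k l h.symm).neg
  rw [funext fun y => p.dPhi_comm k l x y]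
  refine h1.congr_fderiv ?_
  have h2 : ∀ m, p.ddPhi k l m y x = p.ddPhi k l m x y := fun m => by
    unfold ddPhi wdiff; rw [p.qdist_comm x y]; ring
  ext v
  simp [dotCLM_apply, dotProduct, Fin.sum_univ_three, h2]

/-- The Helmholtz equation in the stretched coordinates. -/
lemma sum_ddPhi (k : ℝ) {x y : E3} (h : x ≠ y) :
    ∑ l, p.ddPhi k l l x y = -(k : ℂ) ^ 2 * p.Phi k x y := by
  rw [Phi_eq, ← psi_helmholtz k (Complex.slitPlane_ne_zero (p.qdist_mem_slitPlane h))]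
  have : p.qdist x y = ∑ l, p.wdiff l x y ^ 2 := rfl
  simp only [ddPhi, Fin.sum_univ_three, if_true]
  rw [Fin.sum_univ_three] at this
  linear_combination (-4 * psi₂ k (p.qdist x y)) * this

lemma contDiff_wdiff_right (l : Fin 3) (x : E3) : ContDiff ℝ 1 (fun y => p.wdiff l x y) :=
  contDiff_const.sub ((p.contDiff_stretch l).comp (EuclideanSpace.proj (𝕜 := ℝ) l).contDiff)

lemma contDiff_qdist_right (x : E3) : ContDiff ℝ 1 (fun y => p.qdist x y) :=
  ContDiff.sum fun l _ => (p.contDiff_wdiff_right l x).pow 2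

/-- A complex differentiable function on an open set is analytic, so continuity of the derivative
need not be checked. -/
lemma contDiffAt_of_hasDerivAt_slitPlane {f f' : ℂ → ℂ} (h : ∀ q ∈ Complex.slitPlane, HasDerivAt f (f' q) q)
    {q : ℂ} (hq : q ∈ Complex.slitPlane) : ContDiffAt ℝ 1 f q := by
  have : DifferentiableOn ℂ f Complex.slitPlane := fun q hq => (h q hq).differentiableAt.differentiableWithinAt
  exact ((this.analyticAt (Complex.isOpen_slitPlane.mem_nhds hq)).contDiffAt (n := 1)).restrict_scalars ℝ

lemma contDiffAt_Phi_right (k : ℝ) {x y : E3} (h : x ≠ y) : ContDiffAt ℝ 1 (fun y => p.Phi k x y) y :=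
  ContDiffAt.comp (g := psi₀ k) y (contDiffAt_of_hasDerivAt_slitPlane (fun _ hq => hasDerivAt_psi₀ k hq)
    (p.qdist_mem_slitPlane h)) (p.contDiff_qdist_right x).contDiffAt

lemma contDiffAt_psi₁_right (k : ℝ) {x y : E3} (h : x ≠ y) :
    ContDiffAt ℝ 1 (fun y => psi₁ k (p.qdist x y)) y :=
  ContDiffAt.comp (g := psi₁ k) y (contDiffAt_of_hasDerivAt_slitPlane (fun _ hq => hasDerivAt_psi₁ k hq)
    (p.qdist_mem_slitPlane h)) (p.contDiff_qdist_right x).contDiffAt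

lemma contDiffAt_dPhi_right (k : ℝ) (l : Fin 3) {x y : E3} (h : x ≠ y) :
    ContDiffAt ℝ 1 (fun y => p.dPhi k l x y) y :=
  (contDiffAt_const.mul (p.contDiff_wdiff_right l x).contDiffAt).mul (p.contDiffAt_psi₁_right k h)

lemma norm_alpha_le (x : E3) (l : Fin 3) : ‖p.alpha x l‖ ≤ 1 + p.S := by
  obtain ⟨h1, h2⟩ := p.sigma_bounds l (x l)
  unfold alpha
  refine (norm_add_le _ _).trans ?_
  simp [abs_of_nonneg h1]; exact h2

lemma alpha_ne_zero (x : E3) (l : Fin 3) : p.alpha x l ≠ 0 := by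
  intro h
  have := congrArg Complex.re h
  simp [alpha] at this

lemma continuous_alpha (l : Fin 3) : Continuous fun x => p.alpha x l := by
  unfold alpha
  have := p.continuous_sigma l
  fun_prop

/-- Bounds for the fundamental solution and its derivatives. -/
lemma exists_kernel_bounds (k R : ℝ) : ∃ C : ℝ, 0 < C ∧ ∀ x y : E3, x ≠ y → ‖x - y‖ ≤ R →
    ‖p.Phi k x y‖ ≤ C * ‖x - y‖⁻¹ ∧ (∀ l, ‖p.dPhi k l x y‖ ≤ C * (‖x - y‖ ^ 2)⁻¹) ∧
    ∀ l m, ‖p.ddPhi k l m x y‖ ≤ C * (‖x - y‖ ^ 3)⁻¹ := by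
  have hS := p.S_pos
  set b := 3 * (1 + p.S) with hb
  have hb1 : 1 ≤ b := by rw [hb]; linarith
  set X := |k| * (b * |R|) with hX
  have hX0 : 0 ≤ X := by positivity
  -- `X` bounds `|k ρ|` for points at distance at most `R`, and `A` bounds the exponential times the
  -- polynomial numerators of all three functions `psi₀`, `psi₁`, `psi₂`.
  set A := Real.exp X * (3 + 3 * X + X ^ 2) with hA
  have hApos : 0 < A := by positivity
  -- The second derivatives dictate the constant: two coordinate differences and five inverse roots
  -- give `b ^ 7`, with total coefficient `4 + 2 ≤ 8`.
  refine ⟨8 * A * b ^ 7, by positivity, fun x y hxy hR => ?_⟩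
  have hq := Complex.slitPlane_ne_zero (p.qdist_mem_slitPlane hxy)
  have hd : 0 < ‖x - y‖ := norm_pos_iff.2 (sub_ne_zero.2 hxy)
  have h1 := p.le_norm_qdist x y
  have h2 := p.norm_qdist_le x y
  rw [← norm_sqrt_sq_complex] at h1 h2
  have hw := fun l => p.norm_stretch_sub_le l x y
  set d := ‖x - y‖ with hdd
  set r := p.qdist x y ^ (1 / 2 : ℂ) with hr
  have hr0 : 0 < ‖r‖ := norm_pos_iff.2 (sqrt_ne_zero_complex hq)
  have hlow : d ≤ b * ‖r‖ := by
    refine abs_le_of_sq_le_sq' ?_ (by positivity) |>.2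
    refine h1.trans ?_
    rw [mul_pow]; gcongr; nlinarith
  have hup : ‖r‖ ≤ b * d := by
    refine abs_le_of_sq_le_sq' ?_ (by positivity) |>.2
    refine h2.trans ?_
    rw [mul_pow]; gcongr; nlinarith
  have hri : ‖r‖⁻¹ ≤ b * d⁻¹ := by
    rw [inv_le_comm₀ hr0 (by positivity), mul_inv, inv_inv, inv_mul_le_iff₀ (by positivity)]
    exact hlow
  have hkr : ‖Complex.I * k * r‖ ≤ X := by
    rw [norm_mul, norm_mul, Complex.norm_I, one_mul, Complex.norm_real, hX, Real.norm_eq_abs]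
    have : ‖r‖ ≤ b * |R| := hup.trans (by gcongr; exact hR.trans (le_abs_self R))
    gcongr
  have hexp : ‖Complex.exp (Complex.I * k * r)‖ ≤ Real.exp X :=
    (Complex.norm_exp_le_exp_norm _).trans (Real.exp_le_exp.2 hkr)
  have hpi : (1 : ℝ) ≤ Real.pi := by linarith [Real.pi_gt_three]
  have hpin : ‖(Real.pi : ℂ)‖ = Real.pi := by rw [Complex.norm_real]; exact abs_of_pos Real.pi_pos
  have e0 : ‖psi₀ k (p.qdist x y)‖ ≤ A * (b * d⁻¹) := by
    unfold psi₀
    rw [← hr, norm_div, norm_mul, norm_mul, hpin, div_eq_mul_inv, mul_inv]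
    have : (‖(4 : ℂ)‖ * Real.pi)⁻¹ ≤ 1 := inv_le_one_of_one_le₀ (by norm_num; linarith)
    calc _ ≤ Real.exp X * (1 * (b * d⁻¹)) := by gcongr
      _ ≤ Real.exp X * ((3 + 3 * X + X ^ 2) * (b * d⁻¹)) := by gcongr; nlinarith
      _ = _ := by rw [hA]; ring
  have e1 : ‖psi₁ k (p.qdist x y)‖ ≤ A * (b * d⁻¹) ^ 3 := by
    unfold psi₁
    rw [← hr, norm_div, norm_mul, norm_mul, norm_mul, norm_pow, hpin, div_eq_mul_inv, mul_inv, ← inv_pow]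
    have : (‖(8 : ℂ)‖ * Real.pi)⁻¹ ≤ 1 := inv_le_one_of_one_le₀ (by norm_num; linarith)
    have h3 : ‖Complex.I * k * r - 1‖ ≤ 3 + 3 * X + X ^ 2 := by
      refine (norm_sub_le _ _).trans ?_
      rw [norm_one]; nlinarith
    calc _ ≤ Real.exp X * (3 + 3 * X + X ^ 2) * (1 * (b * d⁻¹) ^ 3) := by gcongr
      _ = _ := by rw [hA]; ring
  have e2 : ‖psi₂ k (p.qdist x y)‖ ≤ A * (b * d⁻¹) ^ 5 := by
    unfold psi₂
    rw [← hr, norm_div, norm_mul, norm_mul, norm_mul, norm_pow, hpin, div_eq_mul_inv, mul_inv, ← inv_pow]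
    have : (‖(16 : ℂ)‖ * Real.pi)⁻¹ ≤ 1 := inv_le_one_of_one_le₀ (by norm_num; linarith)
    have h3 : ‖3 - 3 * (Complex.I * k * r) - (k : ℂ) ^ 2 * r ^ 2‖ ≤ 3 + 3 * X + X ^ 2 := by
      have e : (k : ℂ) ^ 2 * r ^ 2 = -(Complex.I * k * r) ^ 2 := by
        linear_combination ((k : ℂ) ^ 2 * r ^ 2) * Complex.I_sq
      rw [e]
      refine (norm_sub_le _ _).trans (add_le_add ((norm_sub_le _ _).trans ?_) ?_)
      · rw [norm_mul, show ‖(3 : ℂ)‖ = 3 by norm_num]; gcongr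
      · rw [norm_neg, norm_pow]; gcongr
    calc _ ≤ Real.exp X * (3 + 3 * X + X ^ 2) * (1 * (b * d⁻¹) ^ 5) := by gcongr
      _ = _ := by rw [hA]; ring
  have hwb : ∀ l, ‖p.wdiff l x y‖ ≤ b * d := fun l => (hw l).trans (by gcongr; rw [hb]; linarith)
  have hdi : d * d⁻¹ = 1 := mul_inv_cancel₀ hd.ne'
  have hdi0 : 0 < d⁻¹ := by positivity
  have hbpow : ∀ m n : ℕ, m ≤ n → b ^ m ≤ b ^ n := fun m n h => pow_le_pow_right₀ hb1 h
  refine ⟨?_, fun l => ?_, fun l m => ?_⟩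
  · rw [Phi_eq]
    refine e0.trans ?_
    calc A * (b * d⁻¹) = A * b ^ 1 * d⁻¹ := by ring
      _ ≤ (8 * A) * b ^ 7 * d⁻¹ := by gcongr <;> first | exact hb1 | linarith
  · unfold dPhi
    rw [norm_mul, norm_mul]
    calc _ ≤ ‖(2 : ℂ)‖ * (b * d) * (A * (b * d⁻¹) ^ 3) := by gcongr; exact hwb l
      _ = 2 * A * b ^ 4 * (d * d⁻¹) * (d ^ 2)⁻¹ := by norm_num; ring
      _ = 2 * A * b ^ 4 * (d ^ 2)⁻¹ := by rw [hdi, mul_one]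
      _ ≤ (8 * A) * b ^ 7 * (d ^ 2)⁻¹ := by gcongr <;> first | exact hb1 | linarith
  · unfold ddPhi
    have h3 : ‖4 * p.wdiff l x y * p.wdiff m x y * psi₂ k (p.qdist x y)‖ ≤ 4 * A * b ^ 7 * (d ^ 3)⁻¹ := by
      rw [norm_mul, norm_mul, norm_mul]
      calc _ ≤ ‖(4 : ℂ)‖ * (b * d) * (b * d) * (A * (b * d⁻¹) ^ 5) := by
            gcongr
            · exact hwb l
            · exact hwb m
        _ = 4 * A * b ^ 7 * (d * d⁻¹) ^ 2 * (d ^ 3)⁻¹ := by norm_num; ring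
        _ = _ := by rw [hdi]; ring
    have h4 : ‖(if l = m then 2 * psi₁ k (p.qdist x y) else 0 : ℂ)‖ ≤ 2 * A * b ^ 7 * (d ^ 3)⁻¹ := by
      split_ifs
      · rw [norm_mul]
        calc _ ≤ ‖(2 : ℂ)‖ * (A * (b * d⁻¹) ^ 3) := by gcongr
          _ = 2 * A * b ^ 3 * (d ^ 3)⁻¹ := by norm_num; ring
          _ ≤ _ := by gcongr <;> first | exact hb1 | norm_num
      · rw [norm_zero]; positivity
    refine (norm_add_le _ _).trans ((add_le_add h3 h4).trans ?_)
    have : 0 ≤ A * b ^ 7 * (d ^ 3)⁻¹ := by positivity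
    calc _ = 6 * (A * b ^ 7 * (d ^ 3)⁻¹) := by ring
      _ ≤ 8 * (A * b ^ 7 * (d ^ 3)⁻¹) := by linarith
      _ = _ := by ring

end PML
end

noncomputable section

/-! ### Integrals of powers of the distance -/

/-- Balls of radius `r` have measure at most `A r ^ 2`. -/
def UpperRegular (μ : Measure E3) (A : ℝ) : Prop :=
  ∀ z r, 0 < r → μ (Metric.ball z r) ≤ ENNReal.ofReal (A * r ^ 2)

namespace UpperRegular

variable {μ : Measure E3} {A : ℝ}

lemma measure_singleton (h : UpperRegular μ A) (z : E3) : μ {z} = 0 := by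
  have h1 : Tendsto (fun r : ℝ => ENNReal.ofReal (A * r ^ 2)) (𝓝[>] 0) (𝓝 0) := by
    have : Tendsto (fun r : ℝ => A * r ^ 2) (𝓝 0) (𝓝 (A * 0 ^ 2)) :=
      Continuous.tendsto (by fun_prop) 0
    simpa using ENNReal.tendsto_ofReal (this.mono_left nhdsWithin_le_nhds)
  refine le_antisymm (ge_of_tendsto h1 ?_) zero_le
  filter_upwards [self_mem_nhdsWithin] with r hr
  exact (measure_mono (singleton_subset_iff.2 (Metric.mem_ball_self hr))).trans (h z r hr)

lemma ae_ne (h : UpperRegular μ A) (z : E3) : ∀ᵐ y ∂μ, y ≠ z :=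
  measure_eq_zero_iff_ae_notMem.1 (h.measure_singleton z) |>.mono fun y hy => by simpa using hy

/-- Dyadic shells around `z`: the shell of radius `r` contributes at most a constant times `r ^ (-γ)
* r ^ 2`, and these sum geometrically with ratio `q = 2 ^ (γ - 2) < 1`. -/
lemma exists_lintegral_ball_le (h : UpperRegular μ A) (hA : 0 ≤ A) {γ : ℝ} (h0 : 0 ≤ γ) (h2 : γ < 2) :
    ∃ C : ℝ, 0 ≤ C ∧ ∀ z R, 0 < R →
      ∫⁻ y in Metric.ball z R, ENNReal.ofReal (‖z - y‖ ^ (-γ)) ∂μ ≤ ENNReal.ofReal (C * R ^ (2 - γ)) := by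
  set q : ℝ := (1 / 2) ^ (2 - γ) with hq
  have hq0 : 0 ≤ q := by positivity
  have hq1 : q < 1 := Real.rpow_lt_one (by norm_num) (by norm_num) (by linarith)
  have hs := summable_geometric_of_lt_one hq0 hq1
  refine ⟨∑' j : ℕ, A * 4 * 2 ^ γ * q ^ j, tsum_nonneg fun j => by positivity, fun z R hR => ?_⟩
  set S : ℕ → Set E3 := fun j => {y | R * (1 / 2) ^ (j + 1) < ‖z - y‖ ∧ ‖z - y‖ ≤ R * (1 / 2) ^ j} with hS
  have hcov : Metric.ball z R ⊆ {z} ∪ ⋃ j, S j := by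
    intro y hy
    by_cases hyz : y = z
    · exact Or.inl hyz
    right
    rw [Metric.mem_ball, dist_comm, dist_eq_norm] at hy
    have hd : 0 < ‖z - y‖ := norm_pos_iff.2 (sub_ne_zero.2 (Ne.symm hyz))
    obtain ⟨n, hn1, hn2⟩ := exists_nat_pow_near_of_lt_one (x := ‖z - y‖ / R) (y := (1 / 2 : ℝ))
      (by positivity) (by rw [div_le_one hR]; exact hy.le) (by norm_num) (by norm_num)
    refine mem_iUnion.2 ⟨n, ?_, ?_⟩
    · rw [lt_div_iff₀ hR] at hn1; linarith
    · rw [div_le_iff₀ hR] at hn2; linarith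
  have hterm : ∀ j, ∫⁻ y in S j, ENNReal.ofReal (‖z - y‖ ^ (-γ)) ∂μ ≤
      ENNReal.ofReal (A * 4 * 2 ^ γ * q ^ j * R ^ (2 - γ)) := fun j => by
    set r := R * (1 / 2 : ℝ) ^ (j + 1) with hr
    have hr0 : 0 < r := by positivity
    calc ∫⁻ y in S j, ENNReal.ofReal (‖z - y‖ ^ (-γ)) ∂μ
        ≤ ∫⁻ y in S j, ENNReal.ofReal (r ^ (-γ)) ∂μ := by
          refine setLIntegral_mono measurable_const fun y hy => ENNReal.ofReal_le_ofReal ?_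
          exact Real.rpow_le_rpow_of_nonpos hr0 hy.1.le (by linarith)
      _ = ENNReal.ofReal (r ^ (-γ)) * μ (S j) := setLIntegral_const _ _
      _ ≤ ENNReal.ofReal (r ^ (-γ)) * ENNReal.ofReal (A * (4 * r) ^ 2) := by
          gcongr
          -- The shell lies in the closed ball of radius `2 * r`; the doubled radius fits it into an
          -- open ball.
          refine (measure_mono fun y hy => ?_).trans (h z (4 * r) (by positivity))
          rw [Metric.mem_ball, dist_comm, dist_eq_norm]
          refine hy.2.trans_lt ?_
          rw [hr, pow_succ]
          have : 0 < R * (1 / 2 : ℝ) ^ j := by positivity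
          linarith
      _ = ENNReal.ofReal (r ^ (-γ) * (A * (4 * r) ^ 2)) := (ENNReal.ofReal_mul (by positivity)).symm
      _ = _ := by
          congr 1
          have e1 : r ^ (-γ) * r ^ 2 = r ^ (2 - γ) := by
            rw [← Real.rpow_natCast r 2, ← Real.rpow_add hr0]; congr 1; push_cast; ring
          have e2 : r ^ (2 - γ) = R ^ (2 - γ) * (q * q ^ j) := by
            rw [hr, Real.mul_rpow hR.le (by positivity), ← pow_succ', hq, ← Real.rpow_natCast, ← Real.rpow_natCast,
              ← Real.rpow_mul (by norm_num), ← Real.rpow_mul (by norm_num), mul_comm (2 - γ)]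
          have e3 : q = 2 ^ γ / 4 := by
            rw [hq, one_div, Real.inv_rpow (by norm_num), ← Real.rpow_neg (by norm_num), neg_sub,
              Real.rpow_sub (by norm_num)]
            norm_num
          calc r ^ (-γ) * (A * (4 * r) ^ 2) = 16 * A * (r ^ (-γ) * r ^ 2) := by ring
            _ = 16 * A * (R ^ (2 - γ) * (2 ^ γ / 4 * q ^ j)) := by rw [e1, e2]; nth_rewrite 1 [e3]; rfl
            _ = _ := by ring
  calc ∫⁻ y in Metric.ball z R, ENNReal.ofReal (‖z - y‖ ^ (-γ)) ∂μ
      ≤ ∫⁻ y in {z} ∪ ⋃ j, S j, ENNReal.ofReal (‖z - y‖ ^ (-γ)) ∂μ := lintegral_mono_set hcov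
    _ ≤ ∫⁻ y in {z}, ENNReal.ofReal (‖z - y‖ ^ (-γ)) ∂μ +
        ∫⁻ y in ⋃ j, S j, ENNReal.ofReal (‖z - y‖ ^ (-γ)) ∂μ := lintegral_union_le _ _ _
    _ = ∫⁻ y in ⋃ j, S j, ENNReal.ofReal (‖z - y‖ ^ (-γ)) ∂μ := by
        rw [setLIntegral_measure_zero _ _ (h.measure_singleton z), zero_add]
    _ ≤ ∑' j, ∫⁻ y in S j, ENNReal.ofReal (‖z - y‖ ^ (-γ)) ∂μ := lintegral_iUnion_le _ _
    _ ≤ ∑' j, ENNReal.ofReal (A * 4 * 2 ^ γ * q ^ j * R ^ (2 - γ)) := ENNReal.tsum_le_tsum hterm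
    _ = ENNReal.ofReal (∑' j : ℕ, A * 4 * 2 ^ γ * q ^ j * R ^ (2 - γ)) :=
        (ENNReal.ofReal_tsum_of_nonneg (fun j => by positivity) ((hs.mul_left _).mul_right _)).symm
    _ = _ := by rw [tsum_mul_right]

/-- The same summation over shells growing outwards. The cube beats the quadratic growth of the
measure, so the sum is dominated by the innermost shell. -/
lemma lintegral_compl_le (h : UpperRegular μ A) (hA : 0 ≤ A) {R : ℝ} (hR : 0 < R) (z : E3) :
    ∫⁻ y in {y | R ≤ ‖z - y‖}, ENNReal.ofReal ((‖z - y‖ ^ 3)⁻¹) ∂μ ≤ ENNReal.ofReal (8 * A * R⁻¹) := by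
  have hs := summable_geometric_of_lt_one (r := (1 / 2 : ℝ)) (by norm_num) (by norm_num)
  set S : ℕ → Set E3 := fun j => {y | R * 2 ^ j ≤ ‖z - y‖ ∧ ‖z - y‖ < R * 2 ^ (j + 1)} with hS
  have hcov : {y | R ≤ ‖z - y‖} ⊆ ⋃ j, S j := by
    intro y hy
    obtain ⟨n, hn1, hn2⟩ := exists_nat_pow_near (x := ‖z - y‖ / R) (y := (2 : ℝ))
      (by rw [one_le_div hR]; exact hy) (by norm_num)
    refine mem_iUnion.2 ⟨n, ?_, ?_⟩
    · rw [le_div_iff₀ hR] at hn1; linarith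
    · rw [div_lt_iff₀ hR] at hn2; linarith
  have hterm : ∀ j, ∫⁻ y in S j, ENNReal.ofReal ((‖z - y‖ ^ 3)⁻¹) ∂μ ≤
      ENNReal.ofReal (4 * A * R⁻¹ * (1 / 2) ^ j) := fun j => by
    set r := R * 2 ^ j with hr
    have hr0 : 0 < r := by positivity
    calc ∫⁻ y in S j, ENNReal.ofReal ((‖z - y‖ ^ 3)⁻¹) ∂μ
        ≤ ∫⁻ y in S j, ENNReal.ofReal ((r ^ 3)⁻¹) ∂μ := by
          refine setLIntegral_mono measurable_const fun y hy => ENNReal.ofReal_le_ofReal ?_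
          have := hy.1
          gcongr
      _ = ENNReal.ofReal ((r ^ 3)⁻¹) * μ (S j) := setLIntegral_const _ _
      _ ≤ ENNReal.ofReal ((r ^ 3)⁻¹) * ENNReal.ofReal (A * (2 * r) ^ 2) := by
          gcongr
          refine (measure_mono fun y hy => ?_).trans (h z (2 * r) (by positivity))
          rw [Metric.mem_ball, dist_comm, dist_eq_norm]
          refine hy.2.trans_le ?_
          rw [hr, pow_succ]
          linarith
      _ = ENNReal.ofReal ((r ^ 3)⁻¹ * (A * (2 * r) ^ 2)) := (ENNReal.ofReal_mul (by positivity)).symm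
      _ = _ := by
          congr 1
          rw [hr]
          have : (1 / 2 : ℝ) ^ j = (2 ^ j)⁻¹ := by rw [one_div, inv_pow]
          rw [this]
          field_simp
          ring
  calc _ ≤ ∫⁻ y in ⋃ j, S j, ENNReal.ofReal ((‖z - y‖ ^ 3)⁻¹) ∂μ := lintegral_mono_set hcov
    _ ≤ ∑' j, ∫⁻ y in S j, ENNReal.ofReal ((‖z - y‖ ^ 3)⁻¹) ∂μ := lintegral_iUnion_le _ _
    _ ≤ ∑' j, ENNReal.ofReal (4 * A * R⁻¹ * (1 / 2) ^ j) := ENNReal.tsum_le_tsum hterm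
    _ = ENNReal.ofReal (∑' j : ℕ, 4 * A * R⁻¹ * (1 / 2) ^ j) :=
        (ENNReal.ofReal_tsum_of_nonneg (fun j => by positivity) (hs.mul_left _)).symm
    _ = _ := by rw [tsum_mul_left, tsum_geometric_two]; congr 1; ring

lemma measurable_rpow_dist (γ : ℝ) (z : E3) : Measurable fun y : E3 => ‖z - y‖ ^ (-γ) := by fun_prop

/-- Negative powers of the distance of exponent less than two are integrable, uniformly. -/
lemma exists_integral_rpow_le [IsFiniteMeasure μ] (h : UpperRegular μ A) (hA : 0 ≤ A) {γ : ℝ} (h0 : 0 ≤ γ) (h2 : γ < 2) :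
    ∃ C : ℝ, 0 ≤ C ∧ ∀ z, Integrable (fun y => ‖z - y‖ ^ (-γ)) μ ∧ ∫ y, ‖z - y‖ ^ (-γ) ∂μ ≤ C := by
  obtain ⟨C, hC, hb⟩ := h.exists_lintegral_ball_le hA h0 h2
  have key : ∀ z, ∫⁻ y, ENNReal.ofReal (‖z - y‖ ^ (-γ)) ∂μ ≤ ENNReal.ofReal (C + μ.real univ) := fun z => by
    rw [← lintegral_add_compl _ (Metric.isOpen_ball (x := z) (ε := 1)).measurableSet]
    rw [ENNReal.ofReal_add hC measureReal_nonneg]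
    refine add_le_add ((hb z 1 one_pos).trans (by simp)) ?_
    calc _ ≤ ∫⁻ y in (Metric.ball z 1)ᶜ, 1 ∂μ := by
          refine setLIntegral_mono measurable_const fun y hy => ?_
          rw [← ENNReal.ofReal_one]
          refine ENNReal.ofReal_le_ofReal (Real.rpow_le_one_of_one_le_of_nonpos ?_ (by linarith))
          rw [mem_compl_iff, Metric.mem_ball, dist_comm, dist_eq_norm, not_lt] at hy
          exact hy
      _ ≤ μ univ := by simp; exact measure_mono (subset_univ _)
      _ = _ := (ofReal_measureReal).symm
  refine ⟨C + μ.real univ, by positivity, fun z => ⟨⟨(measurable_rpow_dist γ z).aestronglyMeasurable, ?_⟩, ?_⟩⟩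
  · rw [hasFiniteIntegral_iff_ofReal (ae_of_all _ fun y => by positivity)]
    exact (key z).trans_lt ENNReal.ofReal_lt_top
  · rw [integral_eq_lintegral_of_nonneg_ae (ae_of_all _ fun y => by positivity)
      (measurable_rpow_dist γ z).aestronglyMeasurable]
    exact ENNReal.toReal_le_of_le_ofReal (by positivity) (key z)

lemma exists_integral_ball_inv_le (h : UpperRegular μ A) (hA : 0 ≤ A) :
    ∃ C : ℝ, 0 ≤ C ∧ ∀ z R, 0 < R → IntegrableOn (fun y => ‖z - y‖⁻¹) (Metric.ball z R) μ ∧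
      ∫ y in Metric.ball z R, ‖z - y‖⁻¹ ∂μ ≤ C * R := by
  obtain ⟨C, hC, hb⟩ := h.exists_lintegral_ball_le hA (γ := 1) zero_le_one (by norm_num)
  refine ⟨C, hC, fun z R hR => ?_⟩
  have hm : Measurable fun y : E3 => ‖z - y‖⁻¹ := by fun_prop
  have hb' := hb z R hR
  simp only [Real.rpow_neg_one] at hb'
  rw [show (2 : ℝ) - 1 = 1 by norm_num, Real.rpow_one] at hb'
  refine ⟨⟨hm.aestronglyMeasurable, ?_⟩, ?_⟩
  · rw [hasFiniteIntegral_iff_ofReal (ae_of_all _ fun y => by positivity)]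
    exact hb'.trans_lt ENNReal.ofReal_lt_top
  · rw [integral_eq_lintegral_of_nonneg_ae (ae_of_all _ fun y => by positivity) hm.aestronglyMeasurable]
    exact ENNReal.toReal_le_of_le_ofReal (by positivity) hb'

lemma integral_compl_le (h : UpperRegular μ A) (hA : 0 ≤ A) {R : ℝ} (hR : 0 < R) (z : E3) :
    IntegrableOn (fun y => (‖z - y‖ ^ 3)⁻¹) {y | R ≤ ‖z - y‖} μ ∧
      ∫ y in {y | R ≤ ‖z - y‖}, (‖z - y‖ ^ 3)⁻¹ ∂μ ≤ 8 * A * R⁻¹ := by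
  have hm : Measurable fun y : E3 => (‖z - y‖ ^ 3)⁻¹ := by fun_prop
  have hb := h.lintegral_compl_le hA hR z
  refine ⟨⟨hm.aestronglyMeasurable, ?_⟩, ?_⟩
  · rw [hasFiniteIntegral_iff_ofReal (ae_of_all _ fun y => by positivity)]
    exact hb.trans_lt ENNReal.ofReal_lt_top
  · rw [integral_eq_lintegral_of_nonneg_ae (ae_of_all _ fun y => by positivity) hm.aestronglyMeasurable]
    exact ENNReal.toReal_le_of_le_ofReal (by positivity) hb

end UpperRegular

variable {p : PML} (G : LayeredGeometry p)

/-- The bound is proved on the compact closure, inside the full surface whose charts continue past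
the edge; this makes it uniform up to the edge. -/
lemma LayeredGeometry.exists_upperRegular : ∃ A : ℝ, 0 ≤ A ∧ UpperRegular (surfaceMeasure G.surface) A := by
  obtain ⟨A, hA, h⟩ := G.isSurface_fullSurface.exists_measure_ball_le G.isCompact_closure_surface
    (G.closure_surface_subset.trans inter_subset_left)
  refine ⟨A, hA, fun z r hr => le_trans ?_ (h z r hr)⟩
  rw [surfaceMeasure, Measure.restrict_apply Metric.isOpen_ball.measurableSet, inter_comm]
  exact measure_mono (inter_subset_inter_left _ subset_closure)

instance : IsFiniteMeasure (surfaceMeasure G.surface) :=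
  ⟨by rw [surfaceMeasure, Measure.restrict_apply_univ]; exact G.measure_surface_lt_top⟩

end

noncomputable section

/-! ### Second-order contact with the tangent plane -/

/-- The derivative is Lipschitz near `x`, so on the ball of radius `‖y - x‖` it differs from its
value at `x` by at most a multiple of that radius. -/
lemma exists_taylor_two_bound {E F : Type*} [NormedAddCommGroup E] [NormedSpace ℝ E] [NormedAddCommGroup F]
    [NormedSpace ℝ F] {f : E → F} {x : E} (hf : ContDiffAt ℝ 2 f x) :
    ∃ C r : ℝ, 0 ≤ C ∧ 0 < r ∧ ∀ y, ‖y - x‖ < r → ‖f y - f x - fderiv ℝ f x (y - x)‖ ≤ C * ‖y - x‖ ^ 2 := by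
  have h1 : ContDiffAt ℝ 1 (fderiv ℝ f) x := hf.fderiv_right (by norm_num)
  obtain ⟨K, t, ht, hK⟩ := h1.exists_lipschitzOnWith
  have hd : ∀ᶠ y in 𝓝 x, DifferentiableAt ℝ f y :=
    (hf.eventually (by norm_num)).mono fun y hy => hy.differentiableAt (by norm_num)
  obtain ⟨r, hr, hball⟩ := Metric.mem_nhds_iff.1 (inter_mem ht hd)
  refine ⟨K, r, K.2, hr, fun y hy => ?_⟩
  have hseg : ∀ z ∈ Metric.closedBall x ‖y - x‖, z ∈ t ∧ DifferentiableAt ℝ f z := fun z hz =>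
    hball (Metric.closedBall_subset_ball hy hz)
  have hxt : x ∈ t := mem_of_mem_nhds ht
  have := Convex.norm_image_sub_le_of_norm_hasFDerivWithin_le' (f := f) (f' := fderiv ℝ f) (φ := fderiv ℝ f x)
    (C := K * ‖y - x‖) (s := Metric.closedBall x ‖y - x‖) (x := x) (y := y)
    (fun z hz => (hseg z hz).2.hasFDerivAt.hasFDerivWithinAt)
    (fun z hz => (hK.norm_sub_le (hseg z hz).1 hxt).trans (by
      gcongr; rw [← dist_eq_norm]; exact hz)) (convex_closedBall _ _)
    (Metric.mem_closedBall_self (norm_nonneg _)) (by rw [Metric.mem_closedBall, dist_eq_norm])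
  rw [pow_two, ← mul_assoc]; exact this

variable {M : Set E3} {ν : E3 → E3}

lemma SurfaceChart.π_mem (c : SurfaceChart M ν) {y : E3} (hy : y ∈ M) (hV : y ∈ c.V) :
    c.π y ∈ c.U ∧ c.G (c.π y) = y := by
  obtain ⟨u, hu, rfl⟩ := c.mem_image hy hV
  rw [c.π_G u hu]
  exact ⟨hu, rfl⟩

lemma SurfaceChart.inner_ν_fderiv (c : SurfaceChart M ν) {u : E2} (hu : u ∈ c.U) (ξ : E2) :
    inner ℝ (ν (c.G u)) (fderiv ℝ c.G u ξ) = 0 := by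
  have h0 := c.orth u hu 0
  have h1 := c.orth u hu 1
  simp only [tangentVec] at h0 h1
  have : ξ = ξ 0 • EuclideanSpace.single 0 1 + ξ 1 • EuclideanSpace.single 1 1 := by
    ext i; fin_cases i <;> simp
  rw [this, map_add, map_smul, map_smul, inner_add_right, inner_smul_right, inner_smul_right, h0, h1]
  simp

/-- Dimension count: the differential is injective with image inside the plane orthogonal to `ν`,
and both have dimension two. -/
lemma SurfaceChart.exists_fderiv_eq (c : SurfaceChart M ν) {u : E2} (hu : u ∈ c.U) {t : E3}
    (ht : inner ℝ (ν (c.G u)) t = 0) : ∃ ξ, fderiv ℝ c.G u ξ = t := by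
  have hd : HasFDerivAt c.G (fderiv ℝ c.G u) u :=
    ((c.contDiffOn_G.contDiffAt (c.isOpen_U.mem_nhds hu)).differentiableAt (by norm_num)).hasFDerivAt
  have hcomp : ∀ ξ, c.π (fderiv ℝ c.G u ξ) = ξ := by
    have h1 : HasFDerivAt (fun u => c.π (c.G u)) (c.π.comp (fderiv ℝ c.G u)) u := c.π.hasFDerivAt.comp u hd
    have h2 : HasFDerivAt (fun u => c.π (c.G u)) (ContinuousLinearMap.id ℝ E2) u :=
      (hasFDerivAt_id u).congr_of_eventuallyEq
        (Filter.mem_of_superset (c.isOpen_U.mem_nhds hu) fun v hv => c.π_G v hv)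
    intro ξ
    exact congrArg (fun L : E2 →L[ℝ] E2 => L ξ) (h1.unique h2)
  have hinj : Function.Injective (fderiv ℝ c.G u) := fun a b hab => by
    rw [← hcomp a, ← hcomp b, hab]
  have hn : ν (c.G u) ≠ 0 := fun h => by
    have := c.norm_ν_G u hu
    rw [h, norm_zero] at this
    exact zero_ne_one this
  have hle : LinearMap.range (fderiv ℝ c.G u : E2 →ₗ[ℝ] E3) ≤ (ℝ ∙ ν (c.G u))ᗮ := by
    rintro _ ⟨ξ, rfl⟩
    rw [Submodule.mem_orthogonal_singleton_iff_inner_right]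
    exact c.inner_ν_fderiv hu ξ
  have hfin : Module.finrank ℝ (LinearMap.range (fderiv ℝ c.G u : E2 →ₗ[ℝ] E3)) =
      Module.finrank ℝ (ℝ ∙ ν (c.G u))ᗮ := by
    have : Fact (Module.finrank ℝ E3 = 2 + 1) := ⟨by simp⟩
    rw [LinearMap.finrank_range_of_inj hinj, Submodule.finrank_orthogonal_span_singleton (n := 2) hn]
    simp
  have heq := Submodule.eq_of_le_of_finrank_eq hle hfin
  have : t ∈ (ℝ ∙ ν (c.G u))ᗮ := Submodule.mem_orthogonal_singleton_iff_inner_right.2 ht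
  rw [← heq] at this
  exact this

/-- A smooth surface has second-order contact with its tangent planes. -/
lemma IsSurface.exists_abs_inner_le (h : IsSurface M ν) {x : E3} (hx : x ∈ M) :
    ∃ C : ℝ, 0 ≤ C ∧ ∀ z ∈ M, |inner ℝ (ν x) (z - x)| ≤ C * ‖z - x‖ ^ 2 := by
  obtain ⟨c, hc⟩ := h x hx
  obtain ⟨hu, hGu⟩ := c.π_mem hx hc
  obtain ⟨C, r, hC, hr, hT⟩ := exists_taylor_two_bound
    (c.contDiffOn_G.contDiffAt (c.isOpen_U.mem_nhds hu))
  obtain ⟨ρ, hρ, hV⟩ := Metric.isOpen_iff.1 c.isOpen_V x hc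
  set δ := min r ρ with hδ
  have hδ0 : 0 < δ := lt_min hr hρ
  refine ⟨C + δ⁻¹, by positivity, fun z hz => ?_⟩
  have hn := h.norm_ν hx
  by_cases hzx : ‖z - x‖ < δ
  · have hzV : z ∈ c.V := hV (by rw [Metric.mem_ball, dist_eq_norm]; exact hzx.trans_le (min_le_right _ _))
    obtain ⟨hv, hGv⟩ := c.π_mem hz hzV
    have hπ : ‖c.π z - c.π x‖ ≤ ‖z - x‖ := by
      rw [← map_sub]
      exact (c.π.le_opNorm _).trans (by nlinarith [c.norm_π, norm_nonneg (z - x)])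
    have h1 := hT (c.π z) (hπ.trans_lt (hzx.trans_le (min_le_left _ _)))
    rw [hGv, hGu] at h1
    have h2 := c.inner_ν_fderiv hu (c.π z - c.π x)
    rw [hGu] at h2
    -- The linear part of the chart is tangential and can be subtracted at no cost; only the
    -- quadratic Taylor remainder is left.
    have h3 : inner ℝ (ν x) (z - x) = inner ℝ (ν x) (z - x - fderiv ℝ c.G (c.π x) (c.π z - c.π x)) := by
      rw [inner_sub_right _ (z - x) (fderiv ℝ c.G (c.π x) _), h2, sub_zero]
    rw [h3]
    calc _ ≤ ‖ν x‖ * _ := abs_real_inner_le_norm _ _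
      _ ≤ C * ‖c.π z - c.π x‖ ^ 2 := by rw [hn, one_mul]; exact h1
      _ ≤ C * ‖z - x‖ ^ 2 := by gcongr
      _ ≤ _ := by have : 0 ≤ δ⁻¹ * ‖z - x‖ ^ 2 := by positivity
                  linarith
  · rw [not_lt] at hzx
    have h1 := abs_real_inner_le_norm (ν x) (z - x)
    rw [hn, one_mul] at h1
    have h2 : ‖z - x‖ ≤ δ⁻¹ * ‖z - x‖ ^ 2 := by
      rw [pow_two, ← mul_assoc]
      have : 1 ≤ δ⁻¹ * ‖z - x‖ := by rw [inv_mul_eq_div, one_le_div hδ0]; exact hzx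
      nlinarith [norm_nonneg (z - x)]
    nlinarith [sq_nonneg ‖z - x‖]

/-- Tangent vectors are velocities of curves in the surface, up to a second-order error. -/
lemma IsSurface.exists_curve (h : IsSurface M ν) {x : E3} (hx : x ∈ M) {t : E3} (ht : inner ℝ (ν x) t = 0) :
    ∃ (C : ℝ) (y : ℝ → E3), 0 ≤ C ∧ ∀ᶠ s in 𝓝[>] (0 : ℝ), y s ∈ M ∧ ‖y s - x - s • t‖ ≤ C * s ^ 2 := by
  obtain ⟨c, hc⟩ := h x hx
  obtain ⟨hu, hGu⟩ := c.π_mem hx hc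
  obtain ⟨C, r, hC, hr, hT⟩ := exists_taylor_two_bound
    (c.contDiffOn_G.contDiffAt (c.isOpen_U.mem_nhds hu))
  obtain ⟨ξ, hξ⟩ := c.exists_fderiv_eq hu (t := t) (by rwa [hGu])
  refine ⟨C * ‖ξ‖ ^ 2, fun s => c.G (c.π x + s • ξ), by positivity, ?_⟩
  have hcont : Tendsto (fun s : ℝ => c.π x + s • ξ) (𝓝[>] 0) (𝓝 (c.π x)) := by
    have : Tendsto (fun s : ℝ => c.π x + s • ξ) (𝓝 0) (𝓝 (c.π x + (0 : ℝ) • ξ)) :=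
      Continuous.tendsto (by fun_prop) 0
    rw [zero_smul, add_zero] at this
    exact this.mono_left nhdsWithin_le_nhds
  filter_upwards [hcont (c.isOpen_U.mem_nhds hu), hcont (Metric.ball_mem_nhds _ hr)] with s h1 h2
  refine ⟨c.image_subset ⟨_, h1, rfl⟩, ?_⟩
  have h3 := hT (c.π x + s • ξ) (by rwa [mem_preimage, Metric.mem_ball, dist_eq_norm] at h2)
  rw [add_sub_cancel_left, map_smul, hξ, hGu, norm_smul, mul_pow, Real.norm_eq_abs, sq_abs] at h3
  linarith

/-- Points on the normal line are far from the surface. -/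
lemma IsSurface.exists_normal_le (h : IsSurface M ν) {x : E3} (hx : x ∈ M) {s : ℝ} (hs : s = 1 ∨ s = -1) :
    ∀ᶠ r in 𝓝[>] (0 : ℝ), ∀ z ∈ M, (r + ‖z - x‖) / 6 ≤ ‖x + (s * r) • ν x - z‖ := by
  obtain ⟨C, hC, hb⟩ := h.exists_abs_inner_le hx
  have hn := h.norm_ν hx
  have hs2 : s * s = 1 := by rcases hs with rfl | rfl <;> norm_num
  have hsa : |s| = 1 := by rcases hs with rfl | rfl <;> norm_num
  have hsmall : ∀ᶠ r in 𝓝[>] (0 : ℝ), 8 * C * r < 1 := by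
    have : Tendsto (fun r : ℝ => 8 * C * r) (𝓝 0) (𝓝 (8 * C * 0)) := Continuous.tendsto (by fun_prop) 0
    rw [mul_zero] at this
    exact (this.mono_left nhdsWithin_le_nhds).eventually (gt_mem_nhds one_pos)
  filter_upwards [hsmall, self_mem_nhdsWithin] with r h8 hr z hz
  rw [mem_Ioi] at hr
  -- For `z` near `x` the normal component of the difference is at least `r - 4 C r ^ 2 ≥ r / 2`.
  -- For the other `z` the triangle inequality suffices.
  by_cases hz2 : ‖z - x‖ ≤ 2 * r
  · have h1 : s * inner ℝ (ν x) (x + (s * r) • ν x - z) = r - s * inner ℝ (ν x) (z - x) := by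
      rw [show x + (s * r) • ν x - z = (s * r) • ν x - (z - x) by abel, inner_sub_right _ ((s * r) • ν x),
        inner_smul_right, real_inner_self_eq_norm_sq, hn]
      linear_combination r * hs2
    have h2 : |s * inner ℝ (ν x) (z - x)| ≤ C * ‖z - x‖ ^ 2 := by rw [abs_mul, hsa, one_mul]; exact hb z hz
    have h3 : |s * inner ℝ (ν x) (x + (s * r) • ν x - z)| ≤ ‖x + (s * r) • ν x - z‖ := by
      rw [abs_mul, hsa, one_mul]
      exact (abs_real_inner_le_norm _ _).trans (by rw [hn, one_mul])
    have h4 : C * ‖z - x‖ ^ 2 ≤ C * (2 * r) ^ 2 := by gcongr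
    have h5 := le_abs_self (s * inner ℝ (ν x) (x + (s * r) • ν x - z))
    have h6 := le_abs_self (s * inner ℝ (ν x) (z - x))
    nlinarith
  · have h1 : ‖z - x‖ ≤ ‖x + (s * r) • ν x - z‖ + ‖(s * r) • ν x‖ := by
      rw [← norm_neg (x + (s * r) • ν x - z)]
      refine le_trans (le_of_eq ?_) (norm_add_le _ _)
      congr 1; abel
    rw [norm_smul, hn, mul_one, Real.norm_eq_abs, abs_mul, hsa, one_mul, abs_of_pos hr] at h1
    linarith

set_option maxHeartbeats 1000000 in
/-- Segments between nearby points of the surface, shifted along the normal, stay away from the surface. -/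
lemma IsSurface.exists_segment_le (h : IsSurface M ν) (hM : Bornology.IsBounded M) {x : E3} (hx : x ∈ M) {s : ℝ}
    (hs : s = 1 ∨ s = -1) :
    ∃ c : ℝ, 0 < c ∧ ∀ᶠ r in 𝓝[>] (0 : ℝ), ∀ y ∈ M, ‖y - x‖ ≤ r → ∀ θ ∈ Icc (0 : ℝ) 1, ∀ z ∈ M,
      c * r ^ (5 / 4 : ℝ) ≤ ‖x + θ • (y - x) + (s * r ^ (5 / 4 : ℝ)) • ν x - z‖ ∧
      c * ‖z - x‖ ^ (5 / 4 : ℝ) ≤ ‖x + θ • (y - x) + (s * r ^ (5 / 4 : ℝ)) • ν x - z‖ := by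
  obtain ⟨C, hC, hb⟩ := h.exists_abs_inner_le hx
  obtain ⟨R, hR⟩ : ∃ R, ∀ z ∈ M, ‖z - x‖ ≤ R := by
    obtain ⟨R, hR⟩ := hM.subset_closedBall x
    exact ⟨R, fun z hz => by rw [← dist_eq_norm]; exact hR hz⟩
  have hR0 : 0 ≤ R := (norm_nonneg _).trans (hR x hx)
  have hn := h.norm_ν hx
  have hs2 : s * s = 1 := by rcases hs with rfl | rfl <;> norm_num
  have hsa : |s| = 1 := by rcases hs with rfl | rfl <;> norm_num
  -- Near `x` the distance is at least `d / 2` with `d = r ^ (5/4)`, while `‖z - x‖ ^ (5/4) ≤ 8 d`,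
  -- whence `16`. Far away it is at least `‖z - x‖ / 2`, while `‖z - x‖ ^ (5/4) ≤ R ^ (1/4) ‖z -
  -- x‖`, whence the second summand.
  set c : ℝ := (16 + 2 * R ^ (1 / 4 : ℝ))⁻¹ with hc
  have hRp : 0 ≤ R ^ (1 / 4 : ℝ) := by positivity
  have hc0 : 0 < c := by positivity
  have hc1 : c * (16 + 2 * R ^ (1 / 4 : ℝ)) = 1 := inv_mul_cancel₀ (by positivity)
  -- The shift `r ^ (5/4)` must dominate the curvature terms `C (4 r) ^ 2 + C r ^ 2 = 17 C r ^ 2`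
  -- with half to spare; any exponent below two makes this possible.
  have hsmall : ∀ᶠ r in 𝓝[>] (0 : ℝ), 34 * C * r ^ (3 / 4 : ℝ) < 1 := by
    have : Tendsto (fun r : ℝ => 34 * C * r ^ (3 / 4 : ℝ)) (𝓝 0) (𝓝 (34 * C * 0 ^ (3 / 4 : ℝ))) :=
      ContinuousAt.tendsto (ContinuousAt.mul (by fun_prop) (Real.continuousAt_rpow_const _ _ (by norm_num)))
    rw [Real.zero_rpow (by norm_num), mul_zero] at this
    exact (this.mono_left nhdsWithin_le_nhds).eventually (gt_mem_nhds one_pos)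
  refine ⟨c, hc0, ?_⟩
  filter_upwards [hsmall, self_mem_nhdsWithin, nhdsWithin_le_nhds (gt_mem_nhds one_pos)] with r h34 hr hr1 y hy hyr θ hθ z hz
  rw [mem_Ioi] at hr
  set d := r ^ (5 / 4 : ℝ) with hd
  have hd0 : 0 < d := by positivity
  have hdr : d ≤ r := by
    have := Real.rpow_le_rpow_of_exponent_ge hr hr1.le (show (1 : ℝ) ≤ 5 / 4 by norm_num)
    rwa [Real.rpow_one] at this
  have hdC : 34 * C * r ^ 2 ≤ d := by
    have : r ^ 2 = r ^ (3 / 4 : ℝ) * d := by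
      rw [hd, ← Real.rpow_add hr, ← Real.rpow_natCast]; norm_num
    rw [this]; nlinarith
  have hyθ : ‖θ • (y - x)‖ ≤ r := by
    rw [norm_smul, Real.norm_eq_abs, abs_of_nonneg hθ.1]
    nlinarith [hθ.2, norm_nonneg (y - x)]
  have hnd : ‖(s * d) • ν x‖ = d := by
    rw [norm_smul, hn, mul_one, Real.norm_eq_abs, abs_mul, hsa, one_mul, abs_of_pos hd0]
  set N := ‖x + θ • (y - x) + (s * d) • ν x - z‖ with hN
  -- Points within `4 r` of `x` are separated from the segment by its normal shift. The remaining
  -- ones are far because the segment stays within `2 r` of `x`.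
  by_cases hz2 : ‖z - x‖ ≤ 4 * r
  · have h1 : s * inner ℝ (ν x) (x + θ • (y - x) + (s * d) • ν x - z) =
        d + s * θ * inner ℝ (ν x) (y - x) - s * inner ℝ (ν x) (z - x) := by
      rw [show x + θ • (y - x) + (s * d) • ν x - z = (s * d) • ν x + θ • (y - x) - (z - x) by abel,
        inner_sub_right _ ((s * d) • ν x + θ • (y - x)), inner_add_right,
        inner_smul_right, inner_smul_right _ (y - x), real_inner_self_eq_norm_sq, hn]
      linear_combination d * hs2
    have h2 : |s * inner ℝ (ν x) (z - x)| ≤ C * ‖z - x‖ ^ 2 := by rw [abs_mul, hsa, one_mul]; exact hb z hz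
    have h2' : |s * θ * inner ℝ (ν x) (y - x)| ≤ C * r ^ 2 := by
      rw [abs_mul, abs_mul, hsa, one_mul, abs_of_nonneg hθ.1]
      have := hb y hy
      calc _ ≤ 1 * |inner ℝ (ν x) (y - x)| := by gcongr; exact hθ.2
        _ ≤ C * ‖y - x‖ ^ 2 := by rw [one_mul]; exact this
        _ ≤ _ := by gcongr
    have h3 : |s * inner ℝ (ν x) (x + θ • (y - x) + (s * d) • ν x - z)| ≤ N := by
      rw [abs_mul, hsa, one_mul]
      exact (abs_real_inner_le_norm _ _).trans (by rw [hn, one_mul])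
    have h4 : C * ‖z - x‖ ^ 2 ≤ C * (4 * r) ^ 2 := by gcongr
    have h5 := le_abs_self (s * inner ℝ (ν x) (x + θ • (y - x) + (s * d) • ν x - z))
    have h6 := le_abs_self (s * inner ℝ (ν x) (z - x))
    have h7 := neg_abs_le (s * θ * inner ℝ (ν x) (y - x))
    have hNd : d / 2 ≤ N := by nlinarith
    have h8 : ‖z - x‖ ^ (5 / 4 : ℝ) ≤ 8 * d := by
      calc _ ≤ (4 * r) ^ (5 / 4 : ℝ) := by gcongr
        _ = 4 ^ (5 / 4 : ℝ) * d := by rw [Real.mul_rpow (by norm_num) hr.le]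
        _ ≤ 4 ^ (3 / 2 : ℝ) * d := by
          gcongr ?_ * d
          exact Real.rpow_le_rpow_of_exponent_le (by norm_num) (by norm_num)
        _ = 8 * d := by
          congr 1
          rw [show (4 : ℝ) = 2 ^ (2 : ℝ) by norm_num, ← Real.rpow_mul (by norm_num)]; norm_num
    have hc16 : c * 16 ≤ 1 := by nlinarith
    constructor <;> nlinarith
  · rw [not_le] at hz2
    have h1 : ‖z - x‖ ≤ N + ‖θ • (y - x)‖ + ‖(s * d) • ν x‖ := by
      have e : z - x = -(x + θ • (y - x) + (s * d) • ν x - z) + θ • (y - x) + (s * d) • ν x := by abel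
      have e2 := norm_add₃_le (a := -(x + θ • (y - x) + (s * d) • ν x - z)) (b := θ • (y - x)) (c := (s * d) • ν x)
      rwa [← e, norm_neg] at e2
    rw [hnd] at h1
    have hN2 : ‖z - x‖ / 2 ≤ N := by linarith
    have hc16 : c * 16 ≤ 1 := by nlinarith
    have hcd : c * 16 * d ≤ 1 * d := by gcongr
    refine ⟨by linarith, ?_⟩
    have h2 : ‖z - x‖ ^ (5 / 4 : ℝ) ≤ R ^ (1 / 4 : ℝ) * ‖z - x‖ := by
      have hz0 : 0 < ‖z - x‖ := by linarith
      rw [show (5 / 4 : ℝ) = 1 / 4 + 1 by norm_num, Real.rpow_add hz0, Real.rpow_one]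
      gcongr
      exact hR z hz
    have hc2 : c * (2 * R ^ (1 / 4 : ℝ)) ≤ 1 := by nlinarith
    calc _ ≤ c * (R ^ (1 / 4 : ℝ) * ‖z - x‖) := by gcongr
      _ = (c * (2 * R ^ (1 / 4 : ℝ))) * (‖z - x‖ / 2) := by ring
      _ ≤ 1 * (‖z - x‖ / 2) := by gcongr
      _ ≤ N := by linarith

end

noncomputable section

/-! ### Differentiation of the potentials off the surface -/

namespace PML
variable (p : PML)

lemma measurable_psi₀ (k : ℝ) : Measurable (psi₀ k) := by unfold psi₀; fun_prop
lemma measurable_psi₁ (k : ℝ) : Measurable (psi₁ k) := by unfold psi₁; fun_prop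
lemma measurable_psi₂ (k : ℝ) : Measurable (psi₂ k) := by unfold psi₂; fun_prop

lemma measurable_qdist (x : E3) : Measurable fun z => p.qdist x z := (p.contDiff_qdist_right x).continuous.measurable

lemma measurable_wdiff (l : Fin 3) (x : E3) : Measurable fun z => p.wdiff l x z :=
  (p.contDiff_wdiff_right l x).continuous.measurable

lemma measurable_Phi (k : ℝ) (x : E3) : Measurable fun z => p.Phi k x z :=
  (measurable_psi₀ k).comp (p.measurable_qdist x)

lemma measurable_dPhi (k : ℝ) (l : Fin 3) (x : E3) : Measurable fun z => p.dPhi k l x z :=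
  ((p.measurable_wdiff l x).const_mul 2).mul ((measurable_psi₁ k).comp (p.measurable_qdist x))

lemma measurable_ddPhi (k : ℝ) (l m : Fin 3) (x : E3) : Measurable fun z => p.ddPhi k l m x z := by
  have h1 := (measurable_psi₂ k).comp (p.measurable_qdist x)
  have h2 := (measurable_psi₁ k).comp (p.measurable_qdist x)
  have h3 := p.measurable_wdiff l x
  have h4 := p.measurable_wdiff m x
  unfold ddPhi
  simp only [Function.comp_def] at h1 h2
  split_ifs <;> fun_prop

end PML

lemma exists_dist_lower {M : Set E3} {x₀ : E3} (hx : x₀ ∉ closure M) :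
    ∃ δ : ℝ, 0 < δ ∧ ∀ x ∈ Metric.ball x₀ δ, ∀ z ∈ M, δ ≤ ‖x - z‖ := by
  obtain ⟨ε, hε, h⟩ := Metric.isOpen_iff.1 isClosed_closure.isOpen_compl x₀ hx
  refine ⟨ε / 2, by positivity, fun x hx z hz => ?_⟩
  by_contra hlt
  rw [not_le, ← dist_eq_norm] at hlt
  rw [Metric.mem_ball] at hx
  refine h (a := z) (Metric.mem_ball.2 ?_) (subset_closure hz)
  calc dist z x₀ ≤ dist z x + dist x x₀ := dist_triangle _ _ _
    _ < ε := by rw [dist_comm z x]; linarith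

lemma norm_dotCLM_le_of_forall {v : C3} {C : ℝ} (hv : ∀ l, ‖v l‖ ≤ C) : ‖dotCLM v‖ ≤ 3 * C :=
  (norm_dotCLM_le v).trans (by gcongr; exact (pi_norm_le_iff_of_nonneg ((norm_nonneg _).trans (hv 0))).2 hv)

lemma integral_dotCLM {μ : Measure E3} {f : E3 → C3} (hf : ∀ l, Integrable (fun z => f z l) μ) :
    ∫ z, dotCLM (f z) ∂μ = dotCLM fun l => ∫ z, f z l ∂μ := by
  have h1 : ∀ v : C3, dotCLM v = ∑ l, v l • (Complex.ofRealCLM.comp (EuclideanSpace.proj l) : E3 →L[ℝ] ℂ) :=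
    fun v => rfl
  simp only [h1]
  rw [integral_finsetSum _ fun l _ => (hf l).smul_const _]
  exact Finset.sum_congr rfl fun l _ => integral_smul_const _ _

/-- Differentiation of a potential at a point off the support of the density. -/
lemma hasFDerivAt_kernel_integral {μ : Measure E3} [IsFiniteMeasure μ] {M : Set E3} (hM : Bornology.IsBounded M)
    (hμ : ∀ᵐ z ∂μ, z ∈ M) {κ : E3 → E3 → ℂ} {a : E3 → C3} {D : Fin 3 → E3 → E3 → ℂ}
    (hκm : ∀ x, Measurable (κ x)) (hDm : ∀ l x, Measurable (D l x))
    (hd : ∀ x z, x ≠ z → HasFDerivAt (fun x => κ x z) (dotCLM fun l => a x l * D l x z) x)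
    {S : ℝ} (ha : ∀ x l, ‖a x l‖ ≤ S)
    (hb : ∀ R δ : ℝ, 0 < δ → ∃ C, ∀ x z, δ ≤ ‖x - z‖ → ‖x - z‖ ≤ R → ‖κ x z‖ ≤ C ∧ ∀ l, ‖D l x z‖ ≤ C)
    {g : E3 → ℂ} (hg : AEStronglyMeasurable g μ) {B : ℝ} (hgB : ∀ᵐ z ∂μ, ‖g z‖ ≤ B)
    {x₀ : E3} (hx : x₀ ∉ closure M) :
    HasFDerivAt (fun x => ∫ z, κ x z * g z ∂μ) (dotCLM fun l => a x₀ l * ∫ z, D l x₀ z * g z ∂μ) x₀ := by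
  obtain ⟨δ, hδ, hδM⟩ := exists_dist_lower hx
  obtain ⟨R, hR⟩ := hM.exists_norm_le
  obtain ⟨C, hC⟩ := hb (‖x₀‖ + δ + R) δ hδ
  have hS : 0 ≤ S := (norm_nonneg _).trans (ha 0 0)
  have hle : ∀ x ∈ Metric.ball x₀ δ, ∀ z ∈ M, ‖x - z‖ ≤ ‖x₀‖ + δ + R := fun x hx z hz => by
    have h1 : ‖x‖ ≤ ‖x₀‖ + ‖x - x₀‖ := by
      have := norm_add_le x₀ (x - x₀)
      rwa [add_sub_cancel] at this
    rw [Metric.mem_ball, dist_eq_norm] at hx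
    have := norm_sub_le x z
    linarith [hR z hz]
  have hb' : ∀ x ∈ Metric.ball x₀ δ, ∀ z ∈ M, ‖κ x z‖ ≤ C ∧ ∀ l, ‖D l x z‖ ≤ C := fun x hx z hz =>
    hC x z (hδM x hx z hz) (hle x hx z hz)
  have hx0 := Metric.mem_ball_self (x := x₀) hδ
  have hmeas : ∀ x, AEStronglyMeasurable (fun z => κ x z * g z) μ := fun x =>
    (hκm x).aestronglyMeasurable.mul hg
  have hDi : ∀ l, Integrable (fun z => D l x₀ z * g z) μ := fun l => by
    refine Integrable.of_bound ((hDm l x₀).aestronglyMeasurable.mul hg) (C * B) ?_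
    filter_upwards [hμ, hgB] with z hz hgz
    rw [norm_mul]
    have := (hb' x₀ hx0 z hz).2 l
    have := (norm_nonneg _).trans this
    gcongr
  have key := hasFDerivAt_integral_of_dominated_of_fderiv_le (𝕜 := ℝ) (μ := μ) (F := fun x z => κ x z * g z)
    (F' := fun x z => dotCLM fun l => a x l * (D l x z * g z)) (x₀ := x₀) (s := Metric.ball x₀ δ)
    (bound := fun _ => 3 * (S * (C * B)))
    (Metric.ball_mem_nhds _ hδ) (Eventually.of_forall hmeas) ?_ ?_ ?_ (integrable_const _) ?_
  · rw [integral_dotCLM fun l => (hDi l).const_mul _] at key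
    simp only [integral_const_mul] at key
    exact key
  · refine Integrable.of_bound (hmeas x₀) (C * B) ?_
    filter_upwards [hμ, hgB] with z hz hgz
    rw [norm_mul]
    have := (hb' x₀ hx0 z hz).1
    have := (norm_nonneg _).trans this
    gcongr
  · refine continuous_dotCLM.comp_aestronglyMeasurable ?_
    refine (aemeasurable_pi_lambda _ fun l => ?_).aestronglyMeasurable
    exact (((hDm l x₀).aemeasurable.mul hg.aemeasurable)).const_mul _
  · filter_upwards [hμ, hgB] with z hz hgz x hx
    refine norm_dotCLM_le_of_forall fun l => ?_
    rw [norm_mul, norm_mul]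
    have := (hb' x hx z hz).2 l
    have := (norm_nonneg _).trans this
    have := ha x l
    gcongr
  · filter_upwards [hμ] with z hz x hx
    have hne : x ≠ z := by
      rintro rfl
      have := hδM x hx x hz
      simp at this
      linarith
    refine ((hd x z hne).mul_const (g z)).congr_fderiv ?_
    ext v
    simp [dotCLM_apply, dotProduct, Fin.sum_univ_three]
    ring

namespace PML
variable (p : PML) {μ : Measure E3} [IsFiniteMeasure μ] {M : Set E3} (hM : Bornology.IsBounded M)
    (hμ : ∀ᵐ z ∂μ, z ∈ M) {g : E3 → ℂ} (hg : AEStronglyMeasurable g μ) {B : ℝ} (hgB : ∀ᵐ z ∂μ, ‖g z‖ ≤ B)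

lemma exists_kernel_bounds_off (k R δ : ℝ) (hδ : 0 < δ) : ∃ C, ∀ x z : E3, δ ≤ ‖x - z‖ → ‖x - z‖ ≤ R →
    ‖p.Phi k x z‖ ≤ C ∧ (∀ l, ‖p.dPhi k l x z‖ ≤ C) ∧ ∀ l m, ‖p.ddPhi k l m x z‖ ≤ C := by
  obtain ⟨C, hC, h⟩ := p.exists_kernel_bounds k R
  refine ⟨C * (δ⁻¹ + (δ ^ 2)⁻¹ + (δ ^ 3)⁻¹), fun x z h1 h2 => ?_⟩
  have hne : x ≠ z := by
    rintro rfl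
    simp at h1
    linarith
  have i1 : ‖x - z‖⁻¹ ≤ δ⁻¹ := by gcongr
  have i2 : (‖x - z‖ ^ 2)⁻¹ ≤ (δ ^ 2)⁻¹ := by gcongr
  have i3 : (‖x - z‖ ^ 3)⁻¹ ≤ (δ ^ 3)⁻¹ := by gcongr
  have p1 : 0 < δ⁻¹ := by positivity
  have p2 : 0 < (δ ^ 2)⁻¹ := by positivity
  have p3 : 0 < (δ ^ 3)⁻¹ := by positivity
  obtain ⟨b1, b2, b3⟩ := h x z hne h2
  refine ⟨b1.trans ?_, fun l => (b2 l).trans ?_, fun l m => (b3 l m).trans ?_⟩ <;> gcongr <;> linarith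

include hM hμ hg hgB

lemma hasFDerivAt_pot (k : ℝ) {x : E3} (hx : x ∉ closure M) :
    HasFDerivAt (fun x => ∫ z, p.Phi k x z * g z ∂μ)
      (dotCLM fun l => p.alpha x l * ∫ z, p.dPhi k l x z * g z ∂μ) x :=
  hasFDerivAt_kernel_integral hM hμ (p.measurable_Phi k) (p.measurable_dPhi k)
    (fun _ _ h => p.hasFDerivAt_Phi k h) p.norm_alpha_le
    (fun R δ hδ => by
      obtain ⟨C, hC⟩ := p.exists_kernel_bounds_off k R δ hδ
      exact ⟨C, fun x z h1 h2 => ⟨(hC x z h1 h2).1, (hC x z h1 h2).2.1⟩⟩) hg hgB hx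

lemma hasFDerivAt_dPot (k : ℝ) (l : Fin 3) {x : E3} (hx : x ∉ closure M) :
    HasFDerivAt (fun x => ∫ z, p.dPhi k l x z * g z ∂μ)
      (dotCLM fun m => p.alpha x m * ∫ z, p.ddPhi k l m x z * g z ∂μ) x :=
  hasFDerivAt_kernel_integral hM hμ (p.measurable_dPhi k l) (p.measurable_ddPhi k l)
    (fun _ _ h => p.hasFDerivAt_dPhi k l h) p.norm_alpha_le
    (fun R δ hδ => by
      obtain ⟨C, hC⟩ := p.exists_kernel_bounds_off k R δ hδ
      exact ⟨C, fun x z h1 h2 => ⟨(hC x z h1 h2).2.1 l, (hC x z h1 h2).2.2 l⟩⟩) hg hgB hx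

end PML

/-! ### The stretched curl in stretched derivatives -/

namespace PML
variable (p : PML)

/-- The stretched curl in terms of stretched derivatives. -/
lemma curl_eq_of_hasFDerivAt {u : E3 → C3} {w : Fin 3 → Fin 3 → ℂ} {x : E3} (hx : x ∈ p.truncBox)
    (hu : ∀ m, HasFDerivAt (fun z => u z m) (dotCLM fun l => p.alpha x l * w l m) x) :
    p.curl u x = ![w 1 2 - w 2 1, w 2 0 - w 0 2, w 0 1 - w 1 0] := by
  have hσ : ∀ m, HasDerivAt (p.sigma m) (deriv (p.sigma m) (x m)) (x m) := fun m =>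
    ((p.contDiffAt_sigma m (hx m)).differentiableAt (by norm_num)).hasDerivAt
  have hα : ∀ m, HasFDerivAt (fun z => p.alpha z m)
      ((Complex.I * ((deriv (p.sigma m) (x m) : ℝ) : ℂ)) • (Complex.ofRealCLM.comp (EuclideanSpace.proj m)) : E3 →L[ℝ] ℂ) x := by
    intro m
    have h1 : HasFDerivAt (fun z : E3 => p.sigma m (z m)) _ x :=
      HasFDerivAt.comp (g := p.sigma m) x (f := fun z : E3 => z m) (hσ m).hasFDerivAt
        (EuclideanSpace.proj (𝕜 := ℝ) m).hasFDerivAt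
    have h2 : HasFDerivAt (fun z : E3 => ((p.sigma m (z m) : ℝ) : ℂ)) _ x :=
      Complex.ofRealCLM.hasFDerivAt.comp x h1
    have h3 := (h2.const_mul Complex.I).const_add 1
    refine h3.congr_fderiv ?_
    ext v
    simp
    ring
  have hBu : HasFDerivAt (fun z => p.B z *ᵥ u z) (ContinuousLinearMap.pi fun m =>
      p.alpha x m • (dotCLM fun l => p.alpha x l * w l m) + u x m •
        ((Complex.I * ((deriv (p.sigma m) (x m) : ℝ) : ℂ)) • (Complex.ofRealCLM.comp (EuclideanSpace.proj m)) : E3 →L[ℝ] ℂ)) x := by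
    refine hasFDerivAt_pi.2 fun m => ?_
    have e : (fun z => (p.B z *ᵥ u z) m) = fun z => p.alpha z m * u z m :=
      funext fun z => by rw [B, Matrix.mulVec_diagonal]
    rw [e]
    exact (hα m).mul (hu m)
  -- The factor `α_m` depends on `x_m` alone, so its derivative enters only the diagonal partial
  -- derivatives, which the curl does not use. The remaining factors `α_l α_m` are absorbed by `J⁻¹
  -- 𝔹`.
  have hpd : ∀ l m, l ≠ m → partialD (fun z => p.B z *ᵥ u z) l m x = p.alpha x m * (p.alpha x l * w l m) := by
    intro l m hlm
    rw [partialD, hBu.fderiv]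
    simp [dotCLM_single, hlm.symm]
  have h0 := p.alpha_ne_zero x 0
  have h1 := p.alpha_ne_zero x 1
  have h2 := p.alpha_ne_zero x 2
  unfold PML.curl _root_.curl
  rw [hpd 1 2 (by decide), hpd 2 1 (by decide), hpd 2 0 (by decide), hpd 0 2 (by decide), hpd 0 1 (by decide),
    hpd 1 0 (by decide), jac, B]
  funext m
  fin_cases m <;> simp [Matrix.mulVec_diagonal] <;> field_simp

/-- The stretched gradient field of a single layer potential. -/
def gradPot (k : ℝ) (μ : Measure E3) (ψ : E3 → ℂ) (x : E3) : C3 :=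
  fun l => p.alpha x l * ∫ z, p.dPhi k l x z * ψ z ∂μ

end PML
end

noncomputable section

/-! ### Integration by parts and the layer potential off the surface -/

lemma integral_add_add {μ : Measure E3} {f₁ f₂ f₃ : E3 → ℂ} (h₁ : Integrable f₁ μ) (h₂ : Integrable f₂ μ)
    (h₃ : Integrable f₃ μ) :
    ∫ y, f₁ y ∂μ + ∫ y, f₂ y ∂μ + ∫ y, f₃ y ∂μ = ∫ y, f₁ y + f₂ y + f₃ y ∂μ :=
  ((integral_add (h₁.add h₂) h₃).trans (by rw [integral_add' h₁ h₂])).symm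

namespace LayeredGeometry
variable {p : PML} (G : LayeredGeometry p)

lemma ae_mem_surface : ∀ᵐ z ∂(surfaceMeasure G.surface), z ∈ G.surface := ae_restrict_mem G.measurableSet_surface

lemma isBounded_surface : Bornology.IsBounded G.surface := G.isCompact_closure_surface.isBounded.subset subset_closure

lemma aestronglyMeasurable_of_continuousOn {F : Type*} [TopologicalSpace F] [TopologicalSpace.PseudoMetrizableSpace F]
    {f : E3 → F} (hf : ContinuousOn f G.surface) :
    AEStronglyMeasurable f (surfaceMeasure G.surface) :=
  hf.aestronglyMeasurable G.measurableSet_surface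

lemma aestronglyMeasurable_surfaceDiv {w : E3 → C3} (hw : ContDiffOn ℝ 1 w (closure G.surface)) :
    AEStronglyMeasurable (surfaceDiv G.surface G.ν w) (surfaceMeasure G.surface) :=
  G.aestronglyMeasurable_of_continuousOn (G.isSurface_surface.continuousOn_surfaceDiv (hw.mono subset_closure))

lemma exists_ae_bound_surfaceDiv {w : E3 → C3} (hw : ContDiffOn ℝ 1 w (closure G.surface)) :
    ∃ B, ∀ᵐ z ∂(surfaceMeasure G.surface), ‖surfaceDiv G.surface G.ν w z‖ ≤ B := by
  obtain ⟨B, -, hB⟩ := G.exists_bound_surfaceDiv hw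
  exact ⟨B, G.ae_mem_surface.mono hB⟩

lemma integrable_surfaceDiv {w : E3 → C3} (hw : ContDiffOn ℝ 1 w (closure G.surface)) :
    Integrable (surfaceDiv G.surface G.ν w) (surfaceMeasure G.surface) := by
  obtain ⟨B, hB⟩ := G.exists_ae_bound_surfaceDiv hw
  exact Integrable.of_bound (G.aestronglyMeasurable_surfaceDiv hw) B hB

/-- Integration by parts on the truncated surface. -/
lemma integral_mul_surfaceDiv {w : E3 → C3} (hw : ContDiffOn ℝ 1 w (closure G.surface))
    (hwt : ∀ y ∈ G.surface, toC3 (G.ν y) ⬝ᵥ w y = 0) (h0 : ∀ y ∈ closure G.surface \ G.surface, w y = 0)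
    {K : E3 → ℂ} {k : E3 → C3} (hK : ∀ y ∈ closure G.surface, ContDiffAt ℝ 1 K y)
    (hk : ∀ y ∈ G.surface, HasFDerivAt K (dotCLM (k y)) y) :
    ∫ y, K y * surfaceDiv G.surface G.ν w y ∂(surfaceMeasure G.surface) =
      -∫ y, k y ⬝ᵥ w y ∂(surfaceMeasure G.surface) := by
  have hKw : ContDiffOn ℝ 1 (fun y => K y • w y) (closure G.surface) :=
    ContDiffOn.smul (fun y hy => (hK y hy).contDiffWithinAt) hw
  have hI := G.integral_surfaceDiv hKw
    (fun y hy => by rw [dotProduct_smul, hwt y hy, smul_zero]) (fun y hy => by rw [h0 y hy, smul_zero])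
  have hae : ∀ᵐ y ∂(surfaceMeasure G.surface), surfaceDiv G.surface G.ν (fun y => K y • w y) y =
      K y * surfaceDiv G.surface G.ν w y + k y ⬝ᵥ w y := by
    filter_upwards [G.ae_mem_surface] with y hy
    rw [G.isSurface_surface.surfaceDiv_smul hy (hk y hy).hasFDerivWithinAt
      ((hw.differentiableOn (by norm_num) y (subset_closure hy)).mono subset_closure) (hwt y hy)]
    simp only [dotCLM_single]
  obtain ⟨B, hB⟩ := G.isCompact_closure_surface.exists_bound_of_continuousOn
    (f := K) fun y hy => (hK y hy).continuousAt.continuousWithinAt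
  have hi1 : Integrable (fun y => K y * surfaceDiv G.surface G.ν w y) (surfaceMeasure G.surface) :=
    (G.integrable_surfaceDiv hw).bdd_mul (c := B)
      (G.aestronglyMeasurable_of_continuousOn fun y hy => (hK y (subset_closure hy)).continuousAt.continuousWithinAt)
      (G.ae_mem_surface.mono fun y hy => hB y (subset_closure hy))
  have hi2 : Integrable (fun y => k y ⬝ᵥ w y) (surfaceMeasure G.surface) := by
    refine ((G.integrable_surfaceDiv hKw).sub hi1).congr ?_
    filter_upwards [hae] with y hy
    rw [Pi.sub_apply, hy]
    ring
  rw [integral_congr_ae hae, integral_add hi1 hi2] at hI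
  exact eq_neg_of_add_eq_zero_left hI

variable {φ : E3 → C3} (hφ : ContDiffOn ℝ 1 φ (closure G.surface))
include hφ

lemma continuousOn_density (m : Fin 3) : ContinuousOn (fun y => p.alpha y m * φ y m) (closure G.surface) := by
  have h1 := p.continuous_alpha m
  have h2 := continuousOn_pi.1 hφ.continuousOn m
  fun_prop

lemma exists_density_bound : ∃ B, ∀ m, ∀ᵐ y ∂(surfaceMeasure G.surface), ‖p.alpha y m * φ y m‖ ≤ B := by
  choose B hB using fun m => G.isCompact_closure_surface.exists_bound_of_continuousOn (G.continuousOn_density hφ m)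
  refine ⟨max (B 0) (max (B 1) (B 2)), fun m => G.ae_mem_surface.mono fun y hy =>
    (hB m y (subset_closure hy)).trans ?_⟩
  fin_cases m <;> simp

lemma aestronglyMeasurable_density (m : Fin 3) :
    AEStronglyMeasurable (fun y => p.alpha y m * φ y m) (surfaceMeasure G.surface) :=
  G.aestronglyMeasurable_of_continuousOn ((G.continuousOn_density hφ m).mono subset_closure)

omit hφ in
lemma integrable_vec_iff (k : ℝ) (x : E3) :
    Integrable (fun y => p.Phi k x y • (p.B y *ᵥ φ y)) (surfaceMeasure G.surface) ↔
      ∀ m, Integrable (fun y => p.Phi k x y * (p.alpha y m * φ y m)) (surfaceMeasure G.surface) := by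
  have e : ∀ m y, (p.Phi k x y • (p.B y *ᵥ φ y)) m = p.Phi k x y * (p.alpha y m * φ y m) := fun m y => by
    rw [Pi.smul_apply, PML.B, Matrix.mulVec_diagonal, smul_eq_mul]
  simp only [← e]
  exact ⟨fun h m => h.eval m, Integrable.of_eval⟩

omit hφ in
lemma vecPotential_apply {k : ℝ} {x : E3}
    (h : Integrable (fun y => p.Phi k x y • (p.B y *ᵥ φ y)) (surfaceMeasure G.surface)) (m : Fin 3) :
    p.vecPotential k G.surface φ x m = ∫ y, p.Phi k x y * (p.alpha y m * φ y m) ∂(surfaceMeasure G.surface) := by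
  have e : ∀ y, (p.Phi k x y • (p.B y *ᵥ φ y)) m = p.Phi k x y * (p.alpha y m * φ y m) := fun y => by
    rw [Pi.smul_apply, PML.B, Matrix.mulVec_diagonal, smul_eq_mul]
  simp only [← e]
  exact eval_integral ((integrable_pi_iff).1 h) m

omit hφ in
lemma integrable_off {g : E3 → ℂ} (hg : AEStronglyMeasurable g (surfaceMeasure G.surface)) {B : ℝ}
    (hgB : ∀ᵐ z ∂(surfaceMeasure G.surface), ‖g z‖ ≤ B) (k : ℝ) {x : E3} (hx : x ∉ closure G.surface) :
    Integrable (fun y => p.Phi k x y * g y) (surfaceMeasure G.surface) ∧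
    ∀ l m, Integrable (fun y => p.ddPhi k l m x y * g y) (surfaceMeasure G.surface) := by
  obtain ⟨δ, hδ, hδM⟩ := exists_dist_lower hx
  obtain ⟨R, hR⟩ := G.isBounded_surface.exists_norm_le
  obtain ⟨C, hC⟩ := p.exists_kernel_bounds_off k (‖x‖ + R) δ hδ
  have hb : ∀ z ∈ G.surface, ‖p.Phi k x z‖ ≤ C ∧ (∀ l, ‖p.dPhi k l x z‖ ≤ C) ∧ ∀ l m, ‖p.ddPhi k l m x z‖ ≤ C :=
    fun z hz => hC x z (hδM x (Metric.mem_ball_self hδ) z hz) ((norm_sub_le _ _).trans (by linarith [hR z hz]))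
  have hgi := Integrable.of_bound hg B hgB
  exact ⟨hgi.bdd_mul (c := C) (p.measurable_Phi k x).aestronglyMeasurable (G.ae_mem_surface.mono fun z hz => (hb z hz).1),
    fun l m => hgi.bdd_mul (c := C) (p.measurable_ddPhi k l m x).aestronglyMeasurable
      (G.ae_mem_surface.mono fun z hz => (hb z hz).2.2 l m)⟩

/-- The layer potential off the surface. -/
lemma layerPotential_eq (hφt : ∀ y ∈ G.surface, toC3 (G.ν y) ⬝ᵥ φ y = 0)
    (h0 : ∀ y ∈ closure G.surface \ G.surface, φ y = 0) (k : ℝ) {x : E3}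
    (hx : x ∉ closure G.surface) (hxb : x ∈ p.truncBox) :
    p.layerPotential k G.surface φ x = (k : ℂ) ^ 2 • (p.B x *ᵥ p.vecPotential k G.surface φ x) +
      p.gradPot k (surfaceMeasure G.surface) (surfaceDiv G.surface G.ν φ) x := by
  set μ := surfaceMeasure G.surface with hμ
  obtain ⟨B, hB⟩ := G.exists_density_bound hφ
  set g : Fin 3 → E3 → ℂ := fun m y => p.alpha y m * φ y m with hg
  have hgm : ∀ m, AEStronglyMeasurable (g m) μ := G.aestronglyMeasurable_density hφ
  have hopen : ∀ᶠ x' in 𝓝 x, x' ∉ closure G.surface ∧ x' ∈ p.truncBox :=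
    inter_mem (isClosed_closure.isOpen_compl.mem_nhds hx) (p.isOpen_truncBox.mem_nhds hxb)
  have hvec : ∀ x', x' ∉ closure G.surface → ∀ m,
      p.vecPotential k G.surface φ x' m = ∫ y, p.Phi k x' y * g m y ∂μ := fun x' hx' =>
    G.vecPotential_apply ((G.integrable_vec_iff k x').2 fun m => (G.integrable_off (hgm m) (hB m) k hx').1)
  set W : E3 → Fin 3 → Fin 3 → ℂ := fun x' l m => ∫ y, p.dPhi k l x' y * g m y ∂μ with hW
  set WW : Fin 3 → Fin 3 → Fin 3 → ℂ := fun l j m => ∫ y, p.ddPhi k l j x y * g m y ∂μ with hWW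
  have hcurl : ∀ x', x' ∉ closure G.surface → x' ∈ p.truncBox → p.curl (p.vecPotential k G.surface φ) x' =
      ![W x' 1 2 - W x' 2 1, W x' 2 0 - W x' 0 2, W x' 0 1 - W x' 1 0] := fun x' hx' hxb' => by
    refine p.curl_eq_of_hasFDerivAt hxb' fun m => ?_
    refine (p.hasFDerivAt_pot G.isBounded_surface G.ae_mem_surface (hgm m) (hB m) k hx').congr_of_eventuallyEq ?_
    filter_upwards [isClosed_closure.isOpen_compl.mem_nhds hx'] with z hz
    exact hvec z hz m
  have hWd : ∀ l m, HasFDerivAt (fun x' => W x' l m) (dotCLM fun j => p.alpha x j * WW l j m) x := fun l m =>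
    p.hasFDerivAt_dPot G.isBounded_surface G.ae_mem_surface (hgm m) (hB m) k l hx
  have hcc : p.curl (p.curl (p.vecPotential k G.surface φ)) x =
      ![(WW 0 1 1 - WW 1 1 0) - (WW 2 2 0 - WW 0 2 2), (WW 1 2 2 - WW 2 2 1) - (WW 0 0 1 - WW 1 0 0),
        (WW 2 0 0 - WW 0 0 2) - (WW 1 1 2 - WW 2 1 1)] := by
    have := p.curl_eq_of_hasFDerivAt (u := p.curl (p.vecPotential k G.surface φ))
      (w := fun j m => ![WW 1 j 2 - WW 2 j 1, WW 2 j 0 - WW 0 j 2, WW 0 j 1 - WW 1 j 0] m) hxb ?_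
    · simpa using this
    intro m
    have hev : (fun x' => p.curl (p.vecPotential k G.surface φ) x' m) =ᶠ[𝓝 x]
        fun x' => ![W x' 1 2 - W x' 2 1, W x' 2 0 - W x' 0 2, W x' 0 1 - W x' 1 0] m :=
      hopen.mono fun x' h => by simp only [hcurl x' h.1 h.2]
    refine HasFDerivAt.congr_of_eventuallyEq ?_ hev
    have hsub : ∀ l m l' m', HasFDerivAt (fun x' => W x' l m - W x' l' m')
        (dotCLM fun j => p.alpha x j * (WW l j m - WW l' j m')) x := fun l m l' m' => by
      refine ((hWd l m).sub (hWd l' m')).congr_fderiv ?_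
      ext v
      simp [dotCLM_apply, dotProduct, Fin.sum_univ_three]
      ring
    fin_cases m
    · exact hsub 1 2 2 1
    · exact hsub 2 0 0 2
    · exact hsub 0 1 1 0
  have hWWc : ∀ l j m, WW l j m = WW j l m := fun l j m => by
    simp only [hWW, p.ddPhi_comm k l j]
  have hdi : ∀ l j m, Integrable (fun y => p.ddPhi k l j x y * g m y) μ := fun l j m =>
    (G.integrable_off (hgm m) (hB m) k hx).2 l j
  have hnex : ∀ y ∈ closure G.surface, x ≠ y := fun y hy h => hx (h ▸ hy)
  have hLap : ∀ m, WW 0 0 m + WW 1 1 m + WW 2 2 m = -(k : ℂ) ^ 2 * p.vecPotential k G.surface φ x m := fun m => by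
    rw [hvec x hx m]
    simp only [hWW]
    rw [integral_add_add (hdi 0 0 m) (hdi 1 1 m) (hdi 2 2 m), ← integral_const_mul]
    refine integral_congr_ae (G.ae_mem_surface.mono fun y hy => ?_)
    have := p.sum_ddPhi k (hnex y (subset_closure hy))
    rw [Fin.sum_univ_three] at this
    linear_combination g m y * this
  -- The kernel depends on the difference of stretched coordinates, so a derivative in `x` is minus
  -- one in `y`. The factor `α` produced by the chain rule in `y` is exactly the one in the density
  -- `𝔹 φ`, and integration by parts then turns the divergence onto `φ`.
  have hdiv : ∀ l, WW l 0 0 + WW l 1 1 + WW l 2 2 =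
      ∫ y, p.dPhi k l x y * surfaceDiv G.surface G.ν φ y ∂μ := fun l => by
    rw [G.integral_mul_surfaceDiv hφ hφt h0 (fun y hy => p.contDiffAt_dPhi_right k l (hnex y hy))
      (fun y hy => p.hasFDerivAt_dPhi_right k l (hnex y (subset_closure hy)))]
    simp only [hWW]
    rw [integral_add_add (hdi l 0 0) (hdi l 1 1) (hdi l 2 2), ← integral_neg]
    refine integral_congr_ae (ae_of_all _ fun y => ?_)
    simp only [dotProduct, Fin.sum_univ_three, hg]
    ring
  -- Componentwise `curl curl = grad div - Δ`: `hLap` evaluates the Laplacian and `hdiv` the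
  -- gradient of the divergence.
  funext l
  rw [PML.layerPotential, hcc, Pi.add_apply, Pi.smul_apply, PML.B, Matrix.mulVec_diagonal, Matrix.mulVec_diagonal,
    PML.gradPot, ← hdiv l, smul_eq_mul]
  have hl := hLap l
  fin_cases l
  · simp only [Fin.zero_eta, Fin.isValue, Matrix.cons_val_zero] at hl ⊢
    linear_combination (-p.alpha x 0) * hl
  · simp only [Fin.isValue, Fin.mk_one, Matrix.cons_val_one, Matrix.cons_val_zero] at hl ⊢
    rw [hWWc 0 0 1]
    linear_combination (-p.alpha x 1) * hl
  · simp only [Fin.isValue, Fin.reduceFinMk, Matrix.cons_val] at hl ⊢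
    linear_combination (-p.alpha x 2) * hl

end LayeredGeometry
end

noncomputable section

/-! ### Differences of the fundamental solution -/

namespace PML
variable (p : PML)

lemma norm_fderiv_Phi_le {k R C : ℝ} (hC : ∀ x y : E3, x ≠ y → ‖x - y‖ ≤ R →
    ‖p.Phi k x y‖ ≤ C * ‖x - y‖⁻¹ ∧ (∀ l, ‖p.dPhi k l x y‖ ≤ C * (‖x - y‖ ^ 2)⁻¹) ∧
    ∀ l m, ‖p.ddPhi k l m x y‖ ≤ C * (‖x - y‖ ^ 3)⁻¹) {w z : E3} (h : w ≠ z) (hR : ‖w - z‖ ≤ R) :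
    ‖dotCLM fun l => p.alpha w l * p.dPhi k l w z‖ ≤ 3 * ((1 + p.S) * (C * (‖w - z‖ ^ 2)⁻¹)) := by
  refine norm_dotCLM_le_of_forall fun l => ?_
  rw [norm_mul]
  have := p.norm_alpha_le w l
  have h2 := (hC w z h hR).2.1 l
  have := p.S_pos
  gcongr

lemma norm_fderiv_dPhi_le {k R C : ℝ} (hC : ∀ x y : E3, x ≠ y → ‖x - y‖ ≤ R →
    ‖p.Phi k x y‖ ≤ C * ‖x - y‖⁻¹ ∧ (∀ l, ‖p.dPhi k l x y‖ ≤ C * (‖x - y‖ ^ 2)⁻¹) ∧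
    ∀ l m, ‖p.ddPhi k l m x y‖ ≤ C * (‖x - y‖ ^ 3)⁻¹) {w z : E3} (h : w ≠ z) (hR : ‖w - z‖ ≤ R) (l : Fin 3) :
    ‖dotCLM fun m => p.alpha w m * p.ddPhi k l m w z‖ ≤ 3 * ((1 + p.S) * (C * (‖w - z‖ ^ 3)⁻¹)) := by
  refine norm_dotCLM_le_of_forall fun m => ?_
  rw [norm_mul]
  have := p.norm_alpha_le w m
  have h2 := (hC w z h hR).2.2 l m
  have := p.S_pos
  gcongr

/-- Hölder estimate for the fundamental solution. -/
lemma exists_Phi_sub_le (k R : ℝ) {a : ℝ} (ha0 : 0 < a) (ha1 : a < 1) : ∃ C : ℝ, 0 ≤ C ∧ ∀ x y z : E3,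
    x ≠ z → y ≠ z → ‖x - z‖ ≤ R → ‖y - z‖ ≤ R →
    ‖p.Phi k x z - p.Phi k y z‖ ≤ C * ‖x - y‖ ^ a * (‖x - z‖ ^ (-(1 + a)) + ‖y - z‖ ^ (-(1 + a))) := by
  obtain ⟨C, hC0, hC⟩ := p.exists_kernel_bounds k R
  have hS := p.S_pos
  refine ⟨12 * (1 + p.S) * C, by positivity, fun x y z hx hy hxR hyR => ?_⟩
  have hxz : 0 < ‖x - z‖ := norm_pos_iff.2 (sub_ne_zero.2 hx)
  have hyz : 0 < ‖y - z‖ := norm_pos_iff.2 (sub_ne_zero.2 hy)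
  have hpow : ∀ {t : ℝ}, 0 < t → t⁻¹ = t ^ a * t ^ (-(1 + a)) := fun {t} ht => by
    rw [← Real.rpow_add ht, ← Real.rpow_neg_one]; congr 1; ring
  have htri : ‖x - z‖ ≤ ‖x - y‖ + ‖y - z‖ := norm_sub_le_norm_sub_add_norm_sub x y z
  set δ := ‖x - y‖ with hδ
  have hδ0 : 0 ≤ δ := norm_nonneg _
  have hX : 0 < ‖x - z‖ ^ (-(1 + a)) := by positivity
  have hY : 0 < ‖y - z‖ ^ (-(1 + a)) := by positivity
  have hδa : 0 ≤ δ ^ a := by positivity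
  -- If `z` is within a few `δ` of both points, the two kernel values are bounded separately.
  -- Otherwise the segment from `y` to `x` avoids `z` and the mean value inequality applies.
  by_cases hcase : ‖y - z‖ ≤ 2 * δ
  · have h3 : ∀ t : ℝ, 0 < t → t ≤ 3 * δ → t⁻¹ ≤ 3 * δ ^ a * t ^ (-(1 + a)) := fun t ht hle => by
      rw [hpow ht]
      gcongr
      calc t ^ a ≤ (3 * δ) ^ a := by gcongr
        _ = 3 ^ a * δ ^ a := Real.mul_rpow (by norm_num) hδ0
        _ ≤ 3 ^ (1 : ℝ) * δ ^ a := by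
          gcongr ?_ * _
          exact Real.rpow_le_rpow_of_exponent_le (by norm_num) ha1.le
        _ = _ := by rw [Real.rpow_one]
    have e1 := h3 ‖x - z‖ hxz (by linarith)
    have e2 := h3 ‖y - z‖ hyz (by linarith)
    calc _ ≤ ‖p.Phi k x z‖ + ‖p.Phi k y z‖ := norm_sub_le _ _
      _ ≤ C * (3 * δ ^ a * ‖x - z‖ ^ (-(1 + a))) + C * (3 * δ ^ a * ‖y - z‖ ^ (-(1 + a))) := by
        refine add_le_add ((hC x z hx hxR).1.trans ?_) ((hC y z hy hyR).1.trans ?_) <;> gcongr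
      _ = 3 * C * δ ^ a * (‖x - z‖ ^ (-(1 + a)) + ‖y - z‖ ^ (-(1 + a))) := by ring
      _ ≤ _ := by
        gcongr
        nlinarith
  · rw [not_le] at hcase
    have hseg : ∀ w ∈ segment ℝ y x, w ≠ z ∧ ‖w - z‖ ≤ R ∧ ‖y - z‖ / 2 ≤ ‖w - z‖ := by
      intro w hw
      have h1 : ‖w - y‖ ≤ δ := by
        have := (convex_closedBall y δ).segment_subset (Metric.mem_closedBall_self hδ0)
          (by rw [Metric.mem_closedBall, dist_eq_norm]) hw
        rwa [Metric.mem_closedBall, dist_eq_norm] at this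
      have h2 : ‖w - z‖ ≤ R := by
        have := (convex_closedBall z R).segment_subset (by rwa [Metric.mem_closedBall, dist_eq_norm])
          (by rwa [Metric.mem_closedBall, dist_eq_norm]) hw
        rwa [Metric.mem_closedBall, dist_eq_norm] at this
      have h3 := norm_sub_le_norm_sub_add_norm_sub y w z
      rw [norm_sub_rev y w] at h3
      have h4 : ‖y - z‖ / 2 ≤ ‖w - z‖ := by linarith
      exact ⟨fun h => by rw [h, sub_self, norm_zero] at h4; linarith, h2, h4⟩
    have hmv := (convex_segment y x).norm_image_sub_le_of_norm_hasFDerivWithin_le (𝕜 := ℝ)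
      (f := fun w => p.Phi k w z) (C := 12 * (1 + p.S) * C * (‖y - z‖ ^ 2)⁻¹)
      (fun w hw => (p.hasFDerivAt_Phi k (hseg w hw).1).hasFDerivWithinAt)
      (fun w hw => ?_) (left_mem_segment ℝ y x) (right_mem_segment ℝ y x)
    · rw [← hδ] at hmv
      refine hmv.trans ?_
      -- Interpolation: `δ < ‖y - z‖`, so the factor `(δ / ‖y - z‖) ^ (1 - a)` may be dropped.
      have e1 : δ * (‖y - z‖ ^ 2)⁻¹ ≤ δ ^ a * ‖y - z‖ ^ (-(1 + a)) := by
        have i1 : (‖y - z‖ ^ 2)⁻¹ = ‖y - z‖ ^ (-(1 - a)) * ‖y - z‖ ^ (-(1 + a)) := by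
          rw [← Real.rpow_add hyz, ← Real.rpow_natCast, ← Real.rpow_neg hyz.le]
          congr 1; push_cast; ring
        rcases hδ0.eq_or_lt with h0 | h0
        · rw [← h0, zero_mul]; positivity
        have i2 : δ = δ ^ a * δ ^ (1 - a) := by rw [← Real.rpow_add h0]; simp
        have i3 : δ ^ (1 - a) * ‖y - z‖ ^ (-(1 - a)) ≤ 1 := by
          rw [Real.rpow_neg hyz.le, ← div_eq_mul_inv, div_le_one (by positivity)]
          exact Real.rpow_le_rpow hδ0 (by linarith) (by linarith)
        calc δ * (‖y - z‖ ^ 2)⁻¹ = δ ^ a * (δ ^ (1 - a) * ‖y - z‖ ^ (-(1 - a))) * ‖y - z‖ ^ (-(1 + a)) := by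
              rw [i1]; nth_rewrite 1 [i2]; ring
          _ ≤ δ ^ a * 1 * ‖y - z‖ ^ (-(1 + a)) := by gcongr
          _ = _ := by ring
      calc _ = 12 * (1 + p.S) * C * (δ * (‖y - z‖ ^ 2)⁻¹) := by ring
        _ ≤ 12 * (1 + p.S) * C * (δ ^ a * ‖y - z‖ ^ (-(1 + a))) := by gcongr
        _ ≤ 12 * (1 + p.S) * C * (δ ^ a * (‖x - z‖ ^ (-(1 + a)) + ‖y - z‖ ^ (-(1 + a)))) := by
          gcongr; linarith
        _ = _ := by ring
    · obtain ⟨hw1, hw2, hw3⟩ := hseg w hw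
      refine (p.norm_fderiv_Phi_le hC hw1 hw2).trans ?_
      have : (‖w - z‖ ^ 2)⁻¹ ≤ ((‖y - z‖ / 2) ^ 2)⁻¹ := by gcongr
      calc _ ≤ 3 * ((1 + p.S) * (C * ((‖y - z‖ / 2) ^ 2)⁻¹)) := by gcongr
        _ = _ := by rw [div_pow, inv_div]; ring

lemma exists_lipschitz_alpha {x : E3} (hx : x ∈ p.truncBox) : ∃ L ρ : ℝ, 0 ≤ L ∧ 0 < ρ ∧
    ∀ w ∈ Metric.ball x ρ, ∀ w' ∈ Metric.ball x ρ, ∀ l, ‖p.alpha w l - p.alpha w' l‖ ≤ L * ‖w - w'‖ := by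
  have h : ∀ l, ContDiffAt ℝ 1 (fun w => p.alpha w l) x := fun l => by
    have h1 : ContDiffAt ℝ 1 (fun w : E3 => p.sigma l (w l)) x :=
      ContDiffAt.comp (g := p.sigma l) (f := fun w : E3 => w l) x (p.contDiffAt_sigma l (hx l))
        (EuclideanSpace.proj (𝕜 := ℝ) l).contDiff.contDiffAt
    exact contDiffAt_const.add (contDiffAt_const.mul (Complex.ofRealCLM.contDiff.contDiffAt.comp x h1))
  choose K t ht hK using fun l => (h l).exists_lipschitzOnWith
  obtain ⟨ρ, hρ, hball⟩ := Metric.mem_nhds_iff.1 (inter_mem (inter_mem (ht 0) (ht 1)) (ht 2))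
  refine ⟨K 0 + K 1 + K 2, ρ, by positivity, hρ, fun w hw w' hw' l => ?_⟩
  have hm : ∀ v ∈ Metric.ball x ρ, v ∈ t l := fun v hv => by
    obtain ⟨⟨h0, h1⟩, h2⟩ := hball hv
    fin_cases l <;> assumption
  refine ((hK l).norm_sub_le (hm w hw) (hm w' hw')).trans ?_
  gcongr
  have h0 := (K 0).coe_nonneg
  have h1 := (K 1).coe_nonneg
  have h2 := (K 2).coe_nonneg
  fin_cases l <;> simp <;> linarith

/-- First-order Taylor expansion of the fundamental solution about a nearby point. -/
lemma exists_Phi_taylor_le (k R : ℝ) {x : E3} (hx : x ∈ p.truncBox) : ∃ C ρ : ℝ, 0 ≤ C ∧ 0 < ρ ∧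
    ∀ h : ℝ, 0 < h → h < ρ → ∀ y ∈ Metric.closedBall x h, ∀ v ∈ Metric.closedBall x h, ∀ z : E3,
    6 * h ≤ ‖x - z‖ → ‖x - z‖ ≤ R →
    ‖p.Phi k y z - p.Phi k x z - dotCLM (fun l => p.alpha v l * p.dPhi k l v z) (y - x)‖ ≤
      C * h ^ 2 * (‖x - z‖ ^ 3)⁻¹ := by
  obtain ⟨C, hC0, hC⟩ := p.exists_kernel_bounds k (2 * R)
  obtain ⟨L, ρ, hL0, hρ, hL⟩ := p.exists_lipschitz_alpha hx
  have hS := p.S_pos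
  set C₁ := C * (8 * L * |R| + 48 * (1 + p.S) ^ 2) with hC1
  refine ⟨3 * C₁, ρ, by positivity, hρ, fun h h0 hhρ y hy v hv z hz hzR => ?_⟩
  have hr : 0 < ‖x - z‖ := by linarith
  have hin : ∀ w ∈ Metric.closedBall x h, w ≠ z ∧ ‖w - z‖ ≤ 2 * R ∧ ‖x - z‖ / 2 ≤ ‖w - z‖ ∧ w ∈ Metric.ball x ρ := by
    intro w hw
    rw [Metric.mem_closedBall, dist_eq_norm] at hw
    have h1 := norm_sub_le_norm_sub_add_norm_sub x w z
    have h2 := norm_sub_le_norm_sub_add_norm_sub w x z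
    rw [norm_sub_rev x w] at h1
    have h3 : ‖x - z‖ / 2 ≤ ‖w - z‖ := by linarith
    exact ⟨fun h => by rw [h, sub_self, norm_zero] at h3; linarith, by linarith, h3, by
      rw [Metric.mem_ball, dist_eq_norm]; linarith⟩
  -- The gradient is frozen at `v`, not at the base point `x`, so the derivatives have to be
  -- compared across the whole ball. All its points are at distance at least `‖x - z‖ / 2` from `z`.
  have hd : ∀ w ∈ Metric.closedBall x h, ∀ l, ‖p.dPhi k l w z - p.dPhi k l v z‖ ≤
      48 * (1 + p.S) * C * h * (‖x - z‖ ^ 3)⁻¹ := fun w hw l => by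
    have hmv := (convex_closedBall x h).norm_image_sub_le_of_norm_hasFDerivWithin_le (𝕜 := ℝ)
      (f := fun w => p.dPhi k l w z) (C := 24 * (1 + p.S) * C * (‖x - z‖ ^ 3)⁻¹)
      (fun w hw => (p.hasFDerivAt_dPhi k l (hin w hw).1).hasFDerivWithinAt) (fun w hw => ?_) hv hw
    · refine hmv.trans ?_
      have : ‖w - v‖ ≤ 2 * h := by
        rw [Metric.mem_closedBall, dist_eq_norm] at hw hv
        have := norm_sub_le_norm_sub_add_norm_sub w x v
        rw [norm_sub_rev x v] at this
        linarith
      calc _ ≤ 24 * (1 + p.S) * C * (‖x - z‖ ^ 3)⁻¹ * (2 * h) := by gcongr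
        _ = _ := by ring
    · obtain ⟨hw1, hw2, hw3, -⟩ := hin w hw
      refine (p.norm_fderiv_dPhi_le hC hw1 hw2 l).trans ?_
      have : (‖w - z‖ ^ 3)⁻¹ ≤ ((‖x - z‖ / 2) ^ 3)⁻¹ := by gcongr
      calc _ ≤ 3 * ((1 + p.S) * (C * ((‖x - z‖ / 2) ^ 3)⁻¹)) := by gcongr
        _ = _ := by rw [div_pow, inv_div]; ring
  have hmv := (convex_closedBall x h).norm_image_sub_le_of_norm_hasFDerivWithin_le' (𝕜 := ℝ)
    (f := fun w => p.Phi k w z) (φ := dotCLM fun l => p.alpha v l * p.dPhi k l v z)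
    (C := 3 * (C₁ * h * (‖x - z‖ ^ 3)⁻¹))
    (fun w hw => (p.hasFDerivAt_Phi k (hin w hw).1).hasFDerivWithinAt) (fun w hw => ?_)
    (Metric.mem_closedBall_self h0.le) hy
  · refine hmv.trans ?_
    rw [Metric.mem_closedBall, dist_eq_norm] at hy
    calc _ ≤ 3 * (C₁ * h * (‖x - z‖ ^ 3)⁻¹) * h := by gcongr
      _ = _ := by ring
  · obtain ⟨hw1, hw2, hw3, hw4⟩ := hin w hw
    -- The variation of the kernel derivative costs `h ‖x - z‖⁻³`. The variation of `α`, which is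
    -- Lipschitz, costs only `h ‖x - z‖⁻²`, and boundedness of the distance turns this into the same
    -- form.
    have e : dotCLM (fun l => p.alpha w l * p.dPhi k l w z) - dotCLM (fun l => p.alpha v l * p.dPhi k l v z) =
        dotCLM fun l => (p.alpha w l - p.alpha v l) * p.dPhi k l w z +
          p.alpha v l * (p.dPhi k l w z - p.dPhi k l v z) := by
      ext u
      simp [dotCLM_apply, dotProduct, Fin.sum_univ_three]
      ring
    rw [e]
    refine norm_dotCLM_le_of_forall fun l => (norm_add_le _ _).trans ?_
    rw [norm_mul, norm_mul]
    have hwv : ‖w - v‖ ≤ 2 * h := by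
      rw [Metric.mem_closedBall, dist_eq_norm] at hw hv
      have := norm_sub_le_norm_sub_add_norm_sub w x v
      rw [norm_sub_rev x v] at this
      linarith
    have i1 : ‖p.alpha w l - p.alpha v l‖ ≤ L * (2 * h) := (hL w hw4 v (hin v hv).2.2.2 l).trans (by gcongr)
    have i2 : ‖p.dPhi k l w z‖ ≤ C * (4 * (|R| * (‖x - z‖ ^ 3)⁻¹)) := by
      refine ((hC w z hw1 hw2).2.1 l).trans ?_
      gcongr
      calc (‖w - z‖ ^ 2)⁻¹ ≤ ((‖x - z‖ / 2) ^ 2)⁻¹ := by gcongr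
        _ = 4 * (‖x - z‖ * (‖x - z‖ ^ 3)⁻¹) := by field_simp; norm_num
        _ ≤ _ := by gcongr; exact hzR.trans (le_abs_self R)
    have i3 := p.norm_alpha_le v l
    have i4 := hd w hw l
    calc _ ≤ L * (2 * h) * (C * (4 * (|R| * (‖x - z‖ ^ 3)⁻¹))) +
          (1 + p.S) * (48 * (1 + p.S) * C * h * (‖x - z‖ ^ 3)⁻¹) := by gcongr
      _ = _ := by rw [hC1]; ring

end PML
end

noncomputable section

/-! ### First-order expansion of the single layer potential: densities that vanish at the point -/

namespace LayeredGeometry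
variable {p : PML} (G : LayeredGeometry p)

lemma surface_subset_truncBox : G.surface ⊆ p.truncBox := by
  rw [G.surface_eq]; exact inter_subset_right

lemma exists_dist_upper (x : E3) : ∃ R : ℝ, 0 < R ∧ ∀ w ∈ Metric.closedBall x 1, ∀ z ∈ G.surface, ‖w - z‖ ≤ R := by
  obtain ⟨R, hR⟩ := G.isBounded_surface.exists_norm_le
  refine ⟨|R| + ‖x‖ + 1, by positivity, fun w hw z hz => ?_⟩
  rw [Metric.mem_closedBall, dist_eq_norm] at hw
  have h1 : ‖w‖ ≤ ‖x‖ + ‖w - x‖ := by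
    have := norm_add_le x (w - x)
    rwa [add_sub_cancel] at this
  linarith [norm_sub_le w z, hR z hz, le_abs_self R]

/-- The single layer potential is integrable everywhere. -/
lemma integrable_Phi_mul {g : E3 → ℂ} (hg : AEStronglyMeasurable g (surfaceMeasure G.surface)) {B : ℝ}
    (hgB : ∀ᵐ z ∂(surfaceMeasure G.surface), ‖g z‖ ≤ B) (k : ℝ) (x : E3) :
    Integrable (fun y => p.Phi k x y * g y) (surfaceMeasure G.surface) := by
  obtain ⟨A, hA, hreg⟩ := G.exists_upperRegular
  obtain ⟨R, -, hR⟩ := G.exists_dist_upper x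
  obtain ⟨C, hC0, hC⟩ := p.exists_kernel_bounds k R
  obtain ⟨C₁, -, hC₁⟩ := hreg.exists_integral_rpow_le hA (γ := 1) zero_le_one (by norm_num)
  refine Integrable.mono' (((hC₁ x).1).const_mul (C * B))
    ((p.measurable_Phi k x).aestronglyMeasurable.mul hg) ?_
  filter_upwards [G.ae_mem_surface, hgB, hreg.ae_ne x] with z hz hgz hne
  rw [norm_mul, Real.rpow_neg_one]
  have := (hC x z hne.symm (hR x (Metric.mem_closedBall_self zero_le_one) z hz)).1
  calc _ ≤ C * ‖x - z‖⁻¹ * B := by gcongr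
    _ = _ := by ring

lemma integrable_dPhi_mul_off {g : E3 → ℂ} (hg : AEStronglyMeasurable g (surfaceMeasure G.surface)) {B : ℝ}
    (hgB : ∀ᵐ z ∂(surfaceMeasure G.surface), ‖g z‖ ≤ B) (k : ℝ) (l : Fin 3) {x : E3} {δ : ℝ} (hδ : 0 < δ)
    (hx : ∀ z ∈ G.surface, δ ≤ ‖x - z‖) :
    Integrable (fun y => p.dPhi k l x y * g y) (surfaceMeasure G.surface) := by
  obtain ⟨R, -, hR⟩ := G.exists_dist_upper x
  obtain ⟨C, hC⟩ := p.exists_kernel_bounds_off k R δ hδ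
  exact (Integrable.of_bound hg B hgB).bdd_mul (c := C) (p.measurable_dPhi k l x).aestronglyMeasurable
    (G.ae_mem_surface.mono fun z hz => (hC x z (hx z hz) (hR x (Metric.mem_closedBall_self zero_le_one) z hz)).2.1 l)

/-- Along the surface, the potential with density `ψ` has at `x` the first-order expansion whose
coefficients are its gradients at points of the normal line. -/
def FirstOrderAt (k s : ℝ) (ψ : E3 → ℂ) (x : E3) : Prop :=
  ∀ ε : ℝ, 0 < ε → ∀ᶠ h in 𝓝[>] (0 : ℝ), ∀ y ∈ G.surface, ‖y - x‖ ≤ h →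
    ‖p.scalPotential k G.surface ψ y - p.scalPotential k G.surface ψ x -
      dotCLM (p.gradPot k (surfaceMeasure G.surface) ψ (x + (s * h) • G.ν x)) (y - x)‖ ≤ ε * h

lemma potential_sub_eq {ψ : E3 → ℂ} (hψ : AEStronglyMeasurable ψ (surfaceMeasure G.surface)) {B : ℝ}
    (hB : ∀ᵐ z ∂(surfaceMeasure G.surface), ‖ψ z‖ ≤ B) (k : ℝ) (x y : E3) {v : E3} {δ : ℝ} (hδ : 0 < δ)
    (hv : ∀ z ∈ G.surface, δ ≤ ‖v - z‖) :
    p.scalPotential k G.surface ψ y - p.scalPotential k G.surface ψ x -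
      dotCLM (p.gradPot k (surfaceMeasure G.surface) ψ v) (y - x) =
    ∫ z, (p.Phi k y z - p.Phi k x z - dotCLM (fun l => p.alpha v l * p.dPhi k l v z) (y - x)) * ψ z
      ∂(surfaceMeasure G.surface) := by
  have iy := G.integrable_Phi_mul hψ hB k y
  have ix := G.integrable_Phi_mul hψ hB k x
  have id := fun l => G.integrable_dPhi_mul_off hψ hB k l hδ hv
  have e1 : dotCLM (p.gradPot k (surfaceMeasure G.surface) ψ v) (y - x) =
      ∫ z, dotCLM (fun l => p.alpha v l * p.dPhi k l v z) (y - x) * ψ z ∂(surfaceMeasure G.surface) := by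
    simp only [dotCLM_apply, dotProduct, Fin.sum_univ_three, PML.gradPot, ← integral_const_mul, ← integral_mul_const]
    rw [integral_add_add (((id 0).const_mul _).mul_const _) (((id 1).const_mul _).mul_const _)
      (((id 2).const_mul _).mul_const _)]
    congr 1
    ext z
    ring
  have i3 : Integrable (fun z => dotCLM (fun l => p.alpha v l * p.dPhi k l v z) (y - x) * ψ z)
      (surfaceMeasure G.surface) := by
    have := ((((id 0).const_mul (p.alpha v 0)).mul_const (toC3 (y - x) 0)).add
      (((id 1).const_mul (p.alpha v 1)).mul_const (toC3 (y - x) 1))).add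
      (((id 2).const_mul (p.alpha v 2)).mul_const (toC3 (y - x) 2))
    refine this.congr (ae_of_all _ fun z => ?_)
    simp only [Pi.add_apply, dotCLM_apply, dotProduct, Fin.sum_univ_three]
    ring
  have e2 := integral_sub (iy.sub ix) i3
  rw [integral_sub' iy ix] at e2
  rw [e1, PML.scalPotential, PML.scalPotential, ← e2]
  congr 1
  ext z
  simp only [Pi.sub_apply]
  ring

/-- The integrand is split at `‖x - z‖ = 6 h`. Inside, the three kernel terms each integrate to
`O(h)`; outside, the Taylor remainder `h ^ 2 ‖x - z‖⁻³` also integrates to `O(h)`. Smallness of `ψ`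
near `x` turns `O(h)` into `o(h)`, and the part of the surface far from `x` contributes only `O(h ^
2)`. -/
lemma firstOrderAt_of_tendsto_zero {x : E3} (hx : x ∈ G.surface) {s : ℝ} (hs : s = 1 ∨ s = -1) (k : ℝ) {ψ : E3 → ℂ}
    (hψ : AEStronglyMeasurable ψ (surfaceMeasure G.surface)) {B : ℝ} (hB : ∀ z ∈ G.surface, ‖ψ z‖ ≤ B)
    (h0 : Tendsto ψ (𝓝[G.surface] x) (𝓝 0)) : G.FirstOrderAt k s ψ x := by
  intro ε hε
  set μ := surfaceMeasure G.surface with hμ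
  have hBae : ∀ᵐ z ∂μ, ‖ψ z‖ ≤ B := G.ae_mem_surface.mono hB
  have hB0 : 0 ≤ B := (norm_nonneg _).trans (hB x hx)
  have hS := p.S_pos
  obtain ⟨A, hA, hreg⟩ := G.exists_upperRegular
  obtain ⟨R, hR0, hR⟩ := G.exists_dist_upper x
  obtain ⟨C, hC0, hC⟩ := p.exists_kernel_bounds k R
  obtain ⟨D, ρ, hD0, hρ, hD⟩ := p.exists_Phi_taylor_le k R (G.surface_subset_truncBox hx)
  obtain ⟨C₁, hC₁0, hC₁⟩ := hreg.exists_integral_ball_inv_le hA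
  -- `E` collects the scale-free constants. The balls have radius `8 h`, which gives `8 C₁` twice
  -- and the area `64 A h ^ 2`. The gradient at `v` is evaluated at distance at least `h / 6`,
  -- whence `3 * 36 = 108`.
  set E := C * (8 * C₁ + 8 * C₁ + 108 * (1 + p.S) * (A * 64)) + D * (8 * A) with hE
  have hE0 : 0 ≤ E := by positivity
  set ε' := ε / (2 * (E + 1)) with hε'
  have hε'0 : 0 < ε' := by positivity
  have hεE : ε' * E ≤ ε / 2 := by
    rw [hε', div_mul_eq_mul_div, div_le_div_iff₀ (by positivity) (by positivity)]
    nlinarith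
  obtain ⟨η, hη, hsmall⟩ : ∃ η > 0, ∀ z ∈ G.surface, ‖z - x‖ < η → ‖ψ z‖ ≤ ε' := by
    obtain ⟨η, hη, h⟩ := Metric.tendsto_nhdsWithin_nhds.1 h0 ε' hε'0
    refine ⟨η, hη, fun z hz hzx => ?_⟩
    have := h hz (by rwa [dist_eq_norm])
    rw [dist_zero_right] at this
    exact this.le
  have hlast : ∀ᶠ h in 𝓝[>] (0 : ℝ), B * D * (η ^ 3)⁻¹ * μ.real univ * h < ε / 2 := by
    have : Tendsto (fun h : ℝ => B * D * (η ^ 3)⁻¹ * μ.real univ * h) (𝓝 0)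
        (𝓝 (B * D * (η ^ 3)⁻¹ * μ.real univ * 0)) := Continuous.tendsto (by fun_prop) 0
    rw [mul_zero] at this
    exact (this.mono_left nhdsWithin_le_nhds).eventually (gt_mem_nhds (by positivity))
  filter_upwards [hlast, G.isSurface_surface.exists_normal_le hx hs, self_mem_nhdsWithin,
    nhdsWithin_le_nhds (gt_mem_nhds hρ), nhdsWithin_le_nhds (gt_mem_nhds one_pos),
    nhdsWithin_le_nhds (gt_mem_nhds (show 0 < η / 6 by positivity))] with h hlast hnorm h0' hhρ hh1 hhη y hy hyx
  rw [mem_Ioi] at h0'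
  set v := x + (s * h) • G.ν x with hv
  have hvx : ‖v - x‖ = h := by
    rw [hv, add_sub_cancel_left, norm_smul, G.isSurface_surface.norm_ν hx, mul_one, Real.norm_eq_abs, abs_mul]
    rcases hs with rfl | rfl <;> simp [abs_of_pos h0']
  have hvb : v ∈ Metric.closedBall x h := by rw [Metric.mem_closedBall, dist_eq_norm, hvx]
  have hyb : y ∈ Metric.closedBall x h := by rwa [Metric.mem_closedBall, dist_eq_norm]
  have hvz : ∀ z ∈ G.surface, h / 6 ≤ ‖v - z‖ := fun z hz =>
    le_trans (by have := norm_nonneg (z - x); linarith) (hnorm z hz)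
  rw [G.potential_sub_eq hψ hBae k x y (show 0 < h / 6 by positivity) hvz]
  set f₁ : E3 → ℝ := (Metric.ball y (8 * h)).indicator fun z => ‖y - z‖⁻¹ with hf₁
  set f₂ : E3 → ℝ := (Metric.ball x (8 * h)).indicator fun z => ‖x - z‖⁻¹ with hf₂
  set f₃ : E3 → ℝ := (Metric.ball x (8 * h)).indicator fun _ => 108 * (1 + p.S) * h⁻¹ with hf₃
  set f₄ : E3 → ℝ := ({z : E3 | 6 * h ≤ ‖x - z‖}).indicator fun z => (‖x - z‖ ^ 3)⁻¹ with hf₄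
  have hms : MeasurableSet {z : E3 | 6 * h ≤ ‖x - z‖} := measurableSet_le measurable_const (by fun_prop)
  have hmb : ∀ w : E3, MeasurableSet (Metric.ball w (8 * h)) := fun w => Metric.isOpen_ball.measurableSet
  have i₁ : Integrable f₁ μ := (integrable_indicator_iff (hmb y)).2 (hC₁ y (8 * h) (by positivity)).1
  have i₂ : Integrable f₂ μ := (integrable_indicator_iff (hmb x)).2 (hC₁ x (8 * h) (by positivity)).1
  have i₃ : Integrable f₃ μ := (integrable_const _).indicator (hmb x)
  have i₄ : Integrable f₄ μ := (integrable_indicator_iff hms).2 (hreg.integral_compl_le hA (by positivity) x).1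
  have v₁ : ∫ z, f₁ z ∂μ ≤ C₁ * (8 * h) := by
    rw [hf₁, integral_indicator (hmb y)]; exact (hC₁ y (8 * h) (by positivity)).2
  have v₂ : ∫ z, f₂ z ∂μ ≤ C₁ * (8 * h) := by
    rw [hf₂, integral_indicator (hmb x)]; exact (hC₁ x (8 * h) (by positivity)).2
  have v₃ : ∫ z, f₃ z ∂μ ≤ 108 * (1 + p.S) * (A * 64) * h := by
    rw [hf₃, integral_indicator (hmb x), setIntegral_const, smul_eq_mul]
    have : μ.real (Metric.ball x (8 * h)) ≤ A * (8 * h) ^ 2 :=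
      ENNReal.toReal_le_of_le_ofReal (by positivity) (hreg x (8 * h) (by positivity))
    calc _ ≤ A * (8 * h) ^ 2 * (108 * (1 + p.S) * h⁻¹) := by gcongr
      _ = _ := by field_simp; ring
  have v₄ : ∫ z, f₄ z ∂μ ≤ 8 * A * (6 * h)⁻¹ := by
    rw [hf₄, integral_indicator hms]; exact (hreg.integral_compl_le hA (by positivity) x).2
  -- A single majorant: the indicators separate the near and far contributions weighted by `ε'`, and
  -- the constant term covers points at distance at least `η`, where `ψ` is merely bounded.
  set F : E3 → ℝ := fun z => ε' * (C * (f₁ z + f₂ z + f₃ z) + D * h ^ 2 * f₄ z) + B * D * h ^ 2 * (η ^ 3)⁻¹ with hF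
  have iF : Integrable F μ :=
    (((((i₁.add i₂).add i₃).const_mul C).add (i₄.const_mul (D * h ^ 2))).const_mul ε').add (integrable_const _)
  have vF : ∫ z, F z ∂μ ≤ ε * h := by
    have e : ∫ z, F z ∂μ = ε' * (C * (∫ z, f₁ z ∂μ + ∫ z, f₂ z ∂μ + ∫ z, f₃ z ∂μ) + D * h ^ 2 * ∫ z, f₄ z ∂μ) +
        B * D * h ^ 2 * (η ^ 3)⁻¹ * μ.real univ := by
      have a1 := integral_add i₁ i₂
      have a2 := integral_add (i₁.add i₂) i₃
      have a3 := integral_add (((i₁.add i₂).add i₃).const_mul C) (i₄.const_mul (D * h ^ 2))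
      have a4 := integral_add (((((i₁.add i₂).add i₃).const_mul C).add (i₄.const_mul (D * h ^ 2))).const_mul ε')
        (integrable_const (B * D * h ^ 2 * (η ^ 3)⁻¹))
      simp only [Pi.add_apply, integral_const_mul, integral_const, smul_eq_mul] at a1 a2 a3 a4
      rw [hF, a4, a3, a2, a1]
      ring
    rw [e]
    have b1 : C * (∫ z, f₁ z ∂μ + ∫ z, f₂ z ∂μ + ∫ z, f₃ z ∂μ) + D * h ^ 2 * ∫ z, f₄ z ∂μ ≤ E * h := by
      calc _ ≤ C * (C₁ * (8 * h) + C₁ * (8 * h) + 108 * (1 + p.S) * (A * 64) * h) +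
            D * h ^ 2 * (8 * A * (6 * h)⁻¹) := by gcongr
        _ = C * (8 * C₁ + 8 * C₁ + 108 * (1 + p.S) * (A * 64)) * h + D * (8 * A) * h / 6 := by
          field_simp
        _ ≤ C * (8 * C₁ + 8 * C₁ + 108 * (1 + p.S) * (A * 64)) * h + D * (8 * A) * h := by
          have : 0 ≤ D * (8 * A) * h := by positivity
          linarith
        _ = _ := by rw [hE]; ring
    calc _ ≤ ε' * (E * h) + (B * D * (η ^ 3)⁻¹ * μ.real univ * h) * h := by
          refine add_le_add (by gcongr) (le_of_eq (by ring))
      _ ≤ ε / 2 * h + ε / 2 * h := by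
        rw [← mul_assoc]
        gcongr
      _ = _ := by ring
  refine (norm_integral_le_of_norm_le iF ?_).trans vF
  filter_upwards [G.ae_mem_surface, hreg.ae_ne x, hreg.ae_ne y] with z hz hzx hzy
  have n₁ : 0 ≤ f₁ z := indicator_nonneg (fun _ _ => by positivity) z
  have n₂ : 0 ≤ f₂ z := indicator_nonneg (fun _ _ => by positivity) z
  have n₃ : 0 ≤ f₃ z := indicator_nonneg (fun _ _ => by positivity) z
  have n₄ : 0 ≤ f₄ z := indicator_nonneg (fun _ _ => by positivity) z
  have hball : ∀ w ∈ Metric.closedBall x h, ‖w - z‖ ≤ R := fun w hw =>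
    hR w (Metric.closedBall_subset_closedBall hh1.le hw) z hz
  have hxb : x ∈ Metric.closedBall x h := Metric.mem_closedBall_self h0'.le
  rw [norm_mul]
  have nn : 0 ≤ B * D * h ^ 2 * (η ^ 3)⁻¹ := by positivity
  by_cases hr : 6 * h ≤ ‖x - z‖
  · have hk := hD h h0' hhρ y hyb v hvb z hr (hball x hxb)
    have e4 : f₄ z = (‖x - z‖ ^ 3)⁻¹ := indicator_of_mem (s := {z : E3 | 6 * h ≤ ‖x - z‖}) hr _
    by_cases hrη : ‖z - x‖ < η
    · calc _ ≤ D * h ^ 2 * (‖x - z‖ ^ 3)⁻¹ * ε' := by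
            have := hsmall z hz hrη
            gcongr
        _ = ε' * (0 + D * h ^ 2 * f₄ z) + 0 := by rw [e4]; ring
        _ ≤ F z := by
          rw [hF]
          dsimp only
          gcongr
          positivity
    · rw [not_lt, norm_sub_rev] at hrη
      calc _ ≤ D * h ^ 2 * (η ^ 3)⁻¹ * B := by
            have i1 := hB z hz
            have i2 : (‖x - z‖ ^ 3)⁻¹ ≤ (η ^ 3)⁻¹ := by gcongr
            exact mul_le_mul (hk.trans (by gcongr)) i1 (norm_nonneg _) (by positivity)
        _ = 0 + B * D * h ^ 2 * (η ^ 3)⁻¹ := by ring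
        _ ≤ F z := by
          rw [hF]
          dsimp only
          gcongr
          positivity
  · rw [not_le] at hr
    have hyz : ‖y - z‖ < 8 * h := by
      have := norm_sub_le_norm_sub_add_norm_sub y x z
      linarith
    have e1 : f₁ z = ‖y - z‖⁻¹ := indicator_of_mem (by
      rw [Metric.mem_ball, dist_comm, dist_eq_norm]; exact hyz) _
    have hxz8 : z ∈ Metric.ball x (8 * h) := by
      rw [Metric.mem_ball, dist_comm, dist_eq_norm]; linarith
    have e2 : f₂ z = ‖x - z‖⁻¹ := indicator_of_mem hxz8 _
    have e3 : f₃ z = 108 * (1 + p.S) * h⁻¹ := indicator_of_mem hxz8 _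
    have hvz' := hvz z hz
    have hvne : v ≠ z := fun e => by rw [e, sub_self, norm_zero] at hvz'; linarith
    have b1 := (hC y z hzy.symm (hball y hyb)).1
    have b2 := (hC x z hzx.symm (hball x hxb)).1
    have b3 : ‖dotCLM (fun l => p.alpha v l * p.dPhi k l v z) (y - x)‖ ≤ C * (108 * (1 + p.S) * h⁻¹) := by
      refine (ContinuousLinearMap.le_opNorm _ _).trans ?_
      have c1 := p.norm_fderiv_Phi_le hC hvne (hball v hvb)
      calc _ ≤ 3 * ((1 + p.S) * (C * (‖v - z‖ ^ 2)⁻¹)) * h := by gcongr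
        _ ≤ 3 * ((1 + p.S) * (C * ((h / 6) ^ 2)⁻¹)) * h := by gcongr
        _ = _ := by field_simp; norm_num
    have hψz : ‖ψ z‖ ≤ ε' := hsmall z hz (by rw [norm_sub_rev]; linarith)
    calc _ ≤ (C * ‖y - z‖⁻¹ + C * ‖x - z‖⁻¹ + C * (108 * (1 + p.S) * h⁻¹)) * ε' := by
          refine mul_le_mul ((norm_sub_le _ _).trans (add_le_add ((norm_sub_le _ _).trans (add_le_add b1 b2)) b3))
            hψz (norm_nonneg _) (by positivity)
      _ = ε' * (C * (f₁ z + f₂ z + f₃ z) + 0) + 0 := by rw [e1, e2, e3]; ring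
      _ ≤ F z := by
        rw [hF]
        dsimp only
        gcongr
        positivity

end LayeredGeometry
end

noncomputable section

/-! ### Tangential gradients of the single layer potential with a smooth density -/

lemma PML.contDiffAt_alpha (p : PML) {x : E3} (hx : x ∈ p.truncBox) (l : Fin 3) :
    ContDiffAt ℝ 1 (fun w => p.alpha w l) x := by
  have h1 : ContDiffAt ℝ 1 (fun w : E3 => p.sigma l (w l)) x :=
    ContDiffAt.comp (g := p.sigma l) (f := fun w : E3 => w l) x (p.contDiffAt_sigma l (hx l))
      (EuclideanSpace.proj (𝕜 := ℝ) l).contDiff.contDiffAt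
  exact contDiffAt_const.add (contDiffAt_const.mul (Complex.ofRealCLM.contDiff.contDiffAt.comp x h1))

lemma PML.norm_inv_alpha_le (p : PML) (x : E3) (l : Fin 3) : ‖(p.alpha x l)⁻¹‖ ≤ 1 := by
  rw [norm_inv]
  refine inv_le_one_of_one_le₀ ?_
  have : |(p.alpha x l).re| ≤ ‖p.alpha x l‖ := Complex.abs_re_le_norm _
  simpa [PML.alpha] using this

/-- The tangential part of a complex vector. -/
def tangPart (n : E3) (v : C3) : C3 := v - (toC3 n ⬝ᵥ v) • toC3 n

namespace LayeredGeometry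
variable {p : PML} (G : LayeredGeometry p)

/-- Points off the surface that approach `x` not too tangentially. -/
def approachRegion (x : E3) (c : ℝ) : Set E3 :=
  {w | w ∉ closure G.surface ∧ ∀ z ∈ G.surface, c * ‖z - x‖ ^ (5 / 4 : ℝ) ≤ ‖w - z‖}

/-- Dominated convergence: a negative power of the distance with exponent below two is integrable
over the surface, and the point `x` itself has measure zero. -/
lemma tendsto_integral_of_singular {l : Filter E3} [l.IsCountablyGenerated] {γ : ℝ} (h0 : 0 ≤ γ) (h2 : γ < 2)
    {x : E3} {F : E3 → E3 → ℂ} {f : E3 → ℂ} {C : ℝ}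
    (hm : ∀ w, AEStronglyMeasurable (F w) (surfaceMeasure G.surface))
    (hb : ∀ᶠ w in l, ∀ z ∈ G.surface, z ≠ x → ‖F w z‖ ≤ C * ‖x - z‖ ^ (-γ))
    (hlim : ∀ z ∈ G.surface, z ≠ x → Tendsto (fun w => F w z) l (𝓝 (f z))) :
    Tendsto (fun w => ∫ z, F w z ∂(surfaceMeasure G.surface)) l (𝓝 (∫ z, f z ∂(surfaceMeasure G.surface))) := by
  obtain ⟨A, hA, hreg⟩ := G.exists_upperRegular
  obtain ⟨C₁, -, hC₁⟩ := hreg.exists_integral_rpow_le hA h0 h2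
  refine tendsto_integral_filter_of_dominated_convergence _ (Eventually.of_forall hm) ?_ ((hC₁ x).1.const_mul C) ?_
  · filter_upwards [hb] with w hw
    filter_upwards [G.ae_mem_surface, hreg.ae_ne x] with z hz hne
    exact hw z hz hne
  · filter_upwards [G.ae_mem_surface, hreg.ae_ne x] with z hz hne
    exact hlim z hz hne

lemma notMem_truncBox_of_mem_edge {y : E3} (hy : y ∈ closure G.surface \ G.surface) : y ∉ p.truncBox := fun h =>
  hy.2 (by rw [G.surface_eq]; exact ⟨(G.closure_surface_subset hy.1).1, h⟩)

/-- A cutoff function near `x` with a smooth extension of the normal field to its support. -/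
lemma exists_cutoff {x : E3} (hx : x ∈ G.surface) : ∃ (χ : E3 → ℝ) (N : E3 → E3) (r L : ℝ), 0 < r ∧ 0 ≤ L ∧
    Metric.ball x r ⊆ p.truncBox ∧ ContDiff ℝ 1 χ ∧ χ x = 1 ∧ (∀ z, 0 ≤ χ z ∧ χ z ≤ 1) ∧
    tsupport χ ⊆ Metric.ball x r ∧ (∀ z ∈ Metric.ball x r, ContDiffAt ℝ 1 N z) ∧
    (∀ z ∈ G.surface ∩ Metric.ball x r, N z = G.ν z) ∧
    (∀ z ∈ Metric.ball x r, ‖N z - N x‖ ≤ L * ‖z - x‖) ∧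
    ∀ w ∈ Metric.ball x r, ∀ z ∈ Metric.ball x r, ∀ l, ‖p.alpha w l - p.alpha z l‖ ≤ L * ‖w - z‖ := by
  obtain ⟨c, hc⟩ := G.isSurface_surface x hx
  obtain ⟨L, ρ, hL, hρ, hα⟩ := p.exists_lipschitz_alpha (G.surface_subset_truncBox hx)
  have hN : ∀ z ∈ c.V, ContDiffAt ℝ 1 c.N z := fun z hz => c.contDiffOn_N.contDiffAt (c.isOpen_V.mem_nhds hz)
  obtain ⟨K, t, ht, hK⟩ := (hN x hc).exists_lipschitzOnWith
  obtain ⟨r, hr, hball⟩ := Metric.mem_nhds_iff.1 (inter_mem (inter_mem (c.isOpen_V.mem_nhds hc) ht)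
    (inter_mem (p.isOpen_truncBox.mem_nhds (G.surface_subset_truncBox hx)) (Metric.ball_mem_nhds x hρ)))
  let χ : ContDiffBump x := ⟨r / 4, r / 2, by positivity, by linarith⟩
  refine ⟨χ, c.N, r, L + K, hr, by positivity, fun z hz => (hball hz).2.1, χ.contDiff, ?_, fun z => ⟨χ.nonneg, χ.le_one⟩,
    ?_, fun z hz => hN z (hball hz).1.1, fun z hz => c.N_eq z ⟨hz.1, (hball hz.2).1.1⟩, fun z hz => ?_,
    fun w hw z hz l => ?_⟩
  · exact χ.one_of_mem_closedBall (Metric.mem_closedBall_self (by positivity))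
  · rw [χ.tsupport_eq]
    exact Metric.closedBall_subset_ball (show r / 2 < r by linarith)
  · refine (hK.norm_sub_le (hball hz).1.2 (mem_of_mem_nhds ht)).trans ?_
    gcongr
    linarith
  · refine (hα w (hball hw).2.2 z (hball hz).2.2 l).trans ?_
    gcongr
    linarith [K.coe_nonneg]

/-- The tangential part of the gradient of a single layer potential has a limit at `x` along the approach
region, if the density is a cutoff function. -/
theorem exists_tendsto_tangPart_gradPot (k : ℝ) {x : E3} (hx : x ∈ G.surface) : ∃ χ : E3 → ℝ, ContDiff ℝ 1 χ ∧ χ x = 1 ∧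
    (∀ z, ‖((χ z : ℝ) : ℂ)‖ ≤ 1) ∧ ∀ c : ℝ, 0 < c → ∃ g : C3,
      Tendsto (fun w => tangPart (G.ν x) (p.gradPot k (surfaceMeasure G.surface) (fun z => (χ z : ℂ)) w))
        (𝓝[G.approachRegion x c] x) (𝓝 g) := by
  obtain ⟨χ, N, r, L, hr, hL, hbox, hχ, hχx, hχ01, hsupp, hN, hNν, hNL, hαL⟩ := G.exists_cutoff hx
  have hχn : ∀ z, ‖((χ z : ℝ) : ℂ)‖ ≤ 1 := fun z => by
    rw [Complex.norm_real, Real.norm_eq_abs, abs_of_nonneg (hχ01 z).1]; exact (hχ01 z).2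
  refine ⟨χ, hχ, hχx, hχn, fun c hc => ?_⟩
  set μ := surfaceMeasure G.surface with hμ
  have hχ0 : ∀ z, z ∉ Metric.ball x r → χ z = 0 := fun z hz =>
    image_eq_zero_of_notMem_tsupport fun h => hz (hsupp h)
  have hn1 : ∀ z ∈ G.surface, ‖G.ν z‖ = 1 := fun z hz => G.isSurface_surface.norm_ν hz
  -- The tangential projection of `e_j`, weighted by the cutoff and by `α_j⁻¹` to undo the
  -- stretching factor in the `y`-derivative. Pairing it with the `y`-gradient of the kernel
  -- reproduces `-χ` times the `j`-th kernel derivative up to a normal derivative.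
  set W : Fin 3 → E3 → C3 := fun j z => ((χ z : ℂ) * (p.alpha z j)⁻¹) •
    toC3L (EuclideanSpace.single j 1 - N z j • N z) with hW
  have hWC : ∀ j, ContDiff ℝ 1 (W j) := fun j => contDiff_iff_contDiffAt.2 fun z => by
    by_cases hz : z ∈ Metric.ball x r
    · have h1 : ContDiffAt ℝ 1 (fun z => (p.alpha z j)⁻¹) z :=
        (p.contDiffAt_alpha (hbox hz) j).inv (p.alpha_ne_zero z j)
      have h2 : ContDiffAt ℝ 1 (fun z => ((χ z : ℝ) : ℂ)) z :=
        Complex.ofRealCLM.contDiff.contDiffAt.comp z hχ.contDiffAt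
      have h3 : ContDiffAt ℝ 1 (fun z => N z j) z :=
        (EuclideanSpace.proj (𝕜 := ℝ) j).contDiff.contDiffAt.comp z (hN z hz)
      exact (h2.mul h1).smul (toC3L.contDiff.contDiffAt.comp z (contDiffAt_const.sub (h3.smul (hN z hz))))
    · have : W j =ᶠ[𝓝 z] fun _ => 0 := by
        filter_upwards [(isClosed_tsupport χ).isOpen_compl.mem_nhds fun h => hz (hsupp h)] with y hy
        simp only [hW, image_eq_zero_of_notMem_tsupport hy, Complex.ofReal_zero, zero_mul, zero_smul]
      exact contDiffAt_const.congr_of_eventuallyEq this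
  have hWt : ∀ j, ∀ y ∈ G.surface, toC3 (G.ν y) ⬝ᵥ W j y = 0 := fun j y hy => by
    by_cases hyb : y ∈ Metric.ball x r
    · simp only [hW, dotProduct_smul, toC3L_apply]
      rw [hNν y ⟨hy, hyb⟩, toC3_dotProduct, inner_sub_right, inner_smul_right, real_inner_self_eq_norm_sq, hn1 y hy,
        EuclideanSpace.inner_single_right]
      simp
    · simp only [hW, hχ0 y hyb, Complex.ofReal_zero, zero_mul, zero_smul, dotProduct_zero]
  have hW0 : ∀ j, ∀ y ∈ closure G.surface \ G.surface, W j y = 0 := fun j y hy => by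
    have : y ∉ Metric.ball x r := fun h => G.notMem_truncBox_of_mem_edge hy (hbox h)
    simp only [hW, hχ0 y this, Complex.ofReal_zero, zero_mul, zero_smul]
  obtain ⟨R, hR0, hR⟩ := G.exists_dist_upper x
  obtain ⟨C, hC0, hC⟩ := p.exists_kernel_bounds k R
  have hS := p.S_pos
  set n := G.ν x with hn
  have hNx : N x = n := hNν x ⟨hx, Metric.mem_ball_self hr⟩
  have hnn : ‖n‖ = 1 := hn1 x hx
  -- The matrix of the projection onto the tangent plane at `x`; it annihilates `n`.
  set τ : Fin 3 → Fin 3 → ℂ := fun l j => (if l = j then 1 else 0) - (n l : ℂ) * (n j : ℂ) with hτ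
  have hτn : ∀ l, ∑ j, τ l j * (n j : ℂ) = 0 := fun l => by
    have h1 : (n 0 : ℂ) * n 0 + n 1 * n 1 + n 2 * n 2 = 1 := by
      have := toC3_dotProduct n n
      rw [real_inner_self_eq_norm_sq, hnn] at this
      simpa [dotProduct, Fin.sum_univ_three, toC3] using this
    simp only [hτ, Fin.sum_univ_three]
    fin_cases l <;> simp <;> linear_combination (-(n _ : ℂ)) * h1
  have hcomp : ∀ v : E3, ∀ j, |v j| ≤ ‖v‖ := fun v j => PiLp.norm_apply_le v j
  have hτ2 : ∀ l j, ‖τ l j‖ ≤ 2 := fun l j => by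
    refine (norm_sub_le _ _).trans ?_
    have h1 : ‖(if l = j then 1 else 0 : ℂ)‖ ≤ 1 := by split_ifs <;> simp
    have h2 : ‖(n l : ℂ) * (n j : ℂ)‖ ≤ 1 * 1 := by
      rw [norm_mul, Complex.norm_real, Complex.norm_real]
      have := hcomp n l
      have := hcomp n j
      rw [hnn] at *
      gcongr <;> assumption
    linarith
  -- the kernels left by the integration by parts
  set P : Fin 3 → E3 → E3 → ℂ := fun j w z =>
    p.dPhi k j w z * (χ z : ℂ) - ∑ m, p.alpha z m * p.dPhi k m w z * W j z m with hP
  have hPeq : ∀ j w z, P j w z = (χ z : ℂ) * (p.alpha z j)⁻¹ * (N z j : ℂ) *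
      ∑ m, (N z m : ℂ) * (p.alpha z m * p.dPhi k m w z) := fun j w z => by
    have hα := p.alpha_ne_zero z j
    simp only [hP, hW, Fin.sum_univ_three, Pi.smul_apply, toC3L_apply, toC3, smul_eq_mul]
    fin_cases j <;> simp at hα ⊢ <;> field_simp <;> ring
  have hWm : ∀ j m, Measurable fun z => W j z m := fun j m =>
    ((continuous_apply m).comp (hWC j).continuous).measurable
  have hχm : Measurable fun z => ((χ z : ℝ) : ℂ) := (Complex.continuous_ofReal.comp hχ.continuous).measurable
  have hPm : ∀ j w, Measurable (P j w) := fun j w => by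
    refine ((p.measurable_dPhi k j w).mul hχm).sub (Finset.measurable_sum _ fun m _ => ?_)
    exact ((p.continuous_alpha m).measurable.mul (p.measurable_dPhi k m w)).mul (hWm j m)
  -- The leftover normal derivatives are recombined by the tangential projection at `x`. Their
  -- common coefficient tends to `τ n = 0` as `w` and `z` tend to `x`, and this gain makes the
  -- kernel integrable.
  set F : Fin 3 → E3 → E3 → ℂ := fun l w z => ∑ j, τ l j * p.alpha w j * P j w z with hF
  have hFeq : ∀ l w z, F l w z = (∑ j, τ l j * p.alpha w j * ((χ z : ℂ) * (p.alpha z j)⁻¹ * (N z j : ℂ))) *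
      ∑ m, (N z m : ℂ) * (p.alpha z m * p.dPhi k m w z) := fun l w z => by
    simp only [hF, hPeq, Finset.sum_mul, mul_assoc]
  choose Bd hBd0 hBd using fun j => G.exists_bound_surfaceDiv (hWC j).contDiffOn
  have hdm : ∀ j, AEStronglyMeasurable (surfaceDiv G.surface G.ν (W j)) μ := fun j =>
    G.aestronglyMeasurable_surfaceDiv (hWC j).contDiffOn
  have hrep : ∀ w, w ∉ closure G.surface → ∀ l,
      tangPart n (p.gradPot k μ (fun z => (χ z : ℂ)) w) l =
        ∑ j, τ l j * p.alpha w j * ∫ z, p.Phi k w z * surfaceDiv G.surface G.ν (W j) z ∂μ + ∫ z, F l w z ∂μ := by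
    intro w hw l
    obtain ⟨δ, hδ, hδM⟩ := exists_dist_lower hw
    have hδM' : ∀ z ∈ G.surface, δ ≤ ‖w - z‖ := hδM w (Metric.mem_ball_self hδ)
    have hint : ∀ (g : E3 → ℂ), Continuous g → ∀ m, Integrable (fun z => p.dPhi k m w z * g z) μ := fun g hg m => by
      obtain ⟨b, hb⟩ := G.isCompact_closure_surface.exists_bound_of_continuousOn hg.continuousOn
      exact G.integrable_dPhi_mul_off (B := b) hg.aestronglyMeasurable
        (G.ae_mem_surface.mono fun z hz => hb z (subset_closure hz)) k m hδ hδM'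
    have hi1 : ∀ j, Integrable (fun z => p.dPhi k j w z * (χ z : ℂ)) μ := fun j =>
      hint _ (Complex.continuous_ofReal.comp hχ.continuous) j
    have hi2 : ∀ j, Integrable (fun z => ∑ m, p.alpha z m * p.dPhi k m w z * W j z m) μ := fun j => by
      refine integrable_finsetSum _ fun m _ => ?_
      have hc1 : Continuous fun z => p.alpha z m * W j z m :=
        (p.continuous_alpha m).mul ((continuous_apply m).comp (hWC j).continuous)
      exact (hint _ hc1 m).congr (ae_of_all _ fun z => by ring)
    have hne : ∀ y ∈ closure G.surface, w ≠ y := fun y hy h => hw (h ▸ hy)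
    have hibp : ∀ j, ∫ z, p.dPhi k j w z * (χ z : ℂ) ∂μ =
        ∫ z, p.Phi k w z * surfaceDiv G.surface G.ν (W j) z ∂μ + ∫ z, P j w z ∂μ := fun j => by
      rw [G.integral_mul_surfaceDiv (hWC j).contDiffOn (hWt j) (hW0 j)
        (fun y hy => p.contDiffAt_Phi_right k (hne y hy))
        (fun y hy => p.hasFDerivAt_Phi_right k (hne y (subset_closure hy)))]
      simp only [hP]
      rw [integral_sub (hi1 j) (hi2 j), ← integral_neg]
      have : ∀ z, -((fun l => -(p.alpha z l * p.dPhi k l w z)) ⬝ᵥ W j z) =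
          ∑ m, p.alpha z m * p.dPhi k m w z * W j z m := fun z => by
        simp only [dotProduct, neg_mul, Finset.sum_neg_distrib, neg_neg]
      simp only [this]
      ring
    have hFi : ∫ z, F l w z ∂μ = ∑ j, τ l j * p.alpha w j * ∫ z, P j w z ∂μ := by
      simp only [hF]
      have hPi : ∀ j, Integrable (P j w) μ := fun j => (hi1 j).sub (hi2 j)
      rw [integral_finsetSum _ fun j _ => (hPi j).const_mul _]
      exact Finset.sum_congr rfl fun j _ => integral_const_mul _ _
    rw [hFi, ← Finset.sum_add_distrib]
    simp only [← mul_add, ← hibp]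
    simp only [tangPart, Pi.sub_apply, Pi.smul_apply, dotProduct, toC3, PML.gradPot, smul_eq_mul,
      Fin.sum_univ_three, hτ]
    fin_cases l <;> simp <;> ring
  have hcont : ∀ l, Tendsto (fun w => p.alpha w l) (𝓝[G.approachRegion x c] x) (𝓝 (p.alpha x l)) := fun l =>
    ((p.continuous_alpha l).tendsto x).mono_left nhdsWithin_le_nhds
  have hΦc : ∀ z, z ≠ x → Tendsto (fun w => p.Phi k w z) (𝓝[G.approachRegion x c] x) (𝓝 (p.Phi k x z)) := fun z hz =>
    (p.hasFDerivAt_Phi k hz.symm).continuousAt.tendsto.mono_left nhdsWithin_le_nhds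
  have hDc : ∀ m z, z ≠ x → Tendsto (fun w => p.dPhi k m w z) (𝓝[G.approachRegion x c] x) (𝓝 (p.dPhi k m x z)) :=
    fun m z hz => (p.hasFDerivAt_dPhi k m hz.symm).continuousAt.tendsto.mono_left nhdsWithin_le_nhds
  have hnear : ∀ᶠ w in 𝓝[G.approachRegion x c] x, w ∈ G.approachRegion x c ∧ w ∈ Metric.ball x r ∧
      w ∈ Metric.closedBall x 1 := by
    filter_upwards [self_mem_nhdsWithin, nhdsWithin_le_nhds (Metric.ball_mem_nhds x hr),
      nhdsWithin_le_nhds (Metric.closedBall_mem_nhds x one_pos)] with w h1 h2 h3 using ⟨h1, h2, h3⟩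
  have hinv : ∀ w ∈ G.approachRegion x c, ∀ z ∈ G.surface, z ≠ x → 0 < ‖w - z‖ ∧
      ‖w - z‖⁻¹ ≤ c⁻¹ * ‖x - z‖ ^ (-(5 / 4) : ℝ) := fun w hw z hz hzx => by
    have h1 := hw.2 z hz
    rw [norm_sub_rev z x] at h1
    have h2 : 0 < ‖x - z‖ := norm_pos_iff.2 (sub_ne_zero.2 hzx.symm)
    have h3 : 0 < c * ‖x - z‖ ^ (5 / 4 : ℝ) := by positivity
    refine ⟨h3.trans_le h1, ?_⟩
    calc ‖w - z‖⁻¹ ≤ (c * ‖x - z‖ ^ (5 / 4 : ℝ))⁻¹ := by gcongr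
      _ = _ := by rw [mul_inv, Real.rpow_neg h2.le]
  have hlim1 : ∀ j, Tendsto (fun w => ∫ z, p.Phi k w z * surfaceDiv G.surface G.ν (W j) z ∂μ)
      (𝓝[G.approachRegion x c] x) (𝓝 (∫ z, p.Phi k x z * surfaceDiv G.surface G.ν (W j) z ∂μ)) := fun j => by
    refine G.tendsto_integral_of_singular (γ := 5 / 4) (x := x) (C := C * c⁻¹ * Bd j) (by norm_num) (by norm_num)
      (fun w => (p.measurable_Phi k w).aestronglyMeasurable.mul (hdm j)) ?_ fun z _ hzx => (hΦc z hzx).mul_const _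
    filter_upwards [hnear] with w hw z hz hzx
    obtain ⟨h1, h2⟩ := hinv w hw.1 z hz hzx
    have h3 := (hC w z (sub_ne_zero.1 (norm_pos_iff.1 h1)) (hR w hw.2.2 z hz)).1
    rw [norm_mul]
    have := hBd j z hz
    have := hBd0 j
    calc _ ≤ C * (c⁻¹ * ‖x - z‖ ^ (-(5 / 4) : ℝ)) * Bd j := by
          gcongr
          exact h3.trans (by gcongr)
      _ = _ := by ring
  have hlim2 : ∀ l, Tendsto (fun w => ∫ z, F l w z ∂μ) (𝓝[G.approachRegion x c] x) (𝓝 (∫ z, F l x z ∂μ)) := fun l => by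
    -- The kernel is bounded by `‖w - z‖⁻¹ + ‖w - z‖⁻² ‖x - z‖`. In the approach region `‖w - z‖`
    -- dominates `‖x - z‖ ^ (5/4)`, so the worse term has exponent `1 - 5/2 = -3/2`.
    refine G.tendsto_integral_of_singular (γ := 3 / 2) (x := x)
      (C := 18 * L * (1 + p.S) * C * (c⁻¹ * R ^ (1 / 4 : ℝ) + c⁻¹ ^ 2)) (by norm_num) (by norm_num)
      (fun w => (Finset.measurable_sum _ fun j _ => (hPm j w).const_mul _).aestronglyMeasurable) ?_ fun z _ hzx => ?_
    · filter_upwards [hnear] with w hw z hz hzx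
      have hxz : 0 < ‖x - z‖ := norm_pos_iff.2 (sub_ne_zero.2 hzx.symm)
      by_cases hzb : z ∈ Metric.ball x r
      swap
      · rw [hFeq]
        simp only [hχ0 z hzb, Complex.ofReal_zero, zero_mul, mul_zero, Finset.sum_const_zero, norm_zero]
        positivity
      obtain ⟨h1, h2⟩ := hinv w hw.1 z hz hzx
      have hD := (hC w z (sub_ne_zero.1 (norm_pos_iff.1 h1)) (hR w hw.2.2 z hz)).2.1
      have hNz : ∀ m, ‖(N z m : ℂ)‖ ≤ 1 := fun m => by
        rw [Complex.norm_real]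
        refine (hcomp (N z) m).trans ?_
        rw [hNν z ⟨hz, hzb⟩, hn1 z hz]
      have hQ : ‖∑ m, (N z m : ℂ) * (p.alpha z m * p.dPhi k m w z)‖ ≤ 3 * ((1 + p.S) * (C * (‖w - z‖ ^ 2)⁻¹)) := by
        refine (norm_sum_le _ _).trans ?_
        have : ∀ m, ‖(N z m : ℂ) * (p.alpha z m * p.dPhi k m w z)‖ ≤ (1 + p.S) * (C * (‖w - z‖ ^ 2)⁻¹) := fun m => by
          rw [norm_mul, norm_mul, ← one_mul ((1 + p.S) * _)]
          have := p.norm_alpha_le z m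
          have := hNz m
          have := hD m
          gcongr
        rw [Fin.sum_univ_three]
        linarith [this 0, this 1, this 2]
      -- Subtracting the vanishing sum `∑ τ_lj n_j` leaves only the differences `α w - α z` and `N z
      -- - n`, both controlled by Lipschitz bounds.
      have hκ : ‖∑ j, τ l j * p.alpha w j * ((χ z : ℂ) * (p.alpha z j)⁻¹ * (N z j : ℂ))‖ ≤
          6 * (L * (‖w - z‖ + ‖x - z‖)) := by
        have e : ∑ j, τ l j * p.alpha w j * ((χ z : ℂ) * (p.alpha z j)⁻¹ * (N z j : ℂ)) =
            ∑ j, τ l j * (χ z : ℂ) * ((p.alpha w j - p.alpha z j) * (p.alpha z j)⁻¹ * (N z j : ℂ) +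
              ((N z j : ℂ) - (n j : ℂ))) := by
          rw [← sub_eq_zero, ← Finset.sum_sub_distrib]
          rw [← mul_zero (χ z : ℂ), ← hτn l, Finset.mul_sum]
          refine Finset.sum_congr rfl fun j _ => ?_
          have := p.alpha_ne_zero z j
          field_simp
          ring
        rw [e]
        refine (norm_sum_le _ _).trans ?_
        have : ∀ j, ‖τ l j * (χ z : ℂ) * ((p.alpha w j - p.alpha z j) * (p.alpha z j)⁻¹ * (N z j : ℂ) +
              ((N z j : ℂ) - (n j : ℂ)))‖ ≤ 2 * 1 * (L * ‖w - z‖ * 1 * 1 + L * ‖x - z‖) := fun j => by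
          rw [norm_mul, norm_mul]
          have a1 := hτ2 l j
          have a2 := hχn z
          have a3 := hαL w hw.2.1 z hzb j
          have a4 := p.norm_inv_alpha_le z j
          have a5 := hNz j
          have a6 : ‖(N z j : ℂ) - (n j : ℂ)‖ ≤ L * ‖x - z‖ := by
            rw [← Complex.ofReal_sub, Complex.norm_real, norm_sub_rev x z]
            refine le_trans ?_ (hNL z hzb)
            rw [hNx]
            exact hcomp (N z - n) j
          gcongr
          refine (norm_add_le _ _).trans (add_le_add ?_ a6)
          rw [norm_mul, norm_mul]
          gcongr
        rw [Fin.sum_univ_three]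
        linarith [this 0, this 1, this 2]
      have i1 : ‖x - z‖ ^ (-(5 / 4) : ℝ) ≤ R ^ (1 / 4 : ℝ) * ‖x - z‖ ^ (-(3 / 2) : ℝ) := by
        calc ‖x - z‖ ^ (-(5 / 4) : ℝ) = ‖x - z‖ ^ (1 / 4 : ℝ) * ‖x - z‖ ^ (-(3 / 2) : ℝ) := by
              rw [← Real.rpow_add hxz]; norm_num
          _ ≤ _ := by
            gcongr
            exact hR x (Metric.mem_closedBall_self zero_le_one) z hz
      have i2 : (‖x - z‖ ^ (-(5 / 4) : ℝ)) ^ 2 * ‖x - z‖ = ‖x - z‖ ^ (-(3 / 2) : ℝ) := by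
        rw [← Real.rpow_natCast, ← Real.rpow_mul hxz.le]
        nth_rewrite 2 [← Real.rpow_one ‖x - z‖]
        rw [← Real.rpow_add hxz]; norm_num
      rw [hFeq, norm_mul]
      set t := ‖x - z‖ ^ (-(3 / 2) : ℝ) with ht
      calc _ ≤ 6 * (L * (‖w - z‖ + ‖x - z‖)) * (3 * ((1 + p.S) * (C * (‖w - z‖ ^ 2)⁻¹))) := by gcongr
        _ = 18 * L * (1 + p.S) * C * (‖w - z‖⁻¹ + ‖w - z‖⁻¹ ^ 2 * ‖x - z‖) := by
          field_simp; ring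
        _ ≤ 18 * L * (1 + p.S) * C * (c⁻¹ * (R ^ (1 / 4 : ℝ) * t) +
            (c⁻¹ * ‖x - z‖ ^ (-(5 / 4) : ℝ)) ^ 2 * ‖x - z‖) := by
          gcongr
          exact h2.trans (by gcongr)
        _ = 18 * L * (1 + p.S) * C * (c⁻¹ * (R ^ (1 / 4 : ℝ) * t) +
            c⁻¹ ^ 2 * ((‖x - z‖ ^ (-(5 / 4) : ℝ)) ^ 2 * ‖x - z‖)) := by ring
        _ = _ := by rw [i2]; ring
    · simp only [hFeq]
      refine Tendsto.mul (tendsto_finsetSum _ fun j _ => ((hcont j).const_mul _).mul_const _)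
        (tendsto_finsetSum _ fun m _ => ((hDc m z hzx).const_mul _).const_mul _)
  refine ⟨fun l => ∑ j, τ l j * p.alpha x j * ∫ z, p.Phi k x z * surfaceDiv G.surface G.ν (W j) z ∂μ +
    ∫ z, F l x z ∂μ, tendsto_pi_nhds.2 fun l => ?_⟩
  refine Tendsto.congr' ?_ ((tendsto_finsetSum _ fun j _ => ((hcont j).const_mul (τ l j)).mul (hlim1 j)).add (hlim2 l))
  filter_upwards [self_mem_nhdsWithin] with w hw
  exact (hrep w hw.1 l).symm

end LayeredGeometry
end

noncomputable section

/-! ### First-order expansion of the single layer potential: densities with tangential limits -/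

lemma notMem_closure_of_le {M : Set E3} {w : E3} {δ : ℝ} (hδ : 0 < δ) (h : ∀ z ∈ M, δ ≤ ‖w - z‖) : w ∉ closure M := by
  intro hw
  obtain ⟨z, hz, hd⟩ := Metric.mem_closure_iff.1 hw δ hδ
  rw [dist_eq_norm] at hd
  exact (h z hz).not_gt hd

lemma norm_dotProduct_le (v w : C3) : ‖v ⬝ᵥ w‖ ≤ 3 * (‖v‖ * ‖w‖) := by
  refine (norm_sum_le _ _).trans ?_
  have h : ∀ l, ‖v l * w l‖ ≤ ‖v‖ * ‖w‖ := fun l => by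
    rw [norm_mul]
    have := norm_le_pi_norm v l
    have := norm_le_pi_norm w l
    gcongr
  rw [Fin.sum_univ_three]
  linarith [h 0, h 1, h 2]

lemma norm_toC3_le (v : E3) : ‖toC3 v‖ ≤ ‖v‖ :=
  (pi_norm_le_iff_of_nonneg (norm_nonneg v)).2 fun l => by
    rw [toC3, Complex.norm_real]; exact PiLp.norm_apply_le v l

/-- Splitting of a linear functional into its tangential and its normal part. -/
lemma dotCLM_eq_tangPart (n : E3) (v : C3) (t : E3) :
    dotCLM v t = tangPart n v ⬝ᵥ toC3 t + (toC3 n ⬝ᵥ v) * ((inner ℝ n t : ℝ) : ℂ) := by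
  rw [dotCLM_apply, tangPart, sub_dotProduct, smul_dotProduct, toC3_dotProduct, smul_eq_mul]
  ring

namespace LayeredGeometry
variable {p : PML} (G : LayeredGeometry p)

/-- On the normal line the distance to `z` is at least `‖z - x‖ / 6`, which on a bounded surface
dominates a multiple of `‖z - x‖ ^ (5/4)`. -/
lemma exists_normal_mem_approachRegion {x : E3} (hx : x ∈ G.surface) {s : ℝ} (hs : s = 1 ∨ s = -1) :
    ∃ c₀ : ℝ, 0 < c₀ ∧ ∀ c ≤ c₀, ∀ᶠ h in 𝓝[>] (0 : ℝ), x + (s * h) • G.ν x ∈ G.approachRegion x c := by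
  obtain ⟨R, hR0, hR⟩ := G.exists_dist_upper x
  refine ⟨(6 * R ^ (1 / 4 : ℝ))⁻¹, by positivity, fun c hc => ?_⟩
  filter_upwards [G.isSurface_surface.exists_normal_le hx hs, self_mem_nhdsWithin] with h hh h0
  rw [mem_Ioi] at h0
  refine ⟨notMem_closure_of_le (δ := h / 6) (by positivity) fun z hz => le_trans ?_ (hh z hz), fun z hz => ?_⟩
  · have := norm_nonneg (z - x); linarith
  · have h2 : ‖z - x‖ ^ (5 / 4 : ℝ) ≤ R ^ (1 / 4 : ℝ) * ‖z - x‖ := by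
      rcases (norm_nonneg (z - x)).eq_or_lt with he | hz0
      · rw [← he, Real.zero_rpow (by norm_num), mul_zero]
      rw [show (5 / 4 : ℝ) = 1 / 4 + 1 by norm_num, Real.rpow_add hz0, Real.rpow_one]
      gcongr
      rw [norm_sub_rev]
      exact hR x (Metric.mem_closedBall_self zero_le_one) z hz
    refine le_trans ?_ (hh z hz)
    calc _ ≤ (6 * R ^ (1 / 4 : ℝ))⁻¹ * (R ^ (1 / 4 : ℝ) * ‖z - x‖) := by gcongr
      _ = ‖z - x‖ / 6 := by field_simp
      _ ≤ _ := by linarith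

variable {ψ : E3 → ℂ} (hψ : AEStronglyMeasurable ψ (surfaceMeasure G.surface)) {B : ℝ}
  (hB : ∀ z ∈ G.surface, ‖ψ z‖ ≤ B)
include hψ hB

omit hψ in
/-- Growth of the gradient of a single layer potential near the surface. -/
lemma exists_gradPot_le (k : ℝ) (x : E3) : ∃ K : ℝ, 0 ≤ K ∧ ∀ w ∈ Metric.closedBall x 1, ∀ δ : ℝ, 0 < δ →
    (∀ z ∈ G.surface, δ ≤ ‖w - z‖) →
    ‖p.gradPot k (surfaceMeasure G.surface) ψ w‖ ≤ K * δ ^ (-(1 / 10) : ℝ) := by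
  have hS := p.S_pos
  obtain ⟨A, hA, hreg⟩ := G.exists_upperRegular
  obtain ⟨R, hR0, hR⟩ := G.exists_dist_upper x
  obtain ⟨C, hC0, hC⟩ := p.exists_kernel_bounds k R
  -- The kernel derivative has the borderline exponent two. Sacrificing `δ ^ (-1/10)` leaves the
  -- integrable exponent `19/10`.
  obtain ⟨C₁, hC₁0, hC₁⟩ := hreg.exists_integral_rpow_le hA (γ := 19 / 10) (by norm_num) (by norm_num)
  refine ⟨(1 + p.S) * (C * |B| * C₁), by positivity, fun w hw δ hδ hwz => ?_⟩
  refine (pi_norm_le_iff_of_nonneg (by positivity)).2 fun l => ?_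
  have hint : ‖∫ z, p.dPhi k l w z * ψ z ∂(surfaceMeasure G.surface)‖ ≤ C * |B| * δ ^ (-(1 / 10) : ℝ) * C₁ := by
    refine (norm_integral_le_of_norm_le ((hC₁ w).1.const_mul (C * |B| * δ ^ (-(1 / 10) : ℝ))) ?_).trans ?_
    · filter_upwards [G.ae_mem_surface] with z hz
      have h1 := hwz z hz
      have h2 : 0 < ‖w - z‖ := hδ.trans_le h1
      have h3 := (hC w z (sub_ne_zero.1 (norm_pos_iff.1 h2)) (hR w hw z hz)).2.1 l
      have h4 : (‖w - z‖ ^ 2)⁻¹ ≤ δ ^ (-(1 / 10) : ℝ) * ‖w - z‖ ^ (-(19 / 10) : ℝ) := by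
        calc (‖w - z‖ ^ 2)⁻¹ = ‖w - z‖ ^ (-(1 / 10) : ℝ) * ‖w - z‖ ^ (-(19 / 10) : ℝ) := by
              rw [← Real.rpow_add h2, ← Real.rpow_natCast, ← Real.rpow_neg h2.le]; norm_num
          _ ≤ _ := by
            gcongr ?_ * _
            exact Real.rpow_le_rpow_of_nonpos hδ h1 (by norm_num)
      rw [norm_mul]
      have h5 := (hB z hz).trans (le_abs_self B)
      calc _ ≤ C * (δ ^ (-(1 / 10) : ℝ) * ‖w - z‖ ^ (-(19 / 10) : ℝ)) * |B| := by
            gcongr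
            exact h3.trans (by gcongr)
        _ = _ := by ring
    · rw [integral_const_mul]
      have := (hC₁ w).2
      gcongr
  rw [PML.gradPot, norm_mul]
  have := p.norm_alpha_le w l
  calc _ ≤ (1 + p.S) * (C * |B| * δ ^ (-(1 / 10) : ℝ) * C₁) := by gcongr
    _ = _ := by ring

/-- Hölder continuity of the single layer potential. -/
lemma exists_potential_sub_le (k : ℝ) (x : E3) : ∃ K : ℝ, 0 ≤ K ∧ ∀ w ∈ Metric.closedBall x 1, ∀ v ∈ Metric.closedBall x 1,
    ‖p.scalPotential k G.surface ψ w - p.scalPotential k G.surface ψ v‖ ≤ K * ‖w - v‖ ^ (9 / 10 : ℝ) := by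
  obtain ⟨A, hA, hreg⟩ := G.exists_upperRegular
  obtain ⟨R, hR0, hR⟩ := G.exists_dist_upper x
  obtain ⟨C, hC0, hC⟩ := p.exists_Phi_sub_le k R (a := 9 / 10) (by norm_num) (by norm_num)
  obtain ⟨C₁, hC₁0, hC₁⟩ := hreg.exists_integral_rpow_le hA (γ := 1 + 9 / 10) (by norm_num) (by norm_num)
  have hBae : ∀ᵐ z ∂(surfaceMeasure G.surface), ‖ψ z‖ ≤ B := G.ae_mem_surface.mono hB
  refine ⟨C * |B| * (2 * C₁), by positivity, fun w hw v hv => ?_⟩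
  rw [PML.scalPotential, PML.scalPotential,
    ← integral_sub (G.integrable_Phi_mul hψ hBae k w) (G.integrable_Phi_mul hψ hBae k v)]
  refine (norm_integral_le_of_norm_le (((hC₁ w).1.add (hC₁ v).1).const_mul (C * |B| * ‖w - v‖ ^ (9 / 10 : ℝ))) ?_).trans ?_
  · filter_upwards [G.ae_mem_surface, hreg.ae_ne w, hreg.ae_ne v] with z hz hzw hzv
    rw [← sub_mul, norm_mul]
    have h1 := hC w v z hzw.symm hzv.symm (hR w hw z hz) (hR v hv z hz)
    have h5 := (hB z hz).trans (le_abs_self B)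
    calc _ ≤ C * ‖w - v‖ ^ (9 / 10 : ℝ) * (‖w - z‖ ^ (-(1 + 9 / 10 : ℝ)) + ‖v - z‖ ^ (-(1 + 9 / 10 : ℝ))) * |B| := by
          gcongr
      _ = _ := by simp only [Pi.add_apply]; ring
  · rw [integral_const_mul, integral_add' (hC₁ w).1 (hC₁ v).1]
    have h1 := (hC₁ w).2
    have h2 := (hC₁ v).2
    calc _ ≤ C * |B| * ‖w - v‖ ^ (9 / 10 : ℝ) * (C₁ + C₁) := by gcongr
      _ = _ := by ring

/-- A single layer potential whose tangential gradient has a limit along the approach regions. -/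
theorem firstOrderAt_of_tendsto_tangPart {x : E3} (hx : x ∈ G.surface) {s : ℝ} (hs : s = 1 ∨ s = -1) (k : ℝ)
    (hlim : ∀ c : ℝ, 0 < c → ∃ g : C3,
      Tendsto (fun w => tangPart (G.ν x) (p.gradPot k (surfaceMeasure G.surface) ψ w))
        (𝓝[G.approachRegion x c] x) (𝓝 g)) : G.FirstOrderAt k s ψ x := by
  intro ε hε
  set μ := surfaceMeasure G.surface with hμ
  have hBae : ∀ᵐ z ∂μ, ‖ψ z‖ ≤ B := G.ae_mem_surface.mono hB
  obtain ⟨K, hK0, hK⟩ := G.exists_gradPot_le hB k x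
  obtain ⟨H, hH0, hH⟩ := G.exists_potential_sub_le hψ hB k x
  obtain ⟨D, hD0, hD⟩ := G.isSurface_surface.exists_abs_inner_le hx
  obtain ⟨c₁, hc₁, hseg⟩ := G.isSurface_surface.exists_segment_le G.isBounded_surface hx hs
  obtain ⟨c₂, hc₂, hnor⟩ := G.exists_normal_mem_approachRegion hx hs
  -- One aperture for both the shifted segment and the normal line; the bound `1 / 6` also keeps `v`
  -- at distance `c * d` from the surface.
  set c := min (min c₁ c₂) (1 / 6) with hc
  have hc0 : 0 < c := by positivity
  have hcc₁ : c ≤ c₁ := (min_le_left _ _).trans (min_le_left _ _)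
  have hcc₂ : c ≤ c₂ := (min_le_left _ _).trans (min_le_right _ _)
  have hcc₃ : c ≤ 1 / 6 := min_le_right _ _
  obtain ⟨g, hg⟩ := hlim c hc0
  set n := G.ν x with hn
  have hnn : ‖n‖ = 1 := G.isSurface_surface.norm_ν hx
  set T : E3 → C3 := fun w => tangPart n (p.gradPot k μ ψ w) with hT
  obtain ⟨δ, hδ, hTδ⟩ : ∃ δ > 0, ∀ w ∈ G.approachRegion x c, ‖w - x‖ < δ → ‖T w - g‖ ≤ ε / 24 := by
    obtain ⟨δ, hδ, h⟩ := Metric.tendsto_nhdsWithin_nhds.1 hg (ε / 24) (by positivity)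
    refine ⟨δ, hδ, fun w hw hwx => ?_⟩
    have := h hw (by rwa [dist_eq_norm])
    rw [dist_eq_norm] at this
    exact this.le
  have hpow : ∀ (C a : ℝ), 1 < a → ∀ ε' : ℝ, 0 < ε' → ∀ᶠ h in 𝓝[>] (0 : ℝ), C * h ^ a ≤ ε' * h := by
    intro C a ha ε' hε'
    have : Tendsto (fun h : ℝ => C * h ^ (a - 1)) (𝓝 0) (𝓝 (C * 0 ^ (a - 1))) :=
      ContinuousAt.tendsto (ContinuousAt.mul (by fun_prop) (Real.continuousAt_rpow_const _ _ (Or.inr (by linarith))))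
    rw [Real.zero_rpow (by linarith), mul_zero] at this
    filter_upwards [(this.mono_left nhdsWithin_le_nhds).eventually (gt_mem_nhds hε'), self_mem_nhdsWithin] with h h1 h2
    rw [mem_Ioi] at h2
    calc C * h ^ a = C * h ^ (a - 1) * h := by
          nth_rewrite 3 [← Real.rpow_one h]
          rw [mul_assoc, ← Real.rpow_add h2]; simp
      _ ≤ _ := by gcongr
  filter_upwards [hseg, hnor c hcc₂, G.isSurface_surface.exists_normal_le hx hs, hpow H (9 / 8) (by norm_num) (ε / 4) (by positivity),
    hpow (3 * K * c ^ (-(1 / 10) : ℝ) * D) (15 / 8) (by norm_num) (ε / 8) (by positivity), self_mem_nhdsWithin,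
    nhdsWithin_le_nhds (gt_mem_nhds (show (0 : ℝ) < 1 / 2 by norm_num)),
    nhdsWithin_le_nhds (gt_mem_nhds (show 0 < δ / 2 by positivity))] with h hseg hnor hnorl hsm1 hsm2 h0 hh1 hhδ y hy hyx
  rw [mem_Ioi] at h0
  -- The lift has two opposing demands. The Hölder exponent `9/10` makes the shift cost `d ^ (9/10)
  -- = h ^ (9/8) = o(h)`, while `d` is large enough for the segment to stay in the approach region.
  -- The normal gradient, of size `d ^ (-1/10) = h ^ (-1/8)`, meets `ν · (y - x) = O(h ^ 2)` and
  -- gives `h ^ (15/8)`.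
  set d := h ^ (5 / 4 : ℝ) with hd
  have hd0 : 0 < d := by positivity
  have hdh : d ≤ h := by
    have := Real.rpow_le_rpow_of_exponent_ge h0 (show h ≤ 1 by linarith) (show (1 : ℝ) ≤ 5 / 4 by norm_num)
    rwa [Real.rpow_one] at this
  have hsh : ∀ t : ℝ, 0 < t → ‖(s * t) • n‖ = t := fun t ht => by
    rw [norm_smul, hnn, mul_one, Real.norm_eq_abs, abs_mul]
    rcases hs with rfl | rfl <;> simp [abs_of_pos ht]
  set v := x + (s * h) • n with hv
  have hvx : ‖v - x‖ = h := by rw [hv, add_sub_cancel_left, hsh h h0]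
  set γ : ℝ → E3 := fun θ => x + θ • (y - x) + (s * d) • n with hγ
  have hγx : ∀ θ ∈ Icc (0 : ℝ) 1, ‖γ θ - x‖ ≤ 2 * h := fun θ hθ => by
    have e : γ θ - x = θ • (y - x) + (s * d) • n := by simp only [hγ]; abel
    rw [e]
    refine (norm_add_le _ _).trans ?_
    rw [hsh d hd0, norm_smul, Real.norm_eq_abs, abs_of_nonneg hθ.1]
    have : θ * ‖y - x‖ ≤ 1 * h := by gcongr; exact hθ.2
    linarith
  have hγb : ∀ θ ∈ Icc (0 : ℝ) 1, γ θ ∈ Metric.closedBall x 1 := fun θ hθ => by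
    rw [Metric.mem_closedBall, dist_eq_norm]; linarith [hγx θ hθ]
  have hvb : v ∈ Metric.closedBall x 1 := by rw [Metric.mem_closedBall, dist_eq_norm]; linarith
  have hγD : ∀ θ ∈ Icc (0 : ℝ) 1, ∀ z ∈ G.surface, c * d ≤ ‖γ θ - z‖ := fun θ hθ z hz =>
    le_trans (by gcongr) (hseg y hy hyx θ hθ z hz).1
  have hvD : ∀ z ∈ G.surface, c * d ≤ ‖v - z‖ := fun z hz => by
    refine le_trans ?_ (hnorl z hz)
    have := norm_nonneg (z - x)
    have : c * d ≤ 1 / 6 * h := by gcongr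
    linarith
  have hγa : ∀ θ ∈ Icc (0 : ℝ) 1, γ θ ∈ G.approachRegion x c := fun θ hθ =>
    ⟨notMem_closure_of_le (by positivity) (hγD θ hθ), fun z hz =>
      le_trans (by gcongr) (hseg y hy hyx θ hθ z hz).2⟩
  have hinner : |inner ℝ n (y - x)| ≤ D * h ^ 2 := (hD y hy).trans (by gcongr)
  have hnormal : ∀ w ∈ Metric.closedBall x 1, (∀ z ∈ G.surface, c * d ≤ ‖w - z‖) →
      ‖(toC3 n ⬝ᵥ p.gradPot k μ ψ w) * ((inner ℝ n (y - x) : ℝ) : ℂ)‖ ≤ ε / 8 * h := fun w hw hwz => by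
    rw [norm_mul, Complex.norm_real, Real.norm_eq_abs]
    have h1 : ‖toC3 n ⬝ᵥ p.gradPot k μ ψ w‖ ≤ 3 * (1 * (K * (c * d) ^ (-(1 / 10) : ℝ))) := by
      refine (norm_dotProduct_le _ _).trans ?_
      gcongr
      · exact (norm_toC3_le n).trans hnn.le
      · exact hK w hw (c * d) (by positivity) hwz
    calc _ ≤ 3 * (1 * (K * (c * d) ^ (-(1 / 10) : ℝ))) * (D * h ^ 2) := by gcongr
      _ = 3 * K * c ^ (-(1 / 10) : ℝ) * D * h ^ (15 / 8 : ℝ) := by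
        have e : d ^ (-(1 / 10) : ℝ) * h ^ 2 = h ^ (15 / 8 : ℝ) := by
          rw [hd, ← Real.rpow_mul h0.le, ← Real.rpow_natCast, ← Real.rpow_add h0]; norm_num
        rw [Real.mul_rpow hc0.le hd0.le, ← e]
        ring
      _ ≤ _ := hsm2
  have htan : ∀ w ∈ G.approachRegion x c, ‖w - x‖ < δ → ‖(T w - g) ⬝ᵥ toC3 (y - x)‖ ≤ ε / 8 * h := fun w hw hwx => by
    refine (norm_dotProduct_le _ _).trans ?_
    have h1 := hTδ w hw hwx
    have h2 := (norm_toC3_le (y - x)).trans hyx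
    calc _ ≤ 3 * (ε / 24 * h) := by gcongr
      _ = _ := by ring
  -- The tangential gradients at `γ θ` and at `v` are both close to `g`, and the normal parts are
  -- negligible against `y - x`.
  have hdiff : ∀ θ ∈ Icc (0 : ℝ) 1, ‖dotCLM (p.gradPot k μ ψ (γ θ)) (y - x) - dotCLM (p.gradPot k μ ψ v) (y - x)‖ ≤
      ε / 2 * h := fun θ hθ => by
    rw [dotCLM_eq_tangPart n, dotCLM_eq_tangPart n]
    have e : tangPart n (p.gradPot k μ ψ (γ θ)) ⬝ᵥ toC3 (y - x) +
          (toC3 n ⬝ᵥ p.gradPot k μ ψ (γ θ)) * ((inner ℝ n (y - x) : ℝ) : ℂ) -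
        (tangPart n (p.gradPot k μ ψ v) ⬝ᵥ toC3 (y - x) +
          (toC3 n ⬝ᵥ p.gradPot k μ ψ v) * ((inner ℝ n (y - x) : ℝ) : ℂ)) =
        ((T (γ θ) - g) ⬝ᵥ toC3 (y - x) - (T v - g) ⬝ᵥ toC3 (y - x)) +
        ((toC3 n ⬝ᵥ p.gradPot k μ ψ (γ θ)) * ((inner ℝ n (y - x) : ℝ) : ℂ) -
          (toC3 n ⬝ᵥ p.gradPot k μ ψ v) * ((inner ℝ n (y - x) : ℝ) : ℂ)) := by
      simp only [hT, sub_dotProduct]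
      ring
    rw [e]
    have a1 := htan (γ θ) (hγa θ hθ) (by linarith [hγx θ hθ])
    have a2 := htan v hnor (by linarith)
    have a3 := hnormal (γ θ) (hγb θ hθ) (hγD θ hθ)
    have a4 := hnormal v hvb hvD
    calc _ ≤ (ε / 8 * h + ε / 8 * h) + (ε / 8 * h + ε / 8 * h) :=
          (norm_add_le _ _).trans (add_le_add ((norm_sub_le _ _).trans (add_le_add a1 a2))
            ((norm_sub_le _ _).trans (add_le_add a3 a4)))
      _ = _ := by ring
  set U := p.scalPotential k G.surface ψ with hU
  -- Mean value inequality along the lifted segment, after subtracting the linear function with the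
  -- gradient frozen at `v`.
  have hmid : ‖U (γ 1) - U (γ 0) - dotCLM (p.gradPot k μ ψ v) (y - x)‖ ≤ ε / 2 * h := by
    have hUd : ∀ θ ∈ Icc (0 : ℝ) 1, HasDerivAt (fun θ : ℝ => U (γ θ) - θ • dotCLM (p.gradPot k μ ψ v) (y - x))
        (dotCLM (p.gradPot k μ ψ (γ θ)) (y - x) - dotCLM (p.gradPot k μ ψ v) (y - x)) θ := fun θ hθ => by
      have h1 : HasDerivAt γ (y - x) θ := by
        have := (((hasDerivAt_id θ).smul_const (y - x)).const_add x).add_const ((s * d) • n)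
        rw [one_smul] at this
        exact this
      have h2 : HasFDerivAt U (dotCLM (p.gradPot k μ ψ (γ θ))) (γ θ) :=
        p.hasFDerivAt_pot G.isBounded_surface G.ae_mem_surface hψ hBae k (hγa θ hθ).1
      have h3 := h2.comp_hasDerivAt θ h1
      have h4 := (hasDerivAt_id θ).smul_const (dotCLM (p.gradPot k μ ψ v) (y - x))
      have h5 := h3.sub h4
      rw [one_smul] at h5
      exact h5
    have := norm_image_sub_le_of_norm_deriv_le_segment_01' (fun θ hθ => (hUd θ hθ).hasDerivWithinAt)
      (fun θ hθ => hdiff θ (Ico_subset_Icc_self hθ))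
    simp only [one_smul, zero_smul, sub_zero] at this
    rwa [sub_right_comm] at this
  have hpd : ∀ w, w ∈ Metric.closedBall x 1 → w + (s * d) • n ∈ Metric.closedBall x 1 →
      ‖U (w + (s * d) • n) - U w‖ ≤ ε / 4 * h := fun w hw hw' => by
    refine (hH _ hw' _ hw).trans ?_
    rw [add_sub_cancel_left, hsh d hd0, hd, ← Real.rpow_mul h0.le]
    norm_num at hsm1 ⊢
    exact hsm1
  have e1 : γ 1 = y + (s * d) • n := by simp only [hγ, one_smul]; abel
  have e0 : γ 0 = x + (s * d) • n := by simp only [hγ, zero_smul, add_zero]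
  have hyb : y ∈ Metric.closedBall x 1 := by rw [Metric.mem_closedBall, dist_eq_norm]; linarith
  have b1 := hpd y hyb (e1 ▸ hγb 1 (by simp))
  have b0 := hpd x (Metric.mem_closedBall_self zero_le_one) (e0 ▸ hγb 0 (by simp))
  rw [← e1] at b1
  rw [← e0] at b0
  have e : U y - U x - dotCLM (p.gradPot k μ ψ v) (y - x) =
      (U (γ 1) - U (γ 0) - dotCLM (p.gradPot k μ ψ v) (y - x)) - (U (γ 1) - U y) + (U (γ 0) - U x) := by ring
  rw [e]
  calc _ ≤ ε / 2 * h + ε / 4 * h + ε / 4 * h :=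
        (norm_add_le _ _).trans (add_le_add ((norm_sub_le _ _).trans (add_le_add hmid b1)) b0)
    _ = _ := by ring

end LayeredGeometry
end

noncomputable section

/-! ### The surface curl as a limit along the normal -/

namespace LayeredGeometry
variable {p : PML} (G : LayeredGeometry p)

lemma gradPot_add {ψ₁ ψ₂ : E3 → ℂ} (h₁ : AEStronglyMeasurable ψ₁ (surfaceMeasure G.surface))
    (h₂ : AEStronglyMeasurable ψ₂ (surfaceMeasure G.surface)) {B₁ B₂ : ℝ} (hB₁ : ∀ z ∈ G.surface, ‖ψ₁ z‖ ≤ B₁)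
    (hB₂ : ∀ z ∈ G.surface, ‖ψ₂ z‖ ≤ B₂) (k : ℝ) {w : E3} (hw : w ∉ closure G.surface) :
    p.gradPot k (surfaceMeasure G.surface) (ψ₁ + ψ₂) w =
      p.gradPot k (surfaceMeasure G.surface) ψ₁ w + p.gradPot k (surfaceMeasure G.surface) ψ₂ w := by
  obtain ⟨δ, hδ, hδM⟩ := exists_dist_lower hw
  have i := fun {ψ : E3 → ℂ} h {B : ℝ} (hB : ∀ z ∈ G.surface, ‖ψ z‖ ≤ B) l =>
    G.integrable_dPhi_mul_off (g := ψ) h (G.ae_mem_surface.mono hB) k l hδ (hδM w (Metric.mem_ball_self hδ))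
  funext l
  simp only [PML.gradPot, Pi.add_apply, mul_add]
  rw [integral_add (i h₁ hB₁ l) (i h₂ hB₂ l), mul_add]

lemma gradPot_const_mul (a : ℂ) (ψ : E3 → ℂ) (k : ℝ) (w : E3) :
    p.gradPot k (surfaceMeasure G.surface) (fun z => a * ψ z) w = a • p.gradPot k (surfaceMeasure G.surface) ψ w := by
  funext l
  simp only [PML.gradPot, Pi.smul_apply, smul_eq_mul, mul_left_comm _ a, integral_const_mul]

lemma scalPotential_const_mul (a : ℂ) (ψ : E3 → ℂ) (k : ℝ) (w : E3) :
    p.scalPotential k G.surface (fun z => a * ψ z) w = a * p.scalPotential k G.surface ψ w := by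
  simp only [PML.scalPotential, mul_left_comm _ a, integral_const_mul]

lemma scalPotential_add {ψ₁ ψ₂ : E3 → ℂ} (h₁ : AEStronglyMeasurable ψ₁ (surfaceMeasure G.surface))
    (h₂ : AEStronglyMeasurable ψ₂ (surfaceMeasure G.surface)) {B₁ B₂ : ℝ} (hB₁ : ∀ z ∈ G.surface, ‖ψ₁ z‖ ≤ B₁)
    (hB₂ : ∀ z ∈ G.surface, ‖ψ₂ z‖ ≤ B₂) (k : ℝ) (w : E3) :
    p.scalPotential k G.surface (ψ₁ + ψ₂) w =
      p.scalPotential k G.surface ψ₁ w + p.scalPotential k G.surface ψ₂ w := by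
  simp only [PML.scalPotential, Pi.add_apply, mul_add]
  exact integral_add (G.integrable_Phi_mul h₁ (G.ae_mem_surface.mono hB₁) k w)
    (G.integrable_Phi_mul h₂ (G.ae_mem_surface.mono hB₂) k w)

lemma dotCLM_smul (a : ℂ) (v : C3) (t : E3) : dotCLM (a • v) t = a * dotCLM v t := by
  rw [dotCLM_apply, dotCLM_apply, smul_dotProduct, smul_eq_mul]

lemma dotCLM_add (v w : C3) (t : E3) : dotCLM (v + w) t = dotCLM v t + dotCLM w t := by
  rw [dotCLM_apply, dotCLM_apply, dotCLM_apply, add_dotProduct]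

lemma FirstOrderAt.const_mul {G : LayeredGeometry p} {k s : ℝ} {ψ : E3 → ℂ} {x : E3} (h : G.FirstOrderAt k s ψ x) (a : ℂ) :
    G.FirstOrderAt k s (fun z => a * ψ z) x := fun ε hε => by
  filter_upwards [h (ε / (‖a‖ + 1)) (by positivity), self_mem_nhdsWithin] with r hr hr0 y hy hyx
  rw [mem_Ioi] at hr0
  rw [G.scalPotential_const_mul, G.scalPotential_const_mul, G.gradPot_const_mul, dotCLM_smul, ← mul_sub, ← mul_sub, norm_mul]
  calc _ ≤ ‖a‖ * (ε / (‖a‖ + 1) * r) := by gcongr; exact hr y hy hyx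
    _ = ‖a‖ / (‖a‖ + 1) * (ε * r) := by ring
    _ ≤ 1 * (ε * r) := by
      gcongr
      rw [div_le_one (by positivity)]
      linarith
    _ = _ := one_mul _

lemma eventually_notMem_closure {x : E3} (hx : x ∈ G.surface) {s : ℝ} (hs : s = 1 ∨ s = -1) :
    ∀ᶠ h in 𝓝[>] (0 : ℝ), x + (s * h) • G.ν x ∉ closure G.surface := by
  obtain ⟨c, -, h⟩ := G.exists_normal_mem_approachRegion hx hs
  exact (h c le_rfl).mono fun r hr => hr.1

lemma FirstOrderAt.add {G : LayeredGeometry p} {k s : ℝ} (hs : s = 1 ∨ s = -1) {x : E3} (hx : x ∈ G.surface) {ψ₁ ψ₂ : E3 → ℂ}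
    (m₁ : AEStronglyMeasurable ψ₁ (surfaceMeasure G.surface))
    (m₂ : AEStronglyMeasurable ψ₂ (surfaceMeasure G.surface)) {B₁ B₂ : ℝ} (hB₁ : ∀ z ∈ G.surface, ‖ψ₁ z‖ ≤ B₁)
    (hB₂ : ∀ z ∈ G.surface, ‖ψ₂ z‖ ≤ B₂)
    (h₁ : G.FirstOrderAt k s ψ₁ x) (h₂ : G.FirstOrderAt k s ψ₂ x) : G.FirstOrderAt k s (ψ₁ + ψ₂) x := fun ε hε => by
  filter_upwards [h₁ (ε / 2) (by positivity), h₂ (ε / 2) (by positivity), G.eventually_notMem_closure hx hs]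
    with r hr₁ hr₂ hr y hy hyx
  rw [G.scalPotential_add m₁ m₂ hB₁ hB₂, G.scalPotential_add m₁ m₂ hB₁ hB₂, G.gradPot_add m₁ m₂ hB₁ hB₂ k hr, dotCLM_add]
  refine le_trans (le_of_eq ?_) ((norm_add_le _ _).trans (add_le_add (hr₁ y hy hyx) (hr₂ y hy hyx)) |>.trans
    (le_of_eq ?_))
  · congr 1; ring
  · ring

/-- The decomposition of a continuous density into a multiple of a cutoff function and a density that
vanishes at the given point. -/
lemma exists_decomposition {x : E3} (hx : x ∈ G.surface) {ψ : E3 → ℂ} (hψ : ContinuousOn ψ G.surface) {B : ℝ}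
    (hB : ∀ z ∈ G.surface, ‖ψ z‖ ≤ B) (k : ℝ) : ∃ χ : E3 → ℝ, ContDiff ℝ 1 χ ∧ χ x = 1 ∧
    (∀ z, ‖((χ z : ℝ) : ℂ)‖ ≤ 1) ∧ (∀ c : ℝ, 0 < c → ∃ g : C3,
      Tendsto (fun w => tangPart (G.ν x) (p.gradPot k (surfaceMeasure G.surface) (fun z => (χ z : ℂ)) w))
        (𝓝[G.approachRegion x c] x) (𝓝 g)) ∧
    AEStronglyMeasurable (fun z => ψ z - ψ x * (χ z : ℂ)) (surfaceMeasure G.surface) ∧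
    (∀ z ∈ G.surface, ‖ψ z - ψ x * (χ z : ℂ)‖ ≤ 2 * B) ∧
    Tendsto (fun z => ψ z - ψ x * (χ z : ℂ)) (𝓝[G.surface] x) (𝓝 0) := by
  obtain ⟨χ, hχ, hχx, hχn, hlim⟩ := G.exists_tendsto_tangPart_gradPot k hx
  have hcont : ContinuousOn (fun z => ψ z - ψ x * (χ z : ℂ)) G.surface :=
    hψ.sub (continuous_const.mul (Complex.continuous_ofReal.comp hχ.continuous)).continuousOn
  refine ⟨χ, hχ, hχx, hχn, hlim, G.aestronglyMeasurable_of_continuousOn hcont, fun z hz => ?_, ?_⟩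
  · refine (norm_sub_le _ _).trans ?_
    rw [norm_mul]
    have h1 := hB z hz
    have h2 := hB x hx
    have h3 := hχn z
    have : ‖ψ x‖ * ‖((χ z : ℝ) : ℂ)‖ ≤ B * 1 := by
      have := (norm_nonneg _).trans h2
      gcongr
    linarith
  · have := hcont x hx
    rw [ContinuousWithinAt, hχx] at this
    simpa using this

/-- First-order expansion of the single layer potential with a continuous density. -/
theorem firstOrderAt {x : E3} (hx : x ∈ G.surface) {s : ℝ} (hs : s = 1 ∨ s = -1) (k : ℝ) {ψ : E3 → ℂ}
    (hψ : ContinuousOn ψ G.surface) {B : ℝ} (hB : ∀ z ∈ G.surface, ‖ψ z‖ ≤ B) : G.FirstOrderAt k s ψ x := by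
  obtain ⟨χ, hχ, hχx, hχn, hlim, hm, hb, h0⟩ := G.exists_decomposition hx hψ hB k
  have hχc : Continuous fun z => ((χ z : ℝ) : ℂ) := Complex.continuous_ofReal.comp hχ.continuous
  have h1 := G.firstOrderAt_of_tendsto_zero hx hs k hm hb h0
  have h2 := (G.firstOrderAt_of_tendsto_tangPart hχc.aestronglyMeasurable (fun z _ => hχn z) hx hs k hlim).const_mul (ψ x)
  have h3 := FirstOrderAt.add hs hx hm (hχc.const_mul (ψ x) : Continuous fun z => ψ x * ((χ z : ℝ) : ℂ)).aestronglyMeasurable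
    hb (B₂ := ‖ψ x‖ * 1) (fun z _ => by rw [norm_mul]; gcongr; exact hχn z) h1 h2
  have e : (fun z => ψ z - ψ x * (χ z : ℂ)) + (fun z => ψ x * (χ z : ℂ)) = ψ := by
    funext z; simp
  rwa [e] at h3

end LayeredGeometry

/-- The tangent vector `e_l × n`. -/
def tangentOf (n : E3) : Fin 3 → E3 := ![!₂[0, -n 2, n 1], !₂[n 2, 0, -n 0], !₂[-n 1, n 0, 0]]

/-- The components of a cross product with `n` are values of a functional on vectors orthogonal to
`n`, so its convergence is convergence in tangent directions. -/
lemma cross_apply_eq_dotCLM (n : E3) (w : C3) (l : Fin 3) : (toC3 n ⨯₃ w) l = dotCLM w (tangentOf n l) := by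
  rw [dotCLM_apply, cross_apply]
  fin_cases l <;> simp [tangentOf, toC3, dotProduct, Fin.sum_univ_three] <;> ring

lemma inner_tangentOf (n : E3) (l : Fin 3) : inner ℝ n (tangentOf n l) = 0 := by
  rw [PiLp.inner_apply]
  fin_cases l <;> simp [tangentOf, Fin.sum_univ_three] <;> ring

lemma toC3_dotProduct_self {n : E3} (hn : ‖n‖ = 1) : toC3 n ⬝ᵥ toC3 n = 1 := by
  rw [toC3_dotProduct, real_inner_self_eq_norm_sq, hn]; simp

/-- Allows the tangential part to be recovered from the rotated gradient, so that both converge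
together. -/
lemma cross_cross_eq_tangPart {n : E3} (hn : ‖n‖ = 1) (v : C3) : -(toC3 n ⨯₃ (toC3 n ⨯₃ v)) = tangPart n v := by
  have h1 := toC3_dotProduct_self hn
  simp only [dotProduct, Fin.sum_univ_three] at h1
  rw [tangPart, cross_apply, cross_apply]
  funext l
  simp only [Pi.neg_apply, Pi.sub_apply, Pi.smul_apply, dotProduct, Fin.sum_univ_three, smul_eq_mul]
  fin_cases l
  · simp; linear_combination (v 0) * h1
  · simp; linear_combination (v 1) * h1
  · simp; linear_combination (v 2) * h1

lemma cross_tangPart (n : E3) (v : C3) : toC3 n ⨯₃ tangPart n v = toC3 n ⨯₃ v := by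
  rw [tangPart, map_sub, map_smul, cross_self, smul_zero, sub_zero]

lemma continuous_cross (n : C3) : Continuous fun v : C3 => n ⨯₃ v :=
  LinearMap.continuous_of_finiteDimensional (crossProduct n)

namespace LayeredGeometry
variable {p : PML} (G : LayeredGeometry p)

lemma eventually_gradPot_le {x : E3} (hx : x ∈ G.surface) {s : ℝ} (hs : s = 1 ∨ s = -1) (k : ℝ) {ψ : E3 → ℂ} {B : ℝ}
    (hB : ∀ z ∈ G.surface, ‖ψ z‖ ≤ B) : ∃ K : ℝ, 0 ≤ K ∧ ∀ᶠ h in 𝓝[>] (0 : ℝ),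
      ‖p.gradPot k (surfaceMeasure G.surface) ψ (x + (s * h) • G.ν x)‖ ≤ K * h ^ (-(1 / 10) : ℝ) := by
  obtain ⟨K, hK0, hK⟩ := G.exists_gradPot_le hB k x
  refine ⟨K * (6⁻¹) ^ (-(1 / 10) : ℝ), by positivity, ?_⟩
  filter_upwards [G.isSurface_surface.exists_normal_le hx hs, self_mem_nhdsWithin,
    nhdsWithin_le_nhds (gt_mem_nhds one_pos)] with h hh h0 h1
  rw [mem_Ioi] at h0
  refine (hK _ ?_ (6⁻¹ * h) (by positivity) fun z hz => le_trans ?_ (hh z hz)).trans ?_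
  · rw [Metric.mem_closedBall, dist_eq_norm, add_sub_cancel_left, norm_smul, G.isSurface_surface.norm_ν hx, mul_one,
      Real.norm_eq_abs, abs_mul]
    rcases hs with rfl | rfl <;> simp [abs_of_pos h0, h1.le]
  · have := norm_nonneg (z - x); linarith
  · rw [Real.mul_rpow (by norm_num) h0.le, mul_assoc]

lemma eventually_mul_rpow_le (C a : ℝ) (ha : 1 < a) {ε : ℝ} (hε : 0 < ε) :
    ∀ᶠ h in 𝓝[>] (0 : ℝ), C * h ^ a ≤ ε * h := by
  have : Tendsto (fun h : ℝ => C * h ^ (a - 1)) (𝓝 0) (𝓝 (C * 0 ^ (a - 1))) :=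
    ContinuousAt.tendsto (ContinuousAt.mul (by fun_prop) (Real.continuousAt_rpow_const _ _ (Or.inr (by linarith))))
  rw [Real.zero_rpow (by linarith), mul_zero] at this
  filter_upwards [(this.mono_left nhdsWithin_le_nhds).eventually (gt_mem_nhds hε), self_mem_nhdsWithin] with h h1 h2
  rw [mem_Ioi] at h2
  calc C * h ^ a = C * h ^ (a - 1) * h := by
        nth_rewrite 3 [← Real.rpow_one h]
        rw [mul_assoc, ← Real.rpow_add h2]; simp
    _ ≤ _ := by gcongr

variable {x : E3} (hx : x ∈ G.surface) {s : ℝ} (hs : s = 1 ∨ s = -1) {k : ℝ} {ψ : E3 → ℂ}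
  {B : ℝ} (hB : ∀ z ∈ G.surface, ‖ψ z‖ ≤ B) (hfo : G.FirstOrderAt k s ψ x)
include hx hs hB hfo

/-- A second rotation turns the hypothesis into convergence of the tangential gradient to `g`. In
the first-order expansion the frozen gradient may then be replaced by `g`, since its normal part
contributes only `h ^ (-1/10) * h ^ 2`. -/
lemma hasSurfaceCurlAt_of_tendsto {c : C3}
    (hlim : Tendsto (fun h : ℝ => toC3 (G.ν x) ⨯₃ p.gradPot k (surfaceMeasure G.surface) ψ (x + (s * h) • G.ν x))
      (𝓝[>] 0) (𝓝 c)) : HasSurfaceCurlAt G.surface G.ν (p.scalPotential k G.surface ψ) c x := by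
  obtain ⟨K, hK0, hK⟩ := G.eventually_gradPot_le hx hs k hB
  obtain ⟨D, hD0, hD⟩ := G.isSurface_surface.exists_abs_inner_le hx
  set n := G.ν x with hn
  have hnn : ‖n‖ = 1 := G.isSurface_surface.norm_ν hx
  set V : ℝ → C3 := fun h => p.gradPot k (surfaceMeasure G.surface) ψ (x + (s * h) • n) with hV
  set g : C3 := -(toC3 n ⨯₃ c) with hg
  have hc0 : toC3 n ⬝ᵥ c = 0 := by
    have h1 : Tendsto (fun h => toC3 n ⬝ᵥ (toC3 n ⨯₃ V h)) (𝓝[>] 0) (𝓝 (toC3 n ⬝ᵥ c)) :=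
      ((Continuous.tendsto (by unfold dotProduct; fun_prop : Continuous fun v : C3 => toC3 n ⬝ᵥ v) c).comp hlim)
    simp only [dot_self_cross] at h1
    exact tendsto_nhds_unique h1 tendsto_const_nhds
  have hT : Tendsto (fun h => tangPart n (V h)) (𝓝[>] 0) (𝓝 g) := by
    simp only [← cross_cross_eq_tangPart hnn]
    exact (((continuous_cross (toC3 n)).tendsto c).comp hlim).neg
  have hgc : toC3 n ⨯₃ g = c := by
    rw [hg, map_neg, cross_cross_eq_tangPart hnn, tangPart, hc0, zero_smul, sub_zero]
  refine ⟨dotCLM g, ?_, ?_⟩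
  · rw [hasFDerivWithinAt_iff_isLittleO, isLittleO_iff]
    intro ε hε
    -- The expansion is uniform over `‖y - x‖ ≤ h`; it is used with `h` equal to `‖y - x‖`.
    have key : ∀ᶠ h in 𝓝[>] (0 : ℝ), ∀ y ∈ G.surface, ‖y - x‖ = h →
        ‖p.scalPotential k G.surface ψ y - p.scalPotential k G.surface ψ x - dotCLM g (y - x)‖ ≤ ε * h := by
      have hTε : ∀ᶠ h in 𝓝[>] (0 : ℝ), ‖tangPart n (V h) - g‖ < ε / 9 := by
        have := (Metric.tendsto_nhds.1 hT) (ε / 9) (by positivity)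
        simpa only [dist_eq_norm] using this
      filter_upwards [hTε, hK, hfo (ε / 3) (by positivity),
        eventually_mul_rpow_le (3 * K * D) (19 / 10) (by norm_num) (show 0 < ε / 3 by positivity), self_mem_nhdsWithin]
        with h h1 h2 h3 h4 h0 y hy hyx
      rw [mem_Ioi] at h0
      have e : p.scalPotential k G.surface ψ y - p.scalPotential k G.surface ψ x - dotCLM g (y - x) =
          (p.scalPotential k G.surface ψ y - p.scalPotential k G.surface ψ x - dotCLM (V h) (y - x)) +
          (tangPart n (V h) - g) ⬝ᵥ toC3 (y - x) + (toC3 n ⬝ᵥ V h) * ((inner ℝ n (y - x) : ℝ) : ℂ) := by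
        rw [dotCLM_eq_tangPart n (V h), sub_dotProduct, dotCLM_apply]
        ring
      have b2 : ‖(tangPart n (V h) - g) ⬝ᵥ toC3 (y - x)‖ ≤ ε / 3 * h := by
        refine (norm_dotProduct_le _ _).trans ?_
        have := (norm_toC3_le (y - x)).trans hyx.le
        calc _ ≤ 3 * (ε / 9 * h) := by gcongr
          _ = _ := by ring
      have b3 : ‖(toC3 n ⬝ᵥ V h) * ((inner ℝ n (y - x) : ℝ) : ℂ)‖ ≤ ε / 3 * h := by
        rw [norm_mul, Complex.norm_real, Real.norm_eq_abs]
        have c1 : ‖toC3 n ⬝ᵥ V h‖ ≤ 3 * (1 * (K * h ^ (-(1 / 10) : ℝ))) := by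
          refine (norm_dotProduct_le _ _).trans ?_
          gcongr
          exact (norm_toC3_le n).trans hnn.le
        have c2 := hD y hy
        rw [hyx] at c2
        calc _ ≤ 3 * (1 * (K * h ^ (-(1 / 10) : ℝ))) * (D * h ^ 2) := by gcongr
          _ = 3 * K * D * h ^ (19 / 10 : ℝ) := by
            have : h ^ (-(1 / 10) : ℝ) * h ^ 2 = h ^ (19 / 10 : ℝ) := by
              rw [← Real.rpow_natCast, ← Real.rpow_add h0]; norm_num
            rw [← this]; ring
          _ ≤ _ := h4
      rw [e]
      calc _ ≤ ε / 3 * h + ε / 3 * h + ε / 3 * h :=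
            (norm_add_le _ _).trans (add_le_add ((norm_add_le _ _).trans (add_le_add (h3 y hy hyx.le) b2)) b3)
        _ = _ := by ring
    obtain ⟨δ, hδ, hkey⟩ := Metric.mem_nhdsWithin_iff.1 key
    filter_upwards [self_mem_nhdsWithin, nhdsWithin_le_nhds (Metric.ball_mem_nhds x hδ)] with y hy hyδ
    rw [Metric.mem_ball, dist_eq_norm] at hyδ
    rcases (norm_nonneg (y - x)).eq_or_lt with h0 | h0
    · have : y = x := sub_eq_zero.1 (norm_eq_zero.1 h0.symm)
      simp [this]
    · exact hkey ⟨by simpa [Metric.mem_ball] using hyδ, h0⟩ y hy rfl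
  · have : (fun l => dotCLM g (EuclideanSpace.single l 1)) = g := funext fun l => dotCLM_single g l
    rw [this, map_sub, map_smul, cross_self, smul_zero, sub_zero, hgc]

/-- The potential is followed along a curve in the surface with velocity `t`. Its increment is
computed both from the derivative `L` and from the expansion, and division by `h` compares the
frozen gradient with `L` in the direction `t`. -/
lemma tendsto_of_hasSurfaceCurlAt {c : C3}
    (h : HasSurfaceCurlAt G.surface G.ν (p.scalPotential k G.surface ψ) c x) :
    Tendsto (fun h : ℝ => toC3 (G.ν x) ⨯₃ p.gradPot k (surfaceMeasure G.surface) ψ (x + (s * h) • G.ν x))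
      (𝓝[>] 0) (𝓝 c) := by
  obtain ⟨L, hL, rfl⟩ := h
  obtain ⟨K, hK0, hK⟩ := G.eventually_gradPot_le hx hs k hB
  set n := G.ν x with hn
  set V : ℝ → C3 := fun h => p.gradPot k (surfaceMeasure G.surface) ψ (x + (s * h) • n) with hV
  set u := p.scalPotential k G.surface ψ with hu
  have hLe : ∀ t, dotCLM (fun l => L (EuclideanSpace.single l 1)) t = L t := fun t => by
    have : t = ∑ l, t l • EuclideanSpace.single l (1 : ℝ) := by
      ext i; fin_cases i <;> simp [Fin.sum_univ_three]
    conv_rhs => rw [this]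
    rw [map_sum, dotCLM_apply, dotProduct]
    refine Finset.sum_congr rfl fun l _ => ?_
    rw [map_smul, toC3, mul_comm]
    rfl
  -- convergence in the tangent directions of small length
  have small : ∀ t : E3, inner ℝ n t = 0 → ‖t‖ < 1 → Tendsto (fun h => dotCLM (V h) t) (𝓝[>] 0) (𝓝 (L t)) := by
    intro t ht ht1
    obtain ⟨D, y, hD0, hy⟩ := G.isSurface_surface.exists_curve hx ht
    -- The strict inequality `‖t‖ < 1` leaves room for the quadratic error of the curve, so that the
    -- expansion at scale `h` covers `y h`.
    have hyn : ∀ᶠ h in 𝓝[>] (0 : ℝ), ‖y h - x‖ ≤ h := by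
      filter_upwards [hy, eventually_mul_rpow_le D 2 (by norm_num) (show 0 < 1 - ‖t‖ by linarith), self_mem_nhdsWithin]
        with h h1 h2 h0
      rw [mem_Ioi] at h0
      have e : y h - x = (y h - x - h • t) + h • t := by abel
      rw [e]
      refine (norm_add_le _ _).trans ?_
      rw [norm_smul, Real.norm_eq_abs, abs_of_pos h0]
      rw [Real.rpow_two] at h2
      linarith [h1.2]
    rw [Metric.tendsto_nhds]
    intro ε hε
    have hyx : Tendsto y (𝓝[>] 0) (𝓝[G.surface] x) := by
      refine tendsto_nhdsWithin_iff.2 ⟨?_, hy.mono fun h hh => hh.1⟩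
      rw [tendsto_iff_norm_sub_tendsto_zero]
      refine squeeze_zero' (Eventually.of_forall fun _ => norm_nonneg _) hyn ?_
      exact tendsto_nhdsWithin_of_tendsto_nhds tendsto_id
    have hlit := hyx.eventually ((isLittleO_iff.1 (hasFDerivWithinAt_iff_isLittleO.1 hL)) (show 0 < ε / 5 by positivity))
    filter_upwards [hlit, hy, hyn, hK, hfo (ε / 5) (by positivity),
      eventually_mul_rpow_le (3 * K * D) (19 / 10) (by norm_num) (show 0 < ε / 5 by positivity),
      eventually_mul_rpow_le (‖L‖ * D) 2 (by norm_num) (show 0 < ε / 5 by positivity), self_mem_nhdsWithin]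
      with h h1 h2 h3 h4 h5 h6 h7 h0
    rw [mem_Ioi] at h0
    have a1 := h5 (y h) h2.1 h3
    have a2 : ‖u (y h) - u x - L (y h - x)‖ ≤ ε / 5 * h := h1.trans (by gcongr)
    have a3 : ‖dotCLM (V h) (y h - x - h • t)‖ ≤ ε / 5 * h := by
      refine (ContinuousLinearMap.le_opNorm _ _).trans ?_
      have := (norm_dotCLM_le (V h)).trans (mul_le_mul_of_nonneg_left h4 (by norm_num))
      have h22 := h2.2
      calc _ ≤ 3 * (K * h ^ (-(1 / 10) : ℝ)) * (D * h ^ 2) := by gcongr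
        _ = 3 * K * D * h ^ (19 / 10 : ℝ) := by
          have : h ^ (-(1 / 10) : ℝ) * h ^ 2 = h ^ (19 / 10 : ℝ) := by
            rw [← Real.rpow_natCast, ← Real.rpow_add h0]; norm_num
          rw [← this]; ring
        _ ≤ _ := h6
    have a4 : ‖L (y h - x - h • t)‖ ≤ ε / 5 * h := by
      refine (L.le_opNorm _).trans ?_
      have h22 := h2.2
      rw [Real.rpow_two] at h7
      calc _ ≤ ‖L‖ * (D * h ^ 2) := by gcongr
        _ ≤ _ := by rw [← mul_assoc]; exact h7
    have e : h • (dotCLM (V h) t - L t) = -(u (y h) - u x - dotCLM (V h) (y h - x)) + (u (y h) - u x - L (y h - x)) -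
        dotCLM (V h) (y h - x - h • t) + L (y h - x - h • t) := by
      rw [map_sub (dotCLM (V h)) (y h - x), map_sub L (y h - x), map_smul, map_smul, smul_sub]
      ring
    have a5 : h * ‖dotCLM (V h) t - L t‖ ≤ h * (4 * (ε / 5)) := by
      calc h * ‖dotCLM (V h) t - L t‖ = ‖h • (dotCLM (V h) t - L t)‖ := by
            rw [norm_smul, Real.norm_eq_abs, abs_of_pos h0]
        _ ≤ ε / 5 * h + ε / 5 * h + ε / 5 * h + ε / 5 * h := by
          rw [e]
          refine (norm_add_le _ _).trans (add_le_add ((norm_sub_le _ _).trans (add_le_add ((norm_add_le _ _).trans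
            (add_le_add ?_ a2)) a3)) a4)
          rw [norm_neg]
          exact a1
        _ = _ := by ring
    rw [dist_eq_norm]
    have := le_of_mul_le_mul_left a5 h0
    linarith
  -- The restriction on the length of `t` is removed by scaling.
  have hall : ∀ t : E3, inner ℝ n t = 0 → Tendsto (fun h => dotCLM (V h) t) (𝓝[>] 0) (𝓝 (L t)) := by
    intro t ht
    have ha : 0 < ‖t‖ + 1 := by positivity
    have h1 := small ((‖t‖ + 1)⁻¹ • t) (by rw [inner_smul_right, ht, mul_zero]) (by
      rw [norm_smul, norm_inv, Real.norm_eq_abs, abs_of_pos ha, inv_mul_lt_iff₀ ha]; linarith)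
    have h2 := h1.const_smul (‖t‖ + 1)
    simp only [map_smul, smul_smul, mul_inv_cancel₀ ha.ne', one_smul] at h2
    exact h2
  rw [map_sub, map_smul, cross_self, smul_zero, sub_zero]
  refine tendsto_pi_nhds.2 fun l => ?_
  simp only [cross_apply_eq_dotCLM, hLe]
  exact hall _ (inner_tangentOf n l)

end LayeredGeometry
end

noncomputable section

/-! ### The regularization theorem -/

namespace LayeredGeometry
variable {p : PML} (G : LayeredGeometry p) {x : E3} (hx : x ∈ G.surface) {s : ℝ} (hs : s = 1 ∨ s = -1) (k : ℝ)

lemma tendsto_normal (n : E3) : Tendsto (fun h : ℝ => x + (s * h) • n) (𝓝[>] 0) (𝓝 x) := by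
  have : Tendsto (fun h : ℝ => x + (s * h) • n) (𝓝 0) (𝓝 (x + (s * 0) • n)) := Continuous.tendsto (by fun_prop) 0
  rw [mul_zero, zero_smul, add_zero] at this
  exact this.mono_left nhdsWithin_le_nhds

lemma integrable_vecPotential {φ : E3 → C3} (hφ : ContDiffOn ℝ 1 φ (closure G.surface)) (w : E3) :
    Integrable (fun y => p.Phi k w y • (p.B y *ᵥ φ y)) (surfaceMeasure G.surface) := by
  obtain ⟨B, hB⟩ := G.exists_density_bound hφ
  exact (G.integrable_vec_iff k w).2 fun m => G.integrable_Phi_mul (G.aestronglyMeasurable_density hφ m) (hB m) k w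

include hx hs

lemma eventually_normal : ∀ᶠ h in 𝓝[>] (0 : ℝ), x + (s * h) • G.ν x ∈ Metric.closedBall x 1 ∧
    ∀ z ∈ G.surface, z ≠ x → 0 < ‖x + (s * h) • G.ν x - z‖ ∧ ‖x + (s * h) • G.ν x - z‖⁻¹ ≤ 6 * ‖x - z‖⁻¹ := by
  filter_upwards [(tendsto_normal (x := x) (s := s) (G.ν x)).eventually (Metric.closedBall_mem_nhds x one_pos),
    G.isSurface_surface.exists_normal_le hx hs, self_mem_nhdsWithin] with h h1 h2 h0
  rw [mem_Ioi] at h0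
  refine ⟨h1, fun z hz hzx => ?_⟩
  have h3 := h2 z hz
  rw [norm_sub_rev z x] at h3
  have h4 : 0 < ‖x - z‖ := norm_pos_iff.2 (sub_ne_zero.2 hzx.symm)
  have h5 : ‖x - z‖ / 6 ≤ ‖x + (s * h) • G.ν x - z‖ := by linarith
  refine ⟨by linarith, ?_⟩
  calc _ ≤ (‖x - z‖ / 6)⁻¹ := by gcongr
    _ = _ := by rw [inv_div]; ring

/-- The kernel is only weakly singular: along the normal, `‖w - z‖⁻¹ ≤ 6 ‖x - z‖⁻¹` supplies an
integrable majorant. -/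
lemma tendsto_vecPotential {φ : E3 → C3} (hφ : ContDiffOn ℝ 1 φ (closure G.surface)) :
    Tendsto (fun h : ℝ => p.vecPotential k G.surface φ (x + (s * h) • G.ν x)) (𝓝[>] 0)
      (𝓝 (p.vecPotential k G.surface φ x)) := by
  obtain ⟨B, hB⟩ := G.exists_density_bound hφ
  obtain ⟨R, hR0, hR⟩ := G.exists_dist_upper x
  obtain ⟨C, hC0, hC⟩ := p.exists_kernel_bounds k R
  refine tendsto_pi_nhds.2 fun m => ?_
  simp only [G.vecPotential_apply (G.integrable_vecPotential k hφ _)]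
  choose Bm hBm using fun m => G.isCompact_closure_surface.exists_bound_of_continuousOn (G.continuousOn_density hφ m)
  have key := G.tendsto_integral_of_singular (l := map (fun h : ℝ => x + (s * h) • G.ν x) (𝓝[>] 0)) (γ := 1) (x := x)
    (F := fun w z => p.Phi k w z * (p.alpha z m * φ z m)) (f := fun z => p.Phi k x z * (p.alpha z m * φ z m))
    (C := C * 6 * Bm m) zero_le_one (by norm_num)
    (fun w => (p.measurable_Phi k w).aestronglyMeasurable.mul (G.aestronglyMeasurable_density hφ m)) ?_ ?_
  · exact tendsto_map'_iff.1 key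
  · rw [eventually_map]
    filter_upwards [G.eventually_normal hx hs] with h hh z hz hzx
    obtain ⟨h1, h2⟩ := hh.2 z hz hzx
    rw [norm_mul, Real.rpow_neg_one]
    have h3 := (hC _ z (sub_ne_zero.1 (norm_pos_iff.1 h1)) (hR _ hh.1 z hz)).1
    have h4 := hBm m z (subset_closure hz)
    calc _ ≤ C * (6 * ‖x - z‖⁻¹) * Bm m := by
          gcongr
          exact h3.trans (by gcongr)
      _ = _ := by ring
  · intro z hz hzx
    exact ((p.hasFDerivAt_Phi k hzx.symm).continuousAt.tendsto.mono_left (tendsto_normal _)).mul_const _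

/-- The boundary value of the layer potential exists if and only if that of the rotated gradient does. -/
lemma hasHypersingularAt_iff {φ : E3 → C3} (hφ : ContDiffOn ℝ 1 φ (closure G.surface))
    (hφt : ∀ y ∈ G.surface, toC3 (G.ν y) ⬝ᵥ φ y = 0) (h0 : ∀ y ∈ closure G.surface \ G.surface, φ y = 0) (c : C3) :
    p.HasHypersingularAt k G.surface G.ν s φ
        ((k : ℂ) ^ 2 • (toC3 (G.ν x) ⨯₃ (p.B x *ᵥ p.vecPotential k G.surface φ x)) + c) x ↔
      Tendsto (fun h : ℝ => toC3 (G.ν x) ⨯₃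
        p.gradPot k (surfaceMeasure G.surface) (surfaceDiv G.surface G.ν φ) (x + (s * h) • G.ν x)) (𝓝[>] 0) (𝓝 c) := by
  set n := G.ν x with hn
  have hv : Tendsto (fun h : ℝ => (k : ℂ) ^ 2 • (toC3 n ⨯₃ (p.B (x + (s * h) • n) *ᵥ
      p.vecPotential k G.surface φ (x + (s * h) • n)))) (𝓝[>] 0)
      (𝓝 ((k : ℂ) ^ 2 • (toC3 n ⨯₃ (p.B x *ᵥ p.vecPotential k G.surface φ x)))) := by
    refine (((continuous_cross (toC3 n)).tendsto _).comp (tendsto_pi_nhds.2 fun m => ?_)).const_smul _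
    simp only [PML.B, Matrix.mulVec_diagonal]
    exact (((p.continuous_alpha m).tendsto x).comp (tendsto_normal n)).mul
      (tendsto_pi_nhds.1 (G.tendsto_vecPotential hx hs k hφ) m)
  have hev : ∀ᶠ h in 𝓝[>] (0 : ℝ), toC3 n ⨯₃ p.layerPotential k G.surface φ (x + (s * h) • n) =
      (k : ℂ) ^ 2 • (toC3 n ⨯₃ (p.B (x + (s * h) • n) *ᵥ p.vecPotential k G.surface φ (x + (s * h) • n))) +
        toC3 n ⨯₃ p.gradPot k (surfaceMeasure G.surface) (surfaceDiv G.surface G.ν φ) (x + (s * h) • n) := by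
    filter_upwards [G.eventually_notMem_closure hx hs,
      (tendsto_normal (x := x) (s := s) n).eventually (p.isOpen_truncBox.mem_nhds (G.surface_subset_truncBox hx))]
      with h h1 h2
    rw [G.layerPotential_eq hφ hφt h0 k h1 h2, map_add, map_smul]
  constructor
  · intro h
    have h1 := (Tendsto.congr' hev h).sub hv
    simpa using h1
  · intro h
    exact Tendsto.congr' (hev.mono fun _ hh => hh.symm) (hv.add h)

/-- Boundary values of the rotated gradient at points of Hölder continuity of the density. -/
lemma exists_tendsto_of_holder {ψ : E3 → ℂ} (hψ : ContinuousOn ψ G.surface) {B : ℝ} (hB : ∀ z ∈ G.surface, ‖ψ z‖ ≤ B)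
    {β : ℝ} (hβ : 0 < β) (hH : (fun y => ψ y - ψ x) =O[𝓝[G.surface] x] fun y => ‖y - x‖ ^ β) :
    ∃ c : C3, Tendsto (fun h : ℝ => toC3 (G.ν x) ⨯₃ p.gradPot k (surfaceMeasure G.surface) ψ (x + (s * h) • G.ν x))
      (𝓝[>] 0) (𝓝 c) := by
  obtain ⟨χ, hχ, hχx, hχn, hlim, hm, hb, -⟩ := G.exists_decomposition hx hψ hB k
  set ψ₀ : E3 → ℂ := fun z => ψ z - ψ x * (χ z : ℂ) with hψ₀
  have hB0 : 0 ≤ B := (norm_nonneg _).trans (hB x hx)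
  -- The exponent is capped at one because the subtracted multiple of the cutoff is only controlled
  -- by a Lipschitz bound.
  set b := min β 1 with hbdef
  have hb0 : 0 < b := lt_min hβ one_pos
  have hb1 : b ≤ 1 := min_le_right _ _
  -- a Hölder bound on the whole surface
  obtain ⟨K, hK0, hK⟩ : ∃ K : ℝ, 0 ≤ K ∧ ∀ z ∈ G.surface, ‖ψ₀ z‖ ≤ K * ‖x - z‖ ^ b := by
    obtain ⟨C, hC⟩ := hH.bound
    obtain ⟨L, t, ht, hL⟩ := (hχ.contDiffAt (x := x)).exists_lipschitzOnWith
    obtain ⟨η, hη, hball⟩ := Metric.mem_nhdsWithin_iff.1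
      (inter_mem hC (inter_mem (mem_nhdsWithin_of_mem_nhds ht) (mem_nhdsWithin_of_mem_nhds (Metric.ball_mem_nhds x one_pos))))
    refine ⟨|C| + ‖ψ x‖ * L + 2 * B * (η ^ b)⁻¹, by positivity, fun z hz => ?_⟩
    have hzb : 0 ≤ ‖x - z‖ ^ b := by positivity
    by_cases hzη : ‖z - x‖ < η
    · obtain ⟨h1, h2, h3⟩ := hball ⟨show z ∈ Metric.ball x η by rwa [Metric.mem_ball, dist_eq_norm], hz⟩
      rw [Metric.mem_ball, dist_eq_norm, norm_sub_rev] at h3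
      have e : ψ₀ z = (ψ z - ψ x) - ψ x * ((χ z : ℂ) - 1) := by simp only [hψ₀]; ring
      have b1 : ‖ψ z - ψ x‖ ≤ |C| * ‖x - z‖ ^ b := by
        refine le_trans h1 ?_
        rw [Real.norm_eq_abs, abs_of_nonneg (by positivity), norm_sub_rev]
        have : ‖x - z‖ ^ β ≤ ‖x - z‖ ^ b := by
          rcases (norm_nonneg (x - z)).eq_or_lt with h0 | h0
          · rw [← h0, Real.zero_rpow hβ.ne', Real.zero_rpow hb0.ne']
          · exact Real.rpow_le_rpow_of_exponent_ge h0 h3.le (min_le_left _ _)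
        exact mul_le_mul (le_abs_self C) this (by positivity) (abs_nonneg C)
      have b2 : ‖(χ z : ℂ) - 1‖ ≤ L * ‖x - z‖ ^ b := by
        have := hL.norm_sub_le h2 (mem_of_mem_nhds ht)
        rw [hχx, norm_sub_rev z x] at this
        rw [← Complex.ofReal_one, ← Complex.ofReal_sub, Complex.norm_real]
        refine this.trans ?_
        gcongr
        rcases (norm_nonneg (x - z)).eq_or_lt with h0 | h0
        · rw [← h0, Real.zero_rpow hb0.ne']
        · have := Real.rpow_le_rpow_of_exponent_ge h0 h3.le hb1
          rwa [Real.rpow_one] at this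
      rw [e]
      calc _ ≤ |C| * ‖x - z‖ ^ b + ‖ψ x‖ * (L * ‖x - z‖ ^ b) := by
            refine (norm_sub_le _ _).trans (add_le_add b1 ?_)
            rw [norm_mul]
            gcongr
        _ = (|C| + ‖ψ x‖ * L) * ‖x - z‖ ^ b := by ring
        _ ≤ _ := by
          refine mul_le_mul_of_nonneg_right ?_ hzb
          have : 0 ≤ 2 * B * (η ^ b)⁻¹ := by positivity
          linarith
    · rw [not_lt, norm_sub_rev] at hzη
      calc ‖ψ₀ z‖ ≤ 2 * B * 1 := by rw [mul_one]; exact hb z hz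
        _ ≤ 2 * B * ((η ^ b)⁻¹ * ‖x - z‖ ^ b) := by
          gcongr
          rw [inv_mul_eq_div, one_le_div (by positivity)]
          exact Real.rpow_le_rpow hη.le hzη hb0.le
        _ = (2 * B * (η ^ b)⁻¹) * ‖x - z‖ ^ b := by ring
        _ ≤ _ := by
          refine mul_le_mul_of_nonneg_right ?_ hzb
          have : 0 ≤ |C| + ‖ψ x‖ * L := by positivity
          linarith
  obtain ⟨R, hR0, hR⟩ := G.exists_dist_upper x
  obtain ⟨C, hC0, hC⟩ := p.exists_kernel_bounds k R
  set n := G.ν x with hn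
  -- The Hölder bound lowers the singularity of the gradient kernel to `‖x - z‖ ^ (b - 2)`, which is
  -- integrable, so the full gradient converges by domination.
  have h1 : Tendsto (fun h : ℝ => p.gradPot k (surfaceMeasure G.surface) ψ₀ (x + (s * h) • n)) (𝓝[>] 0)
      (𝓝 (p.gradPot k (surfaceMeasure G.surface) ψ₀ x)) := by
    refine tendsto_pi_nhds.2 fun l => ?_
    refine Tendsto.mul (((p.continuous_alpha l).tendsto x).comp (tendsto_normal n)) ?_
    have key := G.tendsto_integral_of_singular (l := map (fun h : ℝ => x + (s * h) • n) (𝓝[>] 0)) (γ := 2 - b) (x := x)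
      (F := fun w z => p.dPhi k l w z * ψ₀ z) (f := fun z => p.dPhi k l x z * ψ₀ z)
      (C := C * 36 * K) (by linarith) (by linarith)
      (fun w => (p.measurable_dPhi k l w).aestronglyMeasurable.mul hm) ?_ ?_
    · exact tendsto_map'_iff.1 key
    · rw [eventually_map]
      filter_upwards [G.eventually_normal hx hs] with h hh z hz hzx
      obtain ⟨a1, a2⟩ := hh.2 z hz hzx
      have hxz : 0 < ‖x - z‖ := norm_pos_iff.2 (sub_ne_zero.2 hzx.symm)
      rw [norm_mul]
      have a3 := (hC _ z (sub_ne_zero.1 (norm_pos_iff.1 a1)) (hR _ hh.1 z hz)).2.1 l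
      have a4 := hK z hz
      calc _ ≤ C * (6 * ‖x - z‖⁻¹) ^ 2 * (K * ‖x - z‖ ^ b) := by
            gcongr
            refine a3.trans ?_
            rw [← inv_pow]
            gcongr
        _ = C * 36 * K * ((‖x - z‖ ^ 2)⁻¹ * ‖x - z‖ ^ b) := by rw [mul_pow, inv_pow]; ring
        _ = _ := by
          congr 1
          rw [← Real.rpow_natCast, ← Real.rpow_neg hxz.le, ← Real.rpow_add hxz]
          congr 1; push_cast; ring
    · intro z hz hzx
      exact ((p.hasFDerivAt_dPhi k l hzx.symm).continuousAt.tendsto.mono_left (tendsto_normal _)).mul_const _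
  obtain ⟨c₀, hc₀, happ⟩ := G.exists_normal_mem_approachRegion hx hs
  obtain ⟨g, hg⟩ := hlim c₀ hc₀
  -- For the cutoff part only the tangential gradient is known to converge. This suffices, since the
  -- cross product with `n` ignores the normal component.
  have h2 : Tendsto (fun h : ℝ => tangPart n (p.gradPot k (surfaceMeasure G.surface) (fun z => (χ z : ℂ)) (x + (s * h) • n)))
      (𝓝[>] 0) (𝓝 g) := hg.comp (tendsto_nhdsWithin_iff.2 ⟨tendsto_normal n, happ c₀ le_rfl⟩)
  have h3 := (((continuous_cross (toC3 n)).tendsto _).comp h1).add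
    ((((continuous_cross (toC3 n)).tendsto _).comp h2).const_smul (ψ x))
  refine ⟨_, Tendsto.congr' ?_ h3⟩
  filter_upwards [G.eventually_notMem_closure hx hs] with h hh
  have hχc : Continuous fun z => ψ x * ((χ z : ℝ) : ℂ) :=
    (Complex.continuous_ofReal.comp hχ.continuous).const_mul (ψ x)
  have e : ψ₀ + (fun z => ψ x * (χ z : ℂ)) = ψ := by
    funext z; simp [hψ₀]
  have e2 := G.gradPot_add hm hχc.aestronglyMeasurable hb (B₂ := ‖ψ x‖ * 1)
    (fun z _ => by rw [norm_mul]; gcongr; exact hχn z) k hh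
  rw [e, G.gradPot_const_mul] at e2
  simp only [Function.comp_apply, cross_tangPart]
  rw [e2, map_add, map_smul]

end LayeredGeometry

end

/-- Candidate values are written as the regular part plus `c`. As `c` runs over all vectors every
possible limit is covered, so one equivalence gives both existence and the formula. -/
theorem mainTheorem3 (p : PML) (G : LayeredGeometry p) (k : ℝ) (hk : 0 < k)
    (φ : E3 → C3)
    (hφ : ContDiffOn ℝ 1 φ (closure G.surface))
    (htan : ∀ y ∈ G.surface, toC3 (G.ν y) ⬝ᵥ φ y = 0)
    (hbdry : ∀ y ∈ closure G.surface \ G.surface, φ y = 0)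
    (x : E3) (hx : x ∈ G.surface) :
    Integrable (fun y => p.Phi k x y • (p.B y *ᵥ φ y)) (surfaceMeasure G.surface) ∧
    Integrable (fun y => p.Phi k x y * surfaceDiv G.surface G.ν φ y) (surfaceMeasure G.surface) ∧
    (∀ s : ℝ, s = 1 ∨ s = -1 → ∀ c : C3,
      p.HasHypersingularAt k G.surface G.ν s φ
          ((k : ℂ) ^ 2 • (toC3 (G.ν x) ⨯₃ (p.B x *ᵥ p.vecPotential k G.surface φ x)) + c) x ↔
        HasSurfaceCurlAt G.surface G.ν
          (p.scalPotential k G.surface (surfaceDiv G.surface G.ν φ)) c x) ∧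
    ((∃ β : ℝ, 0 < β ∧
        (fun y => surfaceDiv G.surface G.ν φ y - surfaceDiv G.surface G.ν φ x)
          =O[𝓝[G.surface] x] fun y => ‖y - x‖ ^ β) →
      ∃ c : C3, HasSurfaceCurlAt G.surface G.ν
        (p.scalPotential k G.surface (surfaceDiv G.surface G.ν φ)) c x) := by
  obtain ⟨B, -, hB⟩ := G.exists_bound_surfaceDiv hφ
  have hcont := G.isSurface_surface.continuousOn_surfaceDiv (hφ.mono subset_closure)
  refine ⟨G.integrable_vecPotential k hφ x,
    G.integrable_Phi_mul (G.aestronglyMeasurable_surfaceDiv hφ) (G.ae_mem_surface.mono hB) k x,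
    fun s hs c => ?_, ?_⟩
  · have hfo := G.firstOrderAt hx hs k hcont hB
    rw [G.hasHypersingularAt_iff hx hs k hφ htan hbdry]
    exact ⟨G.hasSurfaceCurlAt_of_tendsto hx hs hB hfo, G.tendsto_of_hasSurfaceCurlAt hx hs hB hfo⟩
  · rintro ⟨β, hβ, hH⟩
    -- Either side would do here: the existence of the surface curl refers to no side.
    have hs : (1 : ℝ) = 1 ∨ (1 : ℝ) = -1 := Or.inl rfl
    obtain ⟨c, hc⟩ := G.exists_tendsto_of_holder hx hs k hcont hB hβ hH
    exact ⟨c, G.hasSurfaceCurlAt_of_tendsto hx hs hB (G.firstOrderAt hx hs k hcont hB) hc⟩
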